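/- **Setting.** Let $\varphi:\mathbb C\to\mathbb Z_{\ge 0}$ be a function of finite support contained in a single coset $a+\mathbb Z$ (an integral weight function). Put $V_i=\mathbb C^{\varphi(i)}$, $E_\varphi=\bigoplus_i \mathrm{Hom}(V_i,V_{i+1})$ (the Vogan variety), $G_\varphi=\prod_i GL(V_i)$, acting on $E_\varphi$ by conjugation, and write $T=(T_i)_i$, $T_i:V_i\to V_{i+1}$, for a point of $E_\varphi$. For $a+q$ with $q\in\mathbb Q$ write $\lfloor a+q\rfloor=a+\lfloor q\rfloor$ and $\lceil a+q\rceil=a+\lceil q\rceil$, and order $a+\mathbb Z$ by $a+m\le a+m'\iff m\le m'$. Assume that $r=a+q$ with $q\in\mathbb Q\setminus\mathbb Z$ is such that $\varphi(i)\le\varphi(j)$ whenever $i\le j\le\lceil r\rceil$ and $\varphi(i)\ge\varphi(j)$ whenever $\lfloor r\rfloor\le i\le j$ (with $i,j\in a+\mathbb Z$). Then $\lceil r\rceil=\lfloor r\rfloor+1$. Let $\mathbb O_\varphi\subset E_\varphi$ be the full rank part, the open $G_\varphi$-stable subvariety of those $T$ all of whose components $T_i$ have maximal possible rank $\min(\varphi(i),\varphi(i+1))$.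 Let $T\mapsto\underline T$ be the projection $E_\varphi\to\underline E_\varphi=\bigoplus_{i\ne\lfloor r\rfloor}\mathrm{Hom}(V_i,V_{i+1})$ and $\underline{\mathbb O}_\varphi$ the image of $\mathbb O_\varphi$. For $\underline T\in\underline{\mathbb O}_\varphi$ let $\mathbb O_\varphi|_{\underline T}$ be the fibre of $\mathbb O_\varphi\to\underline{\mathbb O}_\varphi$ over $\underline T$, let $G_{\varphi,\underline T}\subset G_\varphi$ be the stabilizer of $\underline T$, and let $G^l_{\varphi,\underline T}$, $G^r_{\varphi,\underline T}$ be the images of $G_{\varphi,\underline T}$ in $GL(V_{\lfloor r\rfloor})$ and $GL(V_{\lceil r\rceil})$. Write $GL(V,W)$ for the variety of linear isomorphisms $V\to W$. Groups are algebraic groups over $\mathbb C$, and quotient stacks are taken for the fppf topology on affine $\mathbb C$-schemes. **Theorem.** We have $\varphi(\lfloor r\rfloor)=\varphi(\lceil r\rceil)$, and the following hold. 1. $\underline{\mathbb O}_\varphi$ is a single $G_\varphi$-orbit. For every $\underline T\in\underline{\mathbb O}_\varphi$: 2. $T\mapsto T_{\lfloor r\rfloor}$ is an isomorphism $\mathbb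 O_\varphi|_{\underline T}\cong GL(V_{\lfloor r\rfloor},V_{\lceil r\rceil})$. 3. $G^l_{\varphi,\underline T}$ is a parabolic subgroup of $GL(V_{\lfloor r\rfloor})$, equal to the stabilizer of the flag $V_{\lfloor r\rfloor}\supset\underline T(V_{\lfloor r\rfloor-1})\supset\underline T^2(V_{\lfloor r\rfloor-2})\supset\cdots\supset 0$, with Levi subgroup isomorphic to $\prod_{k\ge0}GL_{\varphi(\lfloor r\rfloor-k)-\varphi(\lfloor r\rfloor-k-1)}$. $G^r_{\varphi,\underline T}$ is a parabolic subgroup of $GL(V_{\lceil r\rceil})$, equal to the stabilizer of the flag $0\subset\ker\underline T|_{V_{\lceil r\rceil}}\subset\ker\underline T^2|_{V_{\lceil r\rceil}}\subset\cdots\subset V_{\lceil r\rceil}$, with Levi subgroup isomorphic to $\prod_{k\ge0}GL_{\varphi(\lceil r\rceil+k)-\varphi(\lceil r\rceil+k+1)}$. The product of the two projections $G_{\varphi,\underline T}\to G^l_{\varphi,\underline T}\times G^r_{\varphi,\underline T}$ is an isomorphism. 4. The isomorphism in (2) is equivariant along the isomorphism $G_{\varphi,\underline T}\cong G^l_{\varphi,\underline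 T}\times G^r_{\varphi,\underline T}$ in (3), where $(g,h)$ acts on $GL(V_{\lfloor r\rfloor},V_{\lceil r\rceil})$ by $x\mapsto hxg^{-1}$. The inclusion $\mathbb O_\varphi|_{\underline T}\subset\mathbb O_\varphi$ and the isomorphism in (2) induce isomorphisms of stacks $$[G_\varphi\backslash\mathbb O_\varphi]\cong[G_{\varphi,\underline T}\backslash\mathbb O_\varphi|_{\underline T}]\cong[G^r_{\varphi,\underline T}\backslash GL(V_{\lfloor r\rfloor},V_{\lceil r\rceil})/G^l_{\varphi,\underline T}].$$ If, for $n=\varphi(\lfloor r\rfloor)$, bases identify $V_{\lfloor r\rfloor}$ and $V_{\lceil r\rceil}$ with $\mathbb C^n$, and $P_l,P_r\subset GL_n$ denote the parabolic subgroups corresponding to $G^l_{\varphi,\underline T},G^r_{\varphi,\underline T}$, then $[G_\varphi\backslash\mathbb O_\varphi]\cong[P_r\backslash GL_n/P_l]$. **Corollary.** Let $n=\varphi(\lfloor r\rfloor)=\varphi(\lceil r\rceil)$. An integral infinitesimal character of $GL_n(\mathbb C)$ is a pair $\Lambda_{\mathbb R}=(\lambda_L,\lambda_R)$ in $\mathbb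 C^n\times\mathbb C^n$ with $\lambda_L-\lambda_R\in\mathbb Z^n$ and, for $\lambda=\lambda_L$ and $\lambda=\lambda_R$, $\lambda_i-\lambda_j\in\mathbb Z_{\ge0}$ for all $i\le j$; write $\mathcal P_\lambda$ for the variety of partial flags in $\mathbb C^n$ with one member of dimension $d$ for each $1\le d<n$ with $\lambda_d\ne\lambda_{d+1}$. There exist such a $\Lambda_{\mathbb R}$ and an isomorphism of stacks $[\Delta GL_n\backslash(\mathcal P_{\lambda_L}\times\mathcal P_{\lambda_R})]\cong[G_\varphi\backslash\mathbb O_\varphi]$ whose composite with $[G_\varphi\backslash\mathbb O_\varphi]\to[G_\varphi\backslash E_\varphi]$ is an open immersion $$\zeta:[\Delta GL_n\backslash(\mathcal P_{\lambda_L}\times\mathcal P_{\lambda_R})]\cong[G_\varphi\backslash\mathbb O_\varphi]\hookrightarrow[G_\varphi\backslash E_\varphi]$$ from the ABV (Adams–Barbasch–Vogan) space of $GL_n(\mathbb C)$ to the Vogan variety. -/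

import Mathlib

open CategoryTheory Opposite TensorProduct

/-- The category of affine schemes over `ℂ`. -/
abbrev AffC : Type 1 := (CommAlgCat.{0} ℂ)ᵒᵖ

theorem exists_common_field {k K Q : Type} [Field k] [Field K] [Field Q] (f : k →+* K)
    (g : k →+* Q) : ∃ (F : Type) (_ : Field F) (i : K →+* F) (j : Q →+* F),
      ∀ x, i (f x) = j (g x) := by
  let _ : Algebra k K := f.toAlgebra
  let _ : Algebra k Q := g.toAlgebra
  obtain ⟨m, hm⟩ := Ideal.exists_maximal (K ⊗[k] Q)
  refine ⟨(K ⊗[k] Q) ⧸ m, Ideal.Quotient.field m,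
    (Ideal.Quotient.mk m).comp Algebra.TensorProduct.includeLeftRingHom,
    (Ideal.Quotient.mk m).comp
      (Algebra.TensorProduct.includeRight (R := k) (A := K) (B := Q)).toRingHom, fun x => ?_⟩
  simp only [RingHom.comp_apply]
  congr 1
  exact (Algebra.TensorProduct.includeRight (R := k) (A := K) (B := Q)).commutes x |>.symm

theorem exists_prime_tensor {A B A' : Type} [CommRing A] [CommRing B] [CommRing A'] [Algebra A B]
    [Algebra A A'] (p' : PrimeSpectrum A') (q : PrimeSpectrum B)
    (h : PrimeSpectrum.comap (algebraMap A B) q = PrimeSpectrum.comap (algebraMap A A') p') :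
    ∃ x : PrimeSpectrum (A' ⊗[A] B), PrimeSpectrum.comap (algebraMap A' (A' ⊗[A] B)) x = p' := by
  let p : PrimeSpectrum A := PrimeSpectrum.comap (algebraMap A A') p'
  have hq : p.asIdeal = q.asIdeal.comap (algebraMap A B) := congrArg PrimeSpectrum.asIdeal h.symm
  obtain ⟨F, _, i1, i2, hk⟩ := exists_common_field
    (Ideal.ResidueField.map p.asIdeal p'.asIdeal (algebraMap A A') rfl)
    (Ideal.ResidueField.map p.asIdeal q.asIdeal (algebraMap A B) hq)
  let j1 : A' →+* F := i1.comp (algebraMap A' p'.asIdeal.ResidueField)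
  let j2 : B →+* F := i2.comp (algebraMap B q.asIdeal.ResidueField)
  let _ : Algebra A F := (j1.comp (algebraMap A A')).toAlgebra
  have hA : ∀ a : A, j2 (algebraMap A B a) = algebraMap A F a := by
    intro a
    have h1 := Ideal.ResidueField.map_algebraMap p.asIdeal q.asIdeal (algebraMap A B) hq a
    have h2 := Ideal.ResidueField.map_algebraMap p.asIdeal p'.asIdeal (algebraMap A A') rfl a
    change i2 (algebraMap B q.asIdeal.ResidueField (algebraMap A B a)) =
      i1 (algebraMap A' p'.asIdeal.ResidueField (algebraMap A A' a))
    rw [← h1, ← h2, hk]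
  let f1 : A' →ₐ[A] F := { j1 with commutes' := fun _ => rfl }
  let f2 : B →ₐ[A] F := { j2 with commutes' := hA }
  let g : A' ⊗[A] B →ₐ[A] F := Algebra.TensorProduct.lift f1 f2 (fun _ _ => Commute.all _ _)
  refine ⟨PrimeSpectrum.comap g.toRingHom ⊥, ?_⟩
  ext x
  have hg : g (algebraMap A' (A' ⊗[A] B) x) = i1 (algebraMap A' p'.asIdeal.ResidueField x) := by
    change g (x ⊗ₜ[A] 1) = j1 x
    rw [Algebra.TensorProduct.lift_tmul, map_one, mul_one]
    rfl
  change g (algebraMap A' (A' ⊗[A] B) x) ∈ (⊥ : Ideal F) ↔ _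
  rw [hg, Ideal.mem_bot, map_eq_zero]
  exact Ideal.algebraMap_residueField_eq_zero

/-- A sieve on an affine scheme `X` over `ℂ` is an fppf covering if it contains a finite
family of flat, finitely presented morphisms from affine schemes whose images cover `X`. -/
def IsFppfCovering (X : AffC) (S : Sieve X) : Prop :=
  ∃ (ι : Type) (_ : Finite ι) (B : ι → CommAlgCat.{0} ℂ) (f : ∀ i, X.unop ⟶ B i),
    (∀ i, (f i).hom.toRingHom.Flat ∧ (f i).hom.toRingHom.FinitePresentation) ∧
    (∀ p : PrimeSpectrum X.unop, ∃ i, ∃ q : PrimeSpectrum (B i),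
      PrimeSpectrum.comap (f i).hom.toRingHom q = p) ∧
    ∀ i, S (f i).op

theorem exists_base_change {A B A' : CommAlgCat.{0} ℂ} (f : A ⟶ B) (g : A ⟶ A') :
    ∃ (B' : CommAlgCat.{0} ℂ) (f' : A' ⟶ B') (g' : B ⟶ B'), f ≫ g' = g ≫ f' ∧
      (f.hom.toRingHom.Flat → f'.hom.toRingHom.Flat) ∧
      (f.hom.toRingHom.FinitePresentation → f'.hom.toRingHom.FinitePresentation) ∧
      ∀ (p' : PrimeSpectrum A') (q : PrimeSpectrum B),
        PrimeSpectrum.comap f.hom.toRingHom q = PrimeSpectrum.comap g.hom.toRingHom p' →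
        ∃ x : PrimeSpectrum B', PrimeSpectrum.comap f'.hom.toRingHom x = p' := by
  let _ : Algebra A B := f.hom.toRingHom.toAlgebra
  let _ : Algebra A A' := g.hom.toRingHom.toAlgebra
  have : IsScalarTower ℂ A B := IsScalarTower.of_algebraMap_eq fun x => (f.hom.commutes x).symm
  have : IsScalarTower ℂ A A' := IsScalarTower.of_algebraMap_eq fun x => (g.hom.commutes x).symm
  let i1 : A' →ₐ[ℂ] A' ⊗[A] B := Algebra.TensorProduct.includeLeft
  let i2 : B →ₐ[ℂ] A' ⊗[A] B :=
    (Algebra.TensorProduct.includeRight (R := A) (A := A') (B := B)).restrictScalars ℂ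
  refine ⟨CommAlgCat.of ℂ (A' ⊗[A] B), CommAlgCat.ofHom i1, CommAlgCat.ofHom i2, ?_, ?_, ?_, ?_⟩
  · ext a
    change (1 : A') ⊗ₜ[A] (algebraMap A B a) = (algebraMap A A' a) ⊗ₜ[A] (1 : B)
    rw [Algebra.algebraMap_eq_smul_one, Algebra.algebraMap_eq_smul_one, TensorProduct.smul_tmul]
  · intro h
    let _ : Algebra B (A' ⊗[A] B) := Algebra.TensorProduct.rightAlgebra
    exact RingHom.Flat.isStableUnderBaseChange A B A' (A' ⊗[A] B) h
  · intro h
    let _ : Algebra B (A' ⊗[A] B) := Algebra.TensorProduct.rightAlgebra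
    exact RingHom.finitePresentation_isStableUnderBaseChange A B A' (A' ⊗[A] B) h
  · intro p' q h
    exact exists_prime_tensor p' q h

/-- The fppf topology on the category of affine schemes over `ℂ`. -/
def fppfTopology : GrothendieckTopology AffC where
  sieves X := {S | IsFppfCovering X S}
  top_mem' X := ⟨PUnit, inferInstance, fun _ => X.unop, fun _ => 𝟙 _,
    fun _ => ⟨RingHom.Flat.id _, RingHom.FinitePresentation.id _⟩,
    fun p => ⟨⟨⟩, p, rfl⟩, fun _ => trivial⟩
  pullback_stable' X Y S g hS := by
    obtain ⟨ι, hι, B, f, hf, hcov, hSf⟩ := hS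
    choose B' f' g' hcomm hflat hfp hpt using fun i => exists_base_change (f i) g.unop
    refine ⟨ι, hι, B', f', fun i => ⟨hflat i (hf i).1, hfp i (hf i).2⟩, fun p' => ?_, fun i => ?_⟩
    · obtain ⟨i, q, hq⟩ := hcov (PrimeSpectrum.comap g.unop.hom.toRingHom p')
      exact ⟨i, hpt i p' q hq⟩
    · have h1 : (f' i).op ≫ g = (g' i).op ≫ (f i).op := Quiver.Hom.unop_inj (hcomm i).symm
      change S ((f' i).op ≫ g)
      rw [h1]
      exact S.downward_closed (hSf i) _
  transitive' X S hS R hR := by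
    obtain ⟨ι, hι, B, f, hf, hcov, hSf⟩ := hS
    choose κ hκ C g hg hcov' hRg using fun i => hR (hSf i)
    have := hκ
    refine ⟨Σ i, κ i, inferInstance, fun x => C x.1 x.2, fun x => f x.1 ≫ g x.1 x.2,
      fun x => ⟨?_, ?_⟩, fun p => ?_, fun x => hRg x.1 x.2⟩
    · exact RingHom.Flat.comp (hf x.1).1 (hg x.1 x.2).1
    · exact RingHom.FinitePresentation.comp (hg x.1 x.2).2 (hf x.1).2
    · obtain ⟨i, q, hq⟩ := hcov p
      obtain ⟨j, q', hq'⟩ := hcov' i q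
      exact ⟨⟨i, j⟩, q', by rw [← hq, ← hq']; rfl⟩

abbrev GroupFunctor : Type 1 := CommAlgCat.{0} ℂ ⥤ GrpCat.{0}

/-- A functor of points over `ℂ` with a (left) action of the group functor `G`. -/
structure ActedSpace (G : GroupFunctor) where
  X : CommAlgCat.{0} ℂ ⥤ Type
  smul : ∀ {R : CommAlgCat.{0} ℂ}, G.obj R → X.obj R → X.obj R
  one_smul : ∀ {R : CommAlgCat.{0} ℂ} (x : X.obj R), smul (1 : G.obj R) x = x
  mul_smul : ∀ {R : CommAlgCat.{0} ℂ} (g h : G.obj R) (x : X.obj R),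
    smul (g * h) x = smul g (smul h x)
  map_smul : ∀ {R S : CommAlgCat.{0} ℂ} (f : R ⟶ S) (g : G.obj R) (x : X.obj R),
    X.map f (smul g x) = smul (G.map f g) (X.map f x)

/-- A morphism `X ⟶ Y` equivariant with respect to a homomorphism `ρ : G ⟶ H`. -/
structure EquivariantMap {G H : GroupFunctor} (ρ : G ⟶ H) (X : ActedSpace G)
    (Y : ActedSpace H) where
  app : ∀ {R : CommAlgCat.{0} ℂ}, X.X.obj R → Y.X.obj R
  naturality : ∀ {R S : CommAlgCat.{0} ℂ} (f : R ⟶ S) (x : X.X.obj R),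
    app (X.X.map f x) = Y.X.map f (app x)
  map_smul : ∀ {R : CommAlgCat.{0} ℂ} (g : G.obj R) (x : X.X.obj R),
    app (X.smul g x) = Y.smul (ρ.app R g) (app x)

/-- An object of the quotient stack `[G \ X]`: an affine base `Spec base`, a `G`-torsor
`π : P ⟶ Spec base` for the fppf topology, and a `G`-equivariant map `P ⟶ X`. -/
structure QuotientObj (G : GroupFunctor) (X : ActedSpace G) where
  base : CommAlgCat.{0} ℂ
  P : CommAlgCat.{0} ℂ ⥤ Type 1
  isSheaf : Presieve.IsSheaf fppfTopology (unopUnop (CommAlgCat.{0} ℂ) ⋙ P)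
  π : ∀ {R : CommAlgCat.{0} ℂ}, P.obj R → (base ⟶ R)
  π_map : ∀ {R S : CommAlgCat.{0} ℂ} (f : R ⟶ S) (p : P.obj R), π (P.map f p) = π p ≫ f
  smul : ∀ {R : CommAlgCat.{0} ℂ}, G.obj R → P.obj R → P.obj R
  one_smul : ∀ {R : CommAlgCat.{0} ℂ} (p : P.obj R), smul (1 : G.obj R) p = p
  mul_smul : ∀ {R : CommAlgCat.{0} ℂ} (g h : G.obj R) (p : P.obj R),
    smul (g * h) p = smul g (smul h p)
  map_smul : ∀ {R S : CommAlgCat.{0} ℂ} (f : R ⟶ S) (g : G.obj R) (p : P.obj R),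
    P.map f (smul g p) = smul (G.map f g) (P.map f p)
  π_smul : ∀ {R : CommAlgCat.{0} ℂ} (g : G.obj R) (p : P.obj R), π (smul g p) = π p
  simplyTransitive : ∀ {R : CommAlgCat.{0} ℂ} (p q : P.obj R), π p = π q →
    ∃! g : G.obj R, smul g p = q
  locallyNonempty : ∃ S ∈ fppfTopology (op base), ∀ (R : CommAlgCat.{0} ℂ) (f : base ⟶ R),
    S f.op → ∃ p : P.obj R, π p = f
  toX : ∀ {R : CommAlgCat.{0} ℂ}, P.obj R → X.X.obj R
  toX_map : ∀ {R S : CommAlgCat.{0} ℂ} (f : R ⟶ S) (p : P.obj R),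
    toX (P.map f p) = X.X.map f (toX p)
  toX_smul : ∀ {R : CommAlgCat.{0} ℂ} (g : G.obj R) (p : P.obj R),
    toX (smul g p) = X.smul g (toX p)

namespace QuotientObj

variable {G : GroupFunctor} {X : ActedSpace G}

/-- A morphism of `[G \ X]`: a morphism of base schemes covered by a `G`-equivariant map of
torsors that is compatible with the maps to `X`. -/
@[ext]
structure Hom (a b : QuotientObj G X) where
  base : b.base ⟶ a.base
  app : ∀ (R : CommAlgCat.{0} ℂ), a.P.obj R → b.P.obj R
  naturality : ∀ {R S : CommAlgCat.{0} ℂ} (f : R ⟶ S) (p : a.P.obj R),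
    app S (a.P.map f p) = b.P.map f (app R p)
  π_app : ∀ {R : CommAlgCat.{0} ℂ} (p : a.P.obj R), b.π (app R p) = base ≫ a.π p
  app_smul : ∀ {R : CommAlgCat.{0} ℂ} (g : G.obj R) (p : a.P.obj R),
    app R (a.smul g p) = b.smul g (app R p)
  toX_app : ∀ {R : CommAlgCat.{0} ℂ} (p : a.P.obj R), b.toX (app R p) = a.toX p

instance : Category (QuotientObj G X) where
  Hom := Hom
  id a :=
    { base := 𝟙 _
      app := fun _ p => p
      naturality := fun _ _ => rfl
      π_app := fun p => (Category.id_comp _).symm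
      app_smul := fun _ _ => rfl
      toX_app := fun _ => rfl }
  comp u v :=
    { base := v.base ≫ u.base
      app := fun R p => v.app R (u.app R p)
      naturality := fun f p => by rw [u.naturality, v.naturality]
      π_app := fun p => by rw [v.π_app, u.π_app, Category.assoc]
      app_smul := fun g p => by rw [u.app_smul, v.app_smul]
      toX_app := fun p => by rw [v.toX_app, u.toX_app] }
  id_comp u := Hom.ext (Category.comp_id _) rfl
  comp_id u := Hom.ext (Category.id_comp _) rfl
  assoc u v w := Hom.ext (Category.assoc _ _ _).symm rfl

/-- The projection of `[G \ X]` to affine schemes. -/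
def proj (G : GroupFunctor) (X : ActedSpace G) : QuotientObj G X ⥤ AffC where
  obj a := op a.base
  map u := (Hom.base u).op

end QuotientObj

/-- The quotient stack `[G \ X]`, as a category over the category of affine schemes over `ℂ`. -/
abbrev quotientStack (G : GroupFunctor) (X : ActedSpace G) : BasedCategory.{1, 2} AffC :=
  BasedCategory.ofFunctor (QuotientObj.proj G X)

/-- The functor on quotient objects given by composing with a `G`-equivariant map `X ⟶ Y`. -/
def QuotientObj.push {G : GroupFunctor} {X Y : ActedSpace G} (κ : EquivariantMap (𝟙 G) X Y) :
    QuotientObj G X ⥤ QuotientObj G Y where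
  obj a :=
    { a with
      toX := fun p => κ.app (a.toX p)
      toX_map := fun f p => by rw [a.toX_map, κ.naturality]
      toX_smul := fun g p => by rw [a.toX_smul, κ.map_smul]; rfl }
  map {a b} (u : Hom a b) :=
    { base := u.base
      app := u.app
      naturality := u.naturality
      π_app := u.π_app
      app_smul := u.app_smul
      toX_app := fun p => congrArg κ.app (u.toX_app p) }
  map_id _ := rfl
  map_comp _ _ := rfl

/-- The morphism `[G \ X] ⟶ [G \ Y]` given by composing with a `G`-equivariant map `X ⟶ Y`. -/
def quotientStackMap {G : GroupFunctor} {X Y : ActedSpace G} (κ : EquivariantMap (𝟙 G) X Y) :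
    BasedFunctor (quotientStack G X) (quotientStack G Y) where
  toFunctor := QuotientObj.push κ
  w := rfl

/-- The data exhibiting a morphism of stacks `F : [G \ X] ⟶ [H \ Y]` as the one induced by a
homomorphism `ρ : G ⟶ H` and a `ρ`-equivariant map `κ : X ⟶ Y`: a natural `ρ`-equivariant map
`α` from the torsor `P` of each object to the torsor of its image, over the base and compatible
with `κ`. (Such an `α` identifies the torsor of the image with the `H`-torsor `H ×_G P`.) -/
structure InducedBy {G H : GroupFunctor} {X : ActedSpace G} {Y : ActedSpace H} {ρ : G ⟶ H}
    (κ : EquivariantMap ρ X Y) (F : BasedFunctor (quotientStack G X) (quotientStack H Y)) where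
  α : ∀ (a : QuotientObj G X) (R : CommAlgCat.{0} ℂ),
    a.P.obj R → (show QuotientObj H Y from F.obj a).P.obj R
  naturality : ∀ (a : QuotientObj G X) {R S : CommAlgCat.{0} ℂ} (f : R ⟶ S) (p : a.P.obj R),
    α a S (a.P.map f p) = (show QuotientObj H Y from F.obj a).P.map f (α a R p)
  over_base : ∀ (a : QuotientObj G X) {R : CommAlgCat.{0} ℂ} (p : a.P.obj R),
    QuotientObj.π (F.obj a) (α a R p) =
      eqToHom (congrArg unop (BasedFunctor.w_obj F a)) ≫ a.π p
  equivariant : ∀ (a : QuotientObj G X) {R : CommAlgCat.{0} ℂ} (g : G.obj R) (p : a.P.obj R),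
    α a R (a.smul g p) = QuotientObj.smul (F.obj a) (ρ.app R g) (α a R p)
  compatible : ∀ (a : QuotientObj G X) {R : CommAlgCat.{0} ℂ} (p : a.P.obj R),
    QuotientObj.toX (F.obj a) (α a R p) = κ.app (a.toX p)
  map_α : ∀ {a b : QuotientObj G X} (u : a ⟶ b) {R : CommAlgCat.{0} ℂ} (p : a.P.obj R),
    α b R (QuotientObj.Hom.app u R p) = QuotientObj.Hom.app (F.map u) R (α a R p)

/-- An isomorphism of stacks over affine schemes: a functor over the base that is an
equivalence of categories. -/
def IsStackIso {𝒳 𝒴 : BasedCategory.{1, 2} AffC} (F : BasedFunctor 𝒳 𝒴) : Prop :=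
  F.toFunctor.IsEquivalence

/-- A morphism of stacks `F : 𝒳 ⟶ 𝒴` is an open immersion if, for every object `y` of `𝒴` over
an affine scheme `Spec A`, the fibre product `𝒳 ×_𝒴 Spec A` is represented by an open subscheme
`U` of `Spec A`: for `f : Spec B ⟶ Spec A`, the groupoid of pairs of an object `x` over `Spec B`
and a morphism `F x ⟶ y` lying over `f` is nonempty if and only if `f` factors through `U`, and
any two of its objects are isomorphic by a unique isomorphism. -/
def IsOpenImmersionOfStacks {𝒳 𝒴 : BasedCategory.{1, 2} AffC} (F : BasedFunctor 𝒳 𝒴) : Prop :=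
  ∀ y : 𝒴.obj, ∃ U : TopologicalSpace.Opens (PrimeSpectrum (𝒴.p.obj y).unop),
    ∀ (B : CommAlgCat.{0} ℂ) (f : (𝒴.p.obj y).unop ⟶ B),
      ((∃ (x : 𝒳.obj) (u : F.obj x ⟶ y), 𝒴.p.IsHomLift f.op u) ↔
        Set.range (PrimeSpectrum.comap f.hom.toRingHom) ⊆ U) ∧
      ∀ (x x' : 𝒳.obj) (u : F.obj x ⟶ y) (u' : F.obj x' ⟶ y),
        𝒴.p.IsHomLift f.op u → 𝒴.p.IsHomLift f.op u' →
        ∃! e : x ≅ x', 𝒳.p.IsHomLift (𝟙 (op B)) e.hom ∧ F.map e.hom ≫ u' = u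

/-! ### Subgroups, products and images of group functors -/

/-- A subgroup functor of a group functor. -/
@[ext]
structure SubgroupFunctor (G : GroupFunctor) where
  pts : ∀ R : CommAlgCat.{0} ℂ, Subgroup (G.obj R)
  map_mem : ∀ {R S : CommAlgCat.{0} ℂ} (f : R ⟶ S) (g : G.obj R), g ∈ pts R →
    G.map f g ∈ pts S

namespace SubgroupFunctor

variable {G : GroupFunctor}

def toFunctor (H : SubgroupFunctor G) : GroupFunctor where
  obj R := GrpCat.of (H.pts R)
  map {R S} f := GrpCat.ofHom
    (((G.map f).hom.comp (H.pts R).subtype).codRestrict (H.pts S)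
      (fun g => H.map_mem f g.1 g.2))
  map_id R := by
    ext g
    exact ConcreteCategory.congr_hom (G.map_id R) g.1
  map_comp f g := by
    ext x
    exact ConcreteCategory.congr_hom (G.map_comp f g) x.1

def incl (H : SubgroupFunctor G) : H.toFunctor ⟶ G where
  app R := GrpCat.ofHom (H.pts R).subtype
  naturality _ _ _ := rfl

end SubgroupFunctor

/-- The image of a homomorphism `ρ : K ⟶ G` of algebraic groups, as an fppf sheaf: the points of
`G` that lift to `K` fppf-locally. -/
def imageSubgroup {K G : GroupFunctor} (ρ : K ⟶ G) : SubgroupFunctor G where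
  pts R :=
    { carrier := {g | ∃ S ∈ fppfTopology (op R), ∀ (A : CommAlgCat.{0} ℂ) (f : R ⟶ A),
        S f.op → ∃ k : K.obj A, ρ.app A k = G.map f g}
      mul_mem' := by
        rintro g h ⟨S, hS, H⟩ ⟨S', hS', H'⟩
        refine ⟨S ⊓ S', fppfTopology.intersection_covering hS hS', fun A f hf => ?_⟩
        obtain ⟨k, hk⟩ := H A f hf.1
        obtain ⟨k', hk'⟩ := H' A f hf.2
        exact ⟨k * k', by rw [map_mul, map_mul, hk, hk']⟩
      one_mem' := ⟨⊤, fppfTopology.top_mem _, fun A f _ => ⟨1, by rw [map_one, map_one]⟩⟩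
      inv_mem' := by
        rintro g ⟨S, hS, H⟩
        refine ⟨S, hS, fun A f hf => ?_⟩
        obtain ⟨k, hk⟩ := H A f hf
        exact ⟨k⁻¹, by rw [map_inv, map_inv, hk]⟩ }
  map_mem := by
    rintro R R' f g ⟨S, hS, H⟩
    refine ⟨S.pullback f.op, fppfTopology.pullback_stable f.op hS, fun A h hh => ?_⟩
    obtain ⟨k, hk⟩ := H A (f ≫ h) hh
    exact ⟨k, by rw [hk, Functor.map_comp]; rfl⟩

def toImage {K G : GroupFunctor} (ρ : K ⟶ G) : K ⟶ (imageSubgroup ρ).toFunctor where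
  app R := GrpCat.ofHom ((ρ.app R).hom.codRestrict ((imageSubgroup ρ).pts R) (fun k =>
    ⟨⊤, fppfTopology.top_mem _, fun A f _ => ⟨K.map f k, NatTrans.naturality_apply ρ f k⟩⟩))
  naturality R S f := by
    ext k
    exact Subtype.ext (NatTrans.naturality_apply ρ f k)

def prodGroup (G H : GroupFunctor) : GroupFunctor where
  obj R := GrpCat.of (G.obj R × H.obj R)
  map f := GrpCat.ofHom ((G.map f).hom.prodMap (H.map f).hom)
  map_id R := by ext x <;> simp
  map_comp f g := by ext x <;> simp

def prodLift {K G H : GroupFunctor} (ρ : K ⟶ G) (σ : K ⟶ H) : K ⟶ prodGroup G H where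
  app R := GrpCat.ofHom ((ρ.app R).hom.prod (σ.app R).hom)
  naturality R S f := by
    ext k
    exact Prod.ext (NatTrans.naturality_apply ρ f k) (NatTrans.naturality_apply σ f k)

/-- The space `X` with `G` acting through a homomorphism `ρ : G ⟶ H`. -/
def ActedSpace.pullback {G H : GroupFunctor} (ρ : G ⟶ H) (X : ActedSpace H) : ActedSpace G where
  X := X.X
  smul g x := X.smul (ρ.app _ g) x
  one_smul x := by rw [map_one, X.one_smul]
  mul_smul g h x := by rw [map_mul, X.mul_smul]
  map_smul f g x := by rw [X.map_smul]; congr 1; exact (NatTrans.naturality_apply ρ f g).symm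

/-- A subfunctor of `X` stable under the action of `G`. -/
structure StableSubspace {G : GroupFunctor} (X : ActedSpace G) where
  pts : ∀ R : CommAlgCat.{0} ℂ, Set (X.X.obj R)
  map_mem : ∀ {R S : CommAlgCat.{0} ℂ} (f : R ⟶ S) (x : X.X.obj R), x ∈ pts R →
    X.X.map f x ∈ pts S
  smul_mem : ∀ {R : CommAlgCat.{0} ℂ} (g : G.obj R) (x : X.X.obj R), x ∈ pts R →
    X.smul g x ∈ pts R

namespace StableSubspace

variable {G : GroupFunctor} {X : ActedSpace G}

def toActedSpace (Y : StableSubspace X) : ActedSpace G where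
  X :=
    { obj := fun R => Y.pts R
      map := fun {R S} f => ↾fun x => ⟨X.X.map f x.1, Y.map_mem f x.1 x.2⟩
      map_id := fun R => by
        ext x
        exact ConcreteCategory.congr_hom (X.X.map_id R) x.1
      map_comp := fun f g => by
        ext x
        exact ConcreteCategory.congr_hom (X.X.map_comp f g) x.1 }
  smul g x := ⟨X.smul g x.1, Y.smul_mem g x.1 x.2⟩
  one_smul x := Subtype.ext (X.one_smul x.1)
  mul_smul g h x := Subtype.ext (X.mul_smul g h x.1)
  map_smul f g x := Subtype.ext (X.map_smul f g x.1)

def incl (Y : StableSubspace X) : EquivariantMap (𝟙 G) Y.toActedSpace X where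
  app x := x.1
  naturality _ _ := rfl
  map_smul _ _ := rfl

end StableSubspace

/-! ### Linear groups -/

/-- The group functor `∏ i, GL_{d i}`. -/
def piGL {ι : Type} (d : ι → ℕ) : GroupFunctor where
  obj R := GrpCat.of (∀ i, GL (Fin (d i)) R)
  map f := GrpCat.ofHom (MonoidHom.pi fun i =>
    (Matrix.GeneralLinearGroup.map f.hom.toRingHom).comp (Pi.evalMonoidHom _ i))
  map_id _ := by
    ext g i a b
    rfl
  map_comp f g := by
    ext x i a b
    rfl

/-- The group functor `GL_n`. -/
def glFunctor (n : ℕ) : GroupFunctor where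
  obj R := GrpCat.of (GL (Fin n) R)
  map f := GrpCat.ofHom (Matrix.GeneralLinearGroup.map f.hom.toRingHom)
  map_id _ := by
    ext g a b
    rfl
  map_comp f g := by
    ext x a b
    rfl

/-- The matrix of a point of `GL_n`. -/
def mat {n : ℕ} {R : CommAlgCat.{0} ℂ} (g : (glFunctor n).obj R) : Matrix (Fin n) (Fin n) R :=
  Units.val (show GL (Fin n) R from g)

section mat

variable {n : ℕ} {R S : CommAlgCat.{0} ℂ}

theorem mat_one : mat (1 : (glFunctor n).obj R) = 1 := rfl

theorem mat_mul (g h : (glFunctor n).obj R) : mat (g * h) = mat g * mat h := rfl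

theorem mat_mul_mat_inv (g : (glFunctor n).obj R) : mat g * mat g⁻¹ = 1 :=
  Units.mul_inv (show GL (Fin n) R from g)

theorem mat_inv_mul_mat (g : (glFunctor n).obj R) : mat g⁻¹ * mat g = 1 :=
  Units.inv_mul (show GL (Fin n) R from g)

theorem mat_map (f : R ⟶ S) (g : (glFunctor n).obj R) :
    mat ((glFunctor n).map f g) = (mat g).map f.hom := rfl

theorem mat_map_inv (f : R ⟶ S) (g : (glFunctor n).obj R) :
    mat ((glFunctor n).map f g)⁻¹ = (mat g⁻¹).map f.hom := by
  rw [← map_inv, mat_map]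

end mat

def piGLProj {ι : Type} (d : ι → ℕ) (i : ι) : piGL d ⟶ glFunctor (d i) where
  app _ := GrpCat.ofHom (Pi.evalMonoidHom _ i)
  naturality _ _ _ := rfl

/-- `GL(V, W)` for `V = ℂ^n` and `W = ℂ^m`: the functor of invertible `m × n` matrices. The group
`GL(V) × GL(W)` acts by `(g, h) • x = h x g⁻¹`. -/
def isoSpace (n m : ℕ) : ActedSpace (prodGroup (glFunctor n) (glFunctor m)) where
  X :=
    { obj := fun R => {x : Matrix (Fin m) (Fin n) R //
        ∃ y : Matrix (Fin n) (Fin m) R, x * y = 1 ∧ y * x = 1}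
      map := fun f => ↾fun x => ⟨x.1.map f.hom, by
        obtain ⟨y, h1, h2⟩ := x.2
        refine ⟨y.map f.hom, ?_, ?_⟩
        · rw [← Matrix.map_mul, h1, Matrix.map_one _ (map_zero _) (map_one _)]
        · rw [← Matrix.map_mul, h2, Matrix.map_one _ (map_zero _) (map_one _)]⟩
      map_id := fun _ => by ext x; rfl
      map_comp := fun _ _ => by ext x; rfl }
  smul g x := ⟨mat g.2 * x.1 * mat g.1⁻¹, by
    obtain ⟨y, h1, h2⟩ := x.2
    refine ⟨mat g.1 * y * mat g.2⁻¹, ?_, ?_⟩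
    · calc mat g.2 * x.1 * mat g.1⁻¹ * (mat g.1 * y * mat g.2⁻¹)
          = mat g.2 * x.1 * (mat g.1⁻¹ * mat g.1) * y * mat g.2⁻¹ := by
            simp only [Matrix.mul_assoc]
        _ = 1 := by
            rw [mat_inv_mul_mat, Matrix.mul_one, Matrix.mul_assoc (mat g.2), h1, Matrix.mul_one,
              mat_mul_mat_inv]
    · calc mat g.1 * y * mat g.2⁻¹ * (mat g.2 * x.1 * mat g.1⁻¹)
          = mat g.1 * y * (mat g.2⁻¹ * mat g.2) * x.1 * mat g.1⁻¹ := by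
            simp only [Matrix.mul_assoc]
        _ = 1 := by
            rw [mat_inv_mul_mat, Matrix.mul_one, Matrix.mul_assoc (mat g.1), h2, Matrix.mul_one,
              mat_mul_mat_inv]⟩
  one_smul x := Subtype.ext (by
    change mat 1 * x.1 * mat (1 : (glFunctor n).obj _)⁻¹ = x.1
    rw [inv_one, mat_one, mat_one, Matrix.one_mul, Matrix.mul_one])
  mul_smul g h x := Subtype.ext (by
    change mat (g.2 * h.2) * x.1 * mat (g.1 * h.1)⁻¹ =
      mat g.2 * (mat h.2 * x.1 * mat h.1⁻¹) * mat g.1⁻¹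
    rw [_root_.mul_inv_rev]
    simp only [mat_mul, Matrix.mul_assoc])
  map_smul f g x := Subtype.ext (by
    change (mat g.2 * x.1 * mat g.1⁻¹).map f.hom =
      mat ((glFunctor m).map f g.2) * x.1.map f.hom * mat ((glFunctor n).map f g.1)⁻¹
    rw [mat_map_inv, mat_map, Matrix.map_mul, Matrix.map_mul])

/-- Extension of scalars along `f : R → S` of a submodule of `R^n` to one of `S^n`. -/
def extendScalars {R S : Type} [CommRing R] [CommRing S] {n : ℕ} (f : R →+* S)
    (F : Submodule R (Fin n → R)) : Submodule S (Fin n → S) :=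
  Submodule.span S ((fun v i => f (v i)) '' (F : Set (Fin n → R)))

theorem extendScalars_id {R : Type} [CommRing R] {n : ℕ} (F : Submodule R (Fin n → R)) :
    extendScalars (RingHom.id R) F = F := by
  simp [extendScalars]

theorem mem_extendScalars {R S : Type} [CommRing R] [CommRing S] {n : ℕ} (f : R →+* S)
    (F : Submodule R (Fin n → R)) {v : Fin n → R} (hv : v ∈ F) :
    (fun i => f (v i)) ∈ extendScalars f F :=
  Submodule.subset_span ⟨v, hv, rfl⟩

theorem extendScalars_le {R S : Type} [CommRing R] [CommRing S] {n : ℕ} {f : R →+* S}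
    {F : Submodule R (Fin n → R)} {N : Submodule S (Fin n → S)}
    (h : ∀ v ∈ F, (fun i => f (v i)) ∈ N) : extendScalars f F ≤ N := by
  rw [extendScalars, Submodule.span_le]
  rintro _ ⟨v, hv, rfl⟩
  exact h v hv

theorem extendScalars_mono {R S : Type} [CommRing R] [CommRing S] {n : ℕ} (f : R →+* S)
    {F F' : Submodule R (Fin n → R)} (h : F ≤ F') : extendScalars f F ≤ extendScalars f F' :=
  extendScalars_le fun _ hv => mem_extendScalars f F' (h hv)

theorem extendScalars_comp {R S T : Type} [CommRing R] [CommRing S] [CommRing T] {n : ℕ}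
    (f : R →+* S) (g : S →+* T) (F : Submodule R (Fin n → R)) :
    extendScalars (g.comp f) F = extendScalars g (extendScalars f F) := by
  apply le_antisymm
  · exact extendScalars_le fun v hv => mem_extendScalars g _ (mem_extendScalars f F hv)
  · apply extendScalars_le
    intro w hw
    refine Submodule.span_induction (p := fun w _ => (fun i => g (w i)) ∈
      extendScalars (g.comp f) F) ?_ ?_ ?_ ?_ hw
    · rintro _ ⟨v, hv, rfl⟩
      exact mem_extendScalars (g.comp f) F hv
    · convert Submodule.zero_mem _ using 1
      ext i
      simp
    · intro x y _ _ hx hy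
      convert Submodule.add_mem _ hx hy using 1
      ext i
      simp
    · intro a x _ hx
      convert Submodule.smul_mem _ (g a) hx using 1
      ext i
      simp

theorem extendScalars_map {R S : Type} [CommRing R] [CommRing S] {n : ℕ} (f : R →+* S)
    (M : Matrix (Fin n) (Fin n) R) (F : Submodule R (Fin n → R)) :
    extendScalars f (F.map M.mulVecLin) = (extendScalars f F).map (M.map f).mulVecLin := by
  have key : ∀ v : Fin n → R, (fun i => f (M.mulVec v i)) = (M.map f).mulVec (fun i => f (v i)) :=
    fun v => funext fun i => RingHom.map_mulVec f M v i
  apply le_antisymm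
  · apply extendScalars_le
    rintro _ ⟨v, hv, rfl⟩
    exact ⟨_, mem_extendScalars f F hv, (key v).symm⟩
  · rw [Submodule.map_le_iff_le_comap]
    apply extendScalars_le
    intro v hv
    change (M.map f).mulVec (fun i => f (v i)) ∈ extendScalars f (F.map M.mulVecLin)
    rw [← key]
    exact mem_extendScalars f _ ⟨v, hv, rfl⟩

theorem map_mulVecLin_one {R : Type} [CommRing R] {n : ℕ} (F : Submodule R (Fin n → R)) :
    F.map (1 : Matrix (Fin n) (Fin n) R).mulVecLin = F := by
  rw [Matrix.mulVecLin_one, Submodule.map_id]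

theorem map_mulVecLin_mul {R : Type} [CommRing R] {n : ℕ} (M N : Matrix (Fin n) (Fin n) R)
    (F : Submodule R (Fin n → R)) :
    F.map (M * N).mulVecLin = (F.map N.mulVecLin).map M.mulVecLin := by
  rw [Matrix.mulVecLin_mul, Submodule.map_comp]

/-- The stabilizer in `GL_n` of a family of subspaces of `ℂ^n`. -/
def flagStabilizer {n : ℕ} {ι : Type} (F : ι → Submodule ℂ (Fin n → ℂ)) :
    SubgroupFunctor (glFunctor n) where
  pts R :=
    { carrier := {g | ∀ i, (extendScalars (algebraMap ℂ R) (F i)).map (mat g).mulVecLin =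
          extendScalars (algebraMap ℂ R) (F i)}
      mul_mem' := by
        intro g h hg hh i
        rw [mat_mul, map_mulVecLin_mul, hh i, hg i]
      one_mem' := fun i => map_mulVecLin_one _
      inv_mem' := by
        intro g hg i
        conv_lhs => rw [← hg i]
        rw [← map_mulVecLin_mul, mat_inv_mul_mat, map_mulVecLin_one] }
  map_mem := by
    intro R S f g hg i
    have hf : algebraMap ℂ S = f.hom.toRingHom.comp (algebraMap ℂ R) :=
      (AlgHom.comp_algebraMap f.hom).symm
    have := extendScalars_map f.hom.toRingHom (mat g) (extendScalars (algebraMap ℂ R) (F i))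
    rw [hg i, ← extendScalars_comp, ← hf] at this
    exact this.symm

/-- `ℂ` as a `ℂ`-algebra; points over it are the `ℂ`-points. -/
abbrev complexPoint : CommAlgCat.{0} ℂ := CommAlgCat.of ℂ ℂ

namespace SubgroupFunctor

variable {n : ℕ}

/-- A subgroup functor of `GL_n` is a closed subgroup if it is cut out by polynomial equations
in the matrix entries. -/
def IsClosed (H : SubgroupFunctor (glFunctor n)) : Prop :=
  ∃ E : Set (MvPolynomial (Fin n × Fin n) ℂ), ∀ (R : CommAlgCat.{0} ℂ)
    (g : (glFunctor n).obj R), g ∈ H.pts R ↔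
      ∀ p ∈ E, MvPolynomial.aeval (fun ij : Fin n × Fin n => mat g ij.1 ij.2) p = 0

/-- A closed subgroup of `GL_n` is parabolic if it contains a Borel subgroup, that is, a conjugate
of the group of upper triangular matrices. -/
def IsParabolic (P : SubgroupFunctor (glFunctor n)) : Prop :=
  P.IsClosed ∧ ∃ h : GL (Fin n) ℂ, ∀ (R : CommAlgCat.{0} ℂ) (b : (glFunctor n).obj R),
    (∀ i j, j < i → mat b i j = 0) →
      ∀ h' : (glFunctor n).obj R, mat h' = h.1.map (algebraMap ℂ R) → h' * b * h'⁻¹ ∈ P.pts R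

/-- `U` is the unipotent radical of `P ⊆ GL_n`: a closed normal subgroup of `P` consisting of
unipotent matrices, which contains every such subgroup. (Over `ℂ`, unipotent groups are
automatically connected, and closed subgroups are determined by their `ℂ`-points.) -/
structure IsUnipotentRadical (P U : SubgroupFunctor (glFunctor n)) : Prop where
  isClosed : U.IsClosed
  le : ∀ R, U.pts R ≤ P.pts R
  normal : ∀ R, ∀ g ∈ P.pts R, ∀ u ∈ U.pts R, g * u * g⁻¹ ∈ U.pts R
  unipotent : ∀ u ∈ U.pts complexPoint, IsNilpotent (mat u - 1)
  maximal : ∀ N : Subgroup ((glFunctor n).obj complexPoint), N ≤ P.pts complexPoint →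
    (∀ g ∈ P.pts complexPoint, ∀ u ∈ N, g * u * g⁻¹ ∈ N) →
    (∀ u ∈ N, IsNilpotent (mat u - 1)) → N ≤ U.pts complexPoint

/-- `L` is a Levi subgroup of `P`: a closed subgroup such that `P` is the semidirect product of
`L` and the unipotent radical of `P`. -/
def IsLevi (P L : SubgroupFunctor (glFunctor n)) : Prop :=
  L.IsClosed ∧ ∃ U : SubgroupFunctor (glFunctor n), IsUnipotentRadical P U ∧
    (∀ R, L.pts R ≤ P.pts R) ∧
    ∀ R, ∀ g ∈ P.pts R, ∃! lu : L.pts R × U.pts R, lu.1.1 * lu.2.1 = g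

/-- The transport to `GL_n` of a subgroup of `GL_m` through an `m × n` matrix `B` (the
change of basis `ℂ^n ≃ ℂ^m` when `B` is invertible): the `g` with `B g B⁻¹ ∈ H`. -/
def transport {m : ℕ} (H : SubgroupFunctor (glFunctor m)) (B : Matrix (Fin m) (Fin n) ℂ) :
    SubgroupFunctor (glFunctor n) where
  pts R :=
    { carrier := {g | ∃ h ∈ H.pts R,
        mat h * B.map (algebraMap ℂ R) = B.map (algebraMap ℂ R) * mat g}
      mul_mem' := by
        rintro g g' ⟨h, hh, e⟩ ⟨h', hh', e'⟩
        refine ⟨h * h', mul_mem hh hh', ?_⟩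
        rw [mat_mul, mat_mul, Matrix.mul_assoc, e', ← Matrix.mul_assoc, e, Matrix.mul_assoc]
      one_mem' := ⟨1, one_mem _, by rw [mat_one, mat_one, Matrix.one_mul, Matrix.mul_one]⟩
      inv_mem' := by
        rintro g ⟨h, hh, e⟩
        refine ⟨h⁻¹, inv_mem hh, ?_⟩
        calc mat h⁻¹ * B.map (algebraMap ℂ R)
            = mat h⁻¹ * (B.map (algebraMap ℂ R) * (mat g * mat g⁻¹)) := by
              rw [mat_mul_mat_inv, Matrix.mul_one]
          _ = mat h⁻¹ * (mat h * B.map (algebraMap ℂ R) * mat g⁻¹) := by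
              rw [e, Matrix.mul_assoc]
          _ = B.map (algebraMap ℂ R) * mat g⁻¹ := by
              rw [Matrix.mul_assoc, ← Matrix.mul_assoc, mat_inv_mul_mat, Matrix.one_mul] }
  map_mem := by
    rintro R S f g ⟨h, hh, e⟩
    refine ⟨(glFunctor m).map f h, H.map_mem f h hh, ?_⟩
    have hB : B.map (algebraMap ℂ S) = (B.map (algebraMap ℂ R)).map f.hom := by
      ext i j
      exact (f.hom.commutes _).symm
    rw [mat_map, mat_map, hB, ← Matrix.map_mul, ← Matrix.map_mul, e]

end SubgroupFunctor

/-- The inclusion `K × H ⟶ GL_n × GL_m` for subgroups `K` and `H`. -/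
def prodIncl {n m : ℕ} (K : SubgroupFunctor (glFunctor n)) (H : SubgroupFunctor (glFunctor m)) :
    prodGroup K.toFunctor H.toFunctor ⟶ prodGroup (glFunctor n) (glFunctor m) where
  app R := GrpCat.ofHom ((K.pts R).subtype.prodMap (H.pts R).subtype)
  naturality _ _ _ := rfl

/-- `GL(ℂ^n, ℂ^m)` with the action of `K × H`, where `K ⊆ GL_n` acts on the source (on the right)
and `H ⊆ GL_m` on the target (on the left). Its quotient stack is `[H \ GL(ℂ^n, ℂ^m) / K]`. -/
def doubleCosetSpace {n m : ℕ} (K : SubgroupFunctor (glFunctor n))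
    (H : SubgroupFunctor (glFunctor m)) : ActedSpace (prodGroup K.toFunctor H.toFunctor) :=
  (isoSpace n m).pullback (prodIncl K H)

/-! ### Weight functions and the Vogan variety -/

/-- The `a`-shifted floor of `a + q`. -/
def shiftedFloor (a : ℂ) (q : ℚ) : ℂ := a + (⌊q⌋ : ℤ)

/-- The `a`-shifted ceiling of `a + q`. -/
def shiftedCeil (a : ℂ) (q : ℚ) : ℂ := a + (⌈q⌉ : ℤ)

theorem shiftedCeil_eq (a : ℂ) (q : ℚ) (hq : ∀ m : ℤ, q ≠ m) :
    shiftedCeil a q = shiftedFloor a q + 1 := by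
  have h : ⌈q⌉ = ⌊q⌋ + 1 := by
    rw [Int.ceil_eq_iff]
    refine ⟨?_, ?_⟩
    · push_cast
      have := Int.floor_le q
      have h2 := hq ⌊q⌋
      have : (⌊q⌋ : ℚ) < q := lt_of_le_of_ne this (Ne.symm h2)
      linarith
    · push_cast
      exact (Int.lt_floor_add_one q).le
  rw [shiftedCeil, shiftedFloor, h]
  push_cast
  ring

/-- The monotonicity assumption on an integral weight function `φ` supported on `a + ℤ`, for
`r = a + q` with `q` rational and not an integer: `φ` is weakly increasing on `(-∞, ⌈r⌉]` and
weakly decreasing on `[⌊r⌋, ∞)`, where `a + m ≤ a + m'` means `m ≤ m'`. -/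
structure IsUnimodalAt (φ : ℂ → ℕ) (a : ℂ) (q : ℚ) : Prop where
  finite_support : φ.support.Finite
  integral : ∀ i, φ i ≠ 0 → ∃ m : ℤ, i = a + m
  not_int : ∀ m : ℤ, q ≠ m
  increasing : ∀ m m' : ℤ, m ≤ m' → m' ≤ ⌈q⌉ → φ (a + m) ≤ φ (a + m')
  decreasing : ∀ m m' : ℤ, ⌊q⌋ ≤ m → m ≤ m' → φ (a + m') ≤ φ (a + m)

/-- The space `E_φ = ⨁_i Hom(V_i, V_{i+1})` over `R`, where `V_i = R^{φ i}`. The component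
`Hom(V_i, V_{i+1})` is `T i j h` with `h : j = i + 1`. -/
def QuiverRep (φ : ℂ → ℕ) (R : Type) : Type :=
  ∀ i j : ℂ, j = i + 1 → Matrix (Fin (φ j)) (Fin (φ i)) R

/-- `E_φ` with the action of `G_φ = ∏ i, GL(V_i)` by conjugation. -/
def voganVariety (φ : ℂ → ℕ) : ActedSpace (piGL φ) where
  X :=
    { obj := fun R => QuiverRep φ R
      map := fun f => ↾fun T i j h => (T i j h).map f.hom
      map_id := fun _ => rfl
      map_comp := fun _ _ => rfl }
  smul {R} g T i j h := mat ((piGLProj φ j).app R g) * T i j h * mat ((piGLProj φ i).app R g)⁻¹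
  one_smul {R} T := by
    funext i j h
    rw [map_one, map_one, inv_one, mat_one, mat_one, Matrix.one_mul, Matrix.mul_one]
  mul_smul {R} g g' T := by
    funext i j h
    rw [map_mul, map_mul, _root_.mul_inv_rev]
    simp only [mat_mul, Matrix.mul_assoc]
  map_smul {R S} f g T := by
    funext i j h
    change (mat ((piGLProj φ j).app R g) * T i j h * mat ((piGLProj φ i).app R g)⁻¹).map f.hom =
      mat ((glFunctor (φ j)).map f ((piGLProj φ j).app R g)) * (T i j h).map f.hom *
        mat ((glFunctor (φ i)).map f ((piGLProj φ i).app R g))⁻¹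
    rw [mat_map_inv, mat_map, Matrix.map_mul, Matrix.map_mul]

/-- `T` has full rank if, at every point of `Spec R`, each component `T_i` has the maximal
possible rank. -/
def IsFullRank {φ : ℂ → ℕ} {R : Type} [CommRing R] (T : QuiverRep φ R) : Prop :=
  ∀ (K : Type) [Field K] (f : R →+* K) (i j : ℂ) (h : j = i + 1),
    ((T i j h).map f).rank = min (φ i) (φ j)

theorem rank_conj {K : Type} [Field K] {m n : ℕ} {g g' : Matrix (Fin m) (Fin m) K}
    {k k' : Matrix (Fin n) (Fin n) K} (hg : g' * g = 1) (hk : k * k' = 1)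
    (A : Matrix (Fin m) (Fin n) K) : (g * A * k).rank = A.rank := by
  apply le_antisymm
  · exact (Matrix.rank_mul_le_left _ _).trans (Matrix.rank_mul_le_right _ _)
  · have h : A = g' * (g * A * k) * k' := by
      calc A = (g' * g) * A * (k * k') := by rw [hg, hk, Matrix.one_mul, Matrix.mul_one]
        _ = _ := by simp only [Matrix.mul_assoc]
    conv_lhs => rw [h]
    exact (Matrix.rank_mul_le_left _ _).trans (Matrix.rank_mul_le_right _ _)

/-- The full rank part `O_φ`, an open subscheme of `E_φ`. -/
def fullRankPart (φ : ℂ → ℕ) : StableSubspace (voganVariety φ) where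
  pts R := {T : QuiverRep φ R | IsFullRank T}
  map_mem := by
    intro R S f T hT K _ g i j h
    have := hT K (g.comp f.hom.toRingHom) i j h
    rw [← this]
    rfl
  smul_mem := by
    intro R g T hT K _ f i j h
    rw [← hT K f i j h]
    change ((mat ((piGLProj φ j).app R g) * T i j h *
      mat ((piGLProj φ i).app R g)⁻¹).map f).rank = _
    rw [Matrix.map_mul, Matrix.map_mul]
    apply rank_conj (g' := (mat ((piGLProj φ j).app R g)⁻¹).map f)
      (k' := (mat ((piGLProj φ i).app R g)).map f)
    · rw [← Matrix.map_mul, mat_inv_mul_mat, Matrix.map_one _ (map_zero _) (map_one _)]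
    · rw [← Matrix.map_mul, mat_inv_mul_mat, Matrix.map_one _ (map_zero _) (map_one _)]

section Projection

open Classical in
/-- The projection `T ↦ T̲` of `E_φ` onto the sum of the `Hom(V_i, V_{i+1})` with `i ≠ ℓ`, viewed
as a direct summand of `E_φ`. -/
noncomputable def dropComponent {φ : ℂ → ℕ} (ℓ : ℂ) {R : Type} [CommRing R] (T : QuiverRep φ R) :
    QuiverRep φ R :=
  fun i j h => if i = ℓ then 0 else T i j h

theorem map_dropComponent {φ : ℂ → ℕ} (ℓ : ℂ) {R S : CommAlgCat.{0} ℂ} (f : R ⟶ S)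
    (T : QuiverRep φ R) :
    (voganVariety φ).X.map f (dropComponent ℓ T) =
      dropComponent ℓ (R := S) ((voganVariety φ).X.map f T) := by
  funext i j h
  change (dropComponent ℓ T i j h).map f.hom =
    if i = ℓ then (0 : Matrix (Fin (φ j)) (Fin (φ i)) S) else (T i j h).map f.hom
  unfold dropComponent
  split_ifs
  · exact Matrix.map_zero _ (map_zero _)
  · rfl

theorem smul_dropComponent {φ : ℂ → ℕ} (ℓ : ℂ) {R : CommAlgCat.{0} ℂ} (g : (piGL φ).obj R)
    (T : QuiverRep φ R) :
    (voganVariety φ).smul g (dropComponent ℓ T) =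
      dropComponent ℓ (R := R) ((voganVariety φ).smul g T) := by
  funext i j h
  change mat ((piGLProj φ j).app R g) * dropComponent ℓ T i j h *
      mat ((piGLProj φ i).app R g)⁻¹ =
    if i = ℓ then (0 : Matrix (Fin (φ j)) (Fin (φ i)) R) else
      mat ((piGLProj φ j).app R g) * T i j h * mat ((piGLProj φ i).app R g)⁻¹
  unfold dropComponent
  split_ifs
  · rw [Matrix.mul_zero, Matrix.zero_mul]
  · rfl

end Projection

/-- The image of the full rank part (its `ℂ`-points) under the projection `T ↦ T̲`. -/
def projectedPart (φ : ℂ → ℕ) (ℓ : ℂ) : Set (QuiverRep φ ℂ) :=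
  dropComponent ℓ '' (fullRankPart φ).pts complexPoint

/-- The constant `R`-point of `E_φ` given by a `ℂ`-point. -/
def constPoint {φ : ℂ → ℕ} (T : QuiverRep φ ℂ) (R : CommAlgCat.{0} ℂ) : QuiverRep φ R :=
  fun i j h => (T i j h).map (algebraMap ℂ R)

theorem map_constPoint {φ : ℂ → ℕ} (T : QuiverRep φ ℂ) {R S : CommAlgCat.{0} ℂ} (f : R ⟶ S) :
    (voganVariety φ).X.map f (constPoint T R) = constPoint T S := by
  funext i j h
  ext x y
  exact f.hom.commutes _

/-- The stabilizer `G_{φ,T}` in `G_φ` of a `ℂ`-point `T` of `E_φ`. -/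
def stabilizer {φ : ℂ → ℕ} (T : QuiverRep φ ℂ) : SubgroupFunctor (piGL φ) where
  pts R :=
    { carrier := {g | (voganVariety φ).smul g (constPoint T R) = constPoint T R}
      mul_mem' := fun {g h} hg hh =>
        ((voganVariety φ).mul_smul g h _).trans ((congrArg ((voganVariety φ).smul g) hh).trans hg)
      one_mem' := (voganVariety φ).one_smul _
      inv_mem' := fun {g} hg =>
        (congrArg ((voganVariety φ).smul g⁻¹) hg).symm.trans
          (((voganVariety φ).mul_smul g⁻¹ g _).symm.trans
            ((congrArg (fun h => (voganVariety φ).smul h _) (inv_mul_cancel g)).trans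
              ((voganVariety φ).one_smul _))) }
  map_mem := by
    intro R S f g hg
    have := (voganVariety φ).map_smul f g (constPoint T R)
    rw [hg, map_constPoint] at this
    exact this.symm

/-- The fibre of the full rank part over a point `T` of its projection, with the action of the
stabilizer of `T`. -/
def fibreOver {φ : ℂ → ℕ} (ℓ : ℂ) (T : QuiverRep φ ℂ) :
    StableSubspace ((fullRankPart φ).toActedSpace.pullback (stabilizer T).incl) where
  pts R := {T' | dropComponent ℓ (R := R) T'.1 = constPoint T R}
  map_mem := by
    intro R S f T' hT'
    have := map_dropComponent ℓ f (T'.1 : QuiverRep φ R)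
    rw [hT', map_constPoint] at this
    exact this.symm
  smul_mem := by
    intro R g T' hT'
    have := smul_dropComponent ℓ g.1 (T'.1 : QuiverRep φ R)
    rw [hT', g.2] at this
    exact this.symm

/-- The inclusion of the fibre over `T` into the full rank part, equivariant with respect to the
inclusion of the stabilizer of `T` into `G_φ`. -/
def fibreIncl {φ : ℂ → ℕ} (ℓ : ℂ) (T : QuiverRep φ ℂ) :
    EquivariantMap (stabilizer T).incl (fibreOver ℓ T).toActedSpace
      (fullRankPart φ).toActedSpace where
  app x := x.1
  naturality _ _ := rfl
  map_smul _ _ := rfl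

/-- The projection of the stabilizer of `T` to `GL(V_i)`. -/
def stabilizerProj {φ : ℂ → ℕ} (T : QuiverRep φ ℂ) (i : ℂ) :
    (stabilizer T).toFunctor ⟶ glFunctor (φ i) :=
  (stabilizer T).incl ≫ piGLProj φ i

/-- The image in `GL(V_i)` of the stabilizer of `T`. For `i = ⌊r⌋` and `i = ⌈r⌉` these are the
groups `G_{φ,T}^l` and `G_{φ,T}^r`. -/
def stabilizerImage {φ : ℂ → ℕ} (T : QuiverRep φ ℂ) (i : ℂ) : SubgroupFunctor (glFunctor (φ i)) :=
  imageSubgroup (stabilizerProj T i)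

/-- The product of the projections of the stabilizer of `T` to its images in `GL(V_i)` and in
`GL(V_j)`. -/
def stabilizerToImages {φ : ℂ → ℕ} (T : QuiverRep φ ℂ) (i j : ℂ) :
    (stabilizer T).toFunctor ⟶
      prodGroup (stabilizerImage T i).toFunctor (stabilizerImage T j).toFunctor :=
  prodLift (toImage (stabilizerProj T i)) (toImage (stabilizerProj T j))

/-- The subspace `T^k (V_{j-k})` of `V_j`. -/
def imageFlag {φ : ℂ → ℕ} (T : QuiverRep φ ℂ) : ℕ → ∀ j : ℂ, Submodule ℂ (Fin (φ j) → ℂ)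
  | 0, _ => ⊤
  | k + 1, j => (imageFlag T k (j - 1)).map (T (j - 1) j (sub_add_cancel j 1).symm).mulVecLin

/-- The kernel of `T^k` on `V_j`. -/
def kernelFlag {φ : ℂ → ℕ} (T : QuiverRep φ ℂ) : ℕ → ∀ j : ℂ, Submodule ℂ (Fin (φ j) → ℂ)
  | 0, _ => ⊥
  | k + 1, j => (kernelFlag T k (j + 1)).comap (T j (j + 1) rfl).mulVecLin

/-! ### The parameter space of `GL_n(ℂ)` -/

/-- `(λ_L, λ_R)` is a (dominant) integral infinitesimal character of `GL_n(ℂ)`. -/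
structure IsIntegralInfChar {n : ℕ} (lamL lamR : Fin n → ℂ) : Prop where
  sub_int : ∀ i, ∃ m : ℤ, lamL i - lamR i = m
  dominant_left : ∀ i j, i ≤ j → ∃ m : ℕ, lamL i - lamL j = m
  dominant_right : ∀ i j, i ≤ j → ∃ m : ℕ, lamR i - lamR j = m

/-- `F` is a direct summand of `R^n` (the image of an idempotent) of constant rank `d`. -/
def IsSummandOfRank {n : ℕ} {R : Type} [CommRing R] (F : Submodule R (Fin n → R)) (d : ℕ) : Prop :=
  ∃ e : Matrix (Fin n) (Fin n) R, e * e = e ∧ F = LinearMap.range e.mulVecLin ∧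
    ∀ (K : Type) [Field K] (f : R →+* K), (e.map f).rank = d

theorem IsSummandOfRank.extendScalars {n : ℕ} {R S : Type} [CommRing R] [CommRing S]
    {F : Submodule R (Fin n → R)} {d : ℕ} (h : IsSummandOfRank F d) (f : R →+* S) :
    IsSummandOfRank (extendScalars f F) d := by
  obtain ⟨e, he, hF, hr⟩ := h
  refine ⟨e.map f, by rw [← Matrix.map_mul, he], ?_, fun K _ g => ?_⟩
  · rw [hF, LinearMap.range_eq_map, extendScalars_map, LinearMap.range_eq_map]
    congr 1
    rw [eq_top_iff]
    intro v _
    rw [← Finset.univ_sum_single v]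
    refine Submodule.sum_mem _ fun i _ => ?_
    have h1 := mem_extendScalars f (⊤ : Submodule R (Fin n → R)) (v := Pi.single i 1) trivial
    convert Submodule.smul_mem _ (v i) h1 using 1
    ext k
    by_cases hk : k = i
    · subst hk
      simp
    · simp [Pi.single_eq_of_ne hk]
  · rw [← hr K (g.comp f)]
    rfl

theorem IsSummandOfRank.map {n : ℕ} {R : CommAlgCat.{0} ℂ}
    {F : Submodule R (Fin n → R)} {d : ℕ} (h : IsSummandOfRank F d) (g : (glFunctor n).obj R) :
    IsSummandOfRank (F.map (mat g).mulVecLin) d := by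
  obtain ⟨e, he, hF, hr⟩ := h
  refine ⟨mat g * e * mat g⁻¹, ?_, ?_, fun K _ f => ?_⟩
  · calc mat g * e * mat g⁻¹ * (mat g * e * mat g⁻¹)
        = mat g * e * (mat g⁻¹ * mat g) * e * mat g⁻¹ := by simp only [Matrix.mul_assoc]
      _ = mat g * e * mat g⁻¹ := by
        rw [mat_inv_mul_mat, Matrix.mul_one, Matrix.mul_assoc (mat g), he]
  · rw [hF, LinearMap.range_eq_map, LinearMap.range_eq_map, map_mulVecLin_mul, map_mulVecLin_mul]
    congr 2
    symm
    rw [eq_top_iff]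
    intro v _
    refine ⟨(mat g).mulVec v, trivial, ?_⟩
    rw [Matrix.mulVecLin_apply, Matrix.mulVec_mulVec, mat_inv_mul_mat, Matrix.one_mulVec]
  · rw [← hr K f, Matrix.map_mul, Matrix.map_mul]
    apply rank_conj (g' := (mat g⁻¹).map f) (k' := (mat g).map f)
    · rw [← Matrix.map_mul, mat_inv_mul_mat, Matrix.map_one _ (map_zero _) (map_one _)]
    · rw [← Matrix.map_mul, mat_inv_mul_mat, Matrix.map_one _ (map_zero _) (map_one _)]

/-- The positions `j + 1` with `λ_{j+1} ≠ λ_{j+2}` (indices starting from `1`), that is, the simple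
roots not orthogonal to `lam`. -/
def Jumps {n : ℕ} (lam : Fin n → ℂ) : Type :=
  {j : ℕ // ∃ h : j + 1 < n, lam ⟨j, Nat.lt_of_succ_lt h⟩ ≠ lam ⟨j + 1, h⟩}

/-- The `R`-points of the partial flag variety of `GL_n` whose type is given by the simple roots
orthogonal to `lam`: flags of direct summands of `R^n` with one member of rank `d` for each `d`
with `λ_d ≠ λ_{d+1}`. -/
def FlagPoint {n : ℕ} (lam : Fin n → ℂ) (R : Type) [CommRing R] : Type :=
  {F : Jumps lam → Submodule R (Fin n → R) //
    (∀ i j, i.1 ≤ j.1 → F i ≤ F j) ∧ ∀ j, IsSummandOfRank (F j) (j.1 + 1)}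

/-- The partial flag variety of `GL_n` whose type is given by the simple roots orthogonal to
`lam`. -/
def flagVariety {n : ℕ} (lam : Fin n → ℂ) : ActedSpace (glFunctor n) where
  X :=
    { obj := fun R => FlagPoint lam R
      map := fun f => ↾fun F => ⟨fun j => extendScalars f.hom.toRingHom (F.1 j),
        fun i j hij => extendScalars_mono _ (F.2.1 i j hij),
        fun j => (F.2.2 j).extendScalars _⟩
      map_id := fun R => by
        ext F
        exact Subtype.ext (funext fun j => extendScalars_id (F.1 j))
      map_comp := fun f g => by
        ext F
        exact Subtype.ext (funext fun j =>
          extendScalars_comp f.hom.toRingHom g.hom.toRingHom (F.1 j)) }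
  smul g F := ⟨fun j => (F.1 j).map (mat g).mulVecLin,
    fun i j hij => Submodule.map_mono (F.2.1 i j hij), fun j => (F.2.2 j).map g⟩
  one_smul F := Subtype.ext (funext fun j => map_mulVecLin_one (F.1 j))
  mul_smul g h F := Subtype.ext (funext fun j => map_mulVecLin_mul (mat g) (mat h) (F.1 j))
  map_smul f g F := Subtype.ext (funext fun j => extendScalars_map f.hom.toRingHom (mat g) (F.1 j))

/-- The product of two spaces with the diagonal action. -/
def prodSpace {G : GroupFunctor} (X Y : ActedSpace G) : ActedSpace G where
  X :=
    { obj := fun R => X.X.obj R × Y.X.obj R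
      map := fun f => ↾fun x => (X.X.map f x.1, Y.X.map f x.2)
      map_id := fun R => by ext x <;> simp
      map_comp := fun f g => by ext x <;> simp }
  smul g x := (X.smul g x.1, Y.smul g x.2)
  one_smul x := Prod.ext (X.one_smul x.1) (Y.one_smul x.2)
  mul_smul g h x := Prod.ext (X.mul_smul g h x.1) (Y.mul_smul g h x.2)
  map_smul f g x := Prod.ext (X.map_smul f g x.1) (Y.map_smul f g x.2)

/-- The stack `[ΔGL_n \ (𝒫_{λ_L} × 𝒫_{λ_R})]`: the ABV space of `GL_n(ℂ)` at the integral
infinitesimal character `(λ_L, λ_R)`, modulo its group. -/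
abbrev abvStack {n : ℕ} (lamL lamR : Fin n → ℂ) : BasedCategory.{1, 2} AffC :=
  quotientStack (glFunctor n) (prodSpace (flagVariety lamL) (flagVariety lamR))

-- Write `ℓ` and `c` for the two indices around `r`. Away from the arrow `V_ℓ → V_c`, a full rank
-- representation is a chain of injections ending at `V_ℓ` and a chain of surjections starting at
-- `V_c`. A matrix of maximal rank at a point extends there to an invertible matrix
-- (`exists_completion`), so near that point a change of basis at one vertex turns one arrow into a
-- rectangular identity matrix. Treating both chains from their outer ends inwards never spoils an
-- arrow already treated, so locally every component except `T_ℓ` becomes standard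
-- (`near_exists_dropComponent_eq`). Over `Spec ℂ` a flat, finitely presented neighbourhood has a
-- section, and hence the projected part is one orbit (`mem_projectedPart_iff`).
--
-- At the standard point every `V_i` is a coordinate subspace of `V_ℓ` or a coordinate quotient of
-- `V_c`, up to spaces that are zero. An element of the stabilizer is therefore determined by its
-- components at `ℓ` and `c` (`stabilizer_std_ext`). These components preserve coordinate flags, and
-- every pair preserving the two flags occurs (`exists_stabilizer_std`). Stabilizers of coordinate
-- flags are block triangular groups, whose unipotent radical and Levi subgroup are computed
-- directly; all other points are reached by conjugation. Since flag stabilizers are closed, the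
-- fppf image of the stabilizer is no larger than its naive image. As `φ ℓ = φ c`, full rank at `ℓ`
-- means invertibility, so the fibre is the space of isomorphisms `V_ℓ → V_c`.
--
-- The statements on stacks rest on `IsSlice`. Suppose every point of a `G`-space `X` can be moved
-- locally into `Y`, and every element of `G` carrying a point of `Y` to a point of `Y` comes from
-- `H`. Then restricting a `G`-torsor to the part over `Y` and extending an `H`-torsor `P` to `G ×_H
-- P` are inverse equivalences (`IsSlice.equivalence`). The fibre over a point of the projected part
-- is such a slice of the full rank part (`isSlice_fibreIncl`).
--
-- For the corollary, `GL_n × GL_n` acts on `𝒫_{λ_L} × 𝒫_{λ_R} × GL_n`, the last factor by `z ↦ h z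
-- g⁻¹`. The locus `z = 1` is a slice with diagonal group and gives the ABV stack
-- (`isSlice_diagonalIncl`). The locus where both flags are the standard ones is a slice as well,
-- and it is the fibre over the standard representation with its stabilizer (`isSlice_stdIncl`),
-- once `λ_L` and `λ_R` are chosen to jump at the dimensions of the two flags. This requires that
-- flag varieties are fppf sheaves, by descent of direct summands, and that two flags of the same
-- type are locally conjugate. Finally the full rank locus is open, and an open stable subspace
-- gives an open immersion of quotient stacks (`isOpenImmersion_quotientStackMap`).

universe u

/-! ### Sheaves for the fppf topology -/

/-- A functor of points is an fppf sheaf. -/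
def IsFppfSheaf (X : CommAlgCat.{0} ℂ ⥤ Type u) : Prop :=
  Presieve.IsSheaf fppfTopology (unopUnop (CommAlgCat.{0} ℂ) ⋙ X)

/-- Since coverings are sieves, compatibility only has to be required along further base change;
this form avoids the opposite category and fibre products. -/
theorem isFppfSheaf_iff (X : CommAlgCat.{0} ℂ ⥤ Type u) : IsFppfSheaf X ↔
    ∀ (R : CommAlgCat.{0} ℂ) (S : Sieve (op R)), S ∈ fppfTopology (op R) →
      ∀ x : (∀ (A : CommAlgCat.{0} ℂ) (f : R ⟶ A), S f.op → X.obj A),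
        (∀ (A B : CommAlgCat.{0} ℂ) (f : R ⟶ A) (g : A ⟶ B) (hf : S f.op)
          (hfg : S (f ≫ g).op), X.map g (x A f hf) = x B (f ≫ g) hfg) →
        ∃! t : X.obj R, ∀ A f hf, X.map f t = x A f hf := by
  constructor
  · intro H R S hS x hx
    let y : Presieve.FamilyOfElements (unopUnop (CommAlgCat.{0} ℂ) ⋙ X) S.arrows :=
      fun Y f hf => x Y.unop f.unop hf
    obtain ⟨t, ht, hu⟩ := H S hS y ((Presieve.compatible_iff_sieveCompatible y).2
      fun Y Z f g hf =>
        (hx Y.unop Z.unop f.unop g.unop hf (S.downward_closed hf g)).symm)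
    exact ⟨t, fun A f hf => ht f.op hf, fun t' ht' => hu t' fun Y f hf => ht' Y.unop f.unop hf⟩
  · intro H X' S hS x hx
    rw [Presieve.compatible_iff_sieveCompatible] at hx
    obtain ⟨t, ht, hu⟩ := H X'.unop S hS (fun A f hf => x f.op hf)
      (fun A B f g hf hfg => (hx f.op g.op hf).symm)
    exact ⟨t, fun Y f hf => ht Y.unop f.unop hf, fun t' ht' => hu t' fun A f hf => ht' f.op hf⟩

theorem IsFppfSheaf.ext {X : CommAlgCat.{0} ℂ ⥤ Type u} (hX : IsFppfSheaf X)
    {R : CommAlgCat.{0} ℂ} {S : Sieve (op R)} (hS : S ∈ fppfTopology (op R)) {t t' : X.obj R}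
    (h : ∀ (A : CommAlgCat.{0} ℂ) (f : R ⟶ A), S f.op → X.map f t = X.map f t') : t = t' := by
  obtain ⟨s, -, hu⟩ := (isFppfSheaf_iff X).1 hX R S hS (fun A f _ => X.map f t) (by
    intro A B f g _ _
    rw [Functor.map_comp]
    rfl)
  rw [hu t fun _ _ _ => rfl, hu t' fun A f hf => (h A f hf).symm]

/-- The map of spectra of a morphism of `ℂ`-algebras. -/
abbrev specMap {R A : CommAlgCat.{0} ℂ} (f : R ⟶ A) : PrimeSpectrum A → PrimeSpectrum R :=
  PrimeSpectrum.comap f.hom.toRingHom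

/-- The image of a flat and finitely presented morphism is open. -/
theorem isOpenMap_specMap {R A : CommAlgCat.{0} ℂ} (f : R ⟶ A) (h1 : f.hom.toRingHom.Flat)
    (h2 : f.hom.toRingHom.FinitePresentation) : IsOpenMap (specMap f) := by
  algebraize [f.hom.toRingHom]
  exact PrimeSpectrum.isOpenMap_comap_of_hasGoingDown_of_finitePresentation (R := R) (S := A)

/-- `Q` holds on a flat and finitely presented neighbourhood of the point `p`. -/
def Near {R : CommAlgCat.{0} ℂ} (p : PrimeSpectrum R)
    (Q : ∀ A : CommAlgCat.{0} ℂ, (R ⟶ A) → Prop) : Prop :=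
  ∃ (A : CommAlgCat.{0} ℂ) (f : R ⟶ A), f.hom.toRingHom.Flat ∧
    f.hom.toRingHom.FinitePresentation ∧ (∃ x, specMap f x = p) ∧ Q A f

theorem Near.mono {R : CommAlgCat.{0} ℂ} {p : PrimeSpectrum R}
    {Q Q' : ∀ A : CommAlgCat.{0} ℂ, (R ⟶ A) → Prop} (h : Near p Q) (H : ∀ A f, Q A f → Q' A f) :
    Near p Q' := by
  obtain ⟨A, f, h1, h2, h3, h4⟩ := h
  exact ⟨A, f, h1, h2, h3, H _ _ h4⟩

theorem Near.of_self {R : CommAlgCat.{0} ℂ} {p : PrimeSpectrum R}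
    {Q : ∀ A : CommAlgCat.{0} ℂ, (R ⟶ A) → Prop} (h : Q R (𝟙 R)) : Near p Q :=
  ⟨R, 𝟙 R, RingHom.Flat.id _, RingHom.FinitePresentation.id _, ⟨p, rfl⟩, h⟩

/-- Flatness, finite presentation and passing through a given point are stable under composition.
This permits refinement in stages, as in the normalisation of a representation arrow by arrow. -/
theorem Near.trans {R : CommAlgCat.{0} ℂ} {p : PrimeSpectrum R}
    {Q Q' : ∀ A : CommAlgCat.{0} ℂ, (R ⟶ A) → Prop} (h : Near p Q)
    (H : ∀ A f, Q A f → ∀ x : PrimeSpectrum A, specMap f x = p →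
      Near x (fun B g => Q' B (f ≫ g))) : Near p Q' := by
  obtain ⟨A, f, h1, h2, ⟨x, hx⟩, h4⟩ := h
  obtain ⟨B, g, k1, k2, ⟨y, hy⟩, k4⟩ := H A f h4 x hx
  exact ⟨B, f ≫ g, RingHom.Flat.comp h1 k1, RingHom.FinitePresentation.comp k2 h2,
    ⟨y, by rw [← hx, ← hy]; rfl⟩, k4⟩

/-- The principal localization at `t` is flat and finitely presented, and its spectrum contains `p`.
Zariski neighbourhoods enter through this lemma. -/
theorem near_isUnit {R : CommAlgCat.{0} ℂ} (p : PrimeSpectrum R) (t : R) (ht : t ∉ p.asIdeal) :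
    Near p (fun _ f => IsUnit (f.hom t)) := by
  let L := Localization.Away t
  let f : R ⟶ CommAlgCat.of ℂ L := CommAlgCat.ofHom (IsScalarTower.toAlgHom ℂ R L)
  refine ⟨CommAlgCat.of ℂ L, f, ?_, ?_, ?_, IsLocalization.Away.algebraMap_isUnit t⟩
  · have : Module.Flat R L := IsLocalization.flat L (Submonoid.powers t)
    exact (RingHom.flat_algebraMap_iff (R := R) (S := L)).2 this
  · have : Algebra.FinitePresentation R L := IsLocalization.Away.finitePresentation t
    exact RingHom.finitePresentation_algebraMap.2 this
  · have h := PrimeSpectrum.localization_away_comap_range L t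
    have : p ∈ Set.range (PrimeSpectrum.comap (algebraMap R L)) := by
      rw [h]
      exact ht
    exact this

/-- Flat and finitely presented neighbourhoods of all points generate a covering. -/
theorem covering_of_near {R : CommAlgCat.{0} ℂ} {S : Sieve (op R)}
    (h : ∀ p : PrimeSpectrum R, Near p (fun _ f => S f.op)) : S ∈ fppfTopology (op R) := by
  choose A f h1 h2 h3 hS using h
  choose x hx using h3
  -- The images of the chosen neighbourhoods are open, so quasi-compactness of the spectrum leaves
  -- finitely many of them.
  obtain ⟨t, ht⟩ := isCompact_univ.elim_finite_subcover (fun p => Set.range (specMap (f p)))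
    (fun p => (isOpenMap_specMap (f p) (h1 p) (h2 p)).isOpen_range)
    (fun p _ => Set.mem_iUnion.2 ⟨p, x p, hx p⟩)
  refine ⟨t, inferInstance, fun p => A p, fun p => f p, fun p => ⟨h1 p, h2 p⟩, fun p => ?_,
    fun p => hS p⟩
  obtain ⟨i, hi, q, hq⟩ := Set.mem_iUnion₂.1 (ht (Set.mem_univ p))
  exact ⟨⟨i, hi⟩, q, hq⟩

/-- Stability of `Q` under base change makes the morphisms satisfying it a sieve. -/
theorem exists_covering_of_near {R : CommAlgCat.{0} ℂ}
    {Q : ∀ A : CommAlgCat.{0} ℂ, (R ⟶ A) → Prop}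
    (hQ : ∀ A f, Q A f → ∀ (B) (g : A ⟶ B), Q B (f ≫ g))
    (h : ∀ p : PrimeSpectrum R, Near p Q) :
    ∃ S ∈ fppfTopology (op R), ∀ A (f : R ⟶ A), S f.op → Q A f :=
  ⟨{ arrows := fun Y g => Q Y.unop g.unop
     downward_closed := fun hf g => hQ _ _ hf _ g.unop },
    covering_of_near h, fun _ _ h => h⟩

theorem near_of_mem {R : CommAlgCat.{0} ℂ} {S : Sieve (op R)} (hS : S ∈ fppfTopology (op R))
    (p : PrimeSpectrum R) : Near p (fun _ f => S f.op) := by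
  obtain ⟨ι, _, B, f, hf, hcov, hSf⟩ := hS
  obtain ⟨i, q, hq⟩ := hcov p
  exact ⟨B i, f i, (hf i).1, (hf i).2, ⟨q, hq⟩, hSf i⟩

/-- A point of `R` with values in a field lifts, after enlarging the field, to a neighbourhood
of its image. -/
theorem Near.exists_field {R : CommAlgCat.{0} ℂ} {K : Type} [Field K] (f : R →+* K)
    {Q : ∀ A : CommAlgCat.{0} ℂ, (R ⟶ A) → Prop}
    (h : Near (PrimeSpectrum.comap f ⊥) Q) :
    ∃ (A : CommAlgCat.{0} ℂ) (u : R ⟶ A) (L : Type) (_ : Field L) (i : K →+* L) (g : A →+* L),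
      Q A u ∧ ∀ x, i (f x) = g (u.hom x) := by
  obtain ⟨A, u, -, -, ⟨x, hx⟩, hQ⟩ := h
  have h1 : (⊥ : Ideal K).comap f = x.asIdeal.comap u.hom.toRingHom :=
    (congrArg PrimeSpectrum.asIdeal hx).symm
  let p : Ideal R := (⊥ : Ideal K).comap f
  -- The residue field of the image point maps to the residue field of `K` at zero and to that of
  -- `A` at `x`; `L` is a common extension of the two.
  obtain ⟨F, _, i, j, hij⟩ := exists_common_field (Ideal.ResidueField.map p ⊥ f rfl)
    (Ideal.ResidueField.map p x.asIdeal u.hom.toRingHom h1)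
  refine ⟨A, u, F, inferInstance, i.comp (algebraMap K _), j.comp (algebraMap A _), hQ,
    fun r => ?_⟩
  have h2 := Ideal.ResidueField.map_algebraMap p ⊥ f rfl r
  have h3 := Ideal.ResidueField.map_algebraMap p x.asIdeal u.hom.toRingHom h1 r
  change i (algebraMap K _ (f r)) = j (algebraMap A _ (u.hom r))
  rw [← h2, hij]
  exact congrArg j h3

theorem exists_field_of_mem {R : CommAlgCat.{0} ℂ} {S : Sieve (op R)}
    (hS : S ∈ fppfTopology (op R)) {K : Type} [Field K] (f : R →+* K) :
    ∃ (A : CommAlgCat.{0} ℂ) (u : R ⟶ A) (L : Type) (_ : Field L) (i : K →+* L) (g : A →+* L),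
      S u.op ∧ ∀ x, i (f x) = g (u.hom x) :=
  (near_of_mem hS _).exists_field f

/-- The structure sheaf as a functor of points. -/
def ringFunctor : CommAlgCat.{0} ℂ ⥤ Type := forget (CommAlgCat.{0} ℂ)

/-- A finite product of flat algebras is flat, and the points of the factors already cover the
spectrum of `R`. This replaces a finite covering by one faithfully flat algebra. -/
theorem faithfullyFlat_pi {R : Type} [CommRing R] {ι : Type} [Finite ι] {B : ι → Type}
    [∀ i, CommRing (B i)] [∀ i, Algebra R (B i)] (h : ∀ i, Module.Flat R (B i))
    (hc : ∀ p : PrimeSpectrum R, ∃ i, ∃ q : PrimeSpectrum (B i),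
      PrimeSpectrum.comap (algebraMap R (B i)) q = p) : Module.FaithfullyFlat R (∀ i, B i) := by
  classical
  cases nonempty_fintype ι
  have : Module.Flat R (∀ i, B i) :=
    Module.Flat.of_linearEquiv (DirectSum.linearEquivFunOnFintype R ι B).symm
  refine Module.FaithfullyFlat.of_comap_surjective fun p => ?_
  obtain ⟨i, q, hq⟩ := hc p
  exact ⟨PrimeSpectrum.comap (Pi.evalRingHom B i) q, by rw [← hq]; rfl⟩

/-- An element of `(∏ B_i) ⊗ (∏ B_i)` vanishes if its images in all `B_i ⊗ B_j` do. -/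
theorem tensor_pi_ext {R : Type} [CommRing R] {ι : Type} [Finite ι] {B : ι → Type}
    [∀ i, CommRing (B i)] [∀ i, Algebra R (B i)] {z w : (∀ i, B i) ⊗[R] (∀ i, B i)}
    (h : ∀ i j, TensorProduct.map (LinearMap.proj (R := R) (φ := B) i) (LinearMap.proj j) z =
      TensorProduct.map (LinearMap.proj (R := R) (φ := B) i) (LinearMap.proj j) w) : z = w := by
  classical
  cases nonempty_fintype ι
  -- The identity of the product is the sum of its coordinate projectors, so a tensor is the sum of
  -- its parts in the `B i ⊗ B j`.
  have hid : (LinearMap.id : (∀ i, B i) →ₗ[R] ∀ i, B i) =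
      ∑ i, LinearMap.single R B i ∘ₗ LinearMap.proj i := by
    ext x j
    simp [Finset.sum_apply]
  have key : ∀ z : (∀ i, B i) ⊗[R] (∀ i, B i), z = ∑ i, ∑ j,
      TensorProduct.map (LinearMap.single R B i) (LinearMap.single R B j)
        (TensorProduct.map (LinearMap.proj (R := R) (φ := B) i) (LinearMap.proj j) z) := by
    intro z
    induction z with
    | zero => simp
    | add x y hx hy =>
      nth_rw 1 [hx, hy]
      simp only [map_add, Finset.sum_add_distrib]
    | tmul x y =>
      simp only [TensorProduct.map_tmul]
      simp only [← TensorProduct.tmul_sum, ← TensorProduct.sum_tmul]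
      congr 1
      · simpa using congrArg (fun f => f x) hid
      · simpa using congrArg (fun f => f y) hid
  rw [key z, key w]
  simp only [h]

/-- A faithfully flat map of rings is injective. Consequently every polynomial equation can be
tested on a covering. -/
theorem eq_of_mem_fppfTopology {R : CommAlgCat.{0} ℂ} {S : Sieve (op R)}
    (hS : S ∈ fppfTopology (op R)) {s t : R}
    (h : ∀ (A : CommAlgCat.{0} ℂ) (f : R ⟶ A), S f.op → f.hom s = f.hom t) : s = t := by
  obtain ⟨ι, _, B, f, hf, hcov, hSf⟩ := hS
  let _ : ∀ i, Algebra R (B i) := fun i => (f i).hom.toRingHom.toAlgebra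
  have hflat : Module.FaithfullyFlat R (∀ i, B i) := faithfullyFlat_pi (fun i => (hf i).1) hcov
  apply FaithfulSMul.algebraMap_injective R (∀ i, B i)
  funext i
  exact h _ (f i) (hSf i)

/-- Faithfully flat descent for elements: `R` is the equalizer of the two maps from `∏ B_i` to its
tensor square. Most other sheaf properties reduce to this one by coordinates. -/
theorem isFppfSheaf_ringFunctor : IsFppfSheaf ringFunctor := by
  rw [isFppfSheaf_iff]
  intro R S hS x hx
  obtain ⟨ι, _, B, f, hf, hcov, hSf⟩ := hS
  let _ : ∀ i, Algebra R (B i) := fun i => (f i).hom.toRingHom.toAlgebra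
  have hflat : Module.FaithfullyFlat R (∀ i, B i) := faithfullyFlat_pi (fun i => (hf i).1) hcov
  have hR : ∀ i, IsScalarTower ℂ R (B i) :=
    fun i => IsScalarTower.of_algebraMap_eq fun x => ((f i).hom.commutes x).symm
  let y : ∀ i, B i := fun i => x (B i) (f i) (hSf i)
  have hy : y ⊗ₜ[R] (1 : ∀ i, B i) = (1 : ∀ i, B i) ⊗ₜ[R] y := by
    refine tensor_pi_ext fun i j => ?_
    simp only [TensorProduct.map_tmul, LinearMap.proj_apply, Pi.one_apply]
    let C := CommAlgCat.of ℂ (B i ⊗[R] B j)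
    let i1 : B i ⟶ C := CommAlgCat.ofHom (Algebra.TensorProduct.includeLeft)
    let i2 : B j ⟶ C := CommAlgCat.ofHom
      ((Algebra.TensorProduct.includeRight (R := R) (A := B i) (B := B j)).restrictScalars ℂ)
    have hc : f i ≫ i1 = f j ≫ i2 := by
      ext a
      change (algebraMap R (B i) a) ⊗ₜ[R] (1 : B j) = (1 : B i) ⊗ₜ[R] (algebraMap R (B j) a)
      rw [Algebra.algebraMap_eq_smul_one, Algebra.algebraMap_eq_smul_one, TensorProduct.smul_tmul]
    have e1 := hx _ C (f i) i1 (hSf i) (S.downward_closed (hSf i) i1.op)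
    have e2 := hx _ C (f j) i2 (hSf j) (S.downward_closed (hSf j) i2.op)
    have e3 : ∀ (g g' : R ⟶ C) (e : g = g') (h : S g.op) (h' : S g'.op),
        x C g h = x C g' h' := by
      rintro g _ rfl _ _
      rfl
    exact e1.trans ((e3 _ _ hc _ _).trans e2.symm)
  have hr : y ∈ Set.range (algebraMap R (∀ i, B i)) := by
    rw [← Algebra.IsEffective.eqLocus_includeLeft_includeRight
      (Algebra.IsEffective.of_faithfullyFlat R (∀ i, B i))]
    exact hy
  obtain ⟨t, ht⟩ := hr
  -- The value of `t` on an arbitrary member of `S` is checked after pulling back this smaller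
  -- covering, on which `t` is known by construction.
  have hT : Sieve.generate (Presieve.ofArrows (fun i => op (B i)) fun i => (f i).op) ∈
      fppfTopology (op R) :=
    ⟨ι, inferInstance, B, f, hf, hcov, fun i => Sieve.le_generate _ _ _ (Presieve.ofArrows.mk i)⟩
  have e3 : ∀ {C : CommAlgCat.{0} ℂ} (g g' : R ⟶ C) (e : g = g') (h : S g.op) (h' : S g'.op),
      x C g h = x C g' h' := by
    rintro C g _ rfl _ _
    rfl
  refine ⟨t, fun A u hu => ?_, fun t' ht' => ?_⟩
  · refine eq_of_mem_fppfTopology (fppfTopology.pullback_stable u.op hT) fun C v hv => ?_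
    obtain ⟨Y, w, g, ⟨i⟩, hg⟩ := hv
    have hg' : f i ≫ w.unop = u ≫ v := Quiver.Hom.op_inj hg
    have h1 := hx A C u v hu (S.downward_closed hu v.op)
    have h2 := hx (B i) C (f i) w.unop (hSf i) (S.downward_closed (hSf i) w)
    have h3 : v.hom (u.hom t) = w.unop.hom ((f i).hom t) :=
      congrArg (fun g : R ⟶ C => g.hom t) hg'.symm
    have h4 : (f i).hom t = y i := congrFun ht i
    change v.hom (u.hom t) = v.hom (x A u hu)
    rw [h3, h4]
    exact h2.trans ((e3 _ _ hg' _ _).trans h1.symm)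
  · refine eq_of_mem_fppfTopology hT fun C v hv => ?_
    obtain ⟨Y, w, g, ⟨i⟩, hg⟩ := hv
    have hg' : f i ≫ w.unop = v := Quiver.Hom.op_inj hg
    subst hg'
    have h1 : (f i).hom t' = y i := ht' _ _ (hSf i)
    have h4 : (f i).hom t = y i := congrFun ht i
    change w.unop.hom ((f i).hom t') = w.unop.hom ((f i).hom t)
    rw [h1, h4]

/-- A functor of points embedded into an affine space is a sheaf if its image is local. -/
theorem isFppfSheaf_of_coordinates {X : CommAlgCat.{0} ℂ ⥤ Type u} {I : Type*}
    (c : ∀ A : CommAlgCat.{0} ℂ, X.obj A → I → A)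
    (hc : ∀ (A B : CommAlgCat.{0} ℂ) (f : A ⟶ B) (x : X.obj A) (i : I),
      c B (X.map f x) i = f.hom (c A x i))
    (hinj : ∀ A, Function.Injective (c A))
    (hloc : ∀ (R : CommAlgCat.{0} ℂ) (S : Sieve (op R)), S ∈ fppfTopology (op R) → ∀ v : I → R,
      (∀ (A : CommAlgCat.{0} ℂ) (f : R ⟶ A), S f.op → ∃ x, c A x = fun i => f.hom (v i)) →
        ∃ x, c R x = v) : IsFppfSheaf X := by
  rw [isFppfSheaf_iff]
  intro R S hS x hx
  choose v hv hv' using fun i => (isFppfSheaf_iff ringFunctor).1 isFppfSheaf_ringFunctor R S hS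
    (fun A f hf => c A (x A f hf) i) (fun A B f g hf hfg => by
      rw [← hx A B f g hf hfg, hc]
      rfl)
  obtain ⟨t, ht⟩ := hloc R S hS v fun A f hf => ⟨x A f hf, funext fun i => (hv i A f hf).symm⟩
  refine ⟨t, fun A f hf => hinj A (funext fun i => ?_), fun t' ht' => hinj R (funext fun i => ?_)⟩
  · rw [hc, ht]
    exact hv i A f hf
  · rw [ht]
    refine hv' i _ fun A f hf => ?_
    rw [← ht' A f hf, hc]
    rfl

/-! ### Torsors -/

theorem types_map_comp (Z : CommAlgCat.{0} ℂ ⥤ Type u) {R A B : CommAlgCat.{0} ℂ} (f : R ⟶ A)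
    (g : A ⟶ B) (z : Z.obj R) : Z.map (f ≫ g) z = Z.map g (Z.map f z) := by
  rw [Functor.map_comp]
  rfl

theorem types_map_id (Z : CommAlgCat.{0} ℂ ⥤ Type u) {R : CommAlgCat.{0} ℂ} (z : Z.obj R) :
    Z.map (𝟙 R) z = z := by
  rw [CategoryTheory.Functor.map_id]
  rfl

theorem group_map_comp (G : GroupFunctor) {R A B : CommAlgCat.{0} ℂ} (f : R ⟶ A)
    (g : A ⟶ B) (z : G.obj R) : G.map (f ≫ g) z = G.map g (G.map f z) := by
  rw [Functor.map_comp]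
  rfl

theorem group_map_id (G : GroupFunctor) {R : CommAlgCat.{0} ℂ} (z : G.obj R) :
    G.map (𝟙 R) z = z := by
  rw [CategoryTheory.Functor.map_id]
  rfl

/-- The underlying functor of points of a group functor. -/
abbrev GroupFunctor.toTypes (G : GroupFunctor) : CommAlgCat.{0} ℂ ⥤ Type := G ⋙ forget GrpCat

/-- The values on the elements of `B` serve as coordinates, and being an algebra homomorphism is a
system of equations between them, hence a local condition. -/
theorem isFppfSheaf_coyoneda (B : CommAlgCat.{0} ℂ) : IsFppfSheaf (coyoneda.obj (op B)) := by
  refine isFppfSheaf_of_coordinates (I := B) (fun A f b => (show B ⟶ A from f).hom b)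
    (fun _ _ _ _ _ => rfl) (fun A f g h => ?_) fun R S hS v hv => ?_
  · apply CommAlgCat.hom_ext
    ext b
    exact congrFun h b
  · have key : ∀ A (f : R ⟶ A), S f.op → ∃ x : B →ₐ[ℂ] A, ∀ b, x b = f.hom (v b) := by
      intro A f hf
      obtain ⟨x, hx⟩ := hv A f hf
      exact ⟨(show B ⟶ A from x).hom, fun b => congrFun hx b⟩
    refine ⟨CommAlgCat.ofHom
      { toFun := v
        map_one' := ?_
        map_mul' := fun a b => ?_
        map_zero' := ?_
        map_add' := fun a b => ?_
        commutes' := fun c => ?_ }, rfl⟩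
    all_goals
      refine eq_of_mem_fppfTopology hS fun A f hf => ?_
      obtain ⟨x, hx⟩ := key A f hf
      simp only [map_mul, map_add, map_one, map_zero, ← hx, AlgHom.commutes]

theorem hom_ext_of_mem {B R : CommAlgCat.{0} ℂ} {S : Sieve (op R)} (hS : S ∈ fppfTopology (op R))
    {f g : B ⟶ R} (h : ∀ (A : CommAlgCat.{0} ℂ) (u : R ⟶ A), S u.op → f ≫ u = g ≫ u) : f = g :=
  (isFppfSheaf_coyoneda B).ext hS (t := f) (t' := g) h

namespace QuotientObj

variable {G H : GroupFunctor} {X : ActedSpace G} {Y : ActedSpace H}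

theorem exists_covering (a : QuotientObj G X) {R : CommAlgCat.{0} ℂ} (f : a.base ⟶ R) :
    ∃ S ∈ fppfTopology (op R), ∀ (A : CommAlgCat.{0} ℂ) (u : R ⟶ A), S u.op →
      ∃ p : a.P.obj A, a.π p = f ≫ u := by
  obtain ⟨S, hS, h⟩ := a.locallyNonempty
  exact ⟨S.pullback f.op, fppfTopology.pullback_stable f.op hS, fun A u hu => h A (f ≫ u) hu⟩

/-- Descent along a torsor. -/
theorem existsUnique_descent (a : QuotientObj G X) {Z : CommAlgCat.{0} ℂ ⥤ Type u}
    (hZ : IsFppfSheaf Z) {R : CommAlgCat.{0} ℂ} (f : a.base ⟶ R)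
    (x : ∀ (A : CommAlgCat.{0} ℂ) (u : R ⟶ A) (p : a.P.obj A), a.π p = f ≫ u → Z.obj A)
    (hx : ∀ (A B : CommAlgCat.{0} ℂ) (u : R ⟶ A) (v : A ⟶ B) (p : a.P.obj A)
      (hp : a.π p = f ≫ u) (hp' : a.π (a.P.map v p) = f ≫ u ≫ v),
      Z.map v (x A u p hp) = x B (u ≫ v) (a.P.map v p) hp')
    (hinv : ∀ (A : CommAlgCat.{0} ℂ) (u : R ⟶ A) (g : G.obj A) (p : a.P.obj A)
      (hp : a.π p = f ≫ u) (hp' : a.π (a.smul g p) = f ≫ u),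
      x A u (a.smul g p) hp' = x A u p hp) :
    ∃! t : Z.obj R, ∀ (A : CommAlgCat.{0} ℂ) (u : R ⟶ A) (p : a.P.obj A) (hp : a.π p = f ≫ u),
      Z.map u t = x A u p hp := by
  -- Two points of the torsor over the same point of the base differ by an element of `G`, so by
  -- invariance the prescribed value depends on `u` alone.
  have hinv' : ∀ (A : CommAlgCat.{0} ℂ) (u u' : R ⟶ A) (_ : u = u') (p p' : a.P.obj A)
      (hp : a.π p = f ≫ u) (hp' : a.π p' = f ≫ u'), x A u p hp = x A u' p' hp' := by
    rintro A u _ rfl p p' hp hp'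
    obtain ⟨g, rfl, -⟩ := a.simplyTransitive p p' (hp.trans hp'.symm)
    exact (hinv A u g p hp hp').symm
  obtain ⟨S, hS, h⟩ := a.exists_covering f
  choose q hq using h
  obtain ⟨t, ht, hu⟩ := (isFppfSheaf_iff Z).1 hZ R S hS
    (fun A u hu => x A u (q A u hu) (hq A u hu)) (fun A B u v hu huv =>
      (hx A B u v _ (hq A u hu) (by rw [a.π_map, hq, Category.assoc])).trans
        (hinv' _ _ _ rfl _ _ _ _))
  refine ⟨t, fun A u p hp => ?_, fun t' ht' => hu t' fun A u hu => ht' A u _ _⟩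
  refine hZ.ext (fppfTopology.pullback_stable u.op hS) fun B v hv => ?_
  rw [← types_map_comp, ht B (u ≫ v) hv, hx A B u v p hp (by rw [a.π_map, hp, Category.assoc])]
  exact hinv' _ _ _ rfl _ _ _ _

theorem hom_ext {a b : QuotientObj G X} {u v : a ⟶ b} (h : Hom.base u = Hom.base v)
    (h' : ∀ (R : CommAlgCat.{0} ℂ) (p : a.P.obj R), Hom.app u R p = Hom.app v R p) : u = v :=
  Hom.ext h (funext fun R => funext fun p => h' R p)

theorem comp_app {a b c : QuotientObj G X} (u : a ⟶ b) (v : b ⟶ c) {R : CommAlgCat.{0} ℂ}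
    (p : a.P.obj R) : Hom.app (u ≫ v) R p = Hom.app v R (Hom.app u R p) := rfl

theorem comp_base {a b c : QuotientObj G X} (u : a ⟶ b) (v : b ⟶ c) :
    Hom.base (u ≫ v) = Hom.base v ≫ Hom.base u := rfl

theorem smul_left_cancel (a : QuotientObj G X) {R : CommAlgCat.{0} ℂ} {g g' : G.obj R}
    {p : a.P.obj R} (h : a.smul g p = a.smul g' p) : g = g' :=
  (a.simplyTransitive p (a.smul g p) (a.π_smul g p).symm).unique rfl h.symm

theorem inv_smul_smul (a : QuotientObj G X) {R : CommAlgCat.{0} ℂ} (g : G.obj R)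
    (p : a.P.obj R) : a.smul g⁻¹ (a.smul g p) = p := by
  rw [← a.mul_smul, inv_mul_cancel, a.one_smul]

/-- A morphism of torsors is bijective on the fibres over each point of the base. -/
theorem existsUnique_app_eq {b c : QuotientObj G X} (u : b ⟶ c) {R : CommAlgCat.{0} ℂ}
    (r : c.P.obj R) (f : b.base ⟶ R) (hr : c.π r = Hom.base u ≫ f) :
    ∃! q : b.P.obj R, b.π q = f ∧ Hom.app u R q = r := by
  -- At a local point `p` of `b`, the unknown `q` has to be `g p`, where `g` is the unique element
  -- carrying the image of `p` to `r`. Uniqueness of `g` makes these local solutions compatible.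
  have key : ∀ (A : CommAlgCat.{0} ℂ) (v : R ⟶ A) (p : b.P.obj A), b.π p = f ≫ v →
      ∃! g : G.obj A, c.smul g (Hom.app u A p) = c.P.map v r := fun A v p hp =>
    c.simplyTransitive _ _ (by rw [Hom.π_app u, hp, c.π_map, hr, Category.assoc])
  choose g hg _ using key
  obtain ⟨q, hq, -⟩ := b.existsUnique_descent (Z := b.P) b.isSheaf f
    (fun A v p hp => b.smul (g A v p hp) p) (fun A B v w p hp hp' => by
      rw [b.map_smul]
      congr 1
      apply c.smul_left_cancel (p := Hom.app u B (b.P.map w p))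
      rw [hg, Hom.naturality u, ← c.map_smul, hg, types_map_comp])
    (fun A v h p hp hp' => by
      rw [← b.mul_smul]
      congr 1
      apply c.smul_left_cancel (p := Hom.app u A p)
      rw [hg, c.mul_smul, ← Hom.app_smul u, hg])
  obtain ⟨S, hS, h⟩ := b.exists_covering f
  refine ⟨q, ⟨?_, ?_⟩, fun q' hq' => ?_⟩
  · refine hom_ext_of_mem hS fun A v hv => ?_
    obtain ⟨p, hp⟩ := h A v hv
    rw [← b.π_map, hq A v p hp, b.π_smul, hp]
  · refine IsFppfSheaf.ext (X := c.P) c.isSheaf hS fun A v hv => ?_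
    obtain ⟨p, hp⟩ := h A v hv
    rw [← Hom.naturality u, hq A v p hp, Hom.app_smul u, hg]
  · refine IsFppfSheaf.ext (X := b.P) b.isSheaf hS fun A v hv => ?_
    obtain ⟨p, hp⟩ := h A v hv
    rw [hq A v p hp]
    obtain ⟨k, hk, -⟩ := b.simplyTransitive p (b.P.map v q') (by rw [hp, b.π_map, hq'.1])
    rw [← hk]
    congr 1
    apply c.smul_left_cancel (p := Hom.app u A p)
    rw [hg, ← Hom.app_smul u, hk, Hom.naturality u, hq'.2]

/-- All morphisms of a quotient stack are cartesian. -/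
theorem existsUnique_lift {a b c : QuotientObj G X} (u : a ⟶ c) (u' : b ⟶ c)
    (w : b.base ⟶ a.base) (hw : Hom.base u' ≫ w = Hom.base u) :
    ∃! v : a ⟶ b, Hom.base v = w ∧ v ≫ u' = u := by
  choose q hq hq' using fun (R : CommAlgCat.{0} ℂ) (p : a.P.obj R) =>
    existsUnique_app_eq u' (Hom.app u R p) (w ≫ a.π p)
      (by rw [Hom.π_app u, ← hw, Category.assoc])
  let v : Hom a b :=
    { base := w
      app := q
      naturality := fun {R S} f p => (hq' S _ _ ⟨by
        rw [b.π_map, (hq R p).1, a.π_map, Category.assoc], by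
        rw [Hom.naturality u', (hq R p).2, Hom.naturality u]⟩).symm
      π_app := fun {R} p => (hq R p).1
      app_smul := fun {R} g p => (hq' R _ _ ⟨by
        rw [b.π_smul, (hq R p).1, a.π_smul], by
        rw [Hom.app_smul u', (hq R p).2, Hom.app_smul u]⟩).symm
      toX_app := fun {R} p => by
        rw [← Hom.toX_app u', (hq R p).2, Hom.toX_app u] }
  refine ⟨v, ⟨rfl, hom_ext hw fun R p => (hq R p).2⟩, fun v' hv' => hom_ext hv'.1 fun R p => ?_⟩
  refine hq' R p _ ⟨by rw [Hom.π_app v', hv'.1], ?_⟩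
  rw [← comp_app, hv'.2]

/-- As every morphism is cartesian, the inverse is the lift of the identity of `b` along `u` over
the inverse on bases. In particular, morphisms of torsors over the identity are isomorphisms. -/
theorem isIso_of_isIso_base {a b : QuotientObj G X} (u : a ⟶ b) [IsIso (Hom.base u)] :
    IsIso u := by
  obtain ⟨v, ⟨hv, hv'⟩, -⟩ := existsUnique_lift (𝟙 b) u (inv (Hom.base u))
    (IsIso.hom_inv_id _)
  refine ⟨v, ?_, hv'⟩
  refine (existsUnique_lift u u (𝟙 _) (Category.comp_id _)).unique ⟨?_, ?_⟩ ⟨rfl, Category.id_comp _⟩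
  · rw [comp_base, hv, IsIso.inv_hom_id]
  · rw [Category.assoc, hv', Category.comp_id]

end QuotientObj

/-! ### Slices -/

/-- The subfunctor of `P` of the points with a property stable under base change. -/
def subFunctor (P : CommAlgCat.{0} ℂ ⥤ Type u) (s : ∀ R : CommAlgCat.{0} ℂ, P.obj R → Prop)
    (h : ∀ {R S : CommAlgCat.{0} ℂ} (f : R ⟶ S) (p : P.obj R), s R p → s S (P.map f p)) :
    CommAlgCat.{0} ℂ ⥤ Type u where
  obj R := {p : P.obj R // s R p}
  map f := ↾fun p => ⟨P.map f p.1, h f p.1 p.2⟩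
  map_id R := by
    ext p
    exact types_map_id P p.1
  map_comp f g := by
    ext p
    exact types_map_comp P f g p.1

/-- `κ : Y ⟶ X` is a slice for the action of `G` on the sheaf `X`, with group `H`. -/
structure IsSlice {G H : GroupFunctor} {X : ActedSpace G} {Y : ActedSpace H} {ρ : H ⟶ G}
    (κ : EquivariantMap ρ Y X) : Prop where
  sheaf_group : IsFppfSheaf G.toTypes
  sheaf_space : IsFppfSheaf X.X
  group_injective : ∀ R, Function.Injective (ρ.app R)
  injective : ∀ R : CommAlgCat.{0} ℂ, Function.Injective (κ.app (R := R))
  mem_group : ∀ {R : CommAlgCat.{0} ℂ} (g : G.obj R) (y y' : Y.X.obj R),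
    X.smul g (κ.app y) = κ.app y' → ∃ h, ρ.app R h = g
  mem_range : ∀ {R : CommAlgCat.{0} ℂ} {S : Sieve (op R)}, S ∈ fppfTopology (op R) →
    ∀ x : X.X.obj R, (∀ (A : CommAlgCat.{0} ℂ) (f : R ⟶ A), S f.op →
      ∃ y, κ.app y = X.X.map f x) → ∃ y, κ.app y = x
  covers : ∀ {R : CommAlgCat.{0} ℂ} (x : X.X.obj R), ∃ S ∈ fppfTopology (op R),
    ∀ (A : CommAlgCat.{0} ℂ) (f : R ⟶ A), S f.op → ∃ g y, X.smul g (κ.app y) = X.X.map f x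

namespace IsSlice

variable {G H : GroupFunctor} {X : ActedSpace G} {Y : ActedSpace H} {ρ : H ⟶ G}
  {κ : EquivariantMap ρ Y X}

/-- The `H`-torsor of the points of a `G`-torsor that are mapped to the slice. -/
noncomputable def restrictObj (hκ : IsSlice κ) (b : QuotientObj G X) : QuotientObj H Y where
  base := b.base
  P := subFunctor b.P (fun R p => ∃ y, κ.app y = b.toX p) fun f p ⟨y, hy⟩ =>
    ⟨Y.X.map f y, by rw [κ.naturality, hy, b.toX_map]⟩
  isSheaf := by
    refine (isFppfSheaf_iff _).2 fun R S hS x hx => ?_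
    obtain ⟨t, ht, hu⟩ := (isFppfSheaf_iff b.P).1 b.isSheaf R S hS
      (fun A f hf => (x A f hf).1) (fun A B f g hf hfg => congrArg Subtype.val (hx A B f g hf hfg))
    refine ⟨⟨t, hκ.mem_range hS _ fun A f hf => ?_⟩, fun A f hf => Subtype.ext (ht A f hf),
      fun t' ht' => Subtype.ext (hu _ fun A f hf => congrArg Subtype.val (ht' A f hf))⟩
    obtain ⟨y, hy⟩ := (x A f hf).2
    exact ⟨y, by rw [hy, ← ht A f hf, b.toX_map]⟩
  π p := b.π p.1
  π_map f p := b.π_map f p.1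
  smul {R} h p := ⟨b.smul (ρ.app R h) p.1, by
    obtain ⟨y, hy⟩ := p.2
    exact ⟨Y.smul h y, by rw [κ.map_smul, hy, b.toX_smul]⟩⟩
  one_smul p := Subtype.ext
    ((congrArg (fun g => b.smul g p.1) (map_one _)).trans (b.one_smul _))
  mul_smul g h p := Subtype.ext
    ((congrArg (fun g => b.smul g p.1) (map_mul _ g h)).trans (b.mul_smul _ _ _))
  map_smul {R S} f h p := Subtype.ext (by
    change b.P.map f (b.smul (ρ.app R h) p.1) = b.smul (ρ.app S (H.map f h)) (b.P.map f p.1)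
    rw [b.map_smul, NatTrans.naturality_apply])
  π_smul h p := b.π_smul _ p.1
  simplyTransitive {R} p q hpq := by
    obtain ⟨g, hg, hu⟩ := b.simplyTransitive p.1 q.1 hpq
    obtain ⟨y, hy⟩ := p.2
    obtain ⟨y', hy'⟩ := q.2
    -- The element `g` relates two points of the torsor over the slice, so it carries a point of `Y`
    -- to a point of `Y`.
    obtain ⟨h, rfl⟩ := hκ.mem_group g y y' (by rw [hy, hy', ← b.toX_smul, hg])
    exact ⟨h, Subtype.ext hg, fun h' hh' =>
      hκ.group_injective R (hu _ (congrArg Subtype.val hh'))⟩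
  locallyNonempty := by
    obtain ⟨S, hS, hp⟩ := b.locallyNonempty
    -- The base is refined twice: until the `G`-torsor has a point, and then until an element of `G`
    -- moves the image of that point into the slice.
    refine ⟨⟨fun A f => ∃ (p : b.P.obj A.unop) (y : Y.X.obj A.unop),
        b.π p = f.unop ∧ κ.app y = b.toX p, ?_⟩, ?_, ?_⟩
    · rintro A B f ⟨p, y, h1, h2⟩ g
      exact ⟨b.P.map g.unop p, Y.X.map g.unop y, by rw [b.π_map, h1]; rfl,
        by rw [κ.naturality, h2, b.toX_map]⟩
    · refine fppfTopology.transitive hS _ fun A f hf => ?_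
      obtain ⟨p, hp⟩ := hp A.unop f.unop hf
      obtain ⟨S', hS', h'⟩ := hκ.covers (b.toX p)
      refine fppfTopology.superset_covering (fun B g hg => ?_) hS'
      obtain ⟨k, y, hy⟩ := h' B.unop g.unop hg
      refine ⟨b.smul k⁻¹ (b.P.map g.unop p), y, ?_, ?_⟩
      · rw [b.π_smul, b.π_map, hp]
        rfl
      · rw [b.toX_smul, b.toX_map, ← hy, ← X.mul_smul, inv_mul_cancel, X.one_smul]
    · rintro A f ⟨p, y, h1, h2⟩
      exact ⟨⟨p, y, h2⟩, h1⟩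
  -- Injectivity of `κ` makes the chosen preimage the only one, so the choice is natural and
  -- equivariant.
  toX p := p.2.choose
  toX_map {R S} f p := hκ.injective S (by
    rw [κ.naturality, Exists.choose_spec p.2]
    exact (Exists.choose_spec (p := fun y => κ.app y = b.toX (b.P.map f p.1)) _).trans
      (b.toX_map f p.1))
  toX_smul {R} h p := hκ.injective R (by
    rw [κ.map_smul, Exists.choose_spec p.2]
    exact (Exists.choose_spec (p := fun y => κ.app y = b.toX (b.smul (ρ.app R h) p.1)) _).trans
      (b.toX_smul _ p.1))

theorem app_toX_restrictObj (hκ : IsSlice κ) (b : QuotientObj G X) {R : CommAlgCat.{0} ℂ}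
    (p : (hκ.restrictObj b).P.obj R) : κ.app ((hκ.restrictObj b).toX p) = b.toX p.1 :=
  p.2.choose_spec

/-- Restriction of `G`-torsors to the slice. -/
noncomputable def restrict (hκ : IsSlice κ) : QuotientObj G X ⥤ QuotientObj H Y where
  obj := hκ.restrictObj
  map {a b} (u : QuotientObj.Hom a b) :=
    { base := u.base
      app := fun R p => ⟨u.app R p.1, by
        obtain ⟨y, hy⟩ := p.2
        exact ⟨y, by rw [hy, u.toX_app]⟩⟩
      naturality := fun f p => Subtype.ext (u.naturality f p.1)
      π_app := fun p => u.π_app p.1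
      app_smul := fun h p => Subtype.ext (u.app_smul _ p.1)
      toX_app := fun {R} p => hκ.injective R (by
        exact (hκ.app_toX_restrictObj b _).trans
          ((u.toX_app _).trans (hκ.app_toX_restrictObj a p).symm)) }
  map_id _ := rfl
  map_comp _ _ := rfl

end IsSlice

/-! ### Extension of the structure group -/

/-- An `R`-point of the `G`-torsor `G ×_H P` associated with an `H`-torsor `P`: a point `f` of the
base, and an `H`-equivariant map from the fibre of `P` over `f` to `G`. -/
structure InducedPoint {G H : GroupFunctor} {Y : ActedSpace H} (ρ : H ⟶ G) (a : QuotientObj H Y)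
    (R : CommAlgCat.{0} ℂ) : Type 1 where
  f : a.base ⟶ R
  s : ∀ (A : CommAlgCat.{0} ℂ) (u : R ⟶ A) (p : a.P.obj A), a.π p = f ≫ u → G.obj A
  map_s : ∀ (A B : CommAlgCat.{0} ℂ) (u : R ⟶ A) (v : A ⟶ B) (p : a.P.obj A)
    (hp : a.π p = f ≫ u) (hp' : a.π (a.P.map v p) = f ≫ u ≫ v),
    G.map v (s A u p hp) = s B (u ≫ v) (a.P.map v p) hp'
  s_smul : ∀ (A : CommAlgCat.{0} ℂ) (u : R ⟶ A) (h : H.obj A) (p : a.P.obj A)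
    (hp : a.π p = f ≫ u) (hp' : a.π (a.smul h p) = f ≫ u),
    s A u (a.smul h p) hp' = s A u p hp * (ρ.app A h)⁻¹

namespace InducedPoint

variable {G H : GroupFunctor} {Y : ActedSpace H} {ρ : H ⟶ G} {a : QuotientObj H Y}
  {R : CommAlgCat.{0} ℂ}

theorem ext' {x y : InducedPoint ρ a R} (h : x.f = y.f)
    (h' : ∀ (A : CommAlgCat.{0} ℂ) (u : R ⟶ A) (p : a.P.obj A) (hp : a.π p = x.f ≫ u)
      (hp' : a.π p = y.f ≫ u), x.s A u p hp = y.s A u p hp') : x = y := by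
  obtain ⟨f, s, _, _⟩ := x
  obtain ⟨f', s', _, _⟩ := y
  obtain rfl : f = f' := h
  obtain rfl : s = s' := by
    funext A u p hp
    exact h' A u p hp hp
  rfl

/-- The argument `p` comes with a proof about `x.f ≫ u`, and the arguments to be compared below
agree only by associativity or by the functor laws; this isolates the transport. -/
theorem s_congr (x : InducedPoint ρ a R) {A : CommAlgCat.{0} ℂ} {u u' : R ⟶ A} (h : u = u')
    {p p' : a.P.obj A} (h' : p = p') (hp : a.π p = x.f ≫ u) (hp' : a.π p' = x.f ≫ u') :
    x.s A u p hp = x.s A u' p' hp' := by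
  subst h h'
  rfl

/-- Base change of a point of `G ×_H P`. -/
def map {R' : CommAlgCat.{0} ℂ} (v : R ⟶ R') (x : InducedPoint ρ a R) : InducedPoint ρ a R' where
  f := x.f ≫ v
  s A u p hp := x.s A (v ≫ u) p (hp.trans (Category.assoc _ _ _))
  map_s A B u w p hp hp' := (x.map_s A B (v ≫ u) w p _
    (hp'.trans (by simp only [Category.assoc]))).trans (x.s_congr (Category.assoc _ _ _) rfl _ _)
  s_smul A u h p hp hp' := x.s_smul A (v ≫ u) h p _ _

/-- The functor of points of `G ×_H P`. -/
def functor (ρ : H ⟶ G) (a : QuotientObj H Y) : CommAlgCat.{0} ℂ ⥤ Type 1 where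
  obj R := InducedPoint ρ a R
  map v := ↾fun x => x.map v
  map_id R := by
    ext x
    exact ext' (Category.comp_id _) fun A u p hp hp' => x.s_congr (Category.id_comp _) rfl _ _
  map_comp v w := by
    ext x
    exact ext' (Category.assoc _ _ _).symm
      fun A u p hp hp' => x.s_congr (Category.assoc _ _ _) rfl _ _

/-- There are two gluings. The base point glues because representable functors are sheaves; each
value of the equivariant map glues because `G` is a sheaf, over the covering pulled back along `u`.
-/
theorem isFppfSheaf (hG : IsFppfSheaf G.toTypes) : IsFppfSheaf (functor ρ a) := by
  refine (isFppfSheaf_iff _).2 fun R S hS x hx => ?_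
  replace hx : ∀ (A B : CommAlgCat.{0} ℂ) (u : R ⟶ A) (v : A ⟶ B) (hu : S u.op)
    (huv : S (u ≫ v).op), InducedPoint.map v (x A u hu) = x B (u ≫ v) huv := hx
  obtain ⟨f, hf, hfu⟩ := (isFppfSheaf_iff _).1 (isFppfSheaf_coyoneda a.base) R S hS
    (fun A u hu => (show InducedPoint ρ a A from x A u hu).f)
    (fun A B u v hu huv => congrArg InducedPoint.f (hx A B u v hu huv))
  replace hf : ∀ A u hu, f ≫ u = (show InducedPoint ρ a A from x A u hu).f := hf
  -- For a member `w` of the covering, `e` is the value that the glued map is forced to have at a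
  -- point `q` over `w`.
  let e (C : CommAlgCat.{0} ℂ) (w : R ⟶ C) (hw : S w.op) (q : a.P.obj C)
      (hq : a.π q = f ≫ w) : G.obj C :=
    (show InducedPoint ρ a C from x C w hw).s C (𝟙 C) q
      (by rw [Category.comp_id, hq, hf])
  have he : ∀ (A C : CommAlgCat.{0} ℂ) (u : R ⟶ A) (w : A ⟶ C) (hu hw q hq hq'),
      e C (u ≫ w) hw q hq = (show InducedPoint ρ a A from x A u hu).s C w q hq' := by
    intro A C u w hu hw q hq hq'
    have h1 := hx A C u w hu hw
    have h2 : ∀ (y : InducedPoint ρ a C) (_ : InducedPoint.map w (x A u hu) = y) (hq''),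
        y.s C (𝟙 C) q hq'' = (show InducedPoint ρ a A from x A u hu).s C w q hq' := by
      rintro _ rfl hq''
      exact InducedPoint.s_congr _ (Category.comp_id _) rfl _ _
    exact h2 _ h1 _
  have hen : ∀ (C D : CommAlgCat.{0} ℂ) (w : R ⟶ C) (v : C ⟶ D) (hw hwv q hq hq'),
      G.map v (e C w hw q hq) = e D (w ≫ v) hwv (a.P.map v q) hq' := by
    intro C D w v hw hwv q hq hq'
    have h0 : a.π (a.P.map v q) = (show InducedPoint ρ a C from x C w hw).f ≫ v := by
      rw [← hf, hq', Category.assoc]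
    rw [he C D w v hw hwv _ hq' h0]
    exact (InducedPoint.map_s _ _ _ _ _ _ _ (by rw [Category.id_comp]; exact h0)).trans
      (InducedPoint.s_congr _ (Category.id_comp _) rfl _ _)
  have hec : ∀ (C : CommAlgCat.{0} ℂ) (w w' : R ⟶ C) (_ : w = w') (q q' : a.P.obj C) (_ : q = q')
      (hw hw' hq hq'), e C w hw q hq = e C w' hw' q' hq' := by
    rintro C w _ rfl q _ rfl _ _ _ _
    rfl
  -- For an arbitrary `u`, the value at `p` is glued from the values `e` along the maps `v` for
  -- which `u ≫ v` lies in the covering.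
  have key : ∀ (A : CommAlgCat.{0} ℂ) (u : R ⟶ A) (p : a.P.obj A) (hp : a.π p = f ≫ u),
      ∃! g : G.obj A, ∀ (C : CommAlgCat.{0} ℂ) (v : A ⟶ C) (hv : S (u ≫ v).op),
        G.map v g = e C (u ≫ v) hv (a.P.map v p) (by rw [a.π_map, hp, Category.assoc]) := by
    intro A u p hp
    exact (isFppfSheaf_iff _).1 hG A _ (fppfTopology.pullback_stable u.op hS)
      (fun C v hv => e C (u ≫ v) hv (a.P.map v p) (by rw [a.π_map, hp, Category.assoc]))
      (fun C D v w hv hvw => by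
        have k1 : a.π (a.P.map v p) = f ≫ u ≫ v := by rw [a.π_map, hp, Category.assoc]
        have k2 : a.π (a.P.map w (a.P.map v p)) = f ≫ (u ≫ v) ≫ w := by
          rw [a.π_map, k1]
          simp only [Category.assoc]
        have k3 : a.π (a.P.map (v ≫ w) p) = f ≫ u ≫ v ≫ w := by
          rw [types_map_comp, k2, Category.assoc]
        have k4 : S ((u ≫ v) ≫ w).op := by
          rw [Category.assoc]
          exact hvw
        exact (hen C D (u ≫ v) w hv k4 _ k1 k2).trans
          (hec D _ _ (Category.assoc _ _ _) _ _ (types_map_comp a.P v w p).symm k4 hvw k2 k3))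
  choose s hs hsu using key
  refine ⟨⟨f, s, fun A B u v p hp hp' => ?_, fun A u h p hp hp' => ?_⟩, fun A u hu => ?_,
    fun t' ht' => ?_⟩
  · refine hsu B (u ≫ v) (a.P.map v p) hp' _ fun C w hw => ?_
    rw [← group_map_comp, hs A u p hp C (v ≫ w) (by rw [← Category.assoc]; exact hw)]
    exact hec _ _ _ (Category.assoc _ _ _).symm _ _ (types_map_comp a.P v w p) _ _
      (by rw [types_map_comp, a.π_map, hp', Category.assoc, Category.assoc])
      (by rw [a.π_map, hp', Category.assoc])
  · refine (hsu A u (a.smul h p) hp' _ fun C v hv => ?_).symm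
    rw [map_mul, hs A u p hp C v hv, map_inv]
    have h1 : a.π (a.P.map v p) = f ≫ u ≫ v := by rw [a.π_map, hp, Category.assoc]
    have h2 : a.π (a.smul (H.map v h) (a.P.map v p)) = f ≫ u ≫ v := by rw [a.π_smul, h1]
    rw [hec C _ _ rfl _ _ (a.map_smul v h p) hv hv (by rw [a.map_smul, h2]) h2, ← NatTrans.naturality_apply]
    exact (InducedPoint.s_smul _ C (𝟙 C) (H.map v h) (a.P.map v p) _ _).symm
  · refine ext' (hf A u hu) fun C w p hp hp' => ?_
    refine (hsu C (u ≫ w) p _ _ fun D v hv => ?_).symm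
    have hv' : S (u ≫ w ≫ v).op := by
      rw [← Category.assoc]
      exact hv
    have h1 : a.π (a.P.map v p) = f ≫ u ≫ w ≫ v := by
      rw [a.π_map, hp]
      exact Category.assoc _ _ _ |>.trans (Category.assoc _ _ _)
    have h2 : a.π (a.P.map v p) = (show InducedPoint ρ a A from x A u hu).f ≫ w ≫ v := by
      rw [← hf, h1, Category.assoc]
    rw [hec D _ _ (Category.assoc _ _ _) _ _ rfl hv hv' (by rw [h1, Category.assoc]) h1, he A D u (w ≫ v) hu hv' _ h1 h2]
    exact InducedPoint.map_s _ _ _ _ _ _ _ _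
  · replace ht' : ∀ (A : CommAlgCat.{0} ℂ) (u : R ⟶ A) (hu : S u.op),
      InducedPoint.map u t' = x A u hu := ht'
    have hf' : InducedPoint.f t' = f :=
      hfu _ fun A u hu => congrArg InducedPoint.f (ht' A u hu)
    refine ext' hf' fun A u p hp hp' => ?_
    refine hsu A u p hp' _ fun C v hv => ?_
    have h1 : a.π (a.P.map v p) = f ≫ u ≫ v := by rw [a.π_map, hp', Category.assoc]
    have h2 : ∀ (y : InducedPoint ρ a C) (_ : InducedPoint.map (u ≫ v) t' = y) (hq hq'),
        y.s C (𝟙 C) (a.P.map v p) hq =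
          InducedPoint.s t' C (u ≫ v) (a.P.map v p) hq' := by
      rintro _ rfl hq hq'
      exact InducedPoint.s_congr _ (Category.comp_id _) rfl _ _
    exact (InducedPoint.map_s t' _ _ _ _ _ _ _).trans
      (h2 _ (ht' _ (u ≫ v) hv) _ (by rw [h1, hf'])).symm

end InducedPoint

namespace InducedPoint

variable {G H : GroupFunctor} {X : ActedSpace G} {Y : ActedSpace H} {ρ : H ⟶ G}
  {a : QuotientObj H Y} {R : CommAlgCat.{0} ℂ}

/-- The action of `G` on `G ×_H P`. -/
def smul (g : G.obj R) (x : InducedPoint ρ a R) : InducedPoint ρ a R where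
  f := x.f
  s A u p hp := G.map u g * x.s A u p hp
  map_s A B u v p hp hp' := by rw [map_mul, x.map_s _ _ _ _ _ _ hp', group_map_comp]
  s_smul A u h p hp hp' := by rw [x.s_smul _ _ _ _ hp, mul_assoc]

/-- At a point `p` of `P` the element must be `y.s p * (x.s p)⁻¹`. Replacing `p` by `h p` multiplies
both factors on the right by the same element, which cancels in the quotient, so the element
descends. -/
theorem existsUnique_smul (hG : IsFppfSheaf G.toTypes) (x y : InducedPoint ρ a R)
    (h : x.f = y.f) : ∃! g : G.obj R, smul g x = y := by
  obtain ⟨g, hg, hu⟩ := a.existsUnique_descent hG x.f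
    (fun A u p hp => (y.s A u p (by rw [hp, h]) * (x.s A u p hp)⁻¹ : G.obj A))
    (fun A B u v p hp hp' => by
      change G.map v (y.s A u p _ * (x.s A u p hp)⁻¹) = _
      rw [map_mul, map_inv, x.map_s _ _ _ _ _ _ hp', y.map_s _ _ _ _ _ _ (by rw [hp', h])])
    (fun A u k p hp hp' => by
      rw [x.s_smul _ _ _ _ hp, y.s_smul _ _ _ _ (by rw [hp, h])]
      group)
  refine ⟨g, ext' h fun A u p hp hp' => ?_, fun g' hg' => hu _ fun A u p hp => ?_⟩
  · have := hg A u p hp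
    change G.map u g = _ at this
    change G.map u g * _ = _
    rw [this]
    group
  · subst hg'
    change G.map u g' = G.map u g' * _ * _
    group

/-- The point of `G ×_H P` given by a point of `P`. -/
theorem exists_ofPoint (R : CommAlgCat.{0} ℂ) (p : a.P.obj R) : ∃ x : InducedPoint ρ a R,
    x.f = a.π p ∧ ∀ (A : CommAlgCat.{0} ℂ) (u : R ⟶ A) (h : H.obj A)
      (hp : a.π (a.smul h (a.P.map u p)) = x.f ≫ u),
      x.s A u (a.smul h (a.P.map u p)) hp = (ρ.app A h)⁻¹ := by
  have key : ∀ (A : CommAlgCat.{0} ℂ) (u : R ⟶ A) (q : a.P.obj A), a.π q = a.π p ≫ u →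
      ∃! h : H.obj A, a.smul h (a.P.map u p) = q := fun A u q hq =>
    a.simplyTransitive _ _ (by rw [hq, a.π_map])
  choose k hk hku using key
  -- Here `k` carries `p` to `q`, and equivariance forces the value `(ρ k)⁻¹` at `q` once the value
  -- at `p` is `1`.
  refine ⟨⟨a.π p, fun A u q hq => (ρ.app A (k A u q hq))⁻¹, fun A B u v q hq hq' => ?_,
    fun A u h q hq hq' => ?_⟩, rfl, fun A u h hp => ?_⟩
  · rw [map_inv, ← NatTrans.naturality_apply]
    congr 2
    refine hku B (u ≫ v) _ _ _ ?_
    change a.smul (H.map v _) _ = _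
    rw [types_map_comp, ← a.map_smul, hk]
  · rw [← mul_inv_rev, ← map_mul]
    congr 2
    symm
    refine hku A u _ _ _ ?_
    change a.smul (h * _) _ = _
    rw [a.mul_smul, hk]
  · change (ρ.app A (k A u _ _))⁻¹ = _
    congr 2
    exact (hku A u _ _ h rfl).symm

noncomputable def ofPoint (ρ : H ⟶ G) (a : QuotientObj H Y) {R : CommAlgCat.{0} ℂ}
    (p : a.P.obj R) : InducedPoint ρ a R :=
  (exists_ofPoint R p).choose

theorem ofPoint_f (p : a.P.obj R) : (ofPoint ρ a p).f = a.π p :=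
  (exists_ofPoint R p).choose_spec.1

theorem ofPoint_s_smul (p : a.P.obj R) (A : CommAlgCat.{0} ℂ) (u : R ⟶ A) (h : H.obj A)
    (hp : a.π (a.smul h (a.P.map u p)) = (ofPoint ρ a p).f ≫ u) :
    (ofPoint ρ a p).s A u (a.smul h (a.P.map u p)) hp = (ρ.app A h)⁻¹ :=
  (exists_ofPoint R p).choose_spec.2 A u h hp

theorem ofPoint_s (p : a.P.obj R) (A : CommAlgCat.{0} ℂ) (u : R ⟶ A)
    (hp : a.π (a.P.map u p) = (ofPoint ρ a p).f ≫ u) :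
    (ofPoint ρ a p).s A u (a.P.map u p) hp = 1 := by
  have h := ofPoint_s_smul (ρ := ρ) p A u 1 (by rw [a.one_smul, hp])
  rw [map_one, inv_one] at h
  rw [← h]
  exact s_congr _ rfl (a.one_smul _).symm _ _

/-- Points of `G ×_H P` over the same point of the base agree as soon as they agree at a point
of `P`. -/
theorem ext_of_point {x y : InducedPoint ρ a R} (h : x.f = y.f) (p : a.P.obj R)
    (hp : a.π p = x.f) (h' : x.s R (𝟙 R) p (by rw [hp, Category.comp_id]) =
      y.s R (𝟙 R) p (by rw [hp, h, Category.comp_id])) : x = y := by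
  refine ext' h fun A u q hq hq' => ?_
  obtain ⟨k, rfl, -⟩ := a.simplyTransitive (a.P.map u p) q (by rw [a.π_map, hp, hq])
  have h1 : a.π (a.P.map u p) = x.f ≫ u := by rw [a.π_map, hp]
  have h2 : a.π (a.P.map u p) = y.f ≫ u := by rw [h1, h]
  rw [x.s_smul A u k _ h1, y.s_smul A u k _ h2]
  congr 1
  have e1 := x.map_s R A (𝟙 R) u p (by rw [hp, Category.comp_id]) (by rw [Category.id_comp, h1])
  have e2 := y.map_s R A (𝟙 R) u p (by rw [hp, h, Category.comp_id])
    (by rw [Category.id_comp, h2])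
  rw [x.s_congr (Category.id_comp u).symm rfl _ (by rw [Category.id_comp, h1]), ← e1, h', e2]
  exact y.s_congr (Category.id_comp u) rfl _ _

/-- The class of `(g, p)` is to be sent to `g κ(p)`. The pairs `(g, p)` and `(g ρ(h)⁻¹, h p)` have
the same image, so the value descends to the sheaf `X`. -/
theorem exists_toX (hX : IsFppfSheaf X.X) (κ : EquivariantMap ρ Y X) (x : InducedPoint ρ a R) :
    ∃! t : X.X.obj R, ∀ (A : CommAlgCat.{0} ℂ) (u : R ⟶ A) (p : a.P.obj A) (hp : a.π p = x.f ≫ u),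
      X.X.map u t = X.smul (x.s A u p hp) (κ.app (a.toX p)) :=
  a.existsUnique_descent hX x.f (fun A u p hp => X.smul (x.s A u p hp) (κ.app (a.toX p)))
    (fun A B u v p hp hp' => by
      rw [X.map_smul, x.map_s _ _ _ _ _ _ hp', ← κ.naturality, a.toX_map])
    (fun A u h p hp hp' => by
      rw [x.s_smul _ _ _ _ hp, X.mul_smul, a.toX_smul, κ.map_smul, ← X.mul_smul (ρ.app A h)⁻¹,
        inv_mul_cancel, X.one_smul])

end InducedPoint

/-- The `G`-torsor `G ×_H P` with its map to `X`. -/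
noncomputable def inducedObj {G H : GroupFunctor} {X : ActedSpace G} {Y : ActedSpace H}
    {ρ : H ⟶ G} (κ : EquivariantMap ρ Y X) (hG : IsFppfSheaf G.toTypes) (hX : IsFppfSheaf X.X)
    (a : QuotientObj H Y) : QuotientObj G X where
  base := a.base
  P := InducedPoint.functor ρ a
  isSheaf := InducedPoint.isFppfSheaf hG
  π x := InducedPoint.f x
  π_map _ _ := rfl
  smul g x := InducedPoint.smul g x
  one_smul x := InducedPoint.ext' rfl fun A u p hp hp' => by
    change G.map u 1 * _ = _
    rw [map_one, one_mul]
  mul_smul g h x := InducedPoint.ext' rfl fun A u p hp hp' => by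
    change G.map u (g * h) * _ = G.map u g * (G.map u h * _)
    rw [map_mul, mul_assoc]
  map_smul f g x := InducedPoint.ext' rfl fun A u p hp hp' => by
    change G.map (f ≫ u) g * _ = G.map u (G.map f g) * _
    rw [group_map_comp]
    rfl
  π_smul _ _ := rfl
  simplyTransitive x y h := InducedPoint.existsUnique_smul hG x y h
  locallyNonempty := by
    obtain ⟨S, hS, h⟩ := a.locallyNonempty
    refine ⟨S, hS, fun R f hf => ?_⟩
    obtain ⟨p, hp⟩ := h R f hf
    exact ⟨InducedPoint.ofPoint ρ a p, (InducedPoint.ofPoint_f p).trans hp⟩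
  toX x := (InducedPoint.exists_toX hX κ x).choose
  toX_map {R S} f x := by
    symm
    refine (InducedPoint.exists_toX hX κ (InducedPoint.map f x)).choose_spec.2 _
      fun A u p hp => ?_
    rw [← types_map_comp]
    exact (InducedPoint.exists_toX hX κ x).choose_spec.1 A (f ≫ u) p
      (hp.trans (Category.assoc _ _ _))
  toX_smul g x := by
    symm
    refine (InducedPoint.exists_toX hX κ (InducedPoint.smul g x)).choose_spec.2 _
      fun A u p hp => ?_
    change _ = X.smul (G.map u g * _) _
    rw [X.map_smul, X.mul_smul]
    congr 1
    exact (InducedPoint.exists_toX hX κ x).choose_spec.1 A u p hp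

/-! ### The universal property and functoriality of the induced torsor. -/

section Induced

variable {G H : GroupFunctor} {X : ActedSpace G} {Y : ActedSpace H}
  {ρ : H ⟶ G} (κ : EquivariantMap ρ Y X) (hG : IsFppfSheaf G.toTypes) (hX : IsFppfSheaf X.X)

theorem map_toX_inducedObj (a : QuotientObj H Y) {R : CommAlgCat.{0} ℂ}
    (x : InducedPoint ρ a R) (A : CommAlgCat.{0} ℂ) (u : R ⟶ A) (p : a.P.obj A)
    (hp : a.π p = x.f ≫ u) : X.X.map u ((inducedObj κ hG hX a).toX x) =
      X.smul (x.s A u p hp) (κ.app (a.toX p)) :=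
  (InducedPoint.exists_toX hX κ x).choose_spec.1 A u p hp

theorem toX_inducedObj_ofPoint (a : QuotientObj H Y) {R : CommAlgCat.{0} ℂ} (p : a.P.obj R) :
    (inducedObj κ hG hX a).toX (InducedPoint.ofPoint ρ a p) = κ.app (a.toX p) := by
  have e : a.π (a.P.map (𝟙 R) p) = (InducedPoint.ofPoint ρ a p).f ≫ 𝟙 R := by
    rw [InducedPoint.ofPoint_f, a.π_map]
  have h := map_toX_inducedObj κ hG hX a (InducedPoint.ofPoint ρ a p) R (𝟙 R)
    (a.P.map (𝟙 R) p) e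
  rw [types_map_id, InducedPoint.ofPoint_s, X.one_smul, types_map_id] at h
  exact h

/-- A `ρ`-equivariant map of torsors over the base, compatible with `κ`, extends to the
induced torsor. -/
theorem existsUnique_hom_inducedObj (a : QuotientObj H Y) (b : QuotientObj G X)
    (w : b.base ⟶ a.base) (β : ∀ (R : CommAlgCat.{0} ℂ), a.P.obj R → b.P.obj R)
    (hβ : ∀ {R S : CommAlgCat.{0} ℂ} (f : R ⟶ S) (p : a.P.obj R),
      β S (a.P.map f p) = b.P.map f (β R p))
    (hπ : ∀ {R : CommAlgCat.{0} ℂ} (p : a.P.obj R), b.π (β R p) = w ≫ a.π p)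
    (hs : ∀ {R : CommAlgCat.{0} ℂ} (h : H.obj R) (p : a.P.obj R),
      β R (a.smul h p) = b.smul (ρ.app R h) (β R p))
    (ht : ∀ {R : CommAlgCat.{0} ℂ} (p : a.P.obj R), b.toX (β R p) = κ.app (a.toX p)) :
    ∃! v : inducedObj κ hG hX a ⟶ b, QuotientObj.Hom.base v = w ∧
      ∀ (R : CommAlgCat.{0} ℂ) (p : a.P.obj R),
        QuotientObj.Hom.app v R (InducedPoint.ofPoint ρ a p) = β R p := by
  have key : ∀ (R : CommAlgCat.{0} ℂ) (x : InducedPoint ρ a R), ∃! t : b.P.obj R,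
      ∀ (A : CommAlgCat.{0} ℂ) (u : R ⟶ A) (p : a.P.obj A) (hp : a.π p = x.f ≫ u),
        b.P.map u t = b.smul (x.s A u p hp) (β A p) := fun R x =>
    a.existsUnique_descent (Z := b.P) b.isSheaf x.f
      (fun A u p hp => b.smul (x.s A u p hp) (β A p))
      (fun A B u v p hp hp' => by
        rw [b.map_smul, x.map_s _ _ _ _ _ _ hp', hβ])
      (fun A u h p hp hp' => by
        rw [x.s_smul _ _ _ _ hp, b.mul_smul, hs, b.inv_smul_smul])
  choose t h1 h2 using key
  let v : QuotientObj.Hom (inducedObj κ hG hX a) b :=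
    { base := w
      app := t
      naturality := fun {R S} f x => (h2 S (InducedPoint.map f x) _ fun A u p hp => by
        rw [← types_map_comp]
        exact h1 R x A (f ≫ u) p (hp.trans (Category.assoc _ _ _))).symm
      π_app := fun {R} x => by
        obtain ⟨S, hS, h⟩ := a.exists_covering x.f
        refine hom_ext_of_mem hS fun A u hu => ?_
        obtain ⟨p, hp⟩ := h A u hu
        rw [← b.π_map, h1 R x A u p hp, b.π_smul, hπ, hp]
        exact (Category.assoc _ _ _).symm
      app_smul := fun {R} g x => (h2 R (InducedPoint.smul g x) _ fun A u p hp => by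
        rw [b.map_smul, h1 R x A u p hp, ← b.mul_smul]
        rfl).symm
      toX_app := fun {R} x => by
        obtain ⟨S, hS, h⟩ := a.exists_covering x.f
        refine IsFppfSheaf.ext hX hS fun A u hu => ?_
        obtain ⟨p, hp⟩ := h A u hu
        rw [← b.toX_map, h1 R x A u p hp, b.toX_smul, ht,
          map_toX_inducedObj κ hG hX a x A u p hp] }
  refine ⟨v, ⟨rfl, fun R p => ?_⟩, fun v' hv' => QuotientObj.hom_ext hv'.1 fun R x => ?_⟩
  · have e : a.π (a.P.map (𝟙 R) p) = (InducedPoint.ofPoint ρ a p).f ≫ 𝟙 R := by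
      rw [InducedPoint.ofPoint_f, a.π_map]
    have h := h1 R (InducedPoint.ofPoint ρ a p) R (𝟙 R) (a.P.map (𝟙 R) p) e
    rw [types_map_id, InducedPoint.ofPoint_s, b.one_smul, types_map_id] at h
    exact h
  · refine h2 R x _ fun A u p hp => ?_
    rw [← QuotientObj.Hom.naturality v', ← hv'.2]
    -- Locally every point `x` of the induced torsor is `x.s p` applied to the class of `p`, so an
    -- equivariant map is determined by its values on such classes.
    refine Eq.trans (congrArg (QuotientObj.Hom.app v' A) ?_) (QuotientObj.Hom.app_smul v' _ _)
    have e1 : a.π p = (InducedPoint.map u x).f := hp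
    have e2 : (InducedPoint.map u x).f = (InducedPoint.smul (x.s A u p hp)
        (InducedPoint.ofPoint ρ a p)).f := e1.symm.trans (InducedPoint.ofPoint_f p).symm
    refine InducedPoint.ext_of_point e2 p e1 ?_
    have e3 : a.π (a.P.map (𝟙 A) p) = (InducedPoint.ofPoint ρ a p).f ≫ 𝟙 A := by
      rw [InducedPoint.ofPoint_f, a.π_map]
    have e4 : a.π p = (InducedPoint.ofPoint ρ a p).f ≫ 𝟙 A := by
      rw [InducedPoint.ofPoint_f, Category.comp_id]
    change x.s A (u ≫ 𝟙 A) p _ = G.map (𝟙 A) (x.s A u p hp) *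
      (InducedPoint.ofPoint ρ a p).s A (𝟙 A) p e4
    rw [(InducedPoint.ofPoint ρ a p).s_congr rfl (types_map_id a.P p).symm e4 e3,
      InducedPoint.ofPoint_s, mul_one, group_map_id]
    exact x.s_congr (Category.comp_id u) rfl _ _

theorem map_ofPoint (a : QuotientObj H Y) {R S : CommAlgCat.{0} ℂ} (f : R ⟶ S)
    (p : a.P.obj R) : InducedPoint.ofPoint ρ a (a.P.map f p) =
      InducedPoint.map f (InducedPoint.ofPoint ρ a p) := by
  have e1 : a.π (a.P.map f p) = (InducedPoint.ofPoint ρ a (a.P.map f p)).f :=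
    (InducedPoint.ofPoint_f _).symm
  have e2 : (InducedPoint.ofPoint ρ a (a.P.map f p)).f = (InducedPoint.ofPoint ρ a p).f ≫ f := by
    rw [← e1, a.π_map, InducedPoint.ofPoint_f]
  refine InducedPoint.ext_of_point e2 (a.P.map f p) e1 ?_
  have e3 : a.π (a.P.map (𝟙 S) (a.P.map f p)) =
      (InducedPoint.ofPoint ρ a (a.P.map f p)).f ≫ 𝟙 S := by
    rw [types_map_id, ← e1, Category.comp_id]
  rw [InducedPoint.s_congr _ rfl (types_map_id a.P _).symm _ e3, InducedPoint.ofPoint_s]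
  change 1 = (InducedPoint.ofPoint ρ a p).s S (f ≫ 𝟙 S) (a.P.map f p) _
  have e4 : a.π (a.P.map f p) = (InducedPoint.ofPoint ρ a p).f ≫ f := by rw [e1, e2]
  rw [InducedPoint.s_congr _ (Category.comp_id f) rfl _ e4, InducedPoint.ofPoint_s]

theorem ofPoint_smul (a : QuotientObj H Y) {R : CommAlgCat.{0} ℂ} (h : H.obj R)
    (p : a.P.obj R) : InducedPoint.ofPoint ρ a (a.smul h p) =
      InducedPoint.smul (ρ.app R h) (InducedPoint.ofPoint ρ a p) := by
  have e1 : a.π (a.smul h p) = (InducedPoint.ofPoint ρ a (a.smul h p)).f :=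
    (InducedPoint.ofPoint_f _).symm
  have e2 : (InducedPoint.ofPoint ρ a (a.smul h p)).f = (InducedPoint.ofPoint ρ a p).f := by
    rw [← e1, a.π_smul, InducedPoint.ofPoint_f]
  refine InducedPoint.ext_of_point e2 (a.smul h p) e1 ?_
  have e3 : a.π (a.P.map (𝟙 R) (a.smul h p)) =
      (InducedPoint.ofPoint ρ a (a.smul h p)).f ≫ 𝟙 R := by
    rw [types_map_id, ← e1, Category.comp_id]
  rw [InducedPoint.s_congr _ rfl (types_map_id a.P _).symm _ e3, InducedPoint.ofPoint_s]
  have e5 : a.π (a.smul h p) = (InducedPoint.ofPoint ρ a p).f ≫ 𝟙 R := by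
    rw [e1, e2, Category.comp_id]
  change 1 = G.map (𝟙 R) (ρ.app R h) * (InducedPoint.ofPoint ρ a p).s R (𝟙 R) (a.smul h p) e5
  have e4 : a.π (a.smul h (a.P.map (𝟙 R) p)) = (InducedPoint.ofPoint ρ a p).f ≫ 𝟙 R := by
    rw [types_map_id, e1, e2, Category.comp_id]
  rw [InducedPoint.s_congr _ rfl (congrArg _ (types_map_id a.P p).symm) _ e4,
    InducedPoint.ofPoint_s_smul, group_map_id, mul_inv_cancel]

/-- Both maps solve the extension problem posed by the restriction of `v'` to the points of `P`. -/
theorem inducedObj_hom_ext {a : QuotientObj H Y} {b : QuotientObj G X}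
    {v v' : inducedObj κ hG hX a ⟶ b} (h : QuotientObj.Hom.base v = QuotientObj.Hom.base v')
    (h' : ∀ (R : CommAlgCat.{0} ℂ) (p : a.P.obj R),
      QuotientObj.Hom.app v R (InducedPoint.ofPoint ρ a p) =
        QuotientObj.Hom.app v' R (InducedPoint.ofPoint ρ a p)) : v = v' := by
  refine (existsUnique_hom_inducedObj κ hG hX a b (QuotientObj.Hom.base v')
    (fun R p => QuotientObj.Hom.app v' R (InducedPoint.ofPoint ρ a p)) (fun {R S} f p => ?_)
    (fun {R} p => ?_) (fun {R} k p => ?_) (fun {R} p => ?_)).unique ⟨h, h'⟩ ⟨rfl, fun _ _ => rfl⟩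
  · rw [map_ofPoint]
    exact QuotientObj.Hom.naturality v' f _
  · exact (QuotientObj.Hom.π_app v' _).trans
      (congrArg (QuotientObj.Hom.base v' ≫ ·) (InducedPoint.ofPoint_f p))
  · rw [ofPoint_smul]
    exact QuotientObj.Hom.app_smul v' _ _
  · exact (QuotientObj.Hom.toX_app v' _).trans (toX_inducedObj_ofPoint κ hG hX a p)

theorem existsUnique_inducedMap {a b : QuotientObj H Y} (u : a ⟶ b) :
    ∃! v : inducedObj κ hG hX a ⟶ inducedObj κ hG hX b,
      QuotientObj.Hom.base v = QuotientObj.Hom.base u ∧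
        ∀ (R : CommAlgCat.{0} ℂ) (p : a.P.obj R),
          QuotientObj.Hom.app v R (InducedPoint.ofPoint ρ a p) =
            InducedPoint.ofPoint ρ b (QuotientObj.Hom.app u R p) :=
  existsUnique_hom_inducedObj κ hG hX a (inducedObj κ hG hX b) (QuotientObj.Hom.base u)
    (fun R p => InducedPoint.ofPoint ρ b (QuotientObj.Hom.app u R p))
    (fun f p => by
      rw [QuotientObj.Hom.naturality u, map_ofPoint]
      rfl)
    (fun p => (InducedPoint.ofPoint_f _).trans (QuotientObj.Hom.π_app u p))
    (fun h p => by
      rw [QuotientObj.Hom.app_smul u, ofPoint_smul]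
      rfl)
    (fun p => by rw [toX_inducedObj_ofPoint, QuotientObj.Hom.toX_app u])

/-- The functor `P ↦ G ×_H P` on quotient stacks. -/
noncomputable def extensionFunctor : QuotientObj H Y ⥤ QuotientObj G X where
  obj := inducedObj κ hG hX
  map u := (existsUnique_inducedMap κ hG hX u).choose
  map_id a := ((existsUnique_inducedMap κ hG hX (𝟙 a)).choose_spec.2 _ ⟨rfl, fun _ _ => rfl⟩).symm
  map_comp {a b c} u v := by
    obtain ⟨h1, h2⟩ := (existsUnique_inducedMap κ hG hX u).choose_spec.1
    obtain ⟨k1, k2⟩ := (existsUnique_inducedMap κ hG hX v).choose_spec.1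
    refine ((existsUnique_inducedMap κ hG hX (u ≫ v)).choose_spec.2 _ ⟨?_, fun R p => ?_⟩).symm
    · rw [QuotientObj.comp_base, QuotientObj.comp_base, h1, k1]
      rfl
    · exact (congrArg (QuotientObj.Hom.app _ R) (h2 R p)).trans (k2 R _)

theorem base_extension_map {a b : QuotientObj H Y} (u : a ⟶ b) :
    QuotientObj.Hom.base ((extensionFunctor κ hG hX).map u) = QuotientObj.Hom.base u :=
  (existsUnique_inducedMap κ hG hX u).choose_spec.1.1

theorem extension_map_ofPoint {a b : QuotientObj H Y} (u : a ⟶ b)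
    {R : CommAlgCat.{0} ℂ} (p : a.P.obj R) :
    QuotientObj.Hom.app ((extensionFunctor κ hG hX).map u) R (InducedPoint.ofPoint ρ a p) =
      InducedPoint.ofPoint ρ b (QuotientObj.Hom.app u R p) :=
  (existsUnique_inducedMap κ hG hX u).choose_spec.1.2 R p

/-- The morphism of quotient stacks `P ↦ G ×_H P`. -/
noncomputable def inducedBased : BasedFunctor (quotientStack H Y) (quotientStack G X) where
  toFunctor := extensionFunctor κ hG hX
  w := CategoryTheory.Functor.hext (fun _ => rfl) fun _ _ u =>
    heq_of_eq (congrArg Quiver.Hom.op (base_extension_map κ hG hX u))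

theorem nonempty_inducedBy_inducedBased : Nonempty (InducedBy κ (inducedBased κ hG hX)) :=
  ⟨{ α := fun a _ p => InducedPoint.ofPoint ρ a p
     naturality := map_ofPoint
     over_base := fun a _ p =>
       (InducedPoint.ofPoint_f p).trans (Category.id_comp (a.π p)).symm
     equivariant := ofPoint_smul
     compatible := toX_inducedObj_ofPoint κ hG hX
     map_α := fun u _ p => (extension_map_ofPoint κ hG hX u p).symm }⟩

end Induced

/-! ### The equivalence between the quotient of a space and the quotient of a slice. -/

namespace IsSlice

variable {G H : GroupFunctor} {X : ActedSpace G} {Y : ActedSpace H} {ρ : H ⟶ G}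
  {κ : EquivariantMap ρ Y X}

/-- A torsor is the part over the slice of its induced torsor. -/
noncomputable def unitHom (hκ : IsSlice κ) (a : QuotientObj H Y) :
    QuotientObj.Hom a (hκ.restrictObj (inducedObj κ hκ.sheaf_group hκ.sheaf_space a)) where
  base := 𝟙 _
  app _ p := ⟨InducedPoint.ofPoint ρ a p, a.toX p, (toX_inducedObj_ofPoint κ _ _ a p).symm⟩
  naturality f p := Subtype.ext (map_ofPoint a f p)
  π_app p := (InducedPoint.ofPoint_f p).trans (Category.id_comp _).symm
  app_smul h p := Subtype.ext (ofPoint_smul a h p)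
  toX_app {R} p := hκ.injective R ((hκ.app_toX_restrictObj _ _).trans
    (toX_inducedObj_ofPoint κ _ _ a p))

/-- The inclusion of the part of a `G`-torsor over the slice is `ρ`-equivariant, so it extends to
the induced torsor. Lying over the identity of the base, the extension is an isomorphism. -/
theorem existsUnique_counitHom (hκ : IsSlice κ) (b : QuotientObj G X) :
    ∃! v : inducedObj κ hκ.sheaf_group hκ.sheaf_space (hκ.restrictObj b) ⟶ b,
      QuotientObj.Hom.base v = 𝟙 _ ∧
        ∀ (R : CommAlgCat.{0} ℂ) (p : (hκ.restrictObj b).P.obj R),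
          QuotientObj.Hom.app v R (InducedPoint.ofPoint ρ (hκ.restrictObj b) p) = p.1 :=
  existsUnique_hom_inducedObj κ hκ.sheaf_group hκ.sheaf_space (hκ.restrictObj b) b (𝟙 _)
    (fun _ p => p.1) (fun _ _ => rfl) (fun _ => (Category.id_comp _).symm) (fun _ _ => rfl)
    (fun p => (hκ.app_toX_restrictObj b p).symm)

/-- Quotients by a group and by a slice are equivalent. -/
noncomputable def equivalence (hκ : IsSlice κ) : QuotientObj H Y ≌ QuotientObj G X :=
  -- Unit and counit lie over identities of the base, so only their naturality needs a check, and
  -- that may be done on classes of points.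
  CategoryTheory.Equivalence.mk (extensionFunctor κ hκ.sheaf_group hκ.sheaf_space) hκ.restrict
    (NatIso.ofComponents (fun a =>
      haveI : IsIso (QuotientObj.Hom.base (show a ⟶ hκ.restrictObj (inducedObj κ hκ.sheaf_group
        hκ.sheaf_space a) from hκ.unitHom a)) := inferInstanceAs (IsIso (𝟙 a.base))
      @asIso _ _ a (hκ.restrictObj (inducedObj κ hκ.sheaf_group hκ.sheaf_space a))
        (hκ.unitHom a) (QuotientObj.isIso_of_isIso_base _))
      (fun {a b} u => QuotientObj.hom_ext
        ((Category.id_comp _).trans ((base_extension_map κ hκ.sheaf_group hκ.sheaf_space u).symm.trans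
          (Category.comp_id _).symm))
        fun R p => Subtype.ext (extension_map_ofPoint κ hκ.sheaf_group hκ.sheaf_space u p).symm))
    (NatIso.ofComponents (fun b =>
      haveI : IsIso (QuotientObj.Hom.base (hκ.existsUnique_counitHom b).choose) := by
        rw [(hκ.existsUnique_counitHom b).choose_spec.1.1]
        exact inferInstanceAs (IsIso (𝟙 b.base))
      @asIso _ _ (inducedObj κ hκ.sheaf_group hκ.sheaf_space (hκ.restrictObj b)) b
        (hκ.existsUnique_counitHom b).choose (QuotientObj.isIso_of_isIso_base _))
      (fun {a b} u => inducedObj_hom_ext κ hκ.sheaf_group hκ.sheaf_space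
        (by
          have h1 := (hκ.existsUnique_counitHom a).choose_spec.1.1
          have h2 := (hκ.existsUnique_counitHom b).choose_spec.1.1
          have h3 := base_extension_map κ hκ.sheaf_group hκ.sheaf_space (hκ.restrict.map u)
          refine ((congrArg₂ (· ≫ ·) h2 h3).trans (Category.id_comp _)).trans ?_
          exact ((congrArg (QuotientObj.Hom.base u ≫ ·) h1).trans (Category.comp_id _)).symm)
        fun R p => by
          have h1 := (hκ.existsUnique_counitHom a).choose_spec.1.2 R p
          have h2 := (hκ.existsUnique_counitHom b).choose_spec.1.2 R
            (QuotientObj.Hom.app (hκ.restrict.map u) R p)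
          have h3 := extension_map_ofPoint κ hκ.sheaf_group hκ.sheaf_space (hκ.restrict.map u) p
          refine ((congrArg (QuotientObj.Hom.app (hκ.existsUnique_counitHom b).choose R) h3).trans
            h2).trans ?_
          exact (congrArg (QuotientObj.Hom.app u R) h1).symm))

/-- The morphism of quotient stacks given by restriction of torsors to a slice. -/
noncomputable def restrictBased (hκ : IsSlice κ) :
    BasedFunctor (quotientStack G X) (quotientStack H Y) where
  toFunctor := hκ.restrict
  w := rfl

theorem isStackIso_inducedBased (hκ : IsSlice κ) :
    IsStackIso (inducedBased κ hκ.sheaf_group hκ.sheaf_space) :=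
  hκ.equivalence.isEquivalence_functor

theorem isStackIso_restrictBased (hκ : IsSlice κ) : IsStackIso hκ.restrictBased :=
  hκ.equivalence.isEquivalence_inverse

end IsSlice

/-! ### Transfer along an isomorphism -/

section Transfer

variable {G H : GroupFunctor} {X : ActedSpace G} {Y : ActedSpace H} (ρ : G ⟶ H) [IsIso ρ]

theorem inv_app_app (R : CommAlgCat.{0} ℂ) (g : G.obj R) : (inv ρ).app R (ρ.app R g) = g := by
  have h : (ρ ≫ inv ρ).app R g = g := by
    rw [IsIso.hom_inv_id]
    rfl
  exact h

theorem app_inv_app (R : CommAlgCat.{0} ℂ) (h : H.obj R) : ρ.app R ((inv ρ).app R h) = h := by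
  have h : (inv ρ ≫ ρ).app R h = h := by
    rw [IsIso.inv_hom_id]
    rfl
  exact h

variable {ρ}

/-- A `G`-torsor as an `H`-torsor, for isomorphic groups `G` and `H`. -/
noncomputable def transferObj (κ : EquivariantMap ρ X Y) (a : QuotientObj G X) :
    QuotientObj H Y where
  base := a.base
  P := a.P
  isSheaf := a.isSheaf
  π := a.π
  π_map := a.π_map
  smul {R} h p := a.smul ((inv ρ).app R h) p
  one_smul p := by rw [map_one, a.one_smul]
  mul_smul g h p := by rw [map_mul, a.mul_smul]
  map_smul f h p := by rw [a.map_smul, NatTrans.naturality_apply]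
  π_smul h p := a.π_smul _ p
  simplyTransitive {R} p q hpq := by
    obtain ⟨g, hg, hu⟩ := a.simplyTransitive p q hpq
    refine ⟨ρ.app R g, ?_, fun h hh => ?_⟩
    · change a.smul _ p = q
      rw [inv_app_app, hg]
    · rw [← app_inv_app ρ R h, hu _ hh]
  locallyNonempty := a.locallyNonempty
  toX p := κ.app (a.toX p)
  toX_map f p := by rw [a.toX_map, κ.naturality]
  toX_smul h p := by rw [a.toX_smul, κ.map_smul, app_inv_app]

/-- The morphism of quotient stacks given by isomorphic groups and spaces. -/
noncomputable def transferBased (κ : EquivariantMap ρ X Y) :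
    BasedFunctor (quotientStack G X) (quotientStack H Y) where
  obj a := transferObj κ a
  map {a b} (u : QuotientObj.Hom a b) := (
    { base := u.base
      app := u.app
      naturality := u.naturality
      π_app := u.π_app
      app_smul := fun _ p => u.app_smul _ p
      toX_app := fun p => congrArg κ.app (u.toX_app p) } :
      QuotientObj.Hom (transferObj κ a) (transferObj κ b))
  map_id _ := rfl
  map_comp _ _ := rfl
  w := rfl

theorem nonempty_inducedBy_transferBased (κ : EquivariantMap ρ X Y) :
    Nonempty (InducedBy κ (transferBased κ)) :=
  ⟨{ α := fun _ _ p => p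
     naturality := fun _ _ _ _ _ => rfl
     over_base := fun a _ p => (Category.id_comp (a.π p)).symm
     equivariant := fun a R g p => by
       change _ = QuotientObj.smul a ((inv ρ).app R (ρ.app R g)) p
       rw [inv_app_app]
     compatible := fun _ _ _ => rfl
     map_α := fun _ _ _ => rfl }⟩

/-- The underlying sheaf of the torsor does not change, only the names of the group and of the space
do. Preimages of objects and morphisms are obtained by renaming back. -/
theorem isStackIso_transferBased (κ : EquivariantMap ρ X Y)
    (hκ : ∀ R : CommAlgCat.{0} ℂ, Function.Bijective (κ.app (R := R))) :
    IsStackIso (transferBased κ) := by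
  have hf : (transferBased κ).toFunctor.Faithful := ⟨fun {a b u v} h => by
    refine QuotientObj.hom_ext (congrArg (QuotientObj.Hom.base (a := transferObj κ a)
      (b := transferObj κ b)) h) fun R p => ?_
    exact congrArg (fun w => QuotientObj.Hom.app (a := transferObj κ a)
      (b := transferObj κ b) w R p) h⟩
  have hfull : (transferBased κ).toFunctor.Full := ⟨fun {a b}
      (v : QuotientObj.Hom (transferObj κ a) (transferObj κ b)) =>
    ⟨{ base := v.base
       app := v.app
       naturality := v.naturality
       π_app := v.π_app
       app_smul := fun {R} g p => by
         have h := v.app_smul (ρ.app R g) p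
         change v.app R (QuotientObj.smul a ((inv ρ).app R (ρ.app R g)) p) =
           QuotientObj.smul b ((inv ρ).app R (ρ.app R g)) _ at h
         rwa [inv_app_app] at h
       toX_app := fun {R} p => (hκ R).1 (v.toX_app p) }, rfl⟩⟩
  have hs : (transferBased κ).toFunctor.EssSurj := ⟨fun (b : QuotientObj H Y) => by
    choose s hs using fun (R : CommAlgCat.{0} ℂ) (y : Y.X.obj R) => (hκ R).2 y
    let a : QuotientObj G X :=
      { base := b.base
        P := b.P
        isSheaf := b.isSheaf
        π := b.π
        π_map := b.π_map
        smul := fun {R} g p => b.smul (ρ.app R g) p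
        one_smul := fun p => by rw [map_one, b.one_smul]
        mul_smul := fun g h p => by rw [map_mul, b.mul_smul]
        map_smul := fun f h p => by rw [b.map_smul, NatTrans.naturality_apply]
        π_smul := fun h p => b.π_smul _ p
        simplyTransitive := fun {R} p q hpq => by
          obtain ⟨g, hg, hu⟩ := b.simplyTransitive p q hpq
          refine ⟨(inv ρ).app R g, ?_, fun h hh => ?_⟩
          · change b.smul _ p = q
            rw [app_inv_app, hg]
          · rw [← inv_app_app ρ R h, hu _ hh]
        locallyNonempty := b.locallyNonempty
        toX := fun {R} p => s R (b.toX p)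
        toX_map := fun {R S} f p => (hκ S).1 (by rw [κ.naturality, hs, hs, b.toX_map])
        toX_smul := fun {R} h p => (hκ R).1 (by rw [κ.map_smul, hs, hs, b.toX_smul]) }
    let v : transferObj κ a ⟶ b := (
      { base := 𝟙 _
        app := fun _ p => p
        naturality := fun _ _ => rfl
        π_app := fun p => (Category.id_comp (b.π p)).symm
        app_smul := fun {R} h p => by
          change b.smul (ρ.app R ((inv ρ).app R h)) p = _
          rw [app_inv_app]
        toX_app := fun {R} p => (hs R (b.toX p)).symm } :
        QuotientObj.Hom (transferObj κ a) b)
    have : IsIso (QuotientObj.Hom.base v) := inferInstanceAs (IsIso (𝟙 b.base))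
    exact ⟨a, ⟨@asIso _ _ (transferObj κ a) b v (QuotientObj.isIso_of_isIso_base v)⟩⟩⟩
  exact { faithful := hf, full := hfull, essSurj := hs }

end Transfer

theorem IsStackIso.comp {𝒳 𝒴 𝒵 : BasedCategory.{1, 2} AffC} {F : BasedFunctor 𝒳 𝒴}
    {F' : BasedFunctor 𝒴 𝒵} (h : IsStackIso F) (h' : IsStackIso F') : IsStackIso (F.comp F') := by
  have h1 : F.toFunctor.IsEquivalence := h
  have h2 : F'.toFunctor.IsEquivalence := h'
  exact inferInstanceAs (F.toFunctor ⋙ F'.toFunctor).IsEquivalence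

/-! ### Open immersions -/

/-- The torsor `a` over an isomorphic base. -/
def QuotientObj.rebase {G : GroupFunctor} {X : ActedSpace G} (a : QuotientObj G X)
    {B : CommAlgCat.{0} ℂ} (w : a.base ≅ B) : QuotientObj G X :=
  { a with
    base := B
    π := fun p => w.inv ≫ a.π p
    π_map := fun f p => by rw [a.π_map, Category.assoc]
    π_smul := fun g p => by rw [a.π_smul]
    simplyTransitive := fun p q h => a.simplyTransitive p q ((cancel_epi w.inv).1 h)
    locallyNonempty := by
      obtain ⟨S, hS, h⟩ := a.locallyNonempty
      refine ⟨S.pullback w.hom.op, fppfTopology.pullback_stable _ hS, fun R f hf => ?_⟩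
      obtain ⟨p, hp⟩ := h R (w.hom ≫ f) hf
      exact ⟨p, by rw [hp, Iso.inv_hom_id_assoc]⟩ }

def QuotientObj.rebaseHom {G : GroupFunctor} {X : ActedSpace G} (a : QuotientObj G X)
    {B : CommAlgCat.{0} ℂ} (w : a.base ≅ B) : QuotientObj.Hom (a.rebase w) a where
  base := w.hom
  app _ p := p
  naturality _ _ := rfl
  π_app p := (Iso.hom_inv_id_assoc w (a.π p)).symm
  app_smul _ _ := rfl
  toX_app _ := rfl

/-- The hypothesis is an equality of objects because a based functor commutes with the projections
by an equality of functors. -/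
theorem isHomLift_id_comp {𝒳 𝒮 : Type*} [Category* 𝒳] [Category* 𝒮] (p : 𝒳 ⥤ 𝒮) {a b c : 𝒳}
    {R S T : 𝒮} (h : R = S) {φ : a ⟶ b} (hφ : p.IsHomLift (𝟙 R) φ) {f : S ⟶ T} {ψ : b ⟶ c}
    (hψ : p.IsHomLift f ψ) : p.IsHomLift f (φ ≫ ψ) := by
  subst h
  infer_instance

/-- Precomposition with an equivalence does not change the fibre products. A preimage under the
equivalence lies only over an isomorphic base; it is moved to the required base by
`QuotientObj.rebase`, which is why the source is a quotient stack. -/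
theorem IsOpenImmersionOfStacks.comp_stackIso {G : GroupFunctor} {X : ActedSpace G}
    {𝒴 𝒵 : BasedCategory.{1, 2} AffC} {e : BasedFunctor (quotientStack G X) 𝒴}
    {j : BasedFunctor 𝒴 𝒵} (hj : IsOpenImmersionOfStacks j) (he : IsStackIso e) :
    IsOpenImmersionOfStacks (e.comp j) := by
  have : e.toFunctor.IsEquivalence := he
  intro y
  obtain ⟨U, hU⟩ := hj y
  refine ⟨U, fun B f => ⟨?_, fun x x' u u' hu hu' => ?_⟩⟩
  · rw [← (hU B f).1]
    constructor
    · rintro ⟨x, u, hu⟩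
      exact ⟨e.obj x, u, hu⟩
    · rintro ⟨x', u, hu⟩
      let x0 : QuotientObj G X := e.toFunctor.objPreimage x'
      let i : e.obj x0 ≅ x' := e.toFunctor.objObjPreimageIso x'
      have hx : 𝒴.p.obj (e.obj x0) = op x0.base := e.w_obj x0
      let g : op x0.base ⟶ 𝒴.p.obj x' := eqToHom hx.symm ≫ 𝒴.p.map i.hom
      have hg : 𝒴.p.IsHomLift g i.hom := inferInstance
      have hgi : IsIso g := inferInstance
      let w : x0.base ≅ (𝒴.p.obj x').unop := (asIso g).symm.unop
      let r : x0.rebase w ⟶ x0 := x0.rebaseHom w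
      have hr : (quotientStack G X).p.IsHomLift w.hom.op r :=
        IsHomLift.map (QuotientObj.proj G X) r
      have h1 : 𝒴.p.IsHomLift w.hom.op (e.map r) := (BasedFunctor.isHomLift_iff e _ r).2 hr
      have h2 : 𝒴.p.IsHomLift (w.hom.op ≫ g) (e.map r ≫ i.hom) := inferInstance
      have h3 : w.hom.op ≫ g = 𝟙 _ := IsIso.inv_hom_id g
      rw [h3] at h2
      have h4 : 𝒵.p.IsHomLift (𝟙 (𝒴.p.obj x')) (j.map (e.map r ≫ i.hom)) :=
        (BasedFunctor.isHomLift_iff j _ _).2 h2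
      have h5 : 𝒵.p.IsHomLift f.op (j.map (e.map r ≫ i.hom) ≫ u) := by
        have h6 : 𝒴.p.obj x' = op B := by
          rw [← j.w_obj]
          exact IsHomLift.domain_eq 𝒵.p f.op u
        exact isHomLift_id_comp 𝒵.p h6 h4 hu
      exact ⟨x0.rebase w, _, h5⟩
  · obtain ⟨ε, ⟨h1, h2⟩, h3⟩ := (hU B f).2 (e.obj x) (e.obj x') u u' hu hu'
    have h4 : e.map (e.toFunctor.preimageIso ε).hom = ε.hom := e.toFunctor.map_preimage ε.hom
    refine ⟨e.toFunctor.preimageIso ε, ⟨?_, ?_⟩, fun ε' hε' => ?_⟩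
    · rw [← BasedFunctor.isHomLift_iff e, h4]
      exact h1
    · change j.map (e.map (e.toFunctor.preimageIso ε).hom) ≫ u' = u
      rw [h4, h2]
    · have h5 := h3 (e.toFunctor.mapIso ε')
        ⟨(BasedFunctor.isHomLift_iff e _ _).2 hε'.1, hε'.2⟩
      apply Iso.ext
      apply e.toFunctor.map_injective
      exact (congrArg Iso.hom h5).trans h4.symm

/-- A stable subspace is open if it is cut out by an open subset of the base for all points of
the ambient space. -/
def StableSubspace.IsOpen {G : GroupFunctor} {X : ActedSpace G} (O : StableSubspace X) : Prop :=
  ∀ (R : CommAlgCat.{0} ℂ) (x : X.X.obj R), ∃ V : TopologicalSpace.Opens (PrimeSpectrum R),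
    ∀ (S : CommAlgCat.{0} ℂ) (f : R ⟶ S), X.X.map f x ∈ O.pts S ↔ Set.range (specMap f) ⊆ V

/-- Two points of spectra over the same point of the base are the images of a common point with
values in a field. -/
theorem exists_field_point {A R R' : CommAlgCat.{0} ℂ} (f : A ⟶ R) (f' : A ⟶ R')
    (q : PrimeSpectrum R) (q' : PrimeSpectrum R') (h : specMap f q = specMap f' q') :
    ∃ (F : CommAlgCat.{0} ℂ) (g : R ⟶ F) (g' : R' ⟶ F), f ≫ g = f' ≫ g' ∧
      Set.range (specMap g) = {q} ∧ Set.range (specMap g') = {q'} := by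
  let p : Ideal A := q.asIdeal.comap f.hom.toRingHom
  have hp : p = q'.asIdeal.comap f'.hom.toRingHom := congrArg PrimeSpectrum.asIdeal h
  obtain ⟨F, hF, i, j, hij⟩ := exists_common_field
    (Ideal.ResidueField.map p q.asIdeal f.hom.toRingHom rfl)
    (Ideal.ResidueField.map p q'.asIdeal f'.hom.toRingHom hp)
  let k : R →+* F := i.comp (algebraMap R _)
  let k' : R' →+* F := j.comp (algebraMap R' _)
  have hk : ∀ a : A, k (f.hom a) = k' (f'.hom a) := by
    intro a
    have h2 := Ideal.ResidueField.map_algebraMap p q.asIdeal f.hom.toRingHom rfl a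
    have h3 := Ideal.ResidueField.map_algebraMap p q'.asIdeal f'.hom.toRingHom hp a
    change i (algebraMap R _ (f.hom a)) = j (algebraMap R' _ (f'.hom a))
    exact (congrArg i h2).symm.trans ((hij _).trans (congrArg j h3))
  let _ : Algebra ℂ F := (k.comp (algebraMap ℂ R)).toAlgebra
  have range_eq : ∀ {R : CommAlgCat.{0} ℂ} (q : PrimeSpectrum R)
      (i : q.asIdeal.ResidueField →+* F) (k : R →+* F),
      k = i.comp (algebraMap R _) → Set.range (PrimeSpectrum.comap k) = {q} := by
    rintro R q i k rfl
    have h1 : ∀ z : PrimeSpectrum F, PrimeSpectrum.comap (i.comp (algebraMap R _)) z = q := by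
      intro z
      obtain rfl : z = ⊥ := Subsingleton.elim _ _
      ext x
      change i (algebraMap R _ x) ∈ (⊥ : Ideal F) ↔ _
      rw [Ideal.mem_bot, map_eq_zero]
      exact Ideal.algebraMap_residueField_eq_zero
    ext z
    constructor
    · rintro ⟨w, rfl⟩
      exact h1 w
    · rintro rfl
      exact ⟨⊥, h1 ⊥⟩
  refine ⟨CommAlgCat.of ℂ F, CommAlgCat.ofHom { k with commutes' := fun _ => rfl },
    CommAlgCat.ofHom { k' with commutes' := fun c => ?_ }, ?_, range_eq q i k rfl,
    range_eq q' j k' rfl⟩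
  · change k' (algebraMap ℂ R' c) = k (algebraMap ℂ R c)
    rw [← f'.hom.commutes c, ← f.hom.commutes c]
    exact (hk _).symm
  · ext a
    exact hk a

section OpenImmersion

variable {G : GroupFunctor} {X : ActedSpace G} (O : StableSubspace X)

/-- The points of the base of a torsor above which the torsor is mapped to `O`. -/
def goodLocus (y : QuotientObj G X) : Set (PrimeSpectrum y.base) :=
  {z | ∃ (F : CommAlgCat.{0} ℂ) (p : y.P.obj F), Set.range (specMap (y.π p)) = {z} ∧
    y.toX p ∈ O.pts F}

variable {O}

theorem StableSubspace.mem_of_smul_mem {R : CommAlgCat.{0} ℂ} {g : G.obj R} {x : X.X.obj R}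
    (h : X.smul g x ∈ O.pts R) : x ∈ O.pts R := by
  have := O.smul_mem g⁻¹ _ h
  rwa [← X.mul_smul, inv_mul_cancel, X.one_smul] at this

/-- Whether a point of the torsor is mapped to `O` depends only on its image in the base: two points
over the same image differ by an element of `G` over a common field, and `O` is stable under `G`. -/
theorem mem_goodLocus_iff (y : QuotientObj G X) {R : CommAlgCat.{0} ℂ}
    (p : y.P.obj R) {V : TopologicalSpace.Opens (PrimeSpectrum R)}
    (hV : ∀ (S : CommAlgCat.{0} ℂ) (f : R ⟶ S), X.X.map f (y.toX p) ∈ O.pts S ↔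
      Set.range (specMap f) ⊆ V) (q : PrimeSpectrum R) :
    specMap (y.π p) q ∈ goodLocus O y ↔ q ∈ V := by
  constructor
  · rintro ⟨F, p', h1, h2⟩
    obtain ⟨q', hq'⟩ : specMap (y.π p) q ∈ Set.range (specMap (y.π p')) := by
      rw [h1]
      rfl
    obtain ⟨K, g, g', hg, hr, -⟩ := exists_field_point (y.π p) (y.π p') q q' hq'.symm
    have h3 := (hV K g).1 (by
      obtain ⟨k, hk, -⟩ := y.simplyTransitive (y.P.map g p) (y.P.map g' p')
        (by rw [y.π_map, y.π_map, hg])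
      rw [← y.toX_map]
      apply StableSubspace.mem_of_smul_mem (g := k)
      rw [← y.toX_smul, hk, y.toX_map]
      exact O.map_mem g' _ h2)
    rw [hr] at h3
    exact h3 rfl
  · intro hq
    obtain ⟨K, g, -, -, hr, -⟩ := exists_field_point (𝟙 R) (𝟙 R) q q rfl
    refine ⟨K, y.P.map g p, ?_, ?_⟩
    · rw [y.π_map]
      change Set.range (specMap (y.π p) ∘ specMap g) = _
      rw [Set.range_comp, hr, Set.image_singleton]
    · rw [y.toX_map, hV, hr]
      exact Set.singleton_subset_iff.2 hq

/-- Near `z` the torsor has a point over a flat, finitely presented neighbourhood. The locus in that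
neighbourhood is open because `O` is open, and so is its image in the base. -/
theorem isOpen_goodLocus (hO : O.IsOpen) (y : QuotientObj G X) : IsOpen (goodLocus O y) := by
  rw [isOpen_iff_forall_mem_open]
  intro z hz
  obtain ⟨S, hS, hp⟩ := y.locallyNonempty
  obtain ⟨A, f, h1, h2, ⟨x, hx⟩, hA⟩ := near_of_mem hS z
  obtain ⟨p, rfl⟩ := hp A f hA
  obtain ⟨V, hV⟩ := hO A (y.toX p)
  refine ⟨specMap (y.π p) '' V, ?_, isOpenMap_specMap _ h1 h2 _ V.isOpen, x, ?_, hx⟩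
  · rintro _ ⟨q, hq, rfl⟩
    exact (mem_goodLocus_iff y p hV q).2 hq
  · subst hx
    exact (mem_goodLocus_iff y p hV x).1 hz

theorem toX_mem_iff (hO : O.IsOpen) (y : QuotientObj G X) {R : CommAlgCat.{0} ℂ}
    (p : y.P.obj R) : y.toX p ∈ O.pts R ↔ Set.range (specMap (y.π p)) ⊆ goodLocus O y := by
  obtain ⟨V, hV⟩ := hO R (y.toX p)
  have h1 := hV R (𝟙 R)
  rw [types_map_id] at h1
  rw [h1]
  constructor
  · rintro h _ ⟨q, rfl⟩
    exact (mem_goodLocus_iff y p hV q).2 (h ⟨q, rfl⟩)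
  · rintro h _ ⟨q, rfl⟩
    exact (mem_goodLocus_iff y p hV q).1 (h ⟨q, rfl⟩)

/-- The points of a torsor over `B`, where `B` lies over the base of the torsor. -/
def pullbackFunctor (y : QuotientObj G X) {B : CommAlgCat.{0} ℂ} (f : y.base ⟶ B) :
    CommAlgCat.{0} ℂ ⥤ Type 1 where
  obj R := {p : y.P.obj R × (B ⟶ R) // y.π p.1 = f ≫ p.2}
  map g := ↾fun p => ⟨(y.P.map g p.1.1, p.1.2 ≫ g), by rw [y.π_map, p.2, Category.assoc]⟩
  map_id R := by
    refine ConcreteCategory.hom_ext _ _ fun p => ?_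
    exact Subtype.ext (Prod.ext (types_map_id y.P p.1.1) (Category.comp_id p.1.2))
  map_comp g h := by
    refine ConcreteCategory.hom_ext _ _ fun p => ?_
    exact Subtype.ext (Prod.ext (types_map_comp y.P g h p.1.1) (Category.assoc p.1.2 g h).symm)

theorem isFppfSheaf_pullbackFunctor (y : QuotientObj G X) {B : CommAlgCat.{0} ℂ}
    (f : y.base ⟶ B) : IsFppfSheaf (pullbackFunctor y f) := by
  refine (isFppfSheaf_iff _).2 fun R S hS x hx => ?_
  obtain ⟨t, ht, htu⟩ := (isFppfSheaf_iff y.P).1 y.isSheaf R S hS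
    (fun A u hu => (x A u hu).1.1)
    (fun A B u v hu huv => congrArg (fun z => z.1.1) (hx A B u v hu huv))
  obtain ⟨h, hh, hhu⟩ := (isFppfSheaf_iff _).1 (isFppfSheaf_coyoneda B) R S hS
    (fun A u hu => (x A u hu).1.2)
    (fun A B u v hu huv => congrArg (fun z => z.1.2) (hx A B u v hu huv))
  refine ⟨⟨(t, h), ?_⟩, fun A u hu => Subtype.ext (Prod.ext (ht A u hu) (hh A u hu)),
    fun t' ht' => Subtype.ext (Prod.ext (htu _ fun A u hu => congrArg (fun z => z.1.1)
      (ht' A u hu)) (hhu _ fun A u hu => congrArg (fun z => z.1.2) (ht' A u hu)))⟩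
  refine hom_ext_of_mem hS fun A u hu => ?_
  have h1 : h ≫ u = (x A u hu).1.2 := hh A u hu
  change y.π t ≫ u = (f ≫ h) ≫ u
  rw [← y.π_map, ht A u hu, (x A u hu).2, Category.assoc, h1]

theorem toX_mem_of_pullback (hO : O.IsOpen) (y : QuotientObj G X) {B : CommAlgCat.{0} ℂ}
    (f : y.base ⟶ B) (hf : Set.range (specMap f) ⊆ goodLocus O y) {R : CommAlgCat.{0} ℂ}
    (p : (pullbackFunctor y f).obj R) : y.toX p.1.1 ∈ O.pts R := by
  refine (toX_mem_iff hO y _).2 ?_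
  rw [p.2]
  rintro _ ⟨q, rfl⟩
  exact hf ⟨specMap p.1.2 q, rfl⟩

/-- The pullback of a torsor along a morphism to the locus where it is mapped to `O`. -/
def pullbackObj (hO : O.IsOpen) (y : QuotientObj G X) {B : CommAlgCat.{0} ℂ} (f : y.base ⟶ B)
    (hf : Set.range (specMap f) ⊆ goodLocus O y) : QuotientObj G O.toActedSpace where
  base := B
  P := pullbackFunctor y f
  isSheaf := isFppfSheaf_pullbackFunctor y f
  π p := p.1.2
  π_map _ _ := rfl
  smul g p := ⟨(y.smul g p.1.1, p.1.2), (y.π_smul _ _).trans p.2⟩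
  one_smul p := Subtype.ext (Prod.ext (y.one_smul _) rfl)
  mul_smul g h p := Subtype.ext (Prod.ext (y.mul_smul _ _ _) rfl)
  map_smul u g p := Subtype.ext (Prod.ext (y.map_smul _ _ _) rfl)
  π_smul _ _ := rfl
  simplyTransitive p q h := by
    obtain ⟨g, hg, hu⟩ := y.simplyTransitive p.1.1 q.1.1
      (p.2.trans ((congrArg (f ≫ ·) h).trans q.2.symm))
    exact ⟨g, Subtype.ext (Prod.ext hg h), fun g' hg' => hu g' (congrArg (fun z => z.1.1) hg')⟩
  locallyNonempty := by
    obtain ⟨S, hS, h⟩ := y.exists_covering f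
    refine ⟨S, hS, fun R g hg => ?_⟩
    obtain ⟨p, hp⟩ := h R g hg
    exact ⟨⟨(p, g), hp⟩, rfl⟩
  toX p := ⟨y.toX p.1.1, toX_mem_of_pullback hO y f hf p⟩
  toX_map u p := Subtype.ext (y.toX_map u p.1.1)
  toX_smul g p := Subtype.ext (y.toX_smul g p.1.1)

theorem isHomLift_base {a b : QuotientObj G X} {B : CommAlgCat.{0} ℂ} (f : b.base ⟶ B)
    (u : a ⟶ b) (h : (quotientStack G X).p.IsHomLift f.op u) :
    ∃ h : B = a.base, QuotientObj.Hom.base u = f ≫ eqToHom h := by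
  have h1 : op a.base = op B := by
    have := h
    exact IsHomLift.domain_eq (quotientStack G X).p f.op u
  obtain rfl : a.base = B := congrArg unop h1
  have h2 : (QuotientObj.Hom.base u).op = eqToHom rfl ≫ f.op ≫ eqToHom rfl := by
    have := h
    exact IsHomLift.fac' (quotientStack G X).p f.op u
  refine ⟨rfl, ?_⟩
  rw [eqToHom_refl, eqToHom_refl, Category.id_comp, Category.comp_id] at h2
  rw [eqToHom_refl, Category.comp_id]
  exact congrArg Quiver.Hom.unop h2

/-- A morphism between the images in `[G \ X]` of two torsors mapped to `O`. -/
def liftHom {a b : QuotientObj G O.toActedSpace}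
    (v : (QuotientObj.push O.incl).obj a ⟶ (QuotientObj.push O.incl).obj b) :
    a ⟶ b :=
  let w : QuotientObj.Hom ((QuotientObj.push O.incl).obj a) ((QuotientObj.push O.incl).obj b) := v
  show QuotientObj.Hom a b from
  { base := w.base
    app := w.app
    naturality := w.naturality
    π_app := w.π_app
    app_smul := w.app_smul
    toX_app := fun p => Subtype.ext (w.toX_app p) }

/-- The fibre product with a torsor `y` is represented by its good locus: above that locus the
pulled back torsor is mapped to `O`, and nowhere else. Existence and uniqueness of the isomorphism
hold because all morphisms of a quotient stack are cartesian. -/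
theorem isOpenImmersion_quotientStackMap (hO : O.IsOpen) :
    IsOpenImmersionOfStacks (quotientStackMap O.incl) := by
  intro (y : QuotientObj G X)
  refine ⟨⟨goodLocus O y, isOpen_goodLocus hO y⟩, fun B (f : y.base ⟶ B) => ⟨⟨?_, fun hf => ?_⟩, ?_⟩⟩
  · rintro ⟨(x : QuotientObj G O.toActedSpace), (u : (QuotientObj.push O.incl).obj x ⟶ y), hu⟩
    obtain ⟨h1, h2⟩ := isHomLift_base f u hu
    obtain rfl : B = x.base := h1
    replace h2 : QuotientObj.Hom.base u = f := h2.trans (Category.comp_id f)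
    rintro _ ⟨z, rfl⟩
    -- Membership in the locus is tested on a neighbourhood of `z` over which `x` has a point; the
    -- image of that point in `X` lies in `O`.
    obtain ⟨S, hS, hp⟩ := x.locallyNonempty
    obtain ⟨A, g, -, -, ⟨q, rfl⟩, hA⟩ := near_of_mem hS z
    obtain ⟨p, rfl⟩ := hp A g hA
    have h3 : y.toX (QuotientObj.Hom.app u A p) ∈ O.pts A := by
      have h5 : y.toX (QuotientObj.Hom.app u A p) = (x.toX p).1 := QuotientObj.Hom.toX_app u p
      rw [h5]
      exact (x.toX p).2
    have h4 := (toX_mem_iff hO y _).1 h3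
    have h5 : y.π (QuotientObj.Hom.app u A p) = f ≫ x.π p :=
      (QuotientObj.Hom.π_app u p).trans (congrArg (· ≫ x.π p) h2)
    rw [h5] at h4
    exact h4 ⟨q, rfl⟩
  · let u : QuotientObj.Hom ((QuotientObj.push O.incl).obj (pullbackObj hO y f hf)) y :=
      { base := f
        app := fun _ p => p.1.1
        naturality := fun _ _ => rfl
        π_app := fun p => p.2
        app_smul := fun _ _ => rfl
        toX_app := fun _ => rfl }
    exact ⟨pullbackObj hO y f hf, u, IsHomLift.map (QuotientObj.proj G X)
      (a := (QuotientObj.push O.incl).obj (pullbackObj hO y f hf)) (b := y) u⟩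
  · intro (x : QuotientObj G O.toActedSpace) (x' : QuotientObj G O.toActedSpace)
      (u : (QuotientObj.push O.incl).obj x ⟶ y) (u' : (QuotientObj.push O.incl).obj x' ⟶ y) hu hu'
    obtain ⟨h1, h2⟩ := isHomLift_base f u hu
    obtain ⟨h1', h2'⟩ := isHomLift_base f u' hu'
    have hw : QuotientObj.Hom.base u' ≫ eqToHom (h1'.symm.trans h1) = QuotientObj.Hom.base u := by
      rw [h2, h2', Category.assoc, eqToHom_trans]
    obtain ⟨v, ⟨hv1, hv2⟩, hv3⟩ := QuotientObj.existsUnique_lift u u' _ hw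
    let v' : x ⟶ x' := liftHom v
    have hb : QuotientObj.Hom.base v' = eqToHom (h1'.symm.trans h1) := hv1
    have : IsIso (QuotientObj.Hom.base v') := by
      rw [hb]
      exact (inferInstance : IsIso (eqToHom (show x'.base = x.base from h1'.symm.trans h1)))
    have : IsIso v' := QuotientObj.isIso_of_isIso_base v'
    let ε₀ : x ≅ x' := asIso v'
    refine ⟨ε₀, ⟨?_, hv2⟩, fun ε hε => ?_⟩
    · refine IsHomLift.of_fac (QuotientObj.proj G O.toActedSpace) (𝟙 (op B)) v'
        (congrArg op h1.symm) (congrArg op h1'.symm) ?_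
      change 𝟙 (op B) = eqToHom _ ≫ (QuotientObj.Hom.base v').op ≫ eqToHom _
      rw [hb]
      have key : ∀ (A A' : CommAlgCat.{0} ℂ) (h : B = A) (h' : B = A'),
          𝟙 (op B) = eqToHom (congrArg op h) ≫ (eqToHom (h'.symm.trans h)).op ≫
            eqToHom (congrArg op h'.symm) := by
        rintro _ _ rfl rfl
        simp
      exact key _ _ h1 h1'
    · apply Iso.ext
      have h3 : (quotientStack G O.toActedSpace).p.IsHomLift (𝟙 (op B)) ε.hom := hε.1
      have h4 : QuotientObj.Hom.base ε.hom = eqToHom (h1'.symm.trans h1) := by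
        have h5 := IsHomLift.fac' (quotientStack G O.toActedSpace).p (𝟙 (op B)) ε.hom
        have h6 := congrArg Quiver.Hom.unop h5
        rw [Category.id_comp, eqToHom_trans, eqToHom_unop] at h6
        exact h6
      have h7 : (QuotientObj.push O.incl).map ε.hom = v := hv3 _ ⟨h4, hε.2⟩
      refine QuotientObj.hom_ext (h4.trans hb.symm) fun R p => ?_
      exact congrArg (fun w : (QuotientObj.push O.incl).obj x ⟶ (QuotientObj.push O.incl).obj x' =>
        QuotientObj.Hom.app w R p) h7

end OpenImmersion

/-! ### Rectangular identity matrices and ranks -/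

/-- The rectangular identity matrix. -/
def stdMat (R : Type*) [Zero R] [One R] (m n : ℕ) : Matrix (Fin m) (Fin n) R :=
  Matrix.of fun a b => if a.1 = b.1 then 1 else 0

section stdMat

variable {R S : Type*} [CommRing R] [CommRing S] {m n k : ℕ}

theorem stdMat_apply (a : Fin m) (b : Fin n) :
    stdMat R m n a b = if a.1 = b.1 then 1 else 0 := rfl

theorem stdMat_map (f : R →+* S) : (stdMat R m n).map f = stdMat S m n := by
  ext a b
  simp [stdMat_apply, apply_ite f]

theorem stdMat_transpose : (stdMat R m n).transpose = stdMat R n m := by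
  ext a b
  simp [stdMat_apply, eq_comm]

theorem stdMat_self : stdMat R n n = 1 := by
  ext a b
  simp [stdMat_apply, Matrix.one_apply, Fin.ext_iff]

theorem mul_stdMat_apply {p : Type*} (M : Matrix p (Fin n) R) (a : p) (b : Fin m) :
    (M * stdMat R n m) a b = if h : b.1 < n then M a ⟨b, h⟩ else 0 := by
  rw [Matrix.mul_apply]
  split_ifs with h
  · rw [Finset.sum_eq_single ⟨b.1, h⟩]
    · simp [stdMat_apply]
    · intro c _ hc
      rw [stdMat_apply, if_neg fun h' => hc (Fin.ext h'), mul_zero]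
    · simp
  · refine Finset.sum_eq_zero fun c _ => ?_
    rw [stdMat_apply, if_neg (fun h' => h (by rw [← h']; exact c.2)), mul_zero]

theorem stdMat_mul_apply {p : Type*} (M : Matrix (Fin n) p R) (a : Fin m) (b : p) :
    (stdMat R m n * M) a b = if h : a.1 < n then M ⟨a, h⟩ b else 0 := by
  have := mul_stdMat_apply (m := m) M.transpose b a
  rw [← stdMat_transpose, ← Matrix.transpose_mul] at this
  exact this

/-- The product truncates the diagonal after `n` entries, which is invisible as soon as one of the
outer sizes is at most `n`. -/
theorem stdMat_mul_stdMat (h : k ≤ n ∨ m ≤ n) :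
    stdMat R m n * stdMat R n k = stdMat R m k := by
  ext a b
  rw [mul_stdMat_apply]
  split_ifs with hb
  · rfl
  · rw [stdMat_apply, if_neg]
    omega

theorem stdMat_mul_stdMat_self (h : n ≤ m) : stdMat R n m * stdMat R m n = 1 := by
  rw [stdMat_mul_stdMat (Or.inl h), stdMat_self]

end stdMat

theorem rank_stdMat (K : Type*) [Field K] (m n : ℕ) : (stdMat K m n).rank = min n m := by
  apply le_antisymm (le_min (Matrix.rank_le_width _) (Matrix.rank_le_height _))
  rcases le_total n m with h | h
  · rw [min_eq_left h]
    calc n = (stdMat K n m * stdMat K m n).rank := by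
          rw [stdMat_mul_stdMat_self h, Matrix.rank_one, Fintype.card_fin]
      _ ≤ _ := Matrix.rank_mul_le_right _ _
  · rw [min_eq_right h]
    calc m = (stdMat K m n * stdMat K n m).rank := by
          rw [stdMat_mul_stdMat_self h, Matrix.rank_one, Fintype.card_fin]
      _ ≤ _ := Matrix.rank_mul_le_left _ _

/-- By Gaussian elimination the matrix is diagonal up to products of transvections. These stay
invertible over the extension, and the number of non-zero diagonal entries does not change. -/
theorem rank_map_square {K L : Type*} [Field K] [Field L] (i : K →+* L) {n : ℕ}
    (M : Matrix (Fin n) (Fin n) K) : (M.map i).rank = M.rank := by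
  classical
  obtain ⟨l, l', D, h⟩ := Matrix.Pivot.exists_list_transvec_mul_diagonal_mul_list_transvec M
  have hU : ∀ l : List (Matrix.TransvectionStruct (Fin n) K),
      IsUnit (l.map Matrix.TransvectionStruct.toMatrix).prod.det := fun l => by simp
  have hU' : ∀ A : Matrix (Fin n) (Fin n) K, IsUnit A.det → IsUnit (A.map i).det := fun A hA => by
    have := hA.map i
    rwa [RingHom.map_det] at this
  have hd : (Matrix.diagonal D).map i = Matrix.diagonal fun x => i (D x) := by
    simp [Matrix.diagonal_map]
  rw [h, Matrix.map_mul, Matrix.map_mul, Matrix.rank_mul_eq_left_of_isUnit_det _ _ (hU l'),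
    Matrix.rank_mul_eq_right_of_isUnit_det _ _ (hU l),
    Matrix.rank_mul_eq_left_of_isUnit_det _ _ (hU' _ (hU l')),
    Matrix.rank_mul_eq_right_of_isUnit_det _ _ (hU' _ (hU l)), hd, Matrix.rank_diagonal,
    Matrix.rank_diagonal]
  simp

/-- Padding with zero columns to a square matrix can be undone. It serves to deduce invariance of
rank under field extension from the square case. -/
theorem rank_mul_stdMat {K : Type*} [Field K] {m n : ℕ} (h : n ≤ m)
    (A : Matrix (Fin m) (Fin n) K) : (A * stdMat K n m).rank = A.rank := by
  apply le_antisymm (Matrix.rank_mul_le_left _ _)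
  calc A.rank = (A * stdMat K n m * stdMat K m n).rank := by
        rw [Matrix.mul_assoc, stdMat_mul_stdMat_self h, Matrix.mul_one]
    _ ≤ _ := Matrix.rank_mul_le_left _ _

theorem rank_stdMat_mul {K : Type*} [Field K] {m n : ℕ} (h : m ≤ n)
    (A : Matrix (Fin m) (Fin n) K) : (stdMat K n m * A).rank = A.rank := by
  apply le_antisymm (Matrix.rank_mul_le_right _ _)
  calc A.rank = (stdMat K m n * (stdMat K n m * A)).rank := by
        rw [← Matrix.mul_assoc, stdMat_mul_stdMat_self h, Matrix.one_mul]
    _ ≤ _ := Matrix.rank_mul_le_right _ _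

/-- The rank of a matrix does not change under a field extension. -/
theorem rank_map_field {K L : Type*} [Field K] [Field L] (i : K →+* L) {m n : ℕ}
    (M : Matrix (Fin m) (Fin n) K) : (M.map i).rank = M.rank := by
  rcases le_total n m with h | h
  · rw [← rank_mul_stdMat h, ← rank_mul_stdMat h M, ← stdMat_map i, ← Matrix.map_mul,
      rank_map_square]
  · rw [← rank_stdMat_mul h, ← rank_stdMat_mul h M, ← stdMat_map i, ← Matrix.map_mul,
      rank_map_square]

/-! ### Completion to invertible matrices -/

/-- A linearly independent family can be extended by elements of given sets with large span. -/
theorem exists_linearIndependent_extension {K V : Type*} [Field K] [AddCommGroup V] [Module K V]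
    [FiniteDimensional K V] (X : ℕ → Set V) {n : ℕ} (w : Fin n → V) (hw : LinearIndependent K w)
    (N : ℕ) (hN : n ≤ N)
    (hX : ∀ b, n ≤ b → b < N → b < Module.finrank K (Submodule.span K (X b))) :
    ∃ v : Fin N → V, LinearIndependent K v ∧ (∀ b : Fin n, v (b.castLE hN) = w b) ∧
      ∀ b : Fin N, n ≤ b.1 → v b ∈ X b := by
  induction N, hN using Nat.le_induction with
  | base => exact ⟨w, hw, fun _ => rfl, fun b hb => absurd b.2 (by omega)⟩
  | succ N hN ih =>
    obtain ⟨v, hv, h1, h2⟩ := ih fun b hb hb' => hX b hb (by omega)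
    -- The first `N` vectors span a space of dimension `N`, too small to contain `X N`.
    have h3 : ∃ x ∈ X N, x ∉ Submodule.span K (Set.range v) := by
      by_contra! h
      have h4 := Submodule.finrank_mono (Submodule.span_le.2 h)
      have h5 := hX N hN (Nat.lt_succ_self N)
      rw [finrank_span_eq_card hv, Fintype.card_fin] at h4
      omega
    obtain ⟨x, hx, hx'⟩ := h3
    refine ⟨Fin.snoc v x, hv.finSnoc hx', fun b => ?_, fun b hb => ?_⟩
    · rw [← h1 b]
      have : b.castLE (by omega) = (b.castLE hN).castSucc := rfl
      rw [this, Fin.snoc_castSucc]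
    · induction b using Fin.lastCases with
      | last => rwa [Fin.snoc_last]
      | cast b =>
        rw [Fin.snoc_castSucc]
        exact h2 b hb

theorem isUnit_det_of_linearIndependent {K : Type*} [Field K] {m : ℕ}
    {M : Matrix (Fin m) (Fin m) K} (h : LinearIndependent K M.col) : M.det ≠ 0 := by
  rw [Matrix.linearIndependent_cols_iff_isUnit, Matrix.isUnit_iff_isUnit_det] at h
  exact h.ne_zero

/-- A matrix of maximal column rank at a point can be completed to a square matrix invertible at
that point. -/
theorem exists_completion {R K : Type*} [CommRing R] [Field K] (f : R →+* K) {m n : ℕ}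
    (hnm : n ≤ m) (M : Matrix (Fin m) (Fin n) R) (hM : (M.map f).rank = n) :
    ∃ h : Matrix (Fin m) (Fin m) R, M = h * stdMat R m n ∧ f h.det ≠ 0 := by
  have hw : LinearIndependent K (M.map f).col := by
    rw [linearIndependent_iff_card_eq_finrank_span, Fintype.card_fin, Set.finrank,
      ← Matrix.rank_eq_finrank_span_cols, hM]
  let X : Set (Fin m → K) := Set.range fun b => (Pi.single b 1 : Fin m → K)
  have hX : Submodule.span K X = ⊤ := by
    have := (Pi.basisFun K (Fin m)).span_eq
    convert this using 2
    ext1 b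
    simp [X]
  obtain ⟨v, hv, h1, h2⟩ := exists_linearIndependent_extension (fun _ => X) _ hw m hnm
    (fun b _ hb => by rw [hX, finrank_top, Module.finrank_fin_fun]; exact hb)
  -- Over the field, the columns are completed by standard basis vectors. These lift to `R`, so that
  -- the first `n` columns can be kept equal to those of `M`.
  have h3 : ∀ b : Fin m, ∃ u : Fin m → R, (fun a => f (u a)) = v b ∧
      ∀ hb : b.1 < n, u = M.col ⟨b, hb⟩ := by
    intro b
    by_cases hb : b.1 < n
    · exact ⟨M.col ⟨b, hb⟩, (h1 ⟨b, hb⟩).symm, fun _ => rfl⟩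
    · obtain ⟨c, hc⟩ := h2 b (not_lt.1 hb)
      refine ⟨Pi.single c 1, ?_, fun h => absurd h hb⟩
      rw [← hc]
      funext a
      simp [Pi.single_apply, apply_ite f]
  choose u hu hu' using h3
  refine ⟨Matrix.of fun a b => u b a, ?_, ?_⟩
  · ext a b
    rw [mul_stdMat_apply, dif_pos (b.2.trans_le hnm), Matrix.of_apply, hu' _ b.2]
    rfl
  · rw [RingHom.map_det]
    apply isUnit_det_of_linearIndependent
    have h4 : (f.mapMatrix (Matrix.of fun a b => u b a)).col = v :=
      funext fun b => hu b
    rwa [h4]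

/-- A matrix of maximal row rank at a point can be completed to a square matrix invertible at
that point. -/
theorem exists_completion_row {R K : Type*} [CommRing R] [Field K] (f : R →+* K) {m n : ℕ}
    (hmn : m ≤ n) (M : Matrix (Fin m) (Fin n) R) (hM : (M.map f).rank = m) :
    ∃ h : Matrix (Fin n) (Fin n) R, M = stdMat R m n * h ∧ f h.det ≠ 0 := by
  obtain ⟨h, h1, h2⟩ := exists_completion f hmn M.transpose (by
    rw [Matrix.transpose_map, Matrix.rank_transpose, hM])
  refine ⟨h.transpose, ?_, by rwa [Matrix.det_transpose]⟩
  rw [← Matrix.transpose_transpose M, h1, Matrix.transpose_mul, stdMat_transpose]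

theorem exists_completion_of_rank {R K : Type*} [CommRing R] [Field K] (f : R →+* K) {m n : ℕ}
    (M : Matrix (Fin m) (Fin n) R) (hM : (M.map f).rank = min n m) :
    ∃ (h : Matrix (Fin m) (Fin m) R) (k : Matrix (Fin n) (Fin n) R),
      M = h * stdMat R m n * k ∧ f (h.det * k.det) ≠ 0 := by
  rcases le_total n m with hnm | hmn
  · obtain ⟨h, h1, h2⟩ := exists_completion f hnm M (by rw [hM, min_eq_left hnm])
    exact ⟨h, 1, by rw [Matrix.mul_one, h1], by rwa [Matrix.det_one, mul_one]⟩
  · obtain ⟨h, h1, h2⟩ := exists_completion_row f hmn M (by rw [hM, min_eq_right hmn])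
    exact ⟨1, h, by rw [Matrix.one_mul, h1], by rwa [Matrix.det_one, one_mul]⟩

theorem rank_of_completion {R K : Type*} [CommRing R] [Field K] (f : R →+* K) {m n : ℕ}
    (h : Matrix (Fin m) (Fin m) R) (k : Matrix (Fin n) (Fin n) R) (hf : f (h.det * k.det) ≠ 0) :
    ((h * stdMat R m n * k).map f).rank = min n m := by
  rw [map_mul] at hf
  have h1 : IsUnit (h.map f).det := by
    have := left_ne_zero_of_mul hf
    rw [RingHom.map_det] at this
    exact this.isUnit
  have h2 : IsUnit (k.map f).det := by
    have := right_ne_zero_of_mul hf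
    rw [RingHom.map_det] at this
    exact this.isUnit
  rw [Matrix.map_mul, Matrix.map_mul, Matrix.rank_mul_eq_left_of_isUnit_det _ _ h2,
    Matrix.rank_mul_eq_right_of_isUnit_det _ _ h1, stdMat_map, rank_stdMat]

/-! ### Sheaf property of linear groups and of the full rank part -/

/-- A non-unit vanishes at some maximal ideal. After a field extension this point lifts to the
covering, where the same element would be zero and a unit. -/
theorem isUnit_of_mem_fppfTopology {R : CommAlgCat.{0} ℂ} {S : Sieve (op R)}
    (hS : S ∈ fppfTopology (op R)) {t : R}
    (h : ∀ (A : CommAlgCat.{0} ℂ) (f : R ⟶ A), S f.op → IsUnit (f.hom t)) : IsUnit t := by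
  by_contra ht
  obtain ⟨m, hm, htm⟩ := exists_max_ideal_of_mem_nonunits ht
  let _ : Field (R ⧸ m) := Ideal.Quotient.field m
  obtain ⟨A, u, L, _, i, g, hu, hx⟩ := exists_field_of_mem hS (Ideal.Quotient.mk m)
  have h1 := (h A u hu).map g
  rw [← hx, Ideal.Quotient.eq_zero_iff_mem.2 htm, map_zero] at h1
  exact not_isUnit_zero h1

/-- A functor that is the product of a family of sheaves is a sheaf. -/
theorem isFppfSheaf_of_proj {X : CommAlgCat.{0} ℂ ⥤ Type u} {I : Type*}
    {Y : I → CommAlgCat.{0} ℂ ⥤ Type u} (hY : ∀ i, IsFppfSheaf (Y i))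
    (pr : ∀ (i : I) (R : CommAlgCat.{0} ℂ), X.obj R → (Y i).obj R)
    (hpr : ∀ (i : I) {R S : CommAlgCat.{0} ℂ} (f : R ⟶ S) (x : X.obj R),
      pr i S (X.map f x) = (Y i).map f (pr i R x))
    (hbij : ∀ (R : CommAlgCat.{0} ℂ) (y : ∀ i, (Y i).obj R), ∃! x, ∀ i, pr i R x = y i) :
    IsFppfSheaf X := by
  refine (isFppfSheaf_iff X).2 fun R S hS x hx => ?_
  have ext : ∀ (A : CommAlgCat.{0} ℂ) (z z' : X.obj A), (∀ i, pr i A z = pr i A z') → z = z' :=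
    fun A z z' h => (hbij A fun i => pr i A z').unique h fun _ => rfl
  choose t ht htu using fun i => (isFppfSheaf_iff (Y i)).1 (hY i) R S hS
    (fun A f hf => pr i A (x A f hf))
    (fun A B f g hf hfg => by rw [← hpr, hx A B f g hf hfg])
  obtain ⟨z, hz, -⟩ := hbij R t
  refine ⟨z, fun A f hf => ext A _ _ fun i => ?_, fun z' hz' => ext R _ _ fun i => ?_⟩
  · rw [hpr, hz]
    exact ht i A f hf
  · rw [hz]
    refine htu i _ fun A f hf => ?_
    rw [← hpr, hz' A f hf]

/-- Matrix entries glue, and invertibility of the determinant is a local condition. -/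
theorem isFppfSheaf_glFunctor (n : ℕ) : IsFppfSheaf (glFunctor n).toTypes := by
  refine isFppfSheaf_of_coordinates (I := Fin n × Fin n)
    (fun A g ab => mat (R := A) g ab.1 ab.2) (fun A B f x ab => rfl)
    (fun A g h hgh => Units.ext (Matrix.ext fun a b => congrFun hgh (a, b))) ?_
  intro R S hS v hv
  let M : Matrix (Fin n) (Fin n) R := Matrix.of fun a b => v (a, b)
  have hM : IsUnit M.det := isUnit_of_mem_fppfTopology hS fun A f hf => by
    obtain ⟨g, hg⟩ := hv A f hf
    have h1 : mat (R := A) g = f.hom.toRingHom.mapMatrix M :=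
      Matrix.ext fun a b => congrFun hg (a, b)
    have h2 : IsUnit (mat (R := A) g) := Units.isUnit _
    rw [h1, Matrix.isUnit_iff_isUnit_det, ← RingHom.map_det] at h2
    exact h2
  obtain ⟨g, hg⟩ := (Matrix.isUnit_iff_isUnit_det M).2 hM
  exact ⟨g, funext fun ab => congrFun (congrFun hg ab.1) ab.2⟩

theorem isFppfSheaf_piGL {ι : Type} (d : ι → ℕ) : IsFppfSheaf (piGL d).toTypes :=
  isFppfSheaf_of_proj (fun i => isFppfSheaf_glFunctor (d i))
    (fun i R g => (piGLProj d i).app R g) (fun _ _ _ _ _ => rfl)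
    (fun _ y => ⟨y, fun _ => rfl, fun _ h => funext h⟩)

theorem isFppfSheaf_prodGroup {G H : GroupFunctor} (hG : IsFppfSheaf G.toTypes)
    (hH : IsFppfSheaf H.toTypes) : IsFppfSheaf (prodGroup G H).toTypes :=
  isFppfSheaf_of_proj (I := Bool) (Y := fun b => if b then G.toTypes else H.toTypes)
    (by rintro (_ | _); exacts [hH, hG])
    (fun b R g => match b with
      | true => (show G.obj R × H.obj R from g).1
      | false => (show G.obj R × H.obj R from g).2)
    (by rintro (_ | _) _ _ _ _ <;> rfl)
    (fun R y => ⟨(show G.obj R × H.obj R from (y true, y false)), by rintro (_ | _) <;> rfl,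
      fun _ h => Prod.ext (h true) (h false)⟩)

theorem isFppfSheaf_prodSpace {G : GroupFunctor} {X Y : ActedSpace G} (hX : IsFppfSheaf X.X)
    (hY : IsFppfSheaf Y.X) : IsFppfSheaf (prodSpace X Y).X :=
  isFppfSheaf_of_proj (I := Bool) (Y := fun b => if b then X.X else Y.X)
    (by rintro (_ | _); exacts [hY, hX])
    (fun b R g => match b with
      | true => (show X.X.obj R × Y.X.obj R from g).1
      | false => (show X.X.obj R × Y.X.obj R from g).2)
    (by rintro (_ | _) _ _ _ _ <;> rfl)
    (fun R y => ⟨(show X.X.obj R × Y.X.obj R from (y true, y false)), by rintro (_ | _) <;> rfl,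
      fun _ h => Prod.ext (h true) (h false)⟩)

theorem isFppfSheaf_isoSpace (n : ℕ) : IsFppfSheaf (isoSpace n n).X := by
  refine isFppfSheaf_of_coordinates (I := Fin n × Fin n)
    (fun A x ab => x.1 ab.1 ab.2) (fun A B f x ab => rfl)
    (fun A g h hgh => Subtype.ext (Matrix.ext fun a b => congrFun hgh (a, b))) ?_
  intro R S hS v hv
  let M : Matrix (Fin n) (Fin n) R := Matrix.of fun a b => v (a, b)
  have hM : IsUnit M.det := isUnit_of_mem_fppfTopology hS fun A f hf => by
    obtain ⟨g, hg⟩ := hv A f hf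
    have h1 : g.1 = f.hom.toRingHom.mapMatrix M := Matrix.ext fun a b => congrFun hg (a, b)
    obtain ⟨y, hy, -⟩ := g.2
    have h2 : IsUnit g.1 := IsUnit.of_mul_eq_one _ hy
    rw [h1, Matrix.isUnit_iff_isUnit_det, ← RingHom.map_det] at h2
    exact h2
  exact ⟨⟨M, M⁻¹, Matrix.mul_nonsing_inv M hM, Matrix.nonsing_inv_mul M hM⟩, rfl⟩

/-- After a field extension every point with values in a field factors through the covering, and the
rank is unchanged by the extension. -/
theorem isFullRank_of_mem_fppfTopology {φ : ℂ → ℕ} {R : CommAlgCat.{0} ℂ} {S : Sieve (op R)}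
    (hS : S ∈ fppfTopology (op R)) (T : QuiverRep φ R)
    (h : ∀ (A : CommAlgCat.{0} ℂ) (f : R ⟶ A), S f.op →
      IsFullRank (R := A) ((voganVariety φ).X.map f T)) : IsFullRank T := by
  intro K _ f i j hij
  obtain ⟨A, u, L, _, e, g, hu, hx⟩ := exists_field_of_mem hS f
  rw [← rank_map_field e, ← h A u hu L g i j hij]
  congr 1
  ext a b
  exact hx _

theorem isFppfSheaf_fullRankPart (φ : ℂ → ℕ) :
    IsFppfSheaf (fullRankPart φ).toActedSpace.X := by
  refine isFppfSheaf_of_coordinates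
    (I := Σ (ij : {ij : ℂ × ℂ // ij.2 = ij.1 + 1}), Fin (φ ij.1.2) × Fin (φ ij.1.1))
    (fun A x s => (show QuiverRep φ A from x.1) s.1.1.1 s.1.1.2 s.1.2 s.2.1 s.2.2)
    (fun A B f x ab => rfl)
    (fun A g h hgh => Subtype.ext (funext fun i => funext fun j => funext fun hij =>
      Matrix.ext fun a b => congrFun hgh ⟨⟨(i, j), hij⟩, (a, b)⟩)) ?_
  intro R S hS v hv
  let T : QuiverRep φ R := fun i j hij => Matrix.of fun a b => v ⟨⟨(i, j), hij⟩, (a, b)⟩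
  refine ⟨⟨T, isFullRank_of_mem_fppfTopology hS T fun A f hf => ?_⟩, rfl⟩
  obtain ⟨x, hx⟩ := hv A f hf
  have h1 : (voganVariety φ).X.map f T = x.1 := funext fun i => funext fun j => funext fun hij =>
      Matrix.ext fun a b => (congrFun hx ⟨⟨(i, j), hij⟩, (a, b)⟩).symm
  rw [h1]
  exact x.2

/-- The set of points at which a matrix has maximal rank. -/
def fullRankLocus {R : Type} [CommRing R] {m n : ℕ} (M : Matrix (Fin m) (Fin n) R) :
    TopologicalSpace.Opens (PrimeSpectrum R) :=
  ⨆ (h : Matrix (Fin m) (Fin m) R) (k : Matrix (Fin n) (Fin n) R)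
    (_ : M = h * stdMat R m n * k), PrimeSpectrum.basicOpen (h.det * k.det)

/-- Completing the matrix at `p` produces a factorization with determinants not vanishing at `p`;
conversely such a factorization has the rank of a rectangular identity. These factorizations play
the role of minors in showing that the locus is open. -/
theorem mem_fullRankLocus {R : Type} [CommRing R] {m n : ℕ} {M : Matrix (Fin m) (Fin n) R}
    {p : PrimeSpectrum R} {K : Type} [Field K] (f : R →+* K) (hp : RingHom.ker f = p.asIdeal) :
    p ∈ fullRankLocus M ↔ (M.map f).rank = min n m := by
  have hmem : ∀ t : R, f t ≠ 0 ↔ t ∉ p.asIdeal := fun t => by rw [← hp, RingHom.mem_ker]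
  simp only [fullRankLocus, TopologicalSpace.Opens.mem_iSup, PrimeSpectrum.mem_basicOpen]
  constructor
  · rintro ⟨h, k, rfl, ht⟩
    exact rank_of_completion f h k ((hmem _).2 ht)
  · intro hM
    obtain ⟨h, k, h1, h2⟩ := exists_completion_of_rank f M hM
    exact ⟨h, k, h1, (hmem _).1 h2⟩

/-- Only arrows leaving the support of `φ` impose a condition, so the locus is a finite intersection
of open sets. -/
theorem isOpen_fullRankPart {φ : ℂ → ℕ} (hφ : φ.support.Finite) : (fullRankPart φ).IsOpen := by
  intro R (T : QuiverRep φ R)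
  refine ⟨⟨⋂ i ∈ φ.support, fullRankLocus (T i (i + 1) rfl),
    hφ.isOpen_biInter fun i _ => (fullRankLocus _).isOpen⟩, fun S f => ?_⟩
  change IsFullRank (R := S) ((voganVariety φ).X.map f T) ↔ _
  constructor
  · rintro h _ ⟨q, rfl⟩
    refine Set.mem_iInter₂.2 fun i _ => ?_
    have h1 := h q.asIdeal.ResidueField (algebraMap S q.asIdeal.ResidueField) i _ rfl
    refine (mem_fullRankLocus ((algebraMap S q.asIdeal.ResidueField).comp f.hom.toRingHom) ?_).2 h1
    rw [← RingHom.comap_ker, Ideal.ker_algebraMap_residueField]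
    rfl
  · intro h K _ g i j hij
    subst hij
    by_cases hi : i ∈ φ.support
    · have h1 := Set.mem_iInter₂.1 (h ⟨PrimeSpectrum.comap g ⊥, rfl⟩) i hi
      exact (mem_fullRankLocus (g.comp f.hom.toRingHom) (by
        rw [← RingHom.comap_ker]
        rfl)).1 h1
    · have h1 : φ i = 0 := Function.notMem_support.1 hi
      have h2 : min (φ i) (φ (i + 1)) = 0 := by omega
      exact (Nat.le_zero.1 ((Matrix.rank_le_width _).trans h1.le)).trans h2.symm

/-! ### Parabolic subgroups of block triangular matrices -/

theorem isIso_of_bijective {G H : GroupFunctor} (ρ : G ⟶ H)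
    (h : ∀ R, Function.Bijective (ρ.app R)) : IsIso ρ := by
  have : ∀ R, IsIso (ρ.app R) := fun R => (ConcreteCategory.isIso_iff_bijective (ρ.app R)).2 (h R)
  exact NatIso.isIso_of_isIso_app ρ

section BlockDiagonal

variable {R : Type*} [CommRing R] {n : ℕ} {ι : Type} [LinearOrder ι] (blk : Fin n → ι)

/-- The block diagonal part of a matrix. -/
def diagPart (M : Matrix (Fin n) (Fin n) R) : Matrix (Fin n) (Fin n) R :=
  Matrix.of fun a b => if blk a = blk b then M a b else 0

variable {blk}

theorem diagPart_apply (M : Matrix (Fin n) (Fin n) R) (a b : Fin n) :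
    diagPart blk M a b = if blk a = blk b then M a b else 0 := rfl

theorem diagPart_one : diagPart blk (1 : Matrix (Fin n) (Fin n) R) = 1 := by
  ext a b
  rw [diagPart_apply]
  split_ifs with h
  · rfl
  · rw [Matrix.one_apply_ne]
    rintro rfl
    exact h rfl

theorem diagPart_sub (M N : Matrix (Fin n) (Fin n) R) :
    diagPart blk (M - N) = diagPart blk M - diagPart blk N := by
  ext a b
  simp only [diagPart_apply, Matrix.sub_apply]
  split_ifs <;> simp

/-- In an entry inside a diagonal block, a summation index from another block makes one of the two
factors an entry below the block diagonal. This multiplicativity is the source of the Levi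
decomposition. -/
theorem diagPart_mul {M N : Matrix (Fin n) (Fin n) R} (hM : M.BlockTriangular blk)
    (hN : N.BlockTriangular blk) : diagPart blk (M * N) = diagPart blk M * diagPart blk N := by
  ext a b
  simp only [diagPart_apply, Matrix.mul_apply]
  split_ifs with h
  · refine Finset.sum_congr rfl fun c _ => ?_
    rcases lt_trichotomy (blk a) (blk c) with h1 | h1 | h1
    · rw [hN (i := c) (j := b) (h ▸ h1), mul_zero, if_neg h1.ne, zero_mul]
    · rw [if_pos h1, if_pos (h1.symm.trans h)]
    · rw [hM (i := a) (j := c) h1, zero_mul, if_neg h1.ne', zero_mul]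
  · refine (Finset.sum_eq_zero fun c _ => ?_).symm
    split_ifs with h1 h2
    · exact absurd (h1.trans h2) h
    all_goals simp

theorem diagPart_eq_self {M : Matrix (Fin n) (Fin n) R} (h : ∀ a b, blk a ≠ blk b → M a b = 0) :
    diagPart blk M = M := by
  ext a b
  rw [diagPart_apply]
  split_ifs with h1
  · rfl
  · exact (h a b h1).symm

theorem blockTriangular_pow {M : Matrix (Fin n) (Fin n) R} (hM : M.BlockTriangular blk) (k : ℕ) :
    (M ^ k).BlockTriangular blk ∧ diagPart blk (M ^ k) = diagPart blk M ^ k := by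
  induction k with
  | zero => exact ⟨by rw [pow_zero]; exact Matrix.blockTriangular_one, by simp [diagPart_one]⟩
  | succ k ih => exact ⟨by rw [pow_succ]; exact ih.1.mul hM,
      by rw [pow_succ, diagPart_mul ih.1 hM, ih.2, pow_succ]⟩

/-- Let `r a` count the indices in blocks before that of `a`. A non-zero entry of `M` strictly
increases `r`, so one of `M ^ k` increases it by at least `k`, whereas `r < n`. -/
theorem isNilpotent_of_diagPart_eq_zero {M : Matrix (Fin n) (Fin n) R}
    (hM : M.BlockTriangular blk) (h : diagPart blk M = 0) : IsNilpotent M := by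
  let r : Fin n → ℕ := fun a => (Finset.univ.filter fun b => blk b < blk a).card
  have hr : ∀ a b, blk a < blk b → r a < r b := fun a b hab => Finset.card_lt_card (by
    refine ⟨fun c hc => ?_, fun hc => ?_⟩
    · simp only [Finset.mem_filter, Finset.mem_univ, true_and] at hc ⊢
      exact hc.trans hab
    · have := hc (Finset.mem_filter.2 ⟨Finset.mem_univ a, hab⟩)
      simp at this)
  have hn : ∀ a, r a < n := fun a => by
    have : r a < (Finset.univ : Finset (Fin n)).card := Finset.card_lt_card (by
      refine ⟨Finset.subset_univ _, fun hc => ?_⟩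
      have := hc (Finset.mem_univ a)
      simp at this)
    rwa [Finset.card_univ, Fintype.card_fin] at this
  have hM0 : ∀ a b, r b < r a + 1 → M a b = 0 := fun a b hab => by
    rcases lt_trichotomy (blk a) (blk b) with h1 | h1 | h1
    · have := hr a b h1
      omega
    · have := congrFun (congrFun h a) b
      rwa [diagPart_apply, if_pos h1] at this
    · exact hM h1
  have key : ∀ k a b, r b < r a + k → (M ^ k) a b = 0 := by
    intro k
    induction k with
    | zero =>
      intro a b hab
      rw [pow_zero, Matrix.one_apply_ne]
      rintro rfl
      omega
    | succ k ih =>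
      intro a b hab
      rw [pow_succ, Matrix.mul_apply]
      refine Finset.sum_eq_zero fun c _ => ?_
      rcases lt_or_ge (r c) (r a + k) with h1 | h1
      · rw [ih a c h1, zero_mul]
      · rw [hM0 c b (by omega), mul_zero]
  exact ⟨n, Matrix.ext fun a b => key n a b (by have := hn b; omega)⟩

end BlockDiagonal

namespace SubgroupFunctor

variable {n : ℕ}

/-- Each block group below is obtained by prescribing constant values for some of the entries. -/
theorem isClosed_of_entries {H : SubgroupFunctor (glFunctor n)} (S : Set (Fin n × Fin n))
    (K : Matrix (Fin n) (Fin n) ℂ) (h : ∀ (R : CommAlgCat.{0} ℂ) (g : (glFunctor n).obj R),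
      g ∈ H.pts R ↔ ∀ ab ∈ S, mat g ab.1 ab.2 = algebraMap ℂ R (K ab.1 ab.2)) : H.IsClosed := by
  refine ⟨(fun ab => MvPolynomial.X ab - MvPolynomial.C (K ab.1 ab.2)) '' S, fun R g => ?_⟩
  rw [h]
  rw [Set.forall_mem_image]
  refine forall₂_congr fun ab _ => ?_
  rw [map_sub, MvPolynomial.aeval_X, MvPolynomial.aeval_C, sub_eq_zero]

/-! ### Block triangular groups, their unipotent radicals and Levi subgroups. -/

section Block

variable {ι : Type} [LinearOrder ι] (blk : Fin n → ι)

/-- The group of invertible block triangular matrices. -/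
def blockTriangular : SubgroupFunctor (glFunctor n) where
  pts R :=
    { carrier := {g | (mat g).BlockTriangular blk}
      mul_mem' := fun {g h} hg hh => by
        change (mat (g * h)).BlockTriangular blk
        rw [mat_mul]
        exact Matrix.BlockTriangular.mul hg hh
      one_mem' := Matrix.blockTriangular_one
      inv_mem' := fun {g} hg => by
        have h1 : mat g⁻¹ = (mat g)⁻¹ := by
          rw [Matrix.inv_eq_right_inv (mat_mul_mat_inv g)]
        let _ : Invertible (mat g) := ⟨mat g⁻¹, mat_inv_mul_mat g, mat_mul_mat_inv g⟩
        change (mat g⁻¹).BlockTriangular blk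
        rw [h1]
        exact Matrix.blockTriangular_inv_of_blockTriangular hg }
  map_mem f g hg i j hij := by
    rw [mat_map, Matrix.map_apply, hg hij, map_zero]

/-- The group of invertible block diagonal matrices. -/
def blockDiagonal : SubgroupFunctor (glFunctor n) where
  pts R := (blockTriangular blk).pts R ⊓ (blockTriangular (OrderDual.toDual ∘ blk)).pts R
  map_mem f g hg := ⟨map_mem _ f g hg.1, map_mem _ f g hg.2⟩

/-- The group of block triangular matrices with trivial block diagonal part. -/
def blockUnipotent : SubgroupFunctor (glFunctor n) where
  pts R :=
    { carrier := {g | g ∈ (blockTriangular blk).pts R ∧ diagPart blk (mat g) = 1}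
      mul_mem' := fun {g h} hg hh => ⟨mul_mem hg.1 hh.1, by
        rw [mat_mul, diagPart_mul hg.1 hh.1, hg.2, hh.2, Matrix.one_mul]⟩
      one_mem' := ⟨one_mem _, diagPart_one⟩
      inv_mem' := fun {g} hg => ⟨inv_mem hg.1, by
        have h1 := diagPart_mul (inv_mem hg.1) hg.1
        rw [mat_inv_mul_mat, diagPart_one, hg.2, Matrix.mul_one] at h1
        exact h1.symm⟩ }
  map_mem f g hg := ⟨map_mem _ f g hg.1, by
    ext a b
    have h1 := congrArg f.hom (congrFun (congrFun hg.2 a) b)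
    rw [diagPart_apply] at h1 ⊢
    rw [mat_map, Matrix.map_apply]
    rw [apply_ite f.hom, map_zero] at h1
    rw [h1, Matrix.one_apply, Matrix.one_apply, apply_ite f.hom, map_one, map_zero]⟩

variable {blk}

theorem mem_blockDiagonal {R : CommAlgCat.{0} ℂ} {g : (glFunctor n).obj R} :
    g ∈ (blockDiagonal blk).pts R ↔ ∀ a b, blk a ≠ blk b → mat g a b = 0 := by
  constructor
  · rintro ⟨h1, h2⟩ a b hab
    rcases lt_or_gt_of_ne hab with h | h
    · exact h2 h
    · exact h1 h
  · intro h
    exact ⟨fun a b hab => h a b (ne_of_gt hab), fun a b hab => h a b (ne_of_lt hab)⟩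

theorem blockDiagonal_toDual : blockDiagonal (OrderDual.toDual ∘ blk) = blockDiagonal blk := by
  ext R g
  rw [mem_blockDiagonal, mem_blockDiagonal]
  rfl

theorem isClosed_blockTriangular : (blockTriangular blk).IsClosed :=
  isClosed_of_entries {ab | blk ab.2 < blk ab.1} 0 fun _ _ =>
    ⟨fun h _ hab => (h hab).trans (map_zero _).symm,
      fun h a b hab => (h (a, b) hab).trans (map_zero _)⟩

theorem isClosed_blockDiagonal : (blockDiagonal blk).IsClosed :=
  isClosed_of_entries {ab | blk ab.1 ≠ blk ab.2} 0 fun R g => by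
    rw [mem_blockDiagonal]
    exact ⟨fun h ab hab => (h ab.1 ab.2 hab).trans (map_zero _).symm,
      fun h a b hab => (h (a, b) hab).trans (map_zero _)⟩

theorem isClosed_blockUnipotent : (blockUnipotent blk).IsClosed :=
  isClosed_of_entries {ab | blk ab.2 ≤ blk ab.1} 1 fun R g => by
    have h1 : ∀ a b : Fin n, algebraMap ℂ R ((1 : Matrix (Fin n) (Fin n) ℂ) a b) =
        (1 : Matrix (Fin n) (Fin n) R) a b := fun a b => by
      rw [Matrix.one_apply, Matrix.one_apply, apply_ite (algebraMap ℂ R), map_one, map_zero]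
    simp only [h1]
    constructor
    · rintro ⟨h2, h3⟩ ⟨a, b⟩ hab
      rcases lt_or_eq_of_le hab with h4 | h4
      · rw [h2 h4, Matrix.one_apply_ne]
        exact fun h => h4.ne' (congrArg blk h)
      · have := congrFun (congrFun h3 a) b
        rwa [diagPart_apply, if_pos h4.symm] at this
    · intro h
      refine ⟨fun a b hab => ?_, ?_⟩
      · rw [h (a, b) hab.le, Matrix.one_apply_ne]
        exact fun h => hab.ne' (congrArg blk h)
      · ext a b
        rw [diagPart_apply]
        split_ifs with h2
        · exact h (a, b) h2.ge
        · rw [Matrix.one_apply_ne]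
          rintro rfl
          exact h2 rfl

theorem trace_of_isNilpotent_sub_one {u : Matrix (Fin n) (Fin n) ℂ} (h : IsNilpotent (u - 1)) :
    u.trace = n := by
  have h1 := (Matrix.isNilpotent_trace_of_isNilpotent h).eq_zero
  rw [Matrix.trace_sub, Matrix.trace_one, Fintype.card_fin, sub_eq_zero] at h1
  exact h1

/-- Normality and unipotence follow from multiplicativity of the block diagonal part. For
maximality, a normal subgroup of unipotent elements has no off-diagonal entries in the diagonal
blocks by a trace argument, and nilpotence then makes its diagonal entries equal to one. -/
theorem isUnipotentRadical_blockUnipotent :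
    IsUnipotentRadical (blockTriangular blk) (blockUnipotent blk) where
  isClosed := isClosed_blockUnipotent
  le R g hg := hg.1
  normal R g hg u hu := ⟨mul_mem (mul_mem hg hu.1) (inv_mem hg), by
    rw [mat_mul, diagPart_mul (mul_mem hg hu.1) (inv_mem hg), mat_mul, diagPart_mul hg hu.1, hu.2,
      Matrix.mul_one, ← diagPart_mul hg (inv_mem hg), mat_mul_mat_inv, diagPart_one]⟩
  unipotent u hu := by
    refine isNilpotent_of_diagPart_eq_zero (blk := blk)
      (Matrix.BlockTriangular.sub hu.1 Matrix.blockTriangular_one) ?_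
    rw [diagPart_sub, diagPart_one, hu.2, sub_self]
  maximal N hN hnorm hnil u hu := by
    -- For the elementary matrix `e` in position `(a, b)` and `g = 1 + e`, the elements `g u g⁻¹ u`
    -- and `u u` both belong to `N`, so both have trace `n`. Their traces differ by the square of
    -- the entry of `u` in position `(b, a)`.
    have hoff : ∀ a b, blk a = blk b → a ≠ b → mat u b a = 0 := by
      intro a b hab hne
      let e : Matrix (Fin n) (Fin n) ℂ := Matrix.single a b 1
      have he : e * e = 0 := by
        simp [e, Matrix.single_mul_single_of_ne _ _ _ _ hne.symm]
      let g : (glFunctor n).obj complexPoint :=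
        (⟨1 + e, 1 - e, by
          rw [mul_sub, add_mul, mul_one, add_mul, one_mul, he]; simp, by
          rw [mul_add, sub_mul, mul_one, sub_mul, one_mul, he]; simp⟩ : GL (Fin n) ℂ)
      have hg : g ∈ (blockTriangular blk).pts complexPoint := by
        intro i j hij
        change (1 + e) i j = 0
        rw [Matrix.add_apply, Matrix.one_apply_ne (by rintro rfl; exact lt_irrefl _ hij), zero_add]
        refine Matrix.single_apply_of_ne _ _ _ _ _ ?_
        rintro ⟨rfl, rfl⟩
        exact hij.ne hab.symm
      have h1 := trace_of_isNilpotent_sub_one (hnil _ (mul_mem (hnorm g hg u hu) hu))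
      have h2 := trace_of_isNilpotent_sub_one (hnil _ (mul_mem hu hu))
      simp only [mat_mul] at h1 h2
      change ((1 + e) * mat u * (1 - e) * mat u).trace = n at h1
      have h3 : (1 + e) * mat u * (1 - e) * mat u = mat u * mat u + e * (mat u * mat u) -
          mat u * e * mat u - e * mat u * e * mat u := by noncomm_ring
      have h4 : (e * (mat u * mat u)).trace = (mat u * e * mat u).trace := by
        rw [Matrix.trace_mul_comm, Matrix.mul_assoc (mat u) e, Matrix.trace_mul_comm (mat u),
          Matrix.trace_mul_comm, Matrix.mul_assoc]
      have h5 : (e * mat u * e * mat u).trace = mat u b a * mat u b a := by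
        have h6 : e * mat u * e = Matrix.single a b (mat u b a) := by
          simp [e, Matrix.single_mul_mul_single]
        rw [h6, Matrix.trace_single_mul, smul_eq_mul]
      rw [h3, Matrix.trace_sub, Matrix.trace_sub, Matrix.trace_add, h2, h4, h5] at h1
      have h6 : mat u b a * mat u b a = 0 := by linear_combination -h1
      exact mul_self_eq_zero.1 h6
    have hx : (mat u - 1).BlockTriangular blk :=
      Matrix.BlockTriangular.sub (hN hu) Matrix.blockTriangular_one
    have hd : diagPart blk (mat u - 1) = Matrix.diagonal fun a => mat u a a - 1 := by
      ext a b
      rw [diagPart_apply]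
      by_cases hab : a = b
      · subst hab
        simp
      · rw [Matrix.diagonal_apply_ne _ hab]
        split_ifs with h
        · rw [Matrix.sub_apply, hoff b a h.symm (Ne.symm hab), Matrix.one_apply_ne hab, sub_zero]
        · rfl
    -- The block diagonal part of `u - 1` is now a diagonal matrix, and a power of it is the block
    -- diagonal part of a vanishing power of `u - 1`.
    obtain ⟨k, hk⟩ := hnil u hu
    have h1 := (blockTriangular_pow hx k).2
    rw [hk, hd, Matrix.diagonal_pow] at h1
    have h2 : diagPart blk (mat u - 1) = 0 := by
      rw [hd]
      ext a b
      by_cases hab : a = b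
      · subst hab
        have h3 := congrFun (congrFun h1 a) a
        rw [Matrix.diagonal_apply_eq, diagPart_apply, if_pos rfl] at h3
        rw [Matrix.diagonal_apply_eq]
        exact eq_zero_of_pow_eq_zero (n := k) h3.symm
      · rw [Matrix.diagonal_apply_ne _ hab]
        rfl
    refine ⟨hN hu, ?_⟩
    rw [diagPart_sub, diagPart_one, sub_eq_zero] at h2
    exact h2

/-- After a permutation sorting the indices by block, every upper triangular matrix is block
triangular. The conjugating element is the matrix of that permutation. -/
theorem isParabolic_blockTriangular : (blockTriangular blk).IsParabolic := by
  refine ⟨isClosed_blockTriangular, ?_⟩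
  let s := Tuple.sort blk
  have hs : Monotone (blk ∘ s) := Tuple.monotone_sort blk
  let P : Matrix (Fin n) (Fin n) ℂ := (1 : Matrix (Fin n) (Fin n) ℂ).submatrix id s
  let Q : Matrix (Fin n) (Fin n) ℂ := (1 : Matrix (Fin n) (Fin n) ℂ).submatrix s id
  refine ⟨⟨P, Q, ?_, ?_⟩, fun R b hb h' hh' => ?_⟩
  · change (1 : Matrix (Fin n) (Fin n) ℂ).submatrix id s * Matrix.submatrix 1 s id = 1
    rw [Matrix.submatrix_mul_equiv, Matrix.one_mul, Matrix.submatrix_id_id]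
  · change (1 : Matrix (Fin n) (Fin n) ℂ).submatrix s (Equiv.refl _) *
      Matrix.submatrix 1 (Equiv.refl _) s = 1
    rw [Matrix.submatrix_mul_equiv, Matrix.one_mul, Matrix.submatrix_one_equiv]
  · have h1 : mat (h' * b * h'⁻¹) * mat h' = mat h' * mat b := by
      rw [← mat_mul, inv_mul_cancel_right, mat_mul]
    have h2 : mat h' = (1 : Matrix (Fin n) (Fin n) R).submatrix id s := by
      rw [hh']
      ext i j
      simp [P, Matrix.one_apply, apply_ite (algebraMap ℂ R)]
    have h3 : ∀ i j, mat (h' * b * h'⁻¹) (s i) (s j) = mat b i j := by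
      intro i j
      have h4 := congrFun (congrFun h1 (s i)) j
      rw [h2, Matrix.mul_apply, Matrix.mul_apply] at h4
      simpa [Matrix.one_apply] using h4
    intro i j hij
    obtain ⟨i, rfl⟩ := s.surjective i
    obtain ⟨j, rfl⟩ := s.surjective j
    rw [h3]
    refine hb i j ?_
    by_contra hc
    exact absurd (hs (not_lt.1 hc)) (not_le.2 hij)

/-- The Levi factor of `g` is its block diagonal part. It is unique because taking that part is
multiplicative, fixes block diagonal matrices and is trivial on the unipotent group. -/
theorem isLevi_blockDiagonal : (blockTriangular blk).IsLevi (blockDiagonal blk) := by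
  refine ⟨isClosed_blockDiagonal, blockUnipotent blk, isUnipotentRadical_blockUnipotent,
    fun R => inf_le_left, fun R g hg => ?_⟩
  let l : (glFunctor n).obj R :=
    (⟨diagPart blk (mat g), diagPart blk (mat g⁻¹), by
      rw [← diagPart_mul hg (inv_mem hg), mat_mul_mat_inv, diagPart_one], by
      rw [← diagPart_mul (inv_mem hg) hg, mat_inv_mul_mat, diagPart_one]⟩ : GL (Fin n) R)
  have hl : l ∈ (blockDiagonal blk).pts R := mem_blockDiagonal.2 fun a b hab => if_neg hab
  have hl1 : l ∈ (blockTriangular blk).pts R := hl.1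
  have hu : l⁻¹ * g ∈ (blockUnipotent blk).pts R := by
    refine ⟨mul_mem (inv_mem hl1) hg, ?_⟩
    rw [mat_mul, diagPart_mul (inv_mem hl1) hg,
      diagPart_eq_self (mem_blockDiagonal.1 ((blockDiagonal blk).pts R |>.inv_mem hl))]
    exact mat_inv_mul_mat l
  refine ⟨⟨⟨l, hl⟩, ⟨l⁻¹ * g, hu⟩⟩, mul_inv_cancel_left l g, ?_⟩
  rintro ⟨⟨l', hl'⟩, ⟨u', hu'⟩⟩ (h : l' * u' = g)
  have h1 : l' = l := Units.ext (by
    change mat l' = diagPart blk (mat g)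
    rw [← h, mat_mul, diagPart_mul hl'.1 hu'.1, hu'.2, Matrix.mul_one,
      diagPart_eq_self (mem_blockDiagonal.1 hl')])
  have h2 : u' = l⁻¹ * g := by rw [← h, h1, inv_mul_cancel_left]
  exact Prod.ext (Subtype.ext h1) (Subtype.ext h2)

end Block

end SubgroupFunctor

/-! ### Conjugation and coordinate flags -/

/-- The constant `R`-point of `GL_n` given by a `ℂ`-point. -/
def constGL {n : ℕ} (γ : GL (Fin n) ℂ) (R : CommAlgCat.{0} ℂ) : (glFunctor n).obj R :=
  Matrix.GeneralLinearGroup.map (algebraMap ℂ R) γ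

section constGL

variable {n : ℕ} (γ : GL (Fin n) ℂ) {R S : CommAlgCat.{0} ℂ}

theorem mat_constGL : mat (constGL γ R) = γ.1.map (algebraMap ℂ R) := rfl

theorem constGL_inv : constGL γ⁻¹ R = (constGL γ R)⁻¹ := map_inv _ γ

theorem map_constGL (f : R ⟶ S) : (glFunctor n).map f (constGL γ R) = constGL γ S :=
  Units.ext (Matrix.ext fun _ _ => f.hom.commutes _)

end constGL

namespace SubgroupFunctor

variable {n : ℕ}

/-- The conjugate `γ H γ⁻¹`. -/
def conj (γ : GL (Fin n) ℂ) (H : SubgroupFunctor (glFunctor n)) :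
    SubgroupFunctor (glFunctor n) where
  pts R := (H.pts R).comap (MulAut.conj (constGL γ R)⁻¹).toMonoidHom
  map_mem {R S} f g hg := by
    have h1 := H.map_mem f _ hg
    rw [← map_constGL γ f, ← map_inv]
    change MulAut.conj ((glFunctor n).map f (constGL γ R)⁻¹) ((glFunctor n).map f g) ∈ H.pts S
    rw [MulAut.conj_apply, ← map_inv, ← map_mul, ← map_mul]
    exact h1

variable {γ : GL (Fin n) ℂ} {H P L U : SubgroupFunctor (glFunctor n)} {R : CommAlgCat.{0} ℂ}

theorem mem_conj {g : (glFunctor n).obj R} :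
    g ∈ (conj γ H).pts R ↔ (constGL γ R)⁻¹ * g * constGL γ R ∈ H.pts R := by
  change MulAut.conj (constGL γ R)⁻¹ g ∈ H.pts R ↔ _
  rw [MulAut.conj_apply, inv_inv]

theorem conj_mem_conj {g : (glFunctor n).obj R} :
    constGL γ R * g * (constGL γ R)⁻¹ ∈ (conj γ H).pts R ↔ g ∈ H.pts R := by
  rw [mem_conj]
  simp only [mul_assoc, inv_mul_cancel_left, inv_mul_cancel, mul_one]

theorem IsClosed.conj (hH : H.IsClosed) : (conj γ H).IsClosed := by
  obtain ⟨E, hE⟩ := hH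
  -- These are the entries of `γ⁻¹ X γ` for the generic matrix `X`; substituting them into the
  -- equations of `H` gives equations of the conjugate.
  let t : Fin n × Fin n → MvPolynomial (Fin n × Fin n) ℂ := fun ij =>
    ∑ d, (∑ c, MvPolynomial.C ((γ⁻¹).1 ij.1 c) * MvPolynomial.X (c, d)) *
      MvPolynomial.C (γ.1 d ij.2)
  refine ⟨(fun p => MvPolynomial.bind₁ t p) '' E, fun R g => ?_⟩
  rw [mem_conj, hE, Set.forall_mem_image]
  refine forall₂_congr fun p _ => ?_
  rw [MvPolynomial.aeval_bind₁]
  have h1 : (fun ij : Fin n × Fin n => mat ((constGL γ R)⁻¹ * g * constGL γ R) ij.1 ij.2) =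
      fun ij => MvPolynomial.aeval (fun ij : Fin n × Fin n => mat g ij.1 ij.2) (t ij) := by
    funext ij
    rw [← constGL_inv, mat_mul, mat_mul, mat_constGL, mat_constGL]
    simp [t, Matrix.mul_apply]
  rw [h1]

theorem IsParabolic.conj (hP : P.IsParabolic) : (conj γ P).IsParabolic := by
  obtain ⟨h1, h, hh⟩ := hP
  refine ⟨h1.conj, γ * h, fun R b hb h' hh' => ?_⟩
  have h2 : h' = constGL γ R * constGL h R := Units.ext (by
    change mat h' = _
    rw [hh', Units.val_mul, Matrix.map_mul]
    rfl)
  have h3 : h' * b * h'⁻¹ =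
      constGL γ R * (constGL h R * b * (constGL h R)⁻¹) * (constGL γ R)⁻¹ := by
    rw [h2]
    group
  rw [h3, conj_mem_conj]
  exact hh R b hb _ rfl

theorem isNilpotent_conj_sub_one (g u : (glFunctor n).obj R) (hu : IsNilpotent (mat u - 1)) :
    IsNilpotent (mat (g * u * g⁻¹) - 1) := by
  obtain ⟨k, hk⟩ := hu
  refine ⟨k, ?_⟩
  have h1 : mat (g * u * g⁻¹) - 1 = mat g * (mat u - 1) * mat g⁻¹ := by
    rw [mul_sub, sub_mul, mul_one, mat_mul_mat_inv, mat_mul, mat_mul]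
  have h2 : ∀ k : ℕ, (mat g * (mat u - 1) * mat g⁻¹) ^ k =
      mat g * (mat u - 1) ^ k * mat g⁻¹ := by
    intro k
    induction k with
    | zero => rw [pow_zero, pow_zero, mul_one, mat_mul_mat_inv]
    | succ k ih =>
      rw [pow_succ, ih, pow_succ]
      calc _ = mat g * (mat u - 1) ^ k * (mat g⁻¹ * mat g) * (mat u - 1) * mat g⁻¹ := by
            simp only [Matrix.mul_assoc]
        _ = _ := by rw [mat_inv_mul_mat]; simp only [Matrix.mul_assoc, Matrix.one_mul]
  rw [h1, h2, hk, mul_zero, zero_mul]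

theorem IsUnipotentRadical.conj (hU : IsUnipotentRadical P U) :
    IsUnipotentRadical (conj γ P) (conj γ U) where
  isClosed := hU.isClosed.conj
  le R := Subgroup.comap_mono (hU.le R)
  normal R g hg u hu := by
    have h1 := hU.normal R _ hg _ hu
    rw [← map_mul, ← map_inv, ← map_mul] at h1
    exact h1
  unipotent u hu := by
    rw [mem_conj] at hu
    have h1 := isNilpotent_conj_sub_one (constGL γ complexPoint) _ (hU.unipotent _ hu)
    convert h1 using 3
    group
  maximal N hN hnorm hnil u hu := by
    let c := MulAut.conj (constGL γ complexPoint)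
    have h1 := hU.maximal (N.comap c.toMonoidHom) (fun x hx => by
        have h2 := hN hx
        exact conj_mem_conj.1 h2)
      (fun g hg x hx => by
        have h2 := hnorm (c g) (conj_mem_conj.2 hg) (c x) hx
        rw [← map_mul, ← map_inv, ← map_mul] at h2
        exact h2)
      (fun x hx => by
        have h2 := isNilpotent_conj_sub_one (constGL γ complexPoint)⁻¹ _ (hnil _ hx)
        convert h2 using 3
        simp only [c, MulEquiv.coe_toMonoidHom, MulAut.conj_apply]
        group)
    rw [mem_conj]
    refine h1 ?_
    change c _ ∈ N
    convert hu using 1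
    simp only [c, MulAut.conj_apply]
    group

theorem IsLevi.conj (hL : P.IsLevi L) : (conj γ P).IsLevi (conj γ L) := by
  obtain ⟨h1, U, hU, hLP, hlu⟩ := hL
  refine ⟨h1.conj, SubgroupFunctor.conj γ U, hU.conj,
    fun R => Subgroup.comap_mono (hLP R), fun R g hg => ?_⟩
  let c := MulAut.conj (constGL γ R)⁻¹
  obtain ⟨⟨l, u⟩, h2, h3⟩ := hlu R (c g) hg
  refine ⟨⟨⟨c.symm l.1, ?_⟩, ⟨c.symm u.1, ?_⟩⟩, ?_, ?_⟩
  · change c (c.symm l.1) ∈ L.pts R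
    rw [MulEquiv.apply_symm_apply]
    exact l.2
  · change c (c.symm u.1) ∈ U.pts R
    rw [MulEquiv.apply_symm_apply]
    exact u.2
  · change c.symm l.1 * c.symm u.1 = g
    rw [← map_mul, h2, MulEquiv.symm_apply_apply]
  · rintro ⟨l', u'⟩ (h4 : l'.1 * u'.1 = g)
    have h5 := h3 ⟨⟨c l'.1, l'.2⟩, ⟨c u'.1, u'.2⟩⟩ (by
      change c l'.1 * c u'.1 = c g
      rw [← map_mul, h4])
    have h6 : c l'.1 = l.1 := congrArg (fun z => z.1.1) h5
    have h7 : c u'.1 = u.1 := congrArg (fun z => z.2.1) h5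
    refine Prod.ext (Subtype.ext ?_) (Subtype.ext ?_)
    · change l'.1 = c.symm l.1
      rw [← h6, MulEquiv.symm_apply_apply]
    · change u'.1 = c.symm u.1
      rw [← h7, MulEquiv.symm_apply_apply]

theorem map_conj_constGL (γ : GL (Fin n) ℂ) {R S : CommAlgCat.{0} ℂ} (f : R ⟶ S)
    (g : (glFunctor n).obj R) : (glFunctor n).map f (MulAut.conj (constGL γ R)⁻¹ g) =
      MulAut.conj (constGL γ S)⁻¹ ((glFunctor n).map f g) := by
  rw [MulAut.conj_apply, MulAut.conj_apply, map_mul, map_mul, map_inv, map_inv, map_inv,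
    map_constGL]

theorem nonempty_conj_iso (γ : GL (Fin n) ℂ) (H : SubgroupFunctor (glFunctor n)) :
    Nonempty ((conj γ H).toFunctor ≅ H.toFunctor) := by
  let ρ : (conj γ H).toFunctor ⟶ H.toFunctor :=
    { app := fun R => GrpCat.ofHom
        (((MulAut.conj (constGL γ R)⁻¹).toMonoidHom.comp ((conj γ H).pts R).subtype).codRestrict
          (H.pts R) fun g => g.2)
      naturality := fun R S f => by
        ext g
        apply Subtype.ext
        exact (map_conj_constGL γ f g.1).symm }
  have : IsIso ρ := isIso_of_bijective ρ fun R => by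
    constructor
    · intro x y hxy
      exact Subtype.ext ((MulAut.conj (constGL γ R)⁻¹).injective (congrArg Subtype.val hxy))
    · intro y
      refine ⟨⟨(MulAut.conj (constGL γ R)⁻¹).symm y.1, ?_⟩, Subtype.ext ?_⟩
      · change MulAut.conj (constGL γ R)⁻¹ ((MulAut.conj (constGL γ R)⁻¹).symm y.1) ∈ H.pts R
        rw [MulEquiv.apply_symm_apply]
        exact y.2
      · exact (MulAut.conj (constGL γ R)⁻¹).apply_symm_apply y.1
  exact ⟨asIso ρ⟩

/-- Moving a flag by `γ` conjugates its stabilizer. Statements on general flags are thereby reduced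
to coordinate flags. -/
theorem flagStabilizer_map {ι : Type} (γ : GL (Fin n) ℂ) (F : ι → Submodule ℂ (Fin n → ℂ)) :
    flagStabilizer (fun i => (F i).map γ.1.mulVecLin) = conj γ (flagStabilizer F) := by
  ext R g
  rw [mem_conj]
  refine forall_congr' fun i => ?_
  have h1 : extendScalars (algebraMap ℂ R) ((F i).map γ.1.mulVecLin) =
      (extendScalars (algebraMap ℂ R) (F i)).map (mat (constGL γ R)).mulVecLin :=
    extendScalars_map _ _ _
  rw [h1, mat_mul, mat_mul, map_mulVecLin_mul, map_mulVecLin_mul]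
  constructor
  · intro h
    rw [h, ← map_mulVecLin_mul, mat_inv_mul_mat, map_mulVecLin_one]
  · intro h
    conv_rhs => rw [← h]
    rw [← map_mulVecLin_mul (mat (constGL γ R)), mat_mul_mat_inv, map_mulVecLin_one]

end SubgroupFunctor

/-- The submodule spanned by the standard basis vectors with index satisfying `p`. -/
def coordSubmodule (R : Type*) [CommRing R] {n : ℕ} (p : Fin n → Prop) :
    Submodule R (Fin n → R) where
  carrier := {v | ∀ a, ¬ p a → v a = 0}
  add_mem' hv hw a ha := by rw [Pi.add_apply, hv a ha, hw a ha, add_zero]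
  zero_mem' _ _ := rfl
  smul_mem' c v hv a ha := by rw [Pi.smul_apply, hv a ha, smul_zero]

theorem single_mem_coordSubmodule {R : Type*} [CommRing R] {n : ℕ} {p : Fin n → Prop} {b : Fin n}
    (hb : p b) : (Pi.single b 1 : Fin n → R) ∈ coordSubmodule R p := fun a ha =>
  Pi.single_eq_of_ne (by rintro rfl; exact ha hb) _

theorem coordSubmodule_le {R : Type*} [CommRing R] {n : ℕ} {p : Fin n → Prop}
    {N : Submodule R (Fin n → R)} (h : ∀ b, p b → (Pi.single b 1 : Fin n → R) ∈ N) :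
    coordSubmodule R p ≤ N := by
  intro v hv
  rw [pi_eq_sum_univ' v]
  refine Submodule.sum_mem _ fun b _ => ?_
  by_cases hb : p b
  · convert Submodule.smul_mem _ (v b) (h b hb) using 2
  · rw [hv b hb, zero_smul]
    exact Submodule.zero_mem _

theorem extendScalars_coordSubmodule {R S : Type} [CommRing R] [CommRing S] (f : R →+* S) {n : ℕ}
    (p : Fin n → Prop) : extendScalars f (coordSubmodule R p) = coordSubmodule S p := by
  apply le_antisymm
  · exact extendScalars_le fun v hv a ha => (congrArg f (hv a ha)).trans (map_zero f)
  · refine coordSubmodule_le fun b hb => ?_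
    convert mem_extendScalars f _ (single_mem_coordSubmodule (R := R) hb) using 1
    ext a
    simp [Pi.single_apply, apply_ite f]

theorem map_coordSubmodule_le {R : Type*} [CommRing R] {n : ℕ} {p : Fin n → Prop}
    {M : Matrix (Fin n) (Fin n) R} : (coordSubmodule R p).map M.mulVecLin ≤ coordSubmodule R p ↔
      ∀ a b, p b → ¬ p a → M a b = 0 := by
  rw [Submodule.map_le_iff_le_comap]
  constructor
  · intro h a b hb ha
    have := h (single_mem_coordSubmodule hb) a ha
    rwa [Matrix.mulVecLin_apply, Matrix.mulVec_single_one] at this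
  · intro h
    refine coordSubmodule_le fun b hb a ha => ?_
    rw [Matrix.mulVecLin_apply, Matrix.mulVec_single_one]
    exact h a b hb ha

/-- Preserving a coordinate subspace kills the entries with column index inside and row index
outside. By hypothesis these are the entries below the block diagonal. Inclusion instead of equality
suffices because it also holds for the inverse. -/
theorem flagStabilizer_coordSubmodule {n : ℕ} {I ι : Type} [LinearOrder ι] (blk : Fin n → ι)
    (p : I → Fin n → Prop) (h : ∀ a b, blk b < blk a ↔ ∃ i, p i b ∧ ¬ p i a) :
    flagStabilizer (fun i => coordSubmodule ℂ (p i)) = SubgroupFunctor.blockTriangular blk := by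
  ext R g
  change (∀ i, _) ↔ _
  simp only [extendScalars_coordSubmodule]
  have key : ∀ g : (glFunctor n).obj R, g ∈ (SubgroupFunctor.blockTriangular blk).pts R ↔
      ∀ i, (coordSubmodule R (p i)).map (mat g).mulVecLin ≤ coordSubmodule R (p i) := by
    intro g
    simp only [map_coordSubmodule_le]
    constructor
    · intro hg i a b hb ha
      exact hg ((h a b).2 ⟨i, hb, ha⟩)
    · intro hg a b hab
      obtain ⟨i, hb, ha⟩ := (h a b).1 hab
      exact hg i a b hb ha
  constructor
  · intro hg
    exact (key g).2 fun i => (hg i).le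
  · intro hg i
    apply le_antisymm ((key g).1 hg i)
    have h1 := Submodule.map_mono (f := (mat g).mulVecLin) ((key g⁻¹).1 (inv_mem hg) i)
    rwa [← map_mulVecLin_mul, mat_mul_mat_inv, map_mulVecLin_one] at h1

/-! ### Levi subgroups as products of general linear groups -/

section Blocks

variable {n : ℕ} {blk : Fin n → ℕ} {m : ℕ → ℕ} {inc : ∀ k, Fin (m k) → Fin n}

/-- Block diagonality of the first factor is enough: a row index in block `k` forces the summation
index into that block, which `inc k` enumerates. -/
theorem submatrix_mul_of_blocks {R : Type*} [CommRing R]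
    (hinj : ∀ k, Function.Injective (inc k)) (hblk : ∀ k x, blk (inc k x) = k)
    (hsurj : ∀ a, ∃ x, inc (blk a) x = a) {M N : Matrix (Fin n) (Fin n) R}
    (hM : ∀ a b, blk a ≠ blk b → M a b = 0) (k : ℕ) :
    (M * N).submatrix (inc k) (inc k) =
      M.submatrix (inc k) (inc k) * N.submatrix (inc k) (inc k) := by
  ext x y
  simp only [Matrix.submatrix_apply, Matrix.mul_apply]
  symm
  refine Finset.sum_of_injOn (inc k) (hinj k).injOn (fun _ _ => Finset.mem_coe.2 (Finset.mem_univ _))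
    (fun a _ ha => ?_) (fun _ _ => rfl)
  rw [hM, zero_mul]
  rw [hblk]
  rintro rfl
  obtain ⟨z, hz⟩ := hsurj a
  exact ha ⟨z, by simp, hz⟩

theorem eq_of_submatrix_eq {R : Type*} [CommRing R]
    (hsurj : ∀ a, ∃ x, inc (blk a) x = a) {M N : Matrix (Fin n) (Fin n) R}
    (hM : ∀ a b, blk a ≠ blk b → M a b = 0) (hN : ∀ a b, blk a ≠ blk b → N a b = 0)
    (h : ∀ k, M.submatrix (inc k) (inc k) = N.submatrix (inc k) (inc k)) : M = N := by
  ext a b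
  by_cases hab : blk a = blk b
  · have h0 := hsurj a
    rw [hab] at h0
    obtain ⟨x, hx⟩ := h0
    obtain ⟨y, hy⟩ := hsurj b
    have h1 := congrFun (congrFun (h (blk b)) x) y
    rwa [Matrix.submatrix_apply, Matrix.submatrix_apply, hx, hy] at h1
  · rw [hM a b hab, hN a b hab]

theorem exists_blocks {R : Type*} [CommRing R]
    (hinj : ∀ k, Function.Injective (inc k)) (hblk : ∀ k x, blk (inc k x) = k)
    (A : ∀ k, Matrix (Fin (m k)) (Fin (m k)) R) :
    ∃ M : Matrix (Fin n) (Fin n) R, (∀ a b, blk a ≠ blk b → M a b = 0) ∧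
      ∀ k, M.submatrix (inc k) (inc k) = A k := by
  classical
  -- By injectivity of `inc k` the double sum has at most one non-zero term; no inverse of `inc k`
  -- has to be chosen.
  let F : ℕ → Fin n → Fin n → R := fun k a b =>
    ∑ x : Fin (m k), ∑ y : Fin (m k), if inc k x = a ∧ inc k y = b then A k x y else 0
  refine ⟨Matrix.of fun a b => F (blk b) a b, fun a b hab => ?_, fun k => ?_⟩
  · change F (blk b) a b = 0
    refine Finset.sum_eq_zero fun x _ => Finset.sum_eq_zero fun y _ => if_neg ?_
    rintro ⟨rfl, -⟩
    exact hab (hblk _ _)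
  · ext x y
    rw [Matrix.submatrix_apply, Matrix.of_apply, hblk]
    simp only [F, (hinj k).eq_iff]
    simp [ite_and]

end Blocks

/-- The diagonal blocks of a block diagonal matrix. -/
def diagonalBlocks {n : ℕ} {blk : Fin n → ℕ} {m : ℕ → ℕ} {inc : ∀ k, Fin (m k) → Fin n}
    (hinj : ∀ k, Function.Injective (inc k)) (hblk : ∀ k x, blk (inc k x) = k)
    (hsurj : ∀ a, ∃ x, inc (blk a) x = a) :
    (SubgroupFunctor.blockDiagonal blk).toFunctor ⟶ piGL m where
  app R := GrpCat.ofHom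
    { toFun := fun g k => (⟨(mat g.1).submatrix (inc k) (inc k),
        (mat g.1⁻¹).submatrix (inc k) (inc k), by
          rw [← submatrix_mul_of_blocks hinj hblk hsurj (SubgroupFunctor.mem_blockDiagonal.1 g.2),
            mat_mul_mat_inv, Matrix.submatrix_one _ (hinj k)], by
          rw [← submatrix_mul_of_blocks hinj hblk hsurj
            (SubgroupFunctor.mem_blockDiagonal.1
              (((SubgroupFunctor.blockDiagonal blk).pts R).inv_mem g.2)), mat_inv_mul_mat,
            Matrix.submatrix_one _ (hinj k)]⟩ : GL (Fin (m k)) R)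
      map_one' := funext fun k => Units.ext (Matrix.submatrix_one _ (hinj k))
      map_mul' := fun g h => funext fun k => Units.ext
        (submatrix_mul_of_blocks hinj hblk hsurj (SubgroupFunctor.mem_blockDiagonal.1 g.2) k) }
  naturality R S f := by
    ext g
    rfl

theorem nonempty_blockDiagonal_iso {n : ℕ} {blk : Fin n → ℕ} {m : ℕ → ℕ}
    {inc : ∀ k, Fin (m k) → Fin n}
    (hinj : ∀ k, Function.Injective (inc k)) (hblk : ∀ k x, blk (inc k x) = k)
    (hsurj : ∀ a, ∃ x, inc (blk a) x = a) :
    Nonempty ((SubgroupFunctor.blockDiagonal blk).toFunctor ≅ piGL m) := by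
  have : IsIso (diagonalBlocks hinj hblk hsurj) := isIso_of_bijective _ fun R => by
    constructor
    · intro g h hgh
      refine Subtype.ext (Units.ext ?_)
      refine eq_of_submatrix_eq (inc := inc) hsurj (SubgroupFunctor.mem_blockDiagonal.1 g.2)
        (SubgroupFunctor.mem_blockDiagonal.1 h.2) fun k => ?_
      exact congrArg Units.val (congrFun hgh k)
    · intro (A : ∀ k, GL (Fin (m k)) R)
      obtain ⟨M, hM, hM'⟩ := exists_blocks hinj hblk fun k => (A k).1
      obtain ⟨N, hN, hN'⟩ := exists_blocks hinj hblk fun k => (A k)⁻¹.1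
      have hmul : ∀ M N : Matrix (Fin n) (Fin n) R, (∀ a b, blk a ≠ blk b → M a b = 0) →
          (∀ a b, blk a ≠ blk b → N a b = 0) →
          (∀ k, M.submatrix (inc k) (inc k) * N.submatrix (inc k) (inc k) = 1) → M * N = 1 := by
        intro M N hM hN h
        refine eq_of_submatrix_eq (inc := inc) hsurj (fun a b hab => ?_) (fun a b hab => ?_)
          fun k => ?_
        · rw [Matrix.mul_apply]
          refine Finset.sum_eq_zero fun c _ => ?_
          by_cases hc : blk a = blk c
          · rw [hN c b (hc ▸ hab), mul_zero]
          · rw [hM a c hc, zero_mul]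
        · exact Matrix.one_apply_ne fun h => hab (congrArg blk h)
        · rw [submatrix_mul_of_blocks hinj hblk hsurj hM, h, Matrix.submatrix_one _ (hinj k)]
      let g : GL (Fin n) R := ⟨M, N,
        hmul M N hM hN fun k => by rw [hM', hN']; exact Units.mul_inv _,
        hmul N M hN hM fun k => by rw [hM', hN']; exact Units.inv_mul _⟩
      exact ⟨⟨g, SubgroupFunctor.mem_blockDiagonal.2 hM⟩, funext fun k => Units.ext (hM' k)⟩
  exact ⟨asIso (diagonalBlocks hinj hblk hsurj)⟩

/-! ### Flags of coordinate subspaces -/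

/-- The block of an index with respect to a decreasing sequence of dimensions. -/
noncomputable def flagBlock {n : ℕ} (d : ℕ → ℕ) (hd : ∃ k, d (k + 1) = 0) (b : Fin n) : ℕ :=
  Nat.find (p := fun k => d (k + 1) ≤ b) ⟨hd.choose, hd.choose_spec.le.trans (Nat.zero_le _)⟩

section flagBlock

variable {n : ℕ} {d : ℕ → ℕ} (hd : ∃ k, d (k + 1) = 0) (hanti : Antitone d) (hn : d 0 = n)

-- The least `k` with `d (k + 1) ≤ b` is, by monotonicity, the last step still containing `b`. The
-- condition `d 0 = n` settles the case `k = 0`.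
include hanti hn in
theorem lt_iff_le_flagBlock (b : Fin n) (k : ℕ) : b.1 < d k ↔ k ≤ flagBlock d hd b := by
  rw [flagBlock, Nat.le_find_iff]
  constructor
  · intro h j hj
    exact not_le.2 (h.trans_le (hanti hj))
  · intro h
    cases k with
    | zero => exact hn ▸ b.2
    | succ k => exact not_le.1 (h k (Nat.lt_succ_self k))

-- Block `k` is the interval of indices from `d (k + 1)` up to but not including `d k`, enumerated
-- by a shift.
include hanti hn in
theorem nonempty_blockDiagonal_iso_flagBlock :
    Nonempty ((SubgroupFunctor.blockDiagonal (flagBlock (n := n) d hd)).toFunctor ≅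
      piGL fun k => d k - d (k + 1)) := by
  have hle : ∀ k, d k ≤ n := fun k => hn ▸ hanti (Nat.zero_le k)
  have key := lt_iff_le_flagBlock hd hanti hn
  refine nonempty_blockDiagonal_iso (m := fun k => d k - d (k + 1))
    (inc := fun k x => ⟨d (k + 1) + x.1, by have := x.2; have := hle k; omega⟩)
    (fun k x y hxy => Fin.ext (by have := congrArg Fin.val hxy; simpa using this))
    (fun k x => ?_) (fun a => ?_)
  · apply le_antisymm
    · rw [← Nat.lt_succ_iff, ← not_le, Nat.succ_eq_add_one, ← key]
      exact not_lt.2 (Nat.le_add_right _ _)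
    · rw [← key]
      have := x.2
      change d (k + 1) + x.1 < d k
      omega
  · have h1 := (key a (flagBlock d hd a)).2 le_rfl
    have h2 := (key a (flagBlock d hd a + 1)).not.2 (by omega)
    exact ⟨⟨a.1 - d (flagBlock d hd a + 1), by omega⟩, Fin.ext (by simp; omega)⟩

include hd hanti hn in
/-- The stabilizer of a decreasing coordinate flag is a parabolic subgroup. -/
theorem isParabolic_stabilizer_decreasing :
    (flagStabilizer fun k => coordSubmodule ℂ fun b : Fin n => b.1 < d k).IsParabolic ∧
      ∃ L, (flagStabilizer fun k => coordSubmodule ℂ fun b : Fin n => b.1 < d k).IsLevi L ∧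
        Nonempty (L.toFunctor ≅ piGL fun k => d k - d (k + 1)) := by
  -- In a decreasing flag the smaller subspaces carry the larger block numbers, so triangularity is
  -- with respect to the reversed order.
  rw [flagStabilizer_coordSubmodule (OrderDual.toDual ∘ flagBlock (n := n) d hd) _ fun a b => ?_]
  · refine ⟨SubgroupFunctor.isParabolic_blockTriangular, _,
      SubgroupFunctor.isLevi_blockDiagonal, ?_⟩
    rw [SubgroupFunctor.blockDiagonal_toDual]
    exact nonempty_blockDiagonal_iso_flagBlock hd hanti hn
  · simp only [lt_iff_le_flagBlock hd hanti hn]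
    exact ⟨fun h => ⟨_, le_rfl, not_le.2 h⟩, fun ⟨_, h1, h2⟩ => (not_le.1 h2).trans_le h1⟩

include hd hanti hn in
/-- The stabilizer of an increasing coordinate flag is a parabolic subgroup. -/
theorem isParabolic_stabilizer_increasing :
    (flagStabilizer fun k => coordSubmodule ℂ fun b : Fin n => d k ≤ b.1).IsParabolic ∧
      ∃ L, (flagStabilizer fun k => coordSubmodule ℂ fun b : Fin n => d k ≤ b.1).IsLevi L ∧
        Nonempty (L.toFunctor ≅ piGL fun k => d k - d (k + 1)) := by
  rw [flagStabilizer_coordSubmodule (flagBlock (n := n) d hd) _ fun a b => ?_]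
  · exact ⟨SubgroupFunctor.isParabolic_blockTriangular, _,
      SubgroupFunctor.isLevi_blockDiagonal, nonempty_blockDiagonal_iso_flagBlock hd hanti hn⟩
  · simp only [← not_lt, lt_iff_le_flagBlock hd hanti hn, not_not]
    exact ⟨fun h => ⟨_, h, lt_irrefl _⟩, fun ⟨_, h1, h2⟩ => h1.trans_le (not_lt.1 h2)⟩

end flagBlock

/-! ### Normal forms of full rank representations -/

/-- A function on `ℂ` that increases up to `ℓ` and decreases from `c = ℓ + 1`, with finite support
in the coset of `ℓ`. -/
structure IsUnimodalPair (φ : ℂ → ℕ) (ℓ c : ℂ) : Prop where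
  eq_add_one : c = ℓ + 1
  finite_support : φ.support.Finite
  antitone_left : Antitone fun k : ℕ => φ (ℓ - k)
  antitone_right : Antitone fun k : ℕ => φ (c + k)
  eq : φ ℓ = φ c
  cases : ∀ i, φ i ≠ 0 → (∃ k : ℕ, i = ℓ - k) ∨ ∃ k : ℕ, i = c + k

/-- The range of increase reaches up to `c` and the range of decrease starts already at `ℓ`; the two
overlap in exactly these indices, whence the equality of dimensions. -/
theorem IsUnimodalAt.isUnimodalPair {φ : ℂ → ℕ} {a : ℂ} {q : ℚ} (hφ : IsUnimodalAt φ a q) :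
    IsUnimodalPair φ (shiftedFloor a q) (shiftedCeil a q) := by
  have hcl := shiftedCeil_eq a q hφ.not_int
  have hq : ⌈q⌉ = ⌊q⌋ + 1 := by
    have : ((⌈q⌉ : ℤ) : ℂ) = ((⌊q⌋ + 1 : ℤ) : ℂ) := by
      unfold shiftedCeil shiftedFloor at hcl
      push_cast
      linear_combination hcl
    exact_mod_cast this
  have hl : ∀ k : ℕ, shiftedFloor a q - k = a + ((⌊q⌋ - k : ℤ) : ℂ) := fun k => by
    unfold shiftedFloor
    push_cast
    ring
  have hr : ∀ k : ℕ, shiftedCeil a q + k = a + ((⌈q⌉ + k : ℤ) : ℂ) := fun k => by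
    unfold shiftedCeil
    push_cast
    ring
  refine ⟨hcl, hφ.finite_support, fun j k hjk => ?_, fun j k hjk => ?_, ?_, fun i hi => ?_⟩
  · simp only [hl]
    exact hφ.increasing _ _ (by omega) (by omega)
  · simp only [hr]
    exact hφ.decreasing _ _ (by omega) (by omega)
  · exact le_antisymm (hφ.increasing _ _ (by omega) le_rfl) (hφ.decreasing _ _ le_rfl (by omega))
  · obtain ⟨m, rfl⟩ := hφ.integral i hi
    rcases le_or_gt m ⌊q⌋ with h | h
    · refine Or.inl ⟨(⌊q⌋ - m).toNat, ?_⟩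
      rw [hl]
      congr 2
      omega
    · refine Or.inr ⟨(m - ⌈q⌉).toNat, ?_⟩
      rw [hr]
      congr 2
      omega

namespace IsUnimodalPair

variable {φ : ℂ → ℕ} {ℓ c : ℂ}

/-- Infinitely many distinct points cannot all lie in the finite support. This anchors the induction
along the left chain. -/
theorem exists_left_eq_zero (h : IsUnimodalPair φ ℓ c) : ∃ k : ℕ, φ (ℓ - (k + 1 : ℕ)) = 0 := by
  by_contra! hk
  exact h.finite_support.not_infinite (Set.infinite_of_injective_forall_mem
    (f := fun k : ℕ => ℓ - (k + 1 : ℕ)) (fun j k hjk => by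
      have : ((j + 1 : ℕ) : ℂ) = (k + 1 : ℕ) := sub_right_injective hjk
      have : j + 1 = k + 1 := by exact_mod_cast this
      omega) hk)

theorem exists_right_eq_zero (h : IsUnimodalPair φ ℓ c) : ∃ k : ℕ, φ (c + (k + 1 : ℕ)) = 0 := by
  by_contra! hk
  exact h.finite_support.not_infinite (Set.infinite_of_injective_forall_mem
    (f := fun k : ℕ => c + (k + 1 : ℕ)) (fun j k hjk => by
      have : ((j + 1 : ℕ) : ℂ) = (k + 1 : ℕ) := add_right_injective c hjk
      have : j + 1 = k + 1 := by exact_mod_cast this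
      omega) hk)

theorem left_ne_right (h : IsUnimodalPair φ ℓ c) (j k : ℕ) : ℓ - j ≠ c + k := by
  rw [h.eq_add_one]
  intro h
  have h1 : ((j + k + 1 : ℕ) : ℂ) = 0 := by
    push_cast
    linear_combination -h
  have h2 : j + k + 1 = 0 := by exact_mod_cast h1
  omega

end IsUnimodalPair

section NormalForm

variable {φ : ℂ → ℕ}

/-- The action of `∏ GL(V_i)` on representations. -/
def QuiverRep.act {R : CommAlgCat.{0} ℂ} (g : (piGL φ).obj R) (T : QuiverRep φ R) :
    QuiverRep φ R :=
  (voganVariety φ).smul g T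

/-- Base change of representations. -/
def QuiverRep.baseChange {R S : CommAlgCat.{0} ℂ} (f : R ⟶ S) (T : QuiverRep φ R) :
    QuiverRep φ S :=
  (voganVariety φ).X.map f T

/-- The component at `i` of a point of `∏ GL(V_i)`. -/
def glAt {R : CommAlgCat.{0} ℂ} (g : (piGL φ).obj R) (i : ℂ) : (glFunctor (φ i)).obj R :=
  (piGLProj φ i).app R g

section act

open QuiverRep

variable {R S A : CommAlgCat.{0} ℂ} (g h : (piGL φ).obj R) (T : QuiverRep φ R) (f : R ⟶ S)
  (f' : S ⟶ A) (i j : ℂ) (hij : j = i + 1)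

theorem glAt_mul : glAt (g * h) i = glAt g i * glAt h i := rfl

theorem glAt_inv : glAt g⁻¹ i = (glAt g i)⁻¹ := rfl

theorem act_apply : act g T i j hij = mat (glAt g j) * T i j hij * mat (glAt g i)⁻¹ := rfl

theorem act_mul : act (g * h) T = act g (act h T) := (voganVariety φ).mul_smul g h T

theorem act_one : act (1 : (piGL φ).obj R) T = T := (voganVariety φ).one_smul T

theorem act_inv_act : act g⁻¹ (act g T) = T := by
  rw [← act_mul, inv_mul_cancel, act_one]

theorem act_act_inv : act g (act g⁻¹ T) = T := by
  rw [← act_mul, mul_inv_cancel, act_one]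

theorem baseChange_act : baseChange f (act g T) = act ((piGL φ).map f g) (baseChange f T) :=
  (voganVariety φ).map_smul f g T

theorem baseChange_comp : baseChange (f ≫ f') T = baseChange f' (baseChange f T) := rfl

theorem act_dropComponent (ℓ : ℂ) :
    act g (dropComponent ℓ T) = dropComponent ℓ (R := R) (act g T) :=
  smul_dropComponent ℓ g T

theorem baseChange_dropComponent (ℓ : ℂ) :
    baseChange f (dropComponent ℓ T) = dropComponent ℓ (R := S) (baseChange f T) :=
  map_dropComponent ℓ f T

theorem baseChange_constPoint (T : QuiverRep φ ℂ) :
    baseChange f (constPoint T R) = constPoint T S :=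
  map_constPoint T f

variable {T}

theorem IsFullRank.act (hT : IsFullRank T) : IsFullRank (act g T) :=
  (fullRankPart φ).smul_mem g T hT

theorem IsFullRank.baseChange (hT : IsFullRank T) : IsFullRank (baseChange f T) :=
  (fullRankPart φ).map_mem f T hT

end act

open QuiverRep

/-- The representation all of whose components are rectangular identity matrices. -/
def stdRep (φ : ℂ → ℕ) (R : Type) [CommRing R] : QuiverRep φ R :=
  fun i j _ => stdMat R (φ j) (φ i)

/-- The component of `T` at `i` is a rectangular identity matrix. -/
def ArrowNormal {R : Type} [CommRing R] (T : QuiverRep φ R) (i : ℂ) : Prop :=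
  ∀ j h, T i j h = stdMat R (φ j) (φ i)

theorem arrowNormal_of_eq_zero {R : Type} [CommRing R] (T : QuiverRep φ R) {i : ℂ}
    (hi : φ i = 0) : ArrowNormal T i := fun j h => by
  ext x y
  exact absurd y.2 (by omega)

theorem ArrowNormal.map {R S : CommAlgCat.{0} ℂ} (f : R ⟶ S) {T : QuiverRep φ R} {i : ℂ}
    (h : ArrowNormal T i) : ArrowNormal (baseChange f T) i := fun j hj => by
  have h1 := stdMat_map (m := φ j) (n := φ i) f.hom.toRingHom
  rw [← h j hj] at h1
  exact h1

open Classical in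
/-- The point of `∏ GL(V_i)` with the given component at `x` and trivial other components. -/
noncomputable def piGLSingle {R : CommAlgCat.{0} ℂ} (x : ℂ) (h : (glFunctor (φ x)).obj R) :
    (piGL φ).obj R :=
  (Pi.mulSingle x h : ∀ i, GL (Fin (φ i)) R)

section piGLSingle

variable {R : CommAlgCat.{0} ℂ} {x : ℂ} (h : (glFunctor (φ x)).obj R)

theorem glAt_single_self : glAt (piGLSingle x h) x = h := by
  classical
  exact Pi.mulSingle_eq_same (M := fun i => GL (Fin (φ i)) R) x h

theorem glAt_single_of_ne {i : ℂ} (hi : i ≠ x) :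
    glAt (piGLSingle x h) i = 1 := by
  classical
  exact Pi.mulSingle_eq_of_ne (M := fun i => GL (Fin (φ i)) R) hi h

/-- A change of basis at `x` affects only the arrows into and out of `x`. -/
theorem ArrowNormal.smul_single {T : QuiverRep φ R} {i : ℂ} (hT : ArrowNormal T i) (h1 : i ≠ x)
    (h2 : i + 1 ≠ x) : ArrowNormal (act (piGLSingle x h) T) i := by
  rintro j rfl
  rw [act_apply, glAt_single_of_ne h h1, glAt_single_of_ne h h2, inv_one, mat_one, mat_one,
    Matrix.one_mul, Matrix.mul_one, hT]

end piGLSingle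

/-- Near every point, a completing matrix that is invertible at the point is invertible. -/
theorem near_exists_gl {R : CommAlgCat.{0} ℂ} (p : PrimeSpectrum R) {n : ℕ}
    (h : Matrix (Fin n) (Fin n) R) (hp : algebraMap R p.asIdeal.ResidueField h.det ≠ 0) :
    Near p fun A f => ∃ g : (glFunctor n).obj A, mat g = h.map f.hom := by
  refine (near_isUnit p h.det fun ht => hp (Ideal.algebraMap_residueField_eq_zero.2 ht)).mono
    fun A f hf => ?_
  have h1 : IsUnit (f.hom.toRingHom.mapMatrix h) := by
    rw [Matrix.isUnit_iff_isUnit_det, ← RingHom.map_det]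
    exact hf
  obtain ⟨g, hg⟩ := h1
  exact ⟨g, hg⟩

/-- At `p` the arrow is injective, so near `p` it consists of the first columns of an invertible
matrix `g`; acting by `g⁻¹` on the target removes `g`. -/
theorem near_arrowNormal_target {R : CommAlgCat.{0} ℂ} (p : PrimeSpectrum R) {T : QuiverRep φ R}
    (hT : IsFullRank T) {i : ℂ} (hi : φ i ≤ φ (i + 1)) :
    Near p fun A f => ∃ h : (glFunctor (φ (i + 1))).obj A, ArrowNormal 
      (act (piGLSingle (i + 1) h) (baseChange f T)) i := by
  obtain ⟨h, h1, h2⟩ := exists_completion (algebraMap R p.asIdeal.ResidueField) hi (T i _ rfl)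
    (by rw [hT, min_eq_left hi])
  refine (near_exists_gl p h h2).mono ?_
  rintro A f ⟨g, hg⟩
  refine ⟨g⁻¹, ?_⟩
  rintro j rfl
  have h3 : baseChange f T i _ rfl =
      mat g * stdMat A (φ (i + 1)) (φ i) := by
    rw [hg, ← stdMat_map f.hom.toRingHom]
    change (T i _ rfl).map f.hom = _
    rw [h1]
    exact Matrix.map_mul (f := f.hom.toRingHom)
  rw [act_apply, glAt_single_self, glAt_single_of_ne _ (by simp), inv_one, mat_one,
    Matrix.mul_one, h3, ← Matrix.mul_assoc, mat_inv_mul_mat, Matrix.one_mul]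

/-- At `p` the arrow is surjective, so near `p` it consists of the first rows of an invertible
matrix, which a change of basis in the source removes. -/
theorem near_arrowNormal_source {R : CommAlgCat.{0} ℂ} (p : PrimeSpectrum R) {T : QuiverRep φ R}
    (hT : IsFullRank T) {i : ℂ} (hi : φ (i + 1) ≤ φ i) :
    Near p fun A f => ∃ h : (glFunctor (φ i)).obj A, ArrowNormal 
      (act (piGLSingle i h) (baseChange f T)) i := by
  obtain ⟨h, h1, h2⟩ := exists_completion_row (algebraMap R p.asIdeal.ResidueField) hi (T i _ rfl)
    (by rw [hT, min_eq_right hi])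
  refine (near_exists_gl p h h2).mono ?_
  rintro A f ⟨g, hg⟩
  refine ⟨g, ?_⟩
  rintro j rfl
  have h3 : baseChange f T i _ rfl =
      stdMat A (φ (i + 1)) (φ i) * mat g := by
    rw [hg, ← stdMat_map f.hom.toRingHom]
    change (T i _ rfl).map f.hom = _
    rw [h1]
    exact Matrix.map_mul (f := f.hom.toRingHom)
  rw [act_apply, glAt_single_self, glAt_single_of_ne _ (by simp), mat_one,
    Matrix.one_mul, h3, Matrix.mul_assoc, mat_mul_mat_inv, Matrix.mul_one]

/-- Near `p`, the components of `T` at the indices in `I` can be made rectangular identity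
matrices. -/
def NearNormal {R : CommAlgCat.{0} ℂ} (p : PrimeSpectrum R) (T : QuiverRep φ R) (I : Set ℂ) :
    Prop :=
  Near p fun A f => ∃ g : (piGL φ).obj A, ∀ i ∈ I, ArrowNormal 
    (act g (baseChange f T)) i

variable {R : CommAlgCat.{0} ℂ} {p : PrimeSpectrum R} {T : QuiverRep φ R} {I : Set ℂ}

/-- An arrow leaving a zero space has no entries, so only indices in the support matter. -/
theorem NearNormal.mono (h : NearNormal p T I) {J : Set ℂ} (hJ : ∀ i ∈ J, φ i ≠ 0 → i ∈ I) :
    NearNormal p T J := by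
  refine Near.mono h ?_
  rintro A f ⟨g, hg⟩
  refine ⟨g, fun i hi => ?_⟩
  by_cases h0 : φ i = 0
  · exact arrowNormal_of_eq_zero _ h0
  · exact hg i (hJ i hi h0)

/-- Normalising a further arrow by a change of basis at `x` is harmless as long as `x` is not an
endpoint of an arrow treated before. -/
theorem NearNormal.insert_of_near (h : NearNormal p T I) (hT : IsFullRank T) {i₀ x : ℂ}
    (hI : ∀ i ∈ I, i ≠ x ∧ i + 1 ≠ x)
    (hx : ∀ {A : CommAlgCat.{0} ℂ} (y : PrimeSpectrum A) {T' : QuiverRep φ A}, IsFullRank T' →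
      Near y fun B f => ∃ h : (glFunctor (φ x)).obj B, ArrowNormal 
        (act (piGLSingle x h) (baseChange f T')) i₀) :
    NearNormal p T (insert i₀ I) := by
  refine Near.trans h ?_
  rintro A f ⟨g, hg⟩ y -
  have hT' : IsFullRank (act g (baseChange f T)) :=
    (hT.baseChange f).act g
  refine (hx y hT').mono ?_
  rintro B f' ⟨h, hh⟩
  have key : act (piGLSingle x h * (piGL φ).map f' g)
      (baseChange (f ≫ f') T) = act (piGLSingle x h)
        (baseChange f' (act g (baseChange f T))) := by
    rw [act_mul, baseChange_act, baseChange_comp]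
  refine ⟨piGLSingle x h * (piGL φ).map f' g, fun i hi => ?_⟩
  rw [key]
  rcases hi with rfl | hi
  · exact hh
  · exact ((hg i hi).map f').smul_single h (hI i hi).1 (hI i hi).2

/-- Descending induction on `k`, from the far left, where the spaces vanish, towards `ℓ`. The arrow
leaving `ℓ - (k + 1)` is normalised at its target `ℓ - k`, which is not an endpoint of any arrow
further to the left. -/
theorem nearNormal_left {ℓ c : ℂ} (hφ : IsUnimodalPair φ ℓ c) (hT : IsFullRank T) (k : ℕ) :
    NearNormal p T {i | ∃ j : ℕ, k ≤ j ∧ i = ℓ - (j + 1 : ℕ)} := by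
  obtain ⟨N, hN⟩ := hφ.exists_left_eq_zero
  have key : ∀ d k : ℕ, N ≤ k + d →
      NearNormal p T {i | ∃ j : ℕ, k ≤ j ∧ i = ℓ - (j + 1 : ℕ)} := by
    intro d
    induction d with
    | zero =>
      intro k hk
      have h0 : NearNormal p T ∅ := Near.of_self ⟨1, fun i hi => absurd hi (Set.notMem_empty i)⟩
      refine h0.mono ?_
      rintro i ⟨j, hj, rfl⟩ h1
      have := hφ.antitone_left (show N + 1 ≤ j + 1 by omega)
      simp only [hN] at this
      omega
    | succ d ih =>
      intro k hk
      have hx : ℓ - (k + 1 : ℕ) + 1 = ℓ - k := by push_cast; ring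
      refine ((ih (k + 1) (by omega)).insert_of_near hT (i₀ := ℓ - (k + 1 : ℕ))
        (x := ℓ - (k + 1 : ℕ) + 1) ?_ fun y T' hT' => near_arrowNormal_target y hT' ?_).mono ?_
      · rintro i ⟨j, hj, rfl⟩
        rw [hx]
        constructor
        · intro h
          have : ((j + 1 : ℕ) : ℂ) = k := sub_right_injective h
          have : j + 1 = k := by exact_mod_cast this
          omega
        · intro h
          have : (j : ℂ) = k := by
            push_cast at h
            linear_combination -h
          have : j = k := by exact_mod_cast this
          omega
      · rw [hx]
        exact hφ.antitone_left (Nat.le_succ k)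
      · rintro i ⟨j, hj, rfl⟩ -
        rcases hj.eq_or_lt with rfl | hj
        · exact Set.mem_insert _ _
        · exact Set.mem_insert_of_mem _ ⟨j, hj, rfl⟩
  exact key N k (by omega)

/-- With the left chain done, the arrows on the right are treated from the far end towards `c`, each
at its source. The only other arrow touched is the one entering that source, which is either not yet
treated or the arrow at `ℓ`. -/
theorem nearNormal_right {ℓ c : ℂ} (hφ : IsUnimodalPair φ ℓ c) (hT : IsFullRank T) (k : ℕ) :
    NearNormal p T ({i | ∃ j : ℕ, i = ℓ - (j + 1 : ℕ)} ∪ {i | ∃ j : ℕ, k ≤ j ∧ i = c + j}) := by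
  obtain ⟨N, hN⟩ := hφ.exists_right_eq_zero
  have key : ∀ d k : ℕ, N + 1 ≤ k + d →
      NearNormal p T
        ({i | ∃ j : ℕ, i = ℓ - (j + 1 : ℕ)} ∪ {i | ∃ j : ℕ, k ≤ j ∧ i = c + j}) := by
    intro d
    induction d with
    | zero =>
      intro k hk
      refine (nearNormal_left hφ hT 0).mono ?_
      rintro i (⟨j, rfl⟩ | ⟨j, hj, rfl⟩) h1
      · exact ⟨j, Nat.zero_le j, rfl⟩
      · have := hφ.antitone_right (show N + 1 ≤ j by omega)
        simp only [hN] at this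
        omega
    | succ d ih =>
      intro k hk
      have hx : c + (k : ℂ) + 1 = c + (k + 1 : ℕ) := by push_cast; ring
      refine ((ih (k + 1) (by omega)).insert_of_near hT (i₀ := c + k)
        (x := c + k) ?_ fun y T' hT' => near_arrowNormal_source y hT' ?_).mono ?_
      · rintro i (⟨j, rfl⟩ | ⟨j, hj, rfl⟩)
        · refine ⟨hφ.left_ne_right _ _, ?_⟩
          have : ℓ - (j + 1 : ℕ) + 1 = ℓ - j := by push_cast; ring
          rw [this]
          exact hφ.left_ne_right _ _
        · constructor
          · intro h
            have : (j : ℂ) = k := add_right_injective c h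
            have : j = k := by exact_mod_cast this
            omega
          · intro h
            have : ((j + 1 : ℕ) : ℂ) = k := by
              push_cast
              linear_combination h
            have : j + 1 = k := by exact_mod_cast this
            omega
      · rw [hx]
        exact hφ.antitone_right (Nat.le_succ k)
      · rintro i (⟨j, rfl⟩ | ⟨j, hj, rfl⟩) -
        · exact Set.mem_insert_of_mem _ (Or.inl ⟨j, rfl⟩)
        · rcases hj.eq_or_lt with rfl | hj
          · exact Set.mem_insert _ _
          · exact Set.mem_insert_of_mem _ (Or.inr ⟨j, hj, rfl⟩)
  exact key (N + 1) k (by omega)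

/-- Fppf locally, a full rank representation can be brought to the standard form away from `ℓ`. -/
theorem near_exists_dropComponent_eq {ℓ c : ℂ} (hφ : IsUnimodalPair φ ℓ c) (hT : IsFullRank T)
    (p : PrimeSpectrum R) : Near p fun A f => ∃ g : (piGL φ).obj A,
      dropComponent ℓ (act g (baseChange f T)) =
        dropComponent ℓ (stdRep φ A) := by
  refine Near.mono (nearNormal_right (p := p) hφ hT 0) ?_
  rintro A f ⟨g, hg⟩
  refine ⟨g, ?_⟩
  funext i j hij
  unfold dropComponent
  split_ifs with hi
  · rfl
  · by_cases h0 : φ i = 0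
    · exact arrowNormal_of_eq_zero _ h0 j hij
    · refine hg i ?_ j hij
      rcases hφ.cases i h0 with ⟨k, rfl⟩ | ⟨k, rfl⟩
      · cases k with
        | zero => exact absurd (by simp) hi
        | succ k => exact Or.inl ⟨k, rfl⟩
      · exact Or.inr ⟨k, Nat.zero_le k, rfl⟩

end NormalForm

/-! ### The orbit of the standard representation -/

open QuiverRep

/-- The structure morphism of a `ℂ`-algebra. -/
def ofComplex (R : CommAlgCat.{0} ℂ) : complexPoint ⟶ R := CommAlgCat.ofHom (Algebra.ofId ℂ R)

/-- A flat and finitely presented neighbourhood of the point `Spec ℂ` has a section. -/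
theorem Near.exists_section {p : PrimeSpectrum complexPoint}
    {Q : ∀ A : CommAlgCat.{0} ℂ, (complexPoint ⟶ A) → Prop} (h : Near p Q) :
    ∃ (A : CommAlgCat.{0} ℂ) (f : complexPoint ⟶ A) (_ : A ⟶ complexPoint), Q A f := by
  obtain ⟨A, f, -, hfp, ⟨x, -⟩, hQ⟩ := h
  suffices h : Nonempty (A ⟶ complexPoint) from ⟨A, f, h.some, hQ⟩
  have h1 : f.hom.toRingHom = algebraMap ℂ A := RingHom.ext fun z => f.hom.commutes z
  rw [h1] at hfp
  have h2 : Algebra.FinitePresentation ℂ A := RingHom.finitePresentation_algebraMap.1 hfp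
  have h3 : Algebra.FiniteType ℂ A := inferInstance
  have : Nontrivial A := x.nontrivial
  obtain ⟨m, hm⟩ := Ideal.exists_maximal A
  let _ : Field (A ⧸ m) := Ideal.Quotient.field m
  have h4 : Algebra.FiniteType ℂ (A ⧸ m) := inferInstance
  -- The Nullstellensatz: a residue field of a finitely generated `ℂ`-algebra at a maximal ideal is
  -- finite over `ℂ`, hence equal to it.
  have h5 : Module.Finite ℂ (A ⧸ m) := finite_of_finite_type_of_isJacobsonRing ℂ (A ⧸ m)
  let e : ℂ ≃ₐ[ℂ] (A ⧸ m) := AlgEquiv.ofBijective (Algebra.ofId ℂ (A ⧸ m))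
    (IsAlgClosed.algebraMap_bijective_of_isIntegral)
  exact ⟨CommAlgCat.ofHom (e.symm.toAlgHom.comp (Ideal.Quotient.mkₐ ℂ m))⟩

theorem complexPoint_hom_ext {R : CommAlgCat.{0} ℂ} (f g : complexPoint ⟶ R) : f = g := by
  ext

section Orbit

variable {φ : ℂ → ℕ} {ℓ c : ℂ}

theorem constPoint_eq_baseChange (T : QuiverRep φ ℂ) (R : CommAlgCat.{0} ℂ) :
    constPoint T R = baseChange (R := complexPoint) (ofComplex R) T := rfl

theorem isFullRank_stdRep (R : Type) [CommRing R] : IsFullRank (stdRep φ R) := by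
  intro K _ f i j h
  unfold stdRep
  rw [stdMat_map, rank_stdMat]

theorem baseChange_stdRep {R S : CommAlgCat.{0} ℂ} (f : R ⟶ S) :
    baseChange f (stdRep φ R) = stdRep φ S := by
  funext i j h
  exact stdMat_map f.hom.toRingHom

theorem constPoint_stdRep (R : CommAlgCat.{0} ℂ) :
    constPoint (dropComponent ℓ (stdRep φ ℂ)) R = dropComponent ℓ (stdRep φ R) := by
  rw [constPoint_eq_baseChange, baseChange_dropComponent (R := complexPoint), baseChange_stdRep]

/-- The change of basis to the standard form exists over a neighbourhood of `Spec ℂ`, and a section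
of this neighbourhood turns it into a `ℂ`-point of the group. -/
theorem mem_projectedPart_iff (hφ : IsUnimodalPair φ ℓ c) (T : QuiverRep φ ℂ) :
    T ∈ projectedPart φ ℓ ↔ ∃ γ : (piGL φ).obj complexPoint,
      T = act γ (dropComponent ℓ (stdRep φ complexPoint)) := by
  constructor
  · rintro ⟨T', (hT' : IsFullRank T'), rfl⟩
    let p : PrimeSpectrum complexPoint := (⊥ : PrimeSpectrum ℂ)
    obtain ⟨A, f, s, g, hg⟩ :=
      (near_exists_dropComponent_eq (R := complexPoint) hφ hT' p).exists_section
    have h1 := congrArg (baseChange s) hg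
    rw [baseChange_dropComponent, baseChange_act, baseChange_dropComponent, baseChange_stdRep,
      ← baseChange_comp, complexPoint_hom_ext (f ≫ s) (𝟙 _), ← act_dropComponent] at h1
    refine ⟨((piGL φ).map s g)⁻¹, ?_⟩
    rw [← h1, act_inv_act]
    rfl
  · rintro ⟨γ, rfl⟩
    refine ⟨act γ (stdRep φ complexPoint), (isFullRank_stdRep ℂ).act (R := complexPoint) γ, ?_⟩
    exact (act_dropComponent γ _ ℓ).symm

end Orbit

/-! ### Stabilizers -/

section Stabilizer

variable {φ : ℂ → ℕ} {ℓ c : ℂ} {R : CommAlgCat.{0} ℂ}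

theorem mem_stabilizer {T : QuiverRep φ ℂ} {g : (piGL φ).obj R} :
    g ∈ (stabilizer T).pts R ↔ act g (constPoint T R) = constPoint T R := Iff.rfl

theorem mem_stabilizer_std {g : (piGL φ).obj R} :
    g ∈ (stabilizer (dropComponent ℓ (stdRep φ ℂ))).pts R ↔ ∀ i j, j = i + 1 → i ≠ ℓ →
      mat (glAt g j) * stdMat R (φ j) (φ i) = stdMat R (φ j) (φ i) * mat (glAt g i) := by
  rw [mem_stabilizer, constPoint_stdRep]
  have key : ∀ i j, j = i + 1 →
      (mat (glAt g j) * stdMat R (φ j) (φ i) = stdMat R (φ j) (φ i) * mat (glAt g i) ↔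
        mat (glAt g j) * stdMat R (φ j) (φ i) * mat (glAt g i)⁻¹ = stdMat R (φ j) (φ i)) := by
    intro i j _
    constructor
    · intro h
      rw [h, Matrix.mul_assoc, mat_mul_mat_inv, Matrix.mul_one]
    · intro h
      conv_rhs => rw [← h]
      rw [Matrix.mul_assoc, mat_inv_mul_mat, Matrix.mul_one]
  constructor
  · intro h i j hij hi
    rw [key i j hij]
    have h1 := congrFun (congrFun (congrFun h i) j) hij
    rw [act_apply] at h1
    unfold dropComponent at h1
    rwa [if_neg hi] at h1
  · intro h
    funext i j hij
    rw [act_apply]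
    unfold dropComponent
    split_ifs with hi
    · rw [Matrix.mul_zero, Matrix.zero_mul]
    · exact (key i j hij).1 (h i j hij hi)

/-- The product of the two outer identity matrices is the projection onto the first `m` coordinates,
and `g` maps the span of the first `m` basis vectors to itself. -/
theorem stdMat_mul_mul_stdMat_eq {n m : ℕ} (hmn : m ≤ n) (g : Matrix (Fin n) (Fin n) R)
    (h : ∀ a b : Fin n, b.1 < m → m ≤ a.1 → g a b = 0) :
    stdMat R n m * (stdMat R m n * (g * stdMat R n m)) = g * stdMat R n m := by
  ext a b
  rw [stdMat_mul_apply]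
  split_ifs with ha
  · rw [stdMat_mul_apply, dif_pos a.2]
  · rw [mul_stdMat_apply, dif_pos (b.2.trans_le hmn), h _ _ b.2 (not_lt.1 ha)]

/-- The dual version: the first `m` coordinates of `g v` depend only on the first `m` coordinates of
`v`. -/
theorem stdMat_mul_mul_stdMat_eq' {n m : ℕ} (hmn : m ≤ n) (g : Matrix (Fin n) (Fin n) R)
    (h : ∀ a b : Fin n, a.1 < m → m ≤ b.1 → g a b = 0) :
    stdMat R m n * g * stdMat R n m * stdMat R m n = stdMat R m n * g := by
  ext a b
  rw [mul_stdMat_apply]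
  split_ifs with hb
  · rw [mul_stdMat_apply, dif_pos b.2]
  · rw [stdMat_mul_apply, dif_pos (a.2.trans_le hmn), h _ _ a.2 (not_lt.1 hb)]

/-- The invertible matrix with entries `E' g E` for the rectangular identity matrices. -/
theorem eq_zero_of_mul_stdMat {n m : ℕ} {g : Matrix (Fin n) (Fin n) R}
    {x : Matrix (Fin m) (Fin m) R} (hx : g * stdMat R n m = stdMat R n m * x) (a b : Fin n)
    (hb : b.1 < m) (ha : m ≤ a.1) : g a b = 0 := by
  have h1 := congrFun (congrFun hx a) ⟨b.1, hb⟩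
  rwa [mul_stdMat_apply, dif_pos b.2, stdMat_mul_apply, dif_neg (not_lt.2 ha)] at h1

theorem eq_zero_of_stdMat_mul {n m : ℕ} {g : Matrix (Fin n) (Fin n) R}
    {x : Matrix (Fin m) (Fin m) R} (hx : stdMat R m n * g = x * stdMat R m n) (a b : Fin n)
    (ha : a.1 < m) (hb : m ≤ b.1) : g a b = 0 := by
  have h1 := congrFun (congrFun hx ⟨a.1, ha⟩) b
  rwa [stdMat_mul_apply, dif_pos a.2, mul_stdMat_apply, dif_neg (not_lt.2 hb)] at h1

/-- Dimensions increase towards `ℓ`, so the composite of the standard injections from `ℓ - k` to `ℓ`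
is again a rectangular identity. It intertwines because each of the injections does. -/
theorem mul_stdMat_left_chain {g : (piGL φ).obj R} (hφ : IsUnimodalPair φ ℓ c)
    (hg : g ∈ (stabilizer (dropComponent ℓ (stdRep φ ℂ))).pts R) (k : ℕ) :
    mat (glAt g ℓ) * stdMat R (φ ℓ) (φ (ℓ - k)) =
      stdMat R (φ ℓ) (φ (ℓ - k)) * mat (glAt g (ℓ - k)) := by
  induction k with
  | zero =>
    have h0 : ∀ i, i = ℓ → mat (glAt g ℓ) * stdMat R (φ ℓ) (φ i) =
        stdMat R (φ ℓ) (φ i) * mat (glAt g i) := by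
      rintro _ rfl
      rw [stdMat_self, Matrix.mul_one, Matrix.one_mul]
    exact h0 _ (by simp)
  | succ k ih =>
    have h1 := mem_stabilizer_std.1 hg (ℓ - (k + 1 : ℕ)) (ℓ - k) (by push_cast; ring) (by
      intro h
      have : ((k + 1 : ℕ) : ℂ) = 0 := by linear_combination -h
      exact absurd this (Nat.cast_ne_zero.2 (Nat.succ_ne_zero k)))
    have h2 : stdMat R (φ ℓ) (φ (ℓ - (k + 1 : ℕ))) =
        stdMat R (φ ℓ) (φ (ℓ - k)) * stdMat R (φ (ℓ - k)) (φ (ℓ - (k + 1 : ℕ))) :=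
      (stdMat_mul_stdMat (Or.inl (hφ.antitone_left (Nat.le_succ k)))).symm
    rw [h2, ← Matrix.mul_assoc, ih, Matrix.mul_assoc, h1, Matrix.mul_assoc]

/-- The same for the composite of the standard surjections from `c` to `c + k`, along which
dimensions decrease. -/
theorem mul_stdMat_right_chain {g : (piGL φ).obj R} (hφ : IsUnimodalPair φ ℓ c)
    (hg : g ∈ (stabilizer (dropComponent ℓ (stdRep φ ℂ))).pts R) (k : ℕ) :
    stdMat R (φ (c + k)) (φ c) * mat (glAt g c) =
      mat (glAt g (c + k)) * stdMat R (φ (c + k)) (φ c) := by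
  induction k with
  | zero =>
    have h0 : ∀ i, i = c → stdMat R (φ i) (φ c) * mat (glAt g c) =
        mat (glAt g i) * stdMat R (φ i) (φ c) := by
      rintro _ rfl
      rw [stdMat_self, Matrix.mul_one, Matrix.one_mul]
    exact h0 _ (by simp)
  | succ k ih =>
    have h1 := mem_stabilizer_std.1 hg (c + k) (c + (k + 1 : ℕ)) (by push_cast; ring) (by
      intro h
      exact hφ.left_ne_right 0 k (by rw [h]; simp))
    have h2 : stdMat R (φ (c + (k + 1 : ℕ))) (φ c) =
        stdMat R (φ (c + (k + 1 : ℕ))) (φ (c + k)) * stdMat R (φ (c + k)) (φ c) :=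
      (stdMat_mul_stdMat (Or.inr (hφ.antitone_right (Nat.le_succ k)))).symm
    rw [h2, Matrix.mul_assoc, ih, ← Matrix.mul_assoc, ← h1, Matrix.mul_assoc]

variable (φ ℓ c) in
/-- The standard flag in `V_ℓ`. -/
def leftFlag (k : ℕ) : Submodule ℂ (Fin (φ ℓ) → ℂ) :=
  coordSubmodule ℂ fun b => b.1 < φ (ℓ - k)

variable (φ c) in
/-- The standard flag in `V_c`. -/
def rightFlag (k : ℕ) : Submodule ℂ (Fin (φ c) → ℂ) :=
  coordSubmodule ℂ fun b => φ (c + k) ≤ b.1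

/-- The triangularity condition for `flagBlock` is tested at one step of the flag for each pair `a`,
`b`: the last step that still contains `b`. -/
theorem mem_flagStabilizer_leftFlag (hφ : IsUnimodalPair φ ℓ c) {g : (glFunctor (φ ℓ)).obj R} :
    g ∈ (flagStabilizer (leftFlag φ ℓ)).pts R ↔
      ∀ (k : ℕ) (a b : Fin (φ ℓ)), b.1 < φ (ℓ - k) → φ (ℓ - k) ≤ a.1 → mat g a b = 0 := by
  have h := hφ.exists_left_eq_zero
  have key := lt_iff_le_flagBlock (n := φ ℓ) (d := fun k : ℕ => φ (ℓ - k)) h hφ.antitone_left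
    (by simp)
  unfold leftFlag
  rw [flagStabilizer_coordSubmodule (OrderDual.toDual ∘ flagBlock (n := φ ℓ) (fun k : ℕ => φ (ℓ - k)) h) _ fun a b => ?_]
  · constructor
    · intro hg k a b hb ha
      refine hg ?_
      have h1 := (key b k).1 hb
      have h2 := (key a k).not.1 (not_lt.2 ha)
      exact OrderDual.toDual_lt_toDual.2 ((not_le.1 h2).trans_le h1)
    · intro hg a b hab
      have h1 : flagBlock (fun k : ℕ => φ (ℓ - k)) h a < flagBlock (fun k : ℕ => φ (ℓ - k)) h b := hab
      exact hg (flagBlock (fun k : ℕ => φ (ℓ - k)) h b) a b ((key b _).2 le_rfl)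
        (not_lt.1 ((key a _).not.2 (not_le.2 h1)))
  · simp only [key]
    exact ⟨fun h => ⟨_, le_rfl, not_le.2 h⟩, fun ⟨_, h1, h2⟩ => (not_le.1 h2).trans_le h1⟩

theorem mem_flagStabilizer_rightFlag (hφ : IsUnimodalPair φ ℓ c) {g : (glFunctor (φ c)).obj R} :
    g ∈ (flagStabilizer (rightFlag φ c)).pts R ↔
      ∀ (k : ℕ) (a b : Fin (φ c)), a.1 < φ (c + k) → φ (c + k) ≤ b.1 → mat g a b = 0 := by
  have h := hφ.exists_right_eq_zero
  have key := lt_iff_le_flagBlock (n := φ c) (d := fun k : ℕ => φ (c + k)) h hφ.antitone_right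
    (by simp)
  unfold rightFlag
  rw [flagStabilizer_coordSubmodule (flagBlock (n := φ c) (fun k : ℕ => φ (c + k)) h) _ fun a b => ?_]
  · constructor
    · intro hg k a b ha hb
      refine hg ?_
      have h1 := (key a k).1 ha
      have h2 := (key b k).not.1 (not_lt.2 hb)
      exact (not_le.1 h2).trans_le h1
    · intro hg a b hab
      exact hg (flagBlock (fun k : ℕ => φ (c + k)) h a) a b ((key a _).2 le_rfl)
        (not_lt.1 ((key b _).not.2 (not_le.2 hab)))
  · simp only [← not_lt, key, not_not]
    exact ⟨fun h => ⟨_, h, lt_irrefl _⟩, fun ⟨_, h1, h2⟩ => h1.trans_le (not_lt.1 h2)⟩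

/-- The stabilizer of the standard representation is the product of two flag stabilizers. -/
theorem stabilizer_std_left (hφ : IsUnimodalPair φ ℓ c) {g : (piGL φ).obj R}
    (hg : g ∈ (stabilizer (dropComponent ℓ (stdRep φ ℂ))).pts R) :
    glAt g ℓ ∈ (flagStabilizer (leftFlag φ ℓ)).pts R :=
  (mem_flagStabilizer_leftFlag hφ).2 fun k a b hb ha =>
    eq_zero_of_mul_stdMat (mul_stdMat_left_chain hφ hg k) a b hb ha

theorem stabilizer_std_right (hφ : IsUnimodalPair φ ℓ c) {g : (piGL φ).obj R}
    (hg : g ∈ (stabilizer (dropComponent ℓ (stdRep φ ℂ))).pts R) :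
    glAt g c ∈ (flagStabilizer (rightFlag φ c)).pts R :=
  (mem_flagStabilizer_rightFlag hφ).2 fun k a b ha hb =>
    eq_zero_of_stdMat_mul (mul_stdMat_right_chain hφ hg k) a b ha hb

/-- The rectangular identities from the left spaces into `V_ℓ` have left inverses, and those from
`V_c` onto the right spaces have right inverses. The intertwining relations thus recover every
component from the two at `ℓ` and `c`. -/
theorem stabilizer_std_ext (hφ : IsUnimodalPair φ ℓ c) {g h : (piGL φ).obj R}
    (hg : g ∈ (stabilizer (dropComponent ℓ (stdRep φ ℂ))).pts R)
    (hh : h ∈ (stabilizer (dropComponent ℓ (stdRep φ ℂ))).pts R)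
    (h1 : glAt g ℓ = glAt h ℓ) (h2 : glAt g c = glAt h c) : g = h := by
  refine funext fun i => Units.ext ?_
  change mat (glAt g i) = mat (glAt h i)
  by_cases h0 : φ i = 0
  · ext a b
    exact absurd a.2 (by omega)
  rcases hφ.cases i h0 with ⟨k, rfl⟩ | ⟨k, rfl⟩
  · have hle : φ (ℓ - k) ≤ φ ℓ := by simpa using hφ.antitone_left (Nat.zero_le k)
    have h3 := mul_stdMat_left_chain hφ hg k
    rw [h1, mul_stdMat_left_chain hφ hh k] at h3
    have h4 := congrArg (stdMat R (φ (ℓ - k)) (φ ℓ) * ·) h3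
    simp only [← Matrix.mul_assoc, stdMat_mul_stdMat_self hle, Matrix.one_mul] at h4
    exact h4.symm
  · have hle : φ (c + k) ≤ φ c := by simpa using hφ.antitone_right (Nat.zero_le k)
    have h3 := mul_stdMat_right_chain hφ hg k
    rw [h2, mul_stdMat_right_chain hφ hh k] at h3
    have h4 := congrArg (· * stdMat R (φ c) (φ (c + k))) h3
    simp only [Matrix.mul_assoc, stdMat_mul_stdMat_self hle, Matrix.mul_one] at h4
    exact h4.symm

end Stabilizer

/-! ### Lifting pairs of flag-preserving matrices to the stabilizer. -/

section StabilizerExistence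

variable {φ : ℂ → ℕ} {ℓ c : ℂ} {R : CommAlgCat.{0} ℂ}

theorem IsUnimodalPair.le_left (hφ : IsUnimodalPair φ ℓ c) (i : ℂ) : φ i ≤ φ ℓ := by
  by_cases h0 : φ i = 0
  · omega
  rcases hφ.cases i h0 with ⟨k, rfl⟩ | ⟨k, rfl⟩
  · simpa using hφ.antitone_left (Nat.zero_le k)
  · rw [hφ.eq]
    simpa using hφ.antitone_right (Nat.zero_le k)

/-- The corner of an invertible matrix preserving a coordinate subspace. -/
def glCorner {n m : ℕ} (g : (glFunctor n).obj R)
    (h : stdMat R m n * mat g * stdMat R n m * (stdMat R m n * mat g⁻¹ * stdMat R n m) = 1)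
    (h' : stdMat R m n * mat g⁻¹ * stdMat R n m * (stdMat R m n * mat g * stdMat R n m) = 1) :
    (glFunctor m).obj R :=
  (⟨stdMat R m n * mat g * stdMat R n m, stdMat R m n * mat g⁻¹ * stdMat R n m, h, h'⟩ :
    GL (Fin m) R)

/-- Either `h` preserves the coordinate subspace or `g` descends to the coordinate quotient; in both
cases the projector between the two factors can be dropped. -/
theorem corner_mul_corner {n m : ℕ} (hmn : m ≤ n) {g h : Matrix (Fin n) (Fin n) R}
    (hgh : g * h = 1)
    (hh : stdMat R n m * (stdMat R m n * (h * stdMat R n m)) = h * stdMat R n m ∨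
      stdMat R m n * g * stdMat R n m * stdMat R m n = stdMat R m n * g) :
    stdMat R m n * g * stdMat R n m * (stdMat R m n * h * stdMat R n m) = 1 := by
  rcases hh with hh | hh
  · calc _ = stdMat R m n * g * (stdMat R n m * (stdMat R m n * (h * stdMat R n m))) := by
          simp only [Matrix.mul_assoc]
      _ = stdMat R m n * (g * h) * stdMat R n m := by rw [hh]; simp only [Matrix.mul_assoc]
      _ = 1 := by rw [hgh, Matrix.mul_one, stdMat_mul_stdMat_self hmn]
  · calc _ = (stdMat R m n * g * stdMat R n m * stdMat R m n) * (h * stdMat R n m) := by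
          simp only [Matrix.mul_assoc]
      _ = stdMat R m n * (g * h) * stdMat R n m := by rw [hh]; simp only [Matrix.mul_assoc]
      _ = 1 := by rw [hgh, Matrix.mul_one, stdMat_mul_stdMat_self hmn]

/-- The component at `i` is the upper left corner of `u` if `i` lies on the left chain, and of `v`
otherwise. Preservation of the flags makes the corners of inverse matrices inverse to each other,
and makes the standard arrows intertwine them. -/
theorem exists_stabilizer_std (hφ : IsUnimodalPair φ ℓ c) {u : (glFunctor (φ ℓ)).obj R}
    {v : (glFunctor (φ c)).obj R} (hu : u ∈ (flagStabilizer (leftFlag φ ℓ)).pts R)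
    (hv : v ∈ (flagStabilizer (rightFlag φ c)).pts R) :
    ∃ g ∈ (stabilizer (dropComponent ℓ (stdRep φ ℂ))).pts R, glAt g ℓ = u ∧ glAt g c = v := by
  classical
  have hleft : ∀ w : (glFunctor (φ ℓ)).obj R, w ∈ (flagStabilizer (leftFlag φ ℓ)).pts R →
      ∀ i, (∃ k : ℕ, i = ℓ - k) →
      stdMat R (φ ℓ) (φ i) * (stdMat R (φ i) (φ ℓ) * (mat w * stdMat R (φ ℓ) (φ i))) =
        mat w * stdMat R (φ ℓ) (φ i) := by
    rintro w hw _ ⟨k, rfl⟩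
    exact stdMat_mul_mul_stdMat_eq (hφ.le_left _) _
      ((mem_flagStabilizer_leftFlag hφ).1 hw k)
  -- Indices on neither chain are put together with the right chain; there `φ i = 0` and nothing is
  -- to be shown.
  have hright : ∀ w : (glFunctor (φ c)).obj R, w ∈ (flagStabilizer (rightFlag φ c)).pts R →
      ∀ i, (¬ ∃ k : ℕ, i = ℓ - k) →
      stdMat R (φ i) (φ c) * mat w * stdMat R (φ c) (φ i) * stdMat R (φ i) (φ c) =
        stdMat R (φ i) (φ c) * mat w := by
    intro w hw i hi
    by_cases h0 : φ i = 0
    · ext a b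
      exact absurd a.2 (by omega)
    obtain ⟨k, rfl⟩ := (hφ.cases i h0).resolve_left hi
    exact stdMat_mul_mul_stdMat_eq' (hφ.eq ▸ hφ.le_left _) _
      ((mem_flagStabilizer_rightFlag hφ).1 hw k)
  have hle := hφ.le_left
  have hle' : ∀ i, φ i ≤ φ c := fun i => hφ.eq ▸ hle i
  have hG : ∀ i, ∃ g : (glFunctor (φ i)).obj R,
      ((∃ k : ℕ, i = ℓ - k) → mat g = stdMat R (φ i) (φ ℓ) * mat u * stdMat R (φ ℓ) (φ i)) ∧
      ((¬ ∃ k : ℕ, i = ℓ - k) →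
        mat g = stdMat R (φ i) (φ c) * mat v * stdMat R (φ c) (φ i)) := by
    intro i
    by_cases hi : ∃ k : ℕ, i = ℓ - k
    · exact ⟨glCorner u
        (corner_mul_corner (hle i) (mat_mul_mat_inv u) (Or.inl (hleft _ (inv_mem hu) i hi)))
        (corner_mul_corner (hle i) (mat_inv_mul_mat u) (Or.inl (hleft _ hu i hi))),
        fun _ => rfl, fun h => absurd hi h⟩
    · exact ⟨glCorner v
        (corner_mul_corner (hle' i) (mat_mul_mat_inv v) (Or.inr (hright _ hv i hi)))
        (corner_mul_corner (hle' i) (mat_inv_mul_mat v) (Or.inr (hright _ (inv_mem hv) i hi))),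
        fun h => absurd h hi, fun _ => rfl⟩
  choose G hG1 hG2 using hG
  have hcl : ¬ ∃ k : ℕ, c = ℓ - k := by
    rintro ⟨k, hk⟩
    exact hφ.left_ne_right k 0 (by rw [← hk]; simp)
  refine ⟨fun i => G i, mem_stabilizer_std.2 fun i j hij hi => ?_, Units.ext ?_, Units.ext ?_⟩
  · change mat (G j) * stdMat R (φ j) (φ i) = stdMat R (φ j) (φ i) * mat (G i)
    by_cases h0 : φ i = 0
    · ext a b
      exact absurd b.2 (by omega)
    by_cases h1 : ∃ k : ℕ, i = ℓ - k
    · obtain ⟨k, hk⟩ := h1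
      cases k with
      | zero => exact absurd (by simpa using hk) hi
      | succ k =>
        have hj : j = ℓ - k := by
          rw [hij, hk]
          push_cast
          ring
        have hmono : φ i ≤ φ j := by
          rw [hj, hk]
          exact hφ.antitone_left (Nat.le_succ k)
        rw [hG1 i ⟨_, hk⟩, hG1 j ⟨_, hj⟩]
        have e1 : stdMat R (φ ℓ) (φ j) * stdMat R (φ j) (φ i) = stdMat R (φ ℓ) (φ i) :=
          stdMat_mul_stdMat (Or.inl hmono)
        have e2 : stdMat R (φ j) (φ ℓ) * stdMat R (φ ℓ) (φ i) = stdMat R (φ j) (φ i) :=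
          stdMat_mul_stdMat (Or.inl (hle i))
        calc _ = stdMat R (φ j) (φ ℓ) * (mat u * stdMat R (φ ℓ) (φ i)) := by
              rw [← e1]; simp only [Matrix.mul_assoc]
          _ = stdMat R (φ j) (φ ℓ) * stdMat R (φ ℓ) (φ i) *
                (stdMat R (φ i) (φ ℓ) * (mat u * stdMat R (φ ℓ) (φ i))) := by
              conv_lhs => rw [← hleft u hu i ⟨_, hk⟩]
              simp only [Matrix.mul_assoc]
          _ = _ := by rw [e2]; simp only [Matrix.mul_assoc]
    · obtain ⟨k, hk⟩ := (hφ.cases i h0).resolve_left h1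
      have hj : j = c + (k + 1 : ℕ) := by
        rw [hij, hk]
        push_cast
        ring
      have hmono : φ j ≤ φ i := by
        rw [hj, hk]
        exact hφ.antitone_right (Nat.le_succ k)
      have hj' : ¬ ∃ k : ℕ, j = ℓ - k := by
        rintro ⟨k', hk'⟩
        exact hφ.left_ne_right k' (k + 1) (by rw [← hk', hj])
      rw [hG2 i h1, hG2 j hj']
      have e1 : stdMat R (φ j) (φ i) * stdMat R (φ i) (φ c) = stdMat R (φ j) (φ c) :=
        stdMat_mul_stdMat (Or.inr hmono)
      have e2 : stdMat R (φ j) (φ c) * stdMat R (φ c) (φ i) = stdMat R (φ j) (φ i) :=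
        stdMat_mul_stdMat (Or.inl (hle' i))
      calc _ = stdMat R (φ j) (φ c) * mat v * stdMat R (φ c) (φ j) *
              (stdMat R (φ j) (φ c) * stdMat R (φ c) (φ i)) := by rw [e2]
        _ = (stdMat R (φ j) (φ c) * mat v * stdMat R (φ c) (φ j) * stdMat R (φ j) (φ c)) *
              stdMat R (φ c) (φ i) := by simp only [Matrix.mul_assoc]
        _ = _ := by rw [hright v hv j hj', ← e1]; simp only [Matrix.mul_assoc]
  · change mat (G ℓ) = mat u
    rw [hG1 ℓ ⟨0, by simp⟩, stdMat_self, Matrix.one_mul, Matrix.mul_one]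
  · change mat (G c) = mat v
    rw [hG2 c hcl, stdMat_self, Matrix.one_mul, Matrix.mul_one]

end StabilizerExistence

/-! ### Stabilizers of the points of the projected part -/

section Conjugate

variable {φ : ℂ → ℕ} {ℓ c : ℂ} {R : CommAlgCat.{0} ℂ}

/-- The constant `R`-point of `∏ GL(V_i)` given by a `ℂ`-point. -/
def constPi (γ : (piGL φ).obj complexPoint) (R : CommAlgCat.{0} ℂ) : (piGL φ).obj R :=
  (piGL φ).map (ofComplex R) γ

theorem constPoint_act (γ : (piGL φ).obj complexPoint) (T : QuiverRep φ complexPoint) :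
    constPoint (act γ T) R = act (constPi γ R) (constPoint T R) :=
  baseChange_act γ T (ofComplex R)

theorem mem_stabilizer_act {γ : (piGL φ).obj complexPoint} {T : QuiverRep φ complexPoint}
    {g : (piGL φ).obj R} : g ∈ (stabilizer (act γ T)).pts R ↔
      (constPi γ R)⁻¹ * g * constPi γ R ∈ (stabilizer (φ := φ) T).pts R := by
  rw [mem_stabilizer, mem_stabilizer, constPoint_act, act_mul, act_mul]
  constructor
  · intro h
    rw [h, act_inv_act]
  · intro h
    have h1 := congrArg (act (constPi γ R)) h
    rwa [act_act_inv] at h1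

theorem imageFlag_act (γ : (piGL φ).obj complexPoint) (T : QuiverRep φ complexPoint) (k : ℕ)
    (j : ℂ) : imageFlag (act γ T) k j =
      (imageFlag (φ := φ) T k j).map (mat (glAt γ j)).mulVecLin := by
  induction k generalizing j with
  | zero =>
    symm
    rw [imageFlag, imageFlag, eq_top_iff]
    intro v _
    refine ⟨(mat (glAt γ j)⁻¹).mulVec v, trivial, ?_⟩
    rw [Matrix.mulVecLin_apply, Matrix.mulVec_mulVec, mat_mul_mat_inv]
    exact Matrix.one_mulVec v
  | succ k ih =>
    rw [imageFlag, imageFlag, ih, act_apply, Matrix.mulVecLin_mul, Matrix.mulVecLin_mul,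
      Submodule.map_comp, ← map_mulVecLin_mul, mat_inv_mul_mat]
    rw [Submodule.map_comp]
    congr 2
    exact map_mulVecLin_one _

theorem kernelFlag_act (γ : (piGL φ).obj complexPoint) (T : QuiverRep φ complexPoint) (k : ℕ)
    (j : ℂ) : kernelFlag (act γ T) k j =
      (kernelFlag (φ := φ) T k j).map (mat (glAt γ j)).mulVecLin := by
  -- For an invertible matrix the image equals the preimage under the inverse, a form that composes
  -- with the preimages defining the kernels.
  have hinv : ∀ (j : ℂ) (F : Submodule ℂ (Fin (φ j) → ℂ)),
      F.map (mat (glAt γ j)).mulVecLin = F.comap (mat (glAt γ j)⁻¹).mulVecLin := by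
    intro j F
    ext v
    constructor
    · rintro ⟨w, hw, rfl⟩
      rw [Submodule.mem_comap, Matrix.mulVecLin_apply, Matrix.mulVecLin_apply,
        Matrix.mulVec_mulVec, mat_inv_mul_mat]
      exact (Matrix.one_mulVec w).symm ▸ hw
    · intro hv
      refine ⟨_, hv, ?_⟩
      rw [Matrix.mulVecLin_apply, Matrix.mulVecLin_apply, Matrix.mulVec_mulVec, mat_mul_mat_inv]
      exact Matrix.one_mulVec v
  induction k generalizing j with
  | zero =>
    rw [kernelFlag, kernelFlag, Submodule.map_bot]
  | succ k ih =>
    rw [kernelFlag, kernelFlag, ih, act_apply, hinv, hinv, ← Submodule.comap_comp,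
      ← Submodule.comap_comp, ← Matrix.mulVecLin_mul, ← Matrix.mulVecLin_mul]
    congr 2
    rw [← Matrix.mul_assoc, ← Matrix.mul_assoc, mat_inv_mul_mat]
    exact congrArg (· * _) (Matrix.one_mul _)

theorem map_coordSubmodule_stdMat {m n d : ℕ} (hdn : d ≤ n) (hnm : n ≤ m) :
    (coordSubmodule ℂ fun b : Fin n => b.1 < d).map (stdMat ℂ m n).mulVecLin =
      coordSubmodule ℂ fun b : Fin m => b.1 < d := by
  have hcol : ∀ b : Fin n, (stdMat ℂ m n).mulVec (Pi.single b 1) =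
      Pi.single (b.castLE hnm) 1 := by
    intro b
    rw [Matrix.mulVec_single_one]
    ext a
    simp [stdMat_apply, Pi.single_apply, Fin.ext_iff]
  apply le_antisymm
  · rw [Submodule.map_le_iff_le_comap]
    refine coordSubmodule_le fun b hb => ?_
    rw [Submodule.mem_comap, Matrix.mulVecLin_apply, hcol]
    exact single_mem_coordSubmodule hb
  · refine coordSubmodule_le fun b hb => ?_
    exact ⟨Pi.single ⟨b.1, hb.trans_le hdn⟩ 1,
      single_mem_coordSubmodule (R := ℂ) (b := ⟨b.1, hb.trans_le hdn⟩) hb, hcol _⟩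

theorem comap_coordSubmodule_stdMat {m n d : ℕ} (hdm : d ≤ m) (hmn : m ≤ n) :
    (coordSubmodule ℂ fun b : Fin m => d ≤ b.1).comap (stdMat ℂ m n).mulVecLin =
      coordSubmodule ℂ fun b : Fin n => d ≤ b.1 := by
  have hval : ∀ (v : Fin n → ℂ) (a : Fin m), (stdMat ℂ m n).mulVec v a = v (a.castLE hmn) := by
    intro v a
    rw [Matrix.mulVec, dotProduct, Finset.sum_eq_single (a.castLE hmn)]
    · simp [stdMat_apply]
    · intro b _ hb
      rw [stdMat_apply, if_neg, zero_mul]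
      intro h
      exact hb (Fin.ext h.symm)
    · simp
  ext v
  rw [Submodule.mem_comap, Matrix.mulVecLin_apply]
  constructor
  · intro h a ha
    have h1 : a.1 < m := (not_le.1 ha).trans_le hdm
    have h2 := h ⟨a.1, h1⟩ ha
    rwa [hval] at h2
  · intro h a ha
    rw [hval]
    exact h _ ha

/-- The recursion for the images moves to the neighbouring vertex on the left, so the induction has
to cover all vertices `ℓ - j` at once. -/
theorem imageFlag_std (hφ : IsUnimodalPair φ ℓ c) (k j : ℕ) :
    imageFlag (dropComponent ℓ (stdRep φ ℂ)) k (ℓ - j) =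
      coordSubmodule ℂ fun b => b.1 < φ (ℓ - (j + k : ℕ)) := by
  induction k generalizing j with
  | zero =>
    rw [imageFlag, eq_comm, eq_top_iff]
    exact fun v _ a ha => absurd a.2 ha
  | succ k ih =>
    rw [imageFlag]
    -- The recursion produces the vertex `ℓ - j - 1`, equal to `ℓ - (j + 1)` only propositionally; a
    -- general `i` allows substitution in the dependent types.
    have key : ∀ i (hi : ℓ - j = i + 1), i = ℓ - (j + 1 : ℕ) →
        (imageFlag (dropComponent ℓ (stdRep φ ℂ)) k i).map
          (dropComponent ℓ (stdRep φ ℂ) i (ℓ - j) hi).mulVecLin =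
        coordSubmodule ℂ fun b => b.1 < φ (ℓ - (j + (k + 1) : ℕ)) := by
      rintro i hi rfl
      have hne : ℓ - (j + 1 : ℕ) ≠ ℓ := by
        intro h
        have : ((j + 1 : ℕ) : ℂ) = 0 := by linear_combination -h
        exact absurd this (Nat.cast_ne_zero.2 (Nat.succ_ne_zero j))
      unfold dropComponent
      rw [if_neg hne]
      change (imageFlag (dropComponent ℓ (stdRep φ ℂ)) k (ℓ - (j + 1 : ℕ))).map
        (stdMat ℂ _ _).mulVecLin = _
      rw [ih (j + 1), map_coordSubmodule_stdMat, show j + 1 + k = j + (k + 1) by omega]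
      · exact hφ.antitone_left (by omega)
      · exact hφ.antitone_left (by omega)
    exact key _ _ (by push_cast; ring)

theorem kernelFlag_std (hφ : IsUnimodalPair φ ℓ c) (k j : ℕ) :
    kernelFlag (dropComponent ℓ (stdRep φ ℂ)) k (c + j) =
      coordSubmodule ℂ fun b => φ (c + (j + k : ℕ)) ≤ b.1 := by
  induction k generalizing j with
  | zero =>
    rw [kernelFlag, eq_comm, eq_bot_iff]
    exact fun v hv => funext fun a => hv a (not_le.2 a.2)
  | succ k ih =>
    rw [kernelFlag]
    have key : ∀ i (hi : i = c + j + 1), i = c + (j + 1 : ℕ) →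
        (kernelFlag (dropComponent ℓ (stdRep φ ℂ)) k i).comap
          (dropComponent ℓ (stdRep φ ℂ) (c + j) i hi).mulVecLin =
        coordSubmodule ℂ fun b => φ (c + (j + (k + 1) : ℕ)) ≤ b.1 := by
      rintro i hi rfl
      have hne : c + j ≠ ℓ := fun h => hφ.left_ne_right 0 j (by rw [h]; simp)
      unfold dropComponent
      rw [if_neg hne]
      change (kernelFlag (dropComponent ℓ (stdRep φ ℂ)) k (c + (j + 1 : ℕ))).comap
        (stdMat ℂ _ _).mulVecLin = _
      rw [ih (j + 1), comap_coordSubmodule_stdMat, show j + 1 + k = j + (k + 1) by omega]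
      · exact hφ.antitone_right (by omega)
      · exact hφ.antitone_right (by omega)
    exact key _ _ (by push_cast; ring)

theorem imageFlag_std_eq (hφ : IsUnimodalPair φ ℓ c) :
    (fun k => imageFlag (dropComponent ℓ (stdRep φ ℂ)) k ℓ) = leftFlag φ ℓ := by
  funext k
  have h : ∀ j, j = ℓ - (0 : ℕ) → imageFlag (dropComponent ℓ (stdRep φ ℂ)) k j =
      coordSubmodule ℂ fun b => b.1 < φ (ℓ - k) := by
    rintro _ rfl
    rw [imageFlag_std hφ, zero_add]
  exact h ℓ (by simp)

theorem kernelFlag_std_eq (hφ : IsUnimodalPair φ ℓ c) :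
    (fun k => kernelFlag (dropComponent ℓ (stdRep φ ℂ)) k c) = rightFlag φ c := by
  funext k
  have h : ∀ j, j = c + (0 : ℕ) → kernelFlag (dropComponent ℓ (stdRep φ ℂ)) k j =
      coordSubmodule ℂ fun b => φ (c + k) ≤ b.1 := by
    rintro _ rfl
    rw [kernelFlag_std hφ, zero_add]
  exact h c (by simp)

end Conjugate

/-! ### Images of the stabilizers of the points of the projected part. -/

section StabilizerImages

variable {φ : ℂ → ℕ} {ℓ c : ℂ} {R : CommAlgCat.{0} ℂ}

/-- Polynomial equations can be tested on a covering. A closed subgroup containing the naive image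
of a homomorphism therefore contains its fppf image. -/
theorem SubgroupFunctor.IsClosed.mem_of_local {n : ℕ} {H : SubgroupFunctor (glFunctor n)}
    (hH : H.IsClosed) {S : Sieve (op R)} (hS : S ∈ fppfTopology (op R)) {g : (glFunctor n).obj R}
    (h : ∀ (A : CommAlgCat.{0} ℂ) (f : R ⟶ A), S f.op → (glFunctor n).map f g ∈ H.pts A) :
    g ∈ H.pts R := by
  obtain ⟨E, hE⟩ := hH
  refine (hE R g).2 fun p hp => eq_of_mem_fppfTopology hS fun A f hf => ?_
  rw [map_zero]
  have h1 := (hE A _).1 (h A f hf) p hp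
  rw [← h1]
  simp only [mat_map, Matrix.map_apply]
  exact (DFunLike.congr_fun (MvPolynomial.comp_aeval (fun ij : Fin n × Fin n => mat g ij.1 ij.2)
    f.hom) p)

/-- A `ℂ`-point of `GL_n` as an invertible matrix. -/
def complexGL {n : ℕ} (g : (glFunctor n).obj complexPoint) : GL (Fin n) ℂ := g

section conj

variable (γ : (piGL φ).obj complexPoint)

theorem flagStabilizer_imageFlag_act (hφ : IsUnimodalPair φ ℓ c) :
    flagStabilizer (fun k => imageFlag (act γ (dropComponent ℓ (stdRep φ ℂ))) k ℓ) =
      SubgroupFunctor.conj (complexGL (glAt γ ℓ)) (flagStabilizer (leftFlag φ ℓ)) := by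
  rw [← imageFlag_std_eq hφ, ← SubgroupFunctor.flagStabilizer_map]
  congr 1
  funext k
  exact imageFlag_act γ _ k ℓ

theorem flagStabilizer_kernelFlag_act (hφ : IsUnimodalPair φ ℓ c) :
    flagStabilizer (fun k => kernelFlag (act γ (dropComponent ℓ (stdRep φ ℂ))) k c) =
      SubgroupFunctor.conj (complexGL (glAt γ c)) (flagStabilizer (rightFlag φ c)) := by
  rw [← kernelFlag_std_eq hφ, ← SubgroupFunctor.flagStabilizer_map]
  congr 1
  funext k
  exact kernelFlag_act γ _ k c

end conj

variable {T : QuiverRep φ ℂ}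

theorem stabilizer_left (hφ : IsUnimodalPair φ ℓ c) (hT : T ∈ projectedPart φ ℓ)
    {g : (piGL φ).obj R} (hg : g ∈ (stabilizer T).pts R) :
    glAt g ℓ ∈ (flagStabilizer fun k => imageFlag T k ℓ).pts R := by
  obtain ⟨γ, rfl⟩ := (mem_projectedPart_iff hφ T).1 hT
  rw [flagStabilizer_imageFlag_act γ hφ, SubgroupFunctor.mem_conj]
  exact stabilizer_std_left hφ (mem_stabilizer_act.1 hg)

theorem stabilizer_right (hφ : IsUnimodalPair φ ℓ c) (hT : T ∈ projectedPart φ ℓ)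
    {g : (piGL φ).obj R} (hg : g ∈ (stabilizer T).pts R) :
    glAt g c ∈ (flagStabilizer fun k => kernelFlag T k c).pts R := by
  obtain ⟨γ, rfl⟩ := (mem_projectedPart_iff hφ T).1 hT
  rw [flagStabilizer_kernelFlag_act γ hφ, SubgroupFunctor.mem_conj]
  exact stabilizer_std_right hφ (mem_stabilizer_act.1 hg)

theorem stabilizer_ext (hφ : IsUnimodalPair φ ℓ c) (hT : T ∈ projectedPart φ ℓ)
    {g h : (piGL φ).obj R} (hg : g ∈ (stabilizer T).pts R) (hh : h ∈ (stabilizer T).pts R)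
    (h1 : glAt g ℓ = glAt h ℓ) (h2 : glAt g c = glAt h c) : g = h := by
  obtain ⟨γ, rfl⟩ := (mem_projectedPart_iff hφ T).1 hT
  have h3 := stabilizer_std_ext hφ (mem_stabilizer_act.1 hg) (mem_stabilizer_act.1 hh)
    (by rw [glAt_mul, glAt_mul, glAt_mul, glAt_mul, h1])
    (by rw [glAt_mul, glAt_mul, glAt_mul, glAt_mul, h2])
  exact mul_left_cancel (mul_right_cancel h3)

theorem exists_stabilizer (hφ : IsUnimodalPair φ ℓ c) (hT : T ∈ projectedPart φ ℓ)
    {u : (glFunctor (φ ℓ)).obj R} {v : (glFunctor (φ c)).obj R}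
    (hu : u ∈ (flagStabilizer fun k => imageFlag T k ℓ).pts R)
    (hv : v ∈ (flagStabilizer fun k => kernelFlag T k c).pts R) :
    ∃ g ∈ (stabilizer T).pts R, glAt g ℓ = u ∧ glAt g c = v := by
  obtain ⟨γ, rfl⟩ := (mem_projectedPart_iff hφ T).1 hT
  rw [flagStabilizer_imageFlag_act γ hφ, SubgroupFunctor.mem_conj] at hu
  rw [flagStabilizer_kernelFlag_act γ hφ, SubgroupFunctor.mem_conj] at hv
  obtain ⟨g, hg, h1, h2⟩ := exists_stabilizer_std hφ hu hv
  refine ⟨constPi γ R * g * (constPi γ R)⁻¹, mem_stabilizer_act.2 ?_, ?_, ?_⟩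
  · simpa [mul_assoc] using hg
  · rw [glAt_mul, glAt_mul, h1, glAt_inv,
      show glAt (constPi γ R) ℓ = constGL (complexGL (glAt γ ℓ)) R from rfl]
    simp [mul_assoc]
  · rw [glAt_mul, glAt_mul, h2, glAt_inv,
      show glAt (constPi γ R) c = constGL (complexGL (glAt γ c)) R from rfl]
    simp [mul_assoc]

theorem isParabolic_leftFlag (hφ : IsUnimodalPair φ ℓ c) :
    (flagStabilizer (leftFlag φ ℓ)).IsParabolic ∧
      ∃ L, (flagStabilizer (leftFlag φ ℓ)).IsLevi L ∧
        Nonempty (L.toFunctor ≅ piGL fun k : ℕ => φ (ℓ - k) - φ (ℓ - k - 1)) := by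
  have h := isParabolic_stabilizer_decreasing (n := φ ℓ) (d := fun k : ℕ => φ (ℓ - k))
    hφ.exists_left_eq_zero hφ.antitone_left (by simp)
  have hd : (fun k : ℕ => φ (ℓ - k) - φ (ℓ - (k + 1 : ℕ))) =
      fun k : ℕ => φ (ℓ - k) - φ (ℓ - k - 1) := by
    funext k
    rw [Nat.cast_succ, sub_add_eq_sub_sub]
  rw [hd] at h
  exact h

theorem isParabolic_rightFlag (hφ : IsUnimodalPair φ ℓ c) :
    (flagStabilizer (rightFlag φ c)).IsParabolic ∧
      ∃ L, (flagStabilizer (rightFlag φ c)).IsLevi L ∧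
        Nonempty (L.toFunctor ≅ piGL fun k : ℕ => φ (c + k) - φ (c + k + 1)) := by
  have h := isParabolic_stabilizer_increasing (n := φ c) (d := fun k : ℕ => φ (c + k))
    hφ.exists_right_eq_zero hφ.antitone_right (by simp)
  have hd : (fun k : ℕ => φ (c + k) - φ (c + (k + 1 : ℕ))) =
      fun k : ℕ => φ (c + k) - φ (c + k + 1) := by
    funext k
    rw [Nat.cast_succ, add_assoc]
  rw [hd] at h
  exact h

theorem isParabolic_imageFlag (hφ : IsUnimodalPair φ ℓ c) (hT : T ∈ projectedPart φ ℓ) :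
    (flagStabilizer fun k => imageFlag T k ℓ).IsParabolic ∧
      ∃ L, (flagStabilizer fun k => imageFlag T k ℓ).IsLevi L ∧
        Nonempty (L.toFunctor ≅ piGL fun k : ℕ => φ (ℓ - k) - φ (ℓ - k - 1)) := by
  obtain ⟨γ, rfl⟩ := (mem_projectedPart_iff hφ T).1 hT
  obtain ⟨h1, L, hL, ⟨e⟩⟩ := isParabolic_leftFlag hφ
  rw [flagStabilizer_imageFlag_act γ hφ]
  exact ⟨h1.conj, _, hL.conj, ⟨(SubgroupFunctor.nonempty_conj_iso (complexGL (glAt γ ℓ)) L).some.trans e⟩⟩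

theorem isParabolic_kernelFlag (hφ : IsUnimodalPair φ ℓ c) (hT : T ∈ projectedPart φ ℓ) :
    (flagStabilizer fun k => kernelFlag T k c).IsParabolic ∧
      ∃ L, (flagStabilizer fun k => kernelFlag T k c).IsLevi L ∧
        Nonempty (L.toFunctor ≅ piGL fun k : ℕ => φ (c + k) - φ (c + k + 1)) := by
  obtain ⟨γ, rfl⟩ := (mem_projectedPart_iff hφ T).1 hT
  obtain ⟨h1, L, hL, ⟨e⟩⟩ := isParabolic_rightFlag hφ
  rw [flagStabilizer_kernelFlag_act γ hφ]
  exact ⟨h1.conj, _, hL.conj, ⟨(SubgroupFunctor.nonempty_conj_iso (complexGL (glAt γ c)) L).some.trans e⟩⟩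

/-- Every `u` preserving the flag already lifts to the stabilizer, paired with the identity at `c`.
Conversely the flag stabilizer is closed, so passing to the fppf image adds nothing. -/
theorem stabilizerImage_left (hφ : IsUnimodalPair φ ℓ c) (hT : T ∈ projectedPart φ ℓ) :
    stabilizerImage T ℓ = flagStabilizer fun k => imageFlag T k ℓ := by
  ext R u
  constructor
  · rintro ⟨S, hS, h⟩
    refine (isParabolic_imageFlag hφ hT).1.1.mem_of_local hS fun A f hf => ?_
    obtain ⟨g, hg⟩ := h A f hf
    rw [← hg]
    exact stabilizer_left hφ hT g.2
  · intro hu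
    obtain ⟨g, hg, h1, -⟩ := exists_stabilizer hφ hT hu (one_mem _)
    exact ⟨⊤, fppfTopology.top_mem _, fun A f _ => ⟨(stabilizer T).toFunctor.map f ⟨g, hg⟩, by
      rw [← h1]
      rfl⟩⟩

theorem stabilizerImage_right (hφ : IsUnimodalPair φ ℓ c) (hT : T ∈ projectedPart φ ℓ) :
    stabilizerImage T c = flagStabilizer fun k => kernelFlag T k c := by
  ext R u
  constructor
  · rintro ⟨S, hS, h⟩
    refine (isParabolic_kernelFlag hφ hT).1.1.mem_of_local hS fun A f hf => ?_
    obtain ⟨g, hg⟩ := h A f hf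
    rw [← hg]
    exact stabilizer_right hφ hT g.2
  · intro hu
    obtain ⟨g, hg, -, h1⟩ := exists_stabilizer hφ hT (one_mem _) hu
    exact ⟨⊤, fppfTopology.top_mem _, fun A f _ => ⟨(stabilizer T).toFunctor.map f ⟨g, hg⟩, by
      rw [← h1]
      rfl⟩⟩

theorem isIso_stabilizerToImages (hφ : IsUnimodalPair φ ℓ c) (hT : T ∈ projectedPart φ ℓ) :
    IsIso (stabilizerToImages T ℓ c) := by
  refine isIso_of_bijective _ fun R => ⟨fun g h hgh => Subtype.ext ?_, fun uv => ?_⟩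
  · exact stabilizer_ext hφ hT g.2 h.2 (congrArg (fun x => x.1.1) hgh)
      (congrArg (fun x => x.2.1) hgh)
  · obtain ⟨⟨u, hu⟩, ⟨v, hv⟩⟩ := uv
    have hu' := hu
    have hv' := hv
    rw [stabilizerImage_left hφ hT] at hu'
    rw [stabilizerImage_right hφ hT] at hv'
    obtain ⟨g, hg, h1, h2⟩ := exists_stabilizer hφ hT hu' hv'
    exact ⟨⟨g, hg⟩, Prod.ext (Subtype.ext h1) (Subtype.ext h2)⟩

theorem antitone_imageFlag (hφ : IsUnimodalPair φ ℓ c) (hT : T ∈ projectedPart φ ℓ) :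
    Antitone (fun k => imageFlag T k ℓ) ∧ ∃ k, imageFlag T k ℓ = ⊥ := by
  obtain ⟨γ, rfl⟩ := (mem_projectedPart_iff hφ T).1 hT
  have h : ∀ k, imageFlag (act γ (dropComponent ℓ (stdRep φ ℂ))) k ℓ =
      (leftFlag φ ℓ k).map (mat (glAt γ ℓ)).mulVecLin := fun k => by
    rw [imageFlag_act, ← imageFlag_std_eq hφ]
  refine ⟨fun j k hjk => ?_, ?_⟩
  · simp only [h]
    exact Submodule.map_mono (coordSubmodule_le fun b hb =>
      single_mem_coordSubmodule (p := fun b => b.1 < φ (ℓ - j))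
        (lt_of_lt_of_le hb (hφ.antitone_left hjk)))
  · obtain ⟨k, hk⟩ := hφ.exists_left_eq_zero
    refine ⟨k + 1, ?_⟩
    rw [h]
    have h1 : leftFlag φ ℓ (k + 1) = ⊥ := by
      rw [eq_bot_iff]
      exact coordSubmodule_le fun b hb => absurd hb (by omega)
    rw [h1]
    exact Submodule.map_bot _

theorem monotone_kernelFlag (hφ : IsUnimodalPair φ ℓ c) (hT : T ∈ projectedPart φ ℓ) :
    Monotone (fun k => kernelFlag T k c) ∧ ∃ k, kernelFlag T k c = ⊤ := by
  obtain ⟨γ, rfl⟩ := (mem_projectedPart_iff hφ T).1 hT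
  have h : ∀ k, kernelFlag (act γ (dropComponent ℓ (stdRep φ ℂ))) k c =
      (rightFlag φ c k).map (mat (glAt γ c)).mulVecLin := fun k => by
    rw [kernelFlag_act, ← kernelFlag_std_eq hφ]
  refine ⟨fun j k hjk => ?_, ?_⟩
  · simp only [h]
    exact Submodule.map_mono (coordSubmodule_le fun b hb =>
      single_mem_coordSubmodule (p := fun b => φ (c + k) ≤ b.1)
        ((hφ.antitone_right hjk).trans hb))
  · obtain ⟨k, hk⟩ := hφ.exists_right_eq_zero
    refine ⟨k + 1, ?_⟩
    rw [h, eq_top_iff]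
    intro v _
    refine ⟨(mat (glAt γ c)⁻¹).mulVec v, fun a ha => absurd ?_ ha, ?_⟩
    · exact hk.le.trans (Nat.zero_le _)
    · rw [Matrix.mulVecLin_apply, Matrix.mulVec_mulVec, mat_mul_mat_inv]
      exact Matrix.one_mulVec v

end StabilizerImages

/-! ### The fibres of the full rank part -/

theorem exists_inverse_of_rank {R : Type} [CommRing R] {n m : ℕ} (h : n = m)
    (M : Matrix (Fin m) (Fin n) R)
    (hM : ∀ (K : Type) [Field K] (f : R →+* K), (M.map f).rank = n) :
    ∃ y : Matrix (Fin n) (Fin m) R, M * y = 1 ∧ y * M = 1 := by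
  subst h
  have h1 : IsUnit M.det := by
    by_contra hu
    obtain ⟨I, hI, hmem⟩ := exists_max_ideal_of_mem_nonunits hu
    let _ : Field (R ⧸ I) := Ideal.Quotient.field I
    -- Completing a square matrix adds no columns, so `N` is `M` itself and the completion lemma
    -- says that its determinant is non-zero at this point.
    obtain ⟨N, hN, hdet⟩ := exists_completion (Ideal.Quotient.mk I) le_rfl M (hM _ _)
    rw [stdMat_self, Matrix.mul_one] at hN
    subst hN
    exact hdet (Ideal.Quotient.eq_zero_iff_mem.2 hmem)
  exact ⟨M⁻¹, Matrix.mul_nonsing_inv _ h1, Matrix.nonsing_inv_mul _ h1⟩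

theorem rank_of_inverse {K : Type} [Field K] {n m : ℕ} {M : Matrix (Fin m) (Fin n) K}
    {y : Matrix (Fin n) (Fin m) K} (h : y * M = 1) : M.rank = n := by
  apply le_antisymm
  · simpa using M.rank_le_width
  · have h1 := Matrix.rank_mul_le_right y M
    rw [h, Matrix.rank_one, Fintype.card_fin] at h1
    exact h1

section Fibre

variable {φ : ℂ → ℕ} {ℓ c : ℂ}

/-- By the local normal form and transitivity on the projected part, any full rank representation
can be moved locally into the fibre. An element carrying one point of the fibre to another fixes
their common projection. -/
theorem isSlice_fibreIncl (hφ : IsUnimodalPair φ ℓ c) {T : QuiverRep φ ℂ}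
    (hT : T ∈ projectedPart φ ℓ) : IsSlice (fibreIncl ℓ T) where
  sheaf_group := isFppfSheaf_piGL φ
  sheaf_space := isFppfSheaf_fullRankPart φ
  group_injective _ := Subtype.val_injective
  injective _ := Subtype.val_injective
  mem_group {R} g y y' h := by
    obtain ⟨⟨(y : QuiverRep φ R), _⟩, (hy : dropComponent ℓ y = constPoint T R)⟩ := y
    obtain ⟨⟨(y' : QuiverRep φ R), _⟩, (hy' : dropComponent ℓ y' = constPoint T R)⟩ := y'
    have h1 : act g y = y' := congrArg Subtype.val h
    refine ⟨⟨g, mem_stabilizer.2 ?_⟩, rfl⟩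
    rw [← hy, act_dropComponent, h1, hy', hy]
  mem_range {R S} hS x hx := by
    obtain ⟨(x : QuiverRep φ R), hx0⟩ := x
    refine ⟨⟨⟨x, hx0⟩, ?_⟩, rfl⟩
    change dropComponent ℓ x = constPoint T R
    funext i j hij
    ext a b
    refine eq_of_mem_fppfTopology hS fun A f hf => ?_
    obtain ⟨⟨⟨(y : QuiverRep φ A), _⟩, (hy' : dropComponent ℓ y = constPoint T A)⟩, hy⟩ :=
      hx A f hf
    have h1 : y = baseChange f x := congrArg Subtype.val hy
    rw [h1, ← baseChange_dropComponent, ← baseChange_constPoint f] at hy'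
    exact congrFun (congrFun (congrFun (congrFun (congrFun hy' i) j) hij) a) b
  covers {R} x := by
    obtain ⟨γ, rfl⟩ := (mem_projectedPart_iff hφ T).1 hT
    obtain ⟨S, hS, h⟩ := exists_covering_of_near (Q := fun A f => ∃ g : (piGL φ).obj A,
      dropComponent ℓ (act g (baseChange f (x.1 : QuiverRep φ R))) =
        dropComponent ℓ (stdRep φ A)) (fun A f hg B u => by
        obtain ⟨g, hg⟩ := hg
        refine ⟨(piGL φ).map u g, ?_⟩
        have h1 := congrArg (baseChange u) hg
        rwa [baseChange_dropComponent, baseChange_act, baseChange_dropComponent,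
          baseChange_stdRep] at h1)
      (fun p => near_exists_dropComponent_eq hφ x.2 p)
    refine ⟨S, hS, fun A f hf => ?_⟩
    obtain ⟨g, hg⟩ := h A f hf
    -- The element `g` moves the projection of `x` to the standard point and `γ` moves that to the
    -- given one; the inverse of the product returns from the fibre to `x`.
    refine ⟨(constPi γ A * g)⁻¹,
      ⟨(fullRankPart φ).toActedSpace.smul (constPi γ A * g)
        ((fullRankPart φ).toActedSpace.X.map f x), ?_⟩, ?_⟩
    · change dropComponent ℓ (act (constPi γ A * g) (baseChange f (x.1 : QuiverRep φ R))) =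
        constPoint (act γ (dropComponent ℓ (stdRep φ complexPoint))) A
      rw [act_mul, ← act_dropComponent, hg, constPoint_act]
      congr 1
      exact (constPoint_stdRep A).symm
    · refine ((fullRankPart φ).toActedSpace.mul_smul _ _ _).symm.trans ?_
      rw [inv_mul_cancel]
      exact (fullRankPart φ).toActedSpace.one_smul _

/-- The component `T_ℓ` of the points of a fibre of the full rank part. -/
def fibreComponent (hφ : IsUnimodalPair φ ℓ c) (T : QuiverRep φ ℂ) :
    EquivariantMap (stabilizerToImages T ℓ c) (fibreOver ℓ T).toActedSpace
      (doubleCosetSpace (stabilizerImage T ℓ) (stabilizerImage T c)) where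
  app {R} x := ⟨(x.1.1 : QuiverRep φ R) ℓ c hφ.eq_add_one,
    exists_inverse_of_rank hφ.eq _ fun K _ f => by
      rw [x.1.2 K f ℓ c hφ.eq_add_one, hφ.eq, min_self]⟩
  naturality _ _ := rfl
  map_smul _ _ := rfl

/-- All components other than the one at `ℓ` are prescribed by the base point and have full rank.
The component at `ℓ` is between spaces of equal dimension, so any invertible matrix is allowed
there. -/
theorem fibreComponent_bijective (hφ : IsUnimodalPair φ ℓ c) {T : QuiverRep φ ℂ}
    (hT : T ∈ projectedPart φ ℓ) (R : CommAlgCat.{0} ℂ) :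
    Function.Bijective ((fibreComponent hφ T).app (R := R)) := by
  constructor
  · intro x y hxy
    refine Subtype.ext (Subtype.ext ?_)
    have hx : dropComponent ℓ (x.1.1 : QuiverRep φ R) = constPoint T R := x.2
    have hy : dropComponent ℓ (y.1.1 : QuiverRep φ R) = constPoint T R := y.2
    change (x.1.1 : QuiverRep φ R) = y.1.1
    funext i j hij
    by_cases hi : i = ℓ
    · subst hi
      obtain rfl : j = c := hij.trans hφ.eq_add_one.symm
      exact congrArg Subtype.val hxy
    · have h1 := congrFun (congrFun (congrFun (hx.trans hy.symm) i) j) hij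
      unfold dropComponent at h1
      rwa [if_neg hi, if_neg hi] at h1
  · rintro ⟨x, y, hxy, hyx⟩
    classical
    obtain ⟨T', hT', rfl⟩ := hT
    -- At `i = ℓ` the indices agree with `ℓ` and `c` only propositionally, so the entries of `x` are
    -- reindexed along the equality of sizes.
    let T₁ : QuiverRep φ R := fun i j hij =>
      if hi : i = ℓ then
        x.submatrix (Fin.cast (by rw [hij, hi, hφ.eq_add_one])) (Fin.cast (by rw [hi]))
      else constPoint T' R i j hij
    have h1 : T₁ ℓ c hφ.eq_add_one = x := dif_pos rfl
    have h2 : ∀ i j hij, i ≠ ℓ → T₁ i j hij = constPoint T' R i j hij :=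
      fun i j hij hi => dif_neg hi
    refine ⟨⟨⟨T₁, fun K _ f i j hij => ?_⟩, ?_⟩, Subtype.ext h1⟩
    · by_cases hi : i = ℓ
      · subst hi
        obtain rfl : j = c := hij.trans hφ.eq_add_one.symm
        rw [h1]
        refine Eq.trans ?_ (min_eq_left hφ.eq.le).symm
        refine rank_of_inverse (y := y.map f) ?_
        rw [← Matrix.map_mul, hyx, Matrix.map_one _ (map_zero _) (map_one _)]
      · rw [h2 i j hij hi]
        exact IsFullRank.baseChange (R := complexPoint) (ofComplex R) hT' K f i j hij
    · change dropComponent ℓ T₁ = constPoint (dropComponent ℓ T') R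
      have h3 : constPoint (dropComponent ℓ T') R = dropComponent ℓ (constPoint T' R) :=
        baseChange_dropComponent (R := complexPoint) (ofComplex R) (T := T') ℓ
      rw [h3]
      funext i j hij
      unfold dropComponent
      split_ifs with hi
      · rfl
      · exact h2 i j hij hi

end Fibre

/-! ### Change of bases in spaces of isomorphisms. -/

section Transport

variable {n m : ℕ} (H : SubgroupFunctor (glFunctor m)) {B : Matrix (Fin m) (Fin n) ℂ}
  {C : Matrix (Fin n) (Fin m) ℂ}

/-- The matrix `B` over `R`. -/
def constMat (B : Matrix (Fin m) (Fin n) ℂ) (R : CommAlgCat.{0} ℂ) : Matrix (Fin m) (Fin n) R :=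
  B.map (algebraMap ℂ R)

theorem constMat_mul (h : B * C = 1) (R : CommAlgCat.{0} ℂ) : constMat B R * constMat C R = 1 := by
  unfold constMat
  rw [← Matrix.map_mul, h, Matrix.map_one _ (map_zero _) (map_one _)]

theorem map_constMat {R S : CommAlgCat.{0} ℂ} (f : R ⟶ S) :
    (constMat B R).map f.hom = constMat B S := by
  ext i j
  exact f.hom.commutes _

theorem conj_constMat_mul (h : B * C = 1) {R : CommAlgCat.{0} ℂ} (u v : Matrix (Fin m) (Fin m) R) :
    constMat C R * u * constMat B R * (constMat C R * v * constMat B R) =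
      constMat C R * (u * v) * constMat B R := by
  calc _ = constMat C R * u * (constMat B R * constMat C R) * v * constMat B R := by
        simp only [Matrix.mul_assoc]
    _ = _ := by rw [constMat_mul h, Matrix.mul_one]; simp only [Matrix.mul_assoc]

/-- Conjugation by an invertible matrix, as an isomorphism of general linear groups. -/
def conjConstMat (h : B * C = 1) (h' : C * B = 1) {R : CommAlgCat.{0} ℂ}
    (g : (glFunctor m).obj R) : (glFunctor n).obj R :=
  (⟨constMat C R * mat g * constMat B R, constMat C R * mat g⁻¹ * constMat B R, by
    rw [conj_constMat_mul h, mat_mul_mat_inv, Matrix.mul_one, constMat_mul h'], by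
    rw [conj_constMat_mul h, mat_inv_mul_mat, Matrix.mul_one, constMat_mul h']⟩ : GL (Fin n) R)

theorem conjConstMat_mem (h : B * C = 1) (h' : C * B = 1) {R : CommAlgCat.{0} ℂ}
    {g : (glFunctor m).obj R} (hg : g ∈ H.pts R) :
    conjConstMat h h' g ∈ (H.transport B).pts R := by
  refine ⟨g, hg, ?_⟩
  change mat g * constMat B R = constMat B R * (constMat C R * mat g * constMat B R)
  rw [← Matrix.mul_assoc, ← Matrix.mul_assoc, constMat_mul h, Matrix.one_mul]

/-- A subgroup of `GL_m` is isomorphic to its transport. -/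
def transportHom (h : B * C = 1) (h' : C * B = 1) : H.toFunctor ⟶ (H.transport B).toFunctor where
  app R := GrpCat.ofHom
    { toFun := fun g => ⟨conjConstMat h h' g.1, conjConstMat_mem H h h' g.2⟩
      map_one' := Subtype.ext (Units.ext (by
        change constMat C R * (1 : Matrix (Fin m) (Fin m) R) * constMat B R = 1
        rw [Matrix.mul_one, constMat_mul h']))
      map_mul' := fun u v => Subtype.ext (Units.ext (by
        exact (conj_constMat_mul h (mat u.1) (mat v.1)).symm)) }
  naturality R S f := by
    ext g
    refine Subtype.ext (Units.ext ?_)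
    change constMat C S * (mat g.1).map f.hom * constMat B S =
      (constMat C R * mat g.1 * constMat B R).map f.hom
    rw [Matrix.map_mul, Matrix.map_mul, map_constMat, map_constMat]

theorem transportHom_bijective (h : B * C = 1) (h' : C * B = 1) (R : CommAlgCat.{0} ℂ) :
    Function.Bijective ((transportHom H h h').app R) := by
  constructor
  · intro u v huv
    refine Subtype.ext (Units.ext ?_)
    have h1 : constMat C R * mat u.1 * constMat B R = constMat C R * mat v.1 * constMat B R :=
      congrArg (fun g => mat g.1) huv
    have h2 := congrArg (fun M => constMat B R * M * constMat C R) h1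
    have h3 : ∀ w : Matrix (Fin m) (Fin m) R,
        constMat B R * (constMat C R * w * constMat B R) * constMat C R = w := by
      intro w
      calc _ = (constMat B R * constMat C R) * w * (constMat B R * constMat C R) := by
            simp only [Matrix.mul_assoc]
        _ = w := by rw [constMat_mul h, Matrix.one_mul, Matrix.mul_one]
    rwa [h3, h3] at h2
  · rintro ⟨g, u, hu, hg⟩
    refine ⟨⟨u, hu⟩, Subtype.ext (Units.ext ?_)⟩
    change constMat C R * mat u * constMat B R = mat g
    rw [Matrix.mul_assoc]
    refine (congrArg (constMat C R * ·) hg).trans ?_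
    rw [← Matrix.mul_assoc]
    refine (congrArg (· * mat g) (constMat_mul h' R)).trans (Matrix.one_mul _)

/-- The product of two homomorphisms. -/
def prodGroupMap {G G' K K' : GroupFunctor} (ρ : G ⟶ G') (σ : K ⟶ K') :
    prodGroup G K ⟶ prodGroup G' K' where
  app R := GrpCat.ofHom ((ρ.app R).hom.prodMap (σ.app R).hom)
  naturality R S f := by
    ext x
    exact Prod.ext (NatTrans.naturality_apply ρ f x.1) (NatTrans.naturality_apply σ f x.2)

theorem isIso_prodGroupMap {G G' K K' : GroupFunctor} {ρ : G ⟶ G'} {σ : K ⟶ K'}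
    (hρ : ∀ R, Function.Bijective (ρ.app R)) (hσ : ∀ R, Function.Bijective (σ.app R)) :
    IsIso (prodGroupMap ρ σ) :=
  isIso_of_bijective _ fun R => (hρ R).prodMap (hσ R)

variable {n' m' : ℕ} (H' : SubgroupFunctor (glFunctor m')) {B' : Matrix (Fin m') (Fin n') ℂ}
  {C' : Matrix (Fin n') (Fin m') ℂ}

/-- The change of bases of a space of isomorphisms. -/
def transportIsoSpace (h : B * C = 1) (h' : C * B = 1) (k : B' * C' = 1) (k' : C' * B' = 1) :
    EquivariantMap (prodGroupMap (transportHom H h h') (transportHom H' k k'))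
      (doubleCosetSpace H H') (doubleCosetSpace (H.transport B) (H'.transport B')) where
  app {R} x := ⟨constMat C' R * x.1 * constMat B R, by
    obtain ⟨y, h1, h2⟩ := x.2
    refine ⟨constMat C R * y * constMat B' R, ?_, ?_⟩
    · calc _ = constMat C' R * (x.1 * (constMat B R * constMat C R) * y) * constMat B' R := by
            simp only [Matrix.mul_assoc]
        _ = 1 := by rw [constMat_mul h, Matrix.mul_one, h1, Matrix.mul_one, constMat_mul k']
    · calc _ = constMat C R * (y * (constMat B' R * constMat C' R) * x.1) * constMat B R := by
            simp only [Matrix.mul_assoc]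
        _ = 1 := by rw [constMat_mul k, Matrix.mul_one, h2, Matrix.mul_one, constMat_mul h']⟩
  naturality {R S} f x := Subtype.ext (by
    change constMat C' S * x.1.map f.hom * constMat B S =
      (constMat C' R * x.1 * constMat B R).map f.hom
    rw [Matrix.map_mul, Matrix.map_mul, map_constMat, map_constMat])
  map_smul {R} g x := Subtype.ext (by
    change constMat C' R * (mat g.2.1 * x.1 * mat (g.1.1)⁻¹) * constMat B R =
      (constMat C' R * mat g.2.1 * constMat B' R) * (constMat C' R * x.1 * constMat B R) *
        (constMat C R * mat (g.1.1)⁻¹ * constMat B R)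
    symm
    calc _ = constMat C' R * mat g.2.1 * (constMat B' R * constMat C' R) * x.1 *
          (constMat B R * constMat C R) * mat (g.1.1)⁻¹ * constMat B R := by
          simp only [Matrix.mul_assoc]
      _ = _ := by
        rw [constMat_mul h, constMat_mul k]
        simp only [Matrix.mul_assoc, Matrix.mul_one])

theorem transportIsoSpace_bijective (h : B * C = 1) (h' : C * B = 1) (k : B' * C' = 1)
    (k' : C' * B' = 1) (R : CommAlgCat.{0} ℂ) :
    Function.Bijective ((transportIsoSpace H H' h h' k k').app (R := R)) := by
  have key : ∀ w : Matrix (Fin m') (Fin m) R,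
      constMat B' R * (constMat C' R * w * constMat B R) * constMat C R = w := by
    intro w
    calc _ = (constMat B' R * constMat C' R) * w * (constMat B R * constMat C R) := by
          simp only [Matrix.mul_assoc]
      _ = w := by rw [constMat_mul h, constMat_mul k, Matrix.one_mul, Matrix.mul_one]
  constructor
  · intro x y hxy
    have h1 : constMat C' R * x.1 * constMat B R = constMat C' R * y.1 * constMat B R :=
      congrArg Subtype.val hxy
    have h2 := congrArg (fun M => constMat B' R * M * constMat C R) h1
    simp only [key] at h2
    exact Subtype.ext h2
  · rintro ⟨x, y, h1, h2⟩
    refine ⟨⟨constMat B' R * x * constMat C R, constMat B R * y * constMat C' R, ?_, ?_⟩,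
      Subtype.ext ?_⟩
    · calc _ = constMat B' R * (x * (constMat C R * constMat B R) * y) * constMat C' R := by
            simp only [Matrix.mul_assoc]
        _ = 1 := by rw [constMat_mul h', Matrix.mul_one, h1, Matrix.mul_one, constMat_mul k]
    · calc _ = constMat B R * (y * (constMat C' R * constMat B' R) * x) * constMat C R := by
            simp only [Matrix.mul_assoc]
        _ = 1 := by rw [constMat_mul k', Matrix.mul_one, h2, Matrix.mul_one, constMat_mul h]
    · change constMat C' R * (constMat B' R * x * constMat C R) * constMat B R = x
      calc _ = (constMat C' R * constMat B' R) * x * (constMat C R * constMat B R) := by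
            simp only [Matrix.mul_assoc]
        _ = x := by rw [constMat_mul h', constMat_mul k', Matrix.one_mul, Matrix.mul_one]

end Transport

/-- The composite of three isomorphisms: restriction of torsors to the fibre, the identification of
the fibre with isomorphisms from `V_ℓ` to `V_c`, and the change of bases. -/
theorem exists_stackIso_transport {φ : ℂ → ℕ} {ℓ c : ℂ} (hφ : IsUnimodalPair φ ℓ c)
    {T : QuiverRep φ ℂ} (hT : T ∈ projectedPart φ ℓ) (Bl Cl : Matrix (Fin (φ ℓ)) (Fin (φ ℓ)) ℂ)
    (Br : Matrix (Fin (φ c)) (Fin (φ ℓ)) ℂ) (Cr : Matrix (Fin (φ ℓ)) (Fin (φ c)) ℂ)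
    (h : Bl * Cl = 1) (h' : Cl * Bl = 1) (k : Br * Cr = 1) (k' : Cr * Br = 1) :
    ∃ F : BasedFunctor (quotientStack _ (fullRankPart φ).toActedSpace)
      (quotientStack _ (doubleCosetSpace ((stabilizerImage T ℓ).transport Bl)
        ((stabilizerImage T c).transport Br))), IsStackIso F := by
  have := isIso_stabilizerToImages hφ hT
  have := isIso_prodGroupMap (transportHom_bijective (stabilizerImage T ℓ) h h')
    (transportHom_bijective (stabilizerImage T c) k k')
  exact ⟨_, ((isSlice_fibreIncl hφ hT).isStackIso_restrictBased.comp
    (isStackIso_transferBased _ (fibreComponent_bijective hφ hT))).comp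
    (isStackIso_transferBased _ (transportIsoSpace_bijective (stabilizerImage T ℓ)
      (stabilizerImage T c) h h' k k'))⟩

/-! ### Descent of direct summands -/

section Descent

variable {R B : Type} [CommRing R] [CommRing B] [Algebra R B]

/-- The solvability of a linear system descends along faithfully flat extensions. -/
theorem exists_mulVec_of_faithfullyFlat [Module.FaithfullyFlat R B] {I J : Type} [Fintype I]
    [Fintype J] (M : Matrix I J R) (v : I → R) (y : J → B)
    (h : (M.map (algebraMap R B)).mulVec y = fun i => algebraMap R B (v i)) :
    ∃ x, M.mulVec x = v := by
  classical
  let N := LinearMap.range M.mulVecLin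
  let π : (I → R) →ₗ[R] (I → R) ⧸ N := N.mkQ
  -- Solvability is the vanishing of the class of `v` in the cokernel of `M`, and the cokernel
  -- embeds into its faithfully flat extension. There the class is a combination, with coefficients
  -- `y`, of the classes of the columns of `M`.
  suffices hv : π v = 0 by
    obtain ⟨x, hx⟩ := (Submodule.Quotient.mk_eq_zero N).1 hv
    exact ⟨x, hx⟩
  apply Module.FaithfullyFlat.tensorProduct_mk_injective (A := R) (B := B)
  rw [map_zero]
  change (1 : B) ⊗ₜ[R] π v = 0
  have h1 : ∀ w : I → R, π w = ∑ i, w i • π (Pi.single i 1) := by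
    intro w
    conv_lhs => rw [pi_eq_sum_univ' w]
    rw [map_sum]
    refine Finset.sum_congr rfl fun i _ => ?_
    rw [map_smul]
  have h2 : ∀ j, ∑ i, M i j • π (Pi.single i 1) = 0 := by
    intro j
    rw [← h1 (fun i => M i j)]
    refine (Submodule.Quotient.mk_eq_zero N).2 ⟨Pi.single j 1, ?_⟩
    rw [Matrix.mulVecLin_apply, Matrix.mulVec_single_one]
    rfl
  calc (1 : B) ⊗ₜ[R] π v = ∑ i, (algebraMap R B (v i)) ⊗ₜ[R] π (Pi.single i 1) := by
        rw [h1 v, TensorProduct.tmul_sum]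
        refine Finset.sum_congr rfl fun i _ => ?_
        rw [TensorProduct.tmul_smul, TensorProduct.smul_tmul', Algebra.algebraMap_eq_smul_one]
    _ = ∑ i, ∑ j, (y j) ⊗ₜ[R] (M i j • π (Pi.single i 1)) := by
        refine Finset.sum_congr rfl fun i _ => ?_
        rw [← congrFun h i, Matrix.mulVec, dotProduct, TensorProduct.sum_tmul]
        refine Finset.sum_congr rfl fun j _ => ?_
        rw [Matrix.map_apply, ← Algebra.smul_def, TensorProduct.smul_tmul]
    _ = 0 := by
        rw [Finset.sum_comm]
        refine Finset.sum_eq_zero fun j _ => ?_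
        rw [← TensorProduct.tmul_sum, h2, TensorProduct.tmul_zero]

/-- Over a faithfully flat extension, the columns of a matrix `e` are combinations of vectors
over the base fixed by `e`, if `e` satisfies a cocycle condition. -/
theorem exists_factorization_of_cocycle [Module.Flat R B] {n : ℕ} (e : Matrix (Fin n) (Fin n) B)
    (he : ∀ a b, ∑ k, (e k b) ⊗ₜ[R] ((1 - e) a k) = 0) :
    ∃ (J : Type) (_ : Fintype J) (_ : DecidableEq J) (V : Matrix (Fin n) J R)
      (Y : Matrix J (Fin n) B),
      e * V.map (algebraMap R B) = V.map (algebraMap R B) ∧ V.map (algebraMap R B) * Y = e := by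
  classical
  -- The map `θ` is `v ↦ (1 - e) v`, so its kernel consists of the vectors over `R` fixed by `e`.
  -- The hypothesis says that the columns of `e` are killed after tensoring with `B`; by flatness
  -- they are combinations of vectors from the kernel.
  let θ : (Fin n → R) →ₗ[R] (Fin n → B) :=
    LinearMap.pi fun a => ∑ k, (LinearMap.proj k).smulRight ((1 - e) a k)
  have hθ : ∀ v a, θ v a = ∑ k, v k • (1 - e) a k := fun v a => by simp [θ]
  let t : Fin n → B ⊗[R] (Fin n → R) := fun b => ∑ k, (e k b) ⊗ₜ[R] Pi.single k 1
  have ht : ∀ b, (θ.lTensor B) (t b) = 0 := by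
    intro b
    apply (TensorProduct.piRight R R B fun _ : Fin n => B).injective
    rw [map_zero]
    funext a
    rw [map_sum, map_sum, Finset.sum_apply, Pi.zero_apply, ← he a b]
    refine Finset.sum_congr rfl fun k _ => ?_
    rw [LinearMap.lTensor_tmul, TensorProduct.piRight_apply, TensorProduct.piRightHom_tmul]
    change _ ⊗ₜ[R] (θ _ a) = _
    rw [hθ]
    congr 1
    rw [Finset.sum_eq_single k]
    · simp
    · intro j _ hj
      rw [Pi.single_eq_of_ne hj, zero_smul]
    · simp
  have hex : Function.Exact ((LinearMap.ker θ).subtype.lTensor B) (θ.lTensor B) :=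
    Module.Flat.lTensor_exact B (LinearMap.exact_subtype_ker_map θ)
  choose s hs using fun b => (hex (t b)).1 (ht b)
  choose S hS using fun b => TensorProduct.exists_finset (s b)
  have key : ∀ a b, e a b = ∑ x ∈ S b, x.2.1 a • x.1 := by
    intro a b
    let μ : B ⊗[R] (Fin n → R) →ₗ[R] B :=
      (TensorProduct.rid R B).toLinearMap ∘ₗ (LinearMap.proj a).lTensor B
    have h1 : μ (t b) = e a b := by
      rw [map_sum, Finset.sum_eq_single a]
      · simp [μ]
      · intro j _ hj
        simp [μ, Pi.single_eq_of_ne' hj]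
      · simp
    rw [← h1, ← hs b, hS b, map_sum, map_sum]
    rfl
  let V : Matrix (Fin n) (Σ b, S b) R := Matrix.of fun a j => j.2.1.2.1 a
  refine ⟨Σ b, S b, inferInstance, inferInstance, V,
    Matrix.of fun j b => if j.1 = b then j.2.1.1 else 0, ?_, ?_⟩
  · ext a j
    have h1 : θ j.2.1.2.1 = 0 := j.2.1.2.2
    have h2 := congrFun h1 a
    rw [hθ, Pi.zero_apply] at h2
    have h3 : ∑ k, j.2.1.2.1 k • (1 - e) a k =
        ((1 - e) * V.map (algebraMap R B) : Matrix (Fin n) (Σ b, S b) B) a j := by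
      rw [Matrix.mul_apply]
      refine Finset.sum_congr rfl fun k _ => ?_
      rw [Algebra.smul_def, mul_comm]
      rfl
    rw [h3, Matrix.sub_mul, Matrix.one_mul, Matrix.sub_apply, sub_eq_zero] at h2
    exact h2.symm
  · ext a b
    rw [Matrix.mul_apply, key, Fintype.sum_sigma, Finset.sum_eq_single b]
    · refine Eq.trans ?_ (Finset.sum_coe_sort (S b) fun x => x.2.1 a • x.1)
      refine Finset.sum_congr rfl fun x _ => ?_
      simp [V, Algebra.smul_def]
    · intro c _ hc
      refine Finset.sum_eq_zero fun x _ => ?_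
      simp [hc]
    · simp

/-- Descent of a direct summand along a faithfully flat extension. -/
theorem exists_idempotent_of_cocycle [Module.FaithfullyFlat R B] {n : ℕ}
    (e : Matrix (Fin n) (Fin n) B) (he : ∀ a b, ∑ k, (e k b) ⊗ₜ[R] ((1 - e) a k) = 0) :
    ∃ e' : Matrix (Fin n) (Fin n) R, e' * e' = e' ∧
      e * e'.map (algebraMap R B) = e'.map (algebraMap R B) ∧
      e'.map (algebraMap R B) * e = e := by
  obtain ⟨J, _, _, V, Y, h1, h2⟩ := exists_factorization_of_cocycle e he
  -- For an unknown `X`, the equation `V X V = V` is a linear system over `R`. It has the solution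
  -- `Y` over `B`, since `V Y V = e V = V`, hence a solution over `R`, and `V X` is the required
  -- idempotent.
  let M : Matrix (Fin n × J) (J × Fin n) R := Matrix.of fun p q => V p.1 q.1 * V q.2 p.2
  obtain ⟨x, hx⟩ := exists_mulVec_of_faithfullyFlat M (fun p => V p.1 p.2) (fun q => Y q.1 q.2) (by
    funext ⟨a, b⟩
    have h3 : (V.map (algebraMap R B) * Y * V.map (algebraMap R B)) a b =
        algebraMap R B (V a b) := by
      rw [h2, h1]
      rfl
    rw [← h3, Matrix.mulVec, dotProduct, Fintype.sum_prod_type, Matrix.mul_apply, Finset.sum_comm]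
    refine Finset.sum_congr rfl fun d _ => ?_
    rw [Matrix.mul_apply, Finset.sum_mul]
    refine Finset.sum_congr rfl fun c _ => ?_
    simp only [M, Matrix.map_apply, Matrix.of_apply, map_mul]
    ring)
  let X : Matrix J (Fin n) R := Matrix.of fun c d => x (c, d)
  have hX : V * X * V = V := by
    ext a b
    rw [← congrFun hx (a, b), Matrix.mulVec, dotProduct, Fintype.sum_prod_type, Matrix.mul_apply,
      Finset.sum_comm]
    refine Finset.sum_congr rfl fun d _ => ?_
    rw [Matrix.mul_apply, Finset.sum_mul]
    refine Finset.sum_congr rfl fun c _ => ?_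
    simp only [M, X, Matrix.of_apply]
    ring
  refine ⟨V * X, ?_, ?_, ?_⟩
  · rw [← Matrix.mul_assoc, hX]
  · rw [Matrix.map_mul, ← Matrix.mul_assoc, h1]
  · have h3 : V.map (algebraMap R B) * X.map (algebraMap R B) * V.map (algebraMap R B) =
        V.map (algebraMap R B) := by
      rw [← Matrix.map_mul, ← Matrix.map_mul, hX]
    rw [Matrix.map_mul]
    conv_lhs => rw [← h2]
    rw [← Matrix.mul_assoc, h3, h2]

end Descent

/-! ### Direct summands as ranges of idempotent matrices. -/

section Summand

variable {R S : Type} [CommRing R] [CommRing S] {n : ℕ}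

theorem range_le_range_iff {e M : Matrix (Fin n) (Fin n) R} (he : e * e = e) :
    LinearMap.range M.mulVecLin ≤ LinearMap.range e.mulVecLin ↔ e * M = M := by
  constructor
  · intro h
    ext a b
    obtain ⟨w, hw⟩ := h ⟨Pi.single b 1, rfl⟩
    rw [Matrix.mulVecLin_apply, Matrix.mulVecLin_apply] at hw
    have h1 : e.mulVec (M.mulVec (Pi.single b 1)) = M.mulVec (Pi.single b 1) := by
      rw [← hw, Matrix.mulVec_mulVec, he]
    rw [Matrix.mulVec_mulVec, Matrix.mulVec_single_one, Matrix.mulVec_single_one] at h1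
    exact congrFun h1 a
  · rintro h _ ⟨v, rfl⟩
    exact ⟨M.mulVec v, by rw [Matrix.mulVecLin_apply, Matrix.mulVec_mulVec, h]; rfl⟩

theorem range_eq_range_iff {e e' : Matrix (Fin n) (Fin n) R} (he : e * e = e) (he' : e' * e' = e') :
    LinearMap.range e.mulVecLin = LinearMap.range e'.mulVecLin ↔ e' * e = e ∧ e * e' = e' := by
  rw [← range_le_range_iff he, ← range_le_range_iff he', le_antisymm_iff]

theorem extendScalars_range (f : R →+* S) (M : Matrix (Fin n) (Fin n) R) :
    extendScalars f (LinearMap.range M.mulVecLin) = LinearMap.range (M.map f).mulVecLin := by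
  rw [LinearMap.range_eq_map, extendScalars_map, LinearMap.range_eq_map]
  congr 1
  rw [eq_top_iff]
  intro v _
  rw [← Finset.univ_sum_single v]
  refine Submodule.sum_mem _ fun i _ => ?_
  have h1 := mem_extendScalars f (⊤ : Submodule R (Fin n → R)) (v := Pi.single i 1) trivial
  convert Submodule.smul_mem _ (v i) h1 using 1
  ext k
  by_cases hk : k = i
  · subst hk
    simp
  · simp [Pi.single_eq_of_ne hk]

theorem map_idempotent {e : Matrix (Fin n) (Fin n) R} (he : e * e = e) (f : R →+* S) :
    e.map f * e.map f = e.map f := by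
  rw [← Matrix.map_mul, he]

theorem IsSummandOfRank.rank_eq {F : Submodule R (Fin n → R)} {d : ℕ} (hF : IsSummandOfRank F d)
    {e : Matrix (Fin n) (Fin n) R} (he : e * e = e) (heF : F = LinearMap.range e.mulVecLin)
    {K : Type} [Field K] (f : R →+* K) : (e.map f).rank = d := by
  obtain ⟨e', he', heF', hr⟩ := hF
  obtain ⟨h1, h2⟩ := (range_eq_range_iff he he').1 (heF.symm.trans heF')
  rw [← hr K f]
  apply le_antisymm
  · rw [← h1, Matrix.map_mul]
    exact Matrix.rank_mul_le_left _ _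
  · rw [← h2, Matrix.map_mul]
    exact Matrix.rank_mul_le_left _ _

/-- For an idempotent `e`, containment in its range is the equation `e M = M`, which can be tested
on a covering. -/
theorem extendScalars_injective_of_local {R : CommAlgCat.{0} ℂ} {T : Sieve (op R)}
    (hT : T ∈ fppfTopology (op R)) {e M : Matrix (Fin n) (Fin n) R} (he : e * e = e)
    (h : ∀ (A : CommAlgCat.{0} ℂ) (f : R ⟶ A), T f.op →
      LinearMap.range (M.map f.hom.toRingHom).mulVecLin ≤
        LinearMap.range (e.map f.hom.toRingHom).mulVecLin) :
    LinearMap.range M.mulVecLin ≤ LinearMap.range e.mulVecLin := by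
  rw [range_le_range_iff he]
  ext a b
  refine eq_of_mem_fppfTopology hT fun A f hf => ?_
  have h1 := (range_le_range_iff (map_idempotent he _)).1 (h A f hf)
  rw [← Matrix.map_mul] at h1
  exact congrFun (congrFun h1 a) b

end Summand

/-- A criterion for sheaves in terms of finite coverings. -/
theorem isFppfSheaf_of_finite (X : CommAlgCat.{0} ℂ ⥤ Type u)
    (hsep : ∀ (R : CommAlgCat.{0} ℂ) (S : Sieve (op R)), S ∈ fppfTopology (op R) →
      ∀ x y : X.obj R, (∀ (A : CommAlgCat.{0} ℂ) (f : R ⟶ A), S f.op → X.map f x = X.map f y) →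
        x = y)
    (hglue : ∀ (R : CommAlgCat.{0} ℂ) (ι : Type) [Finite ι] (B : ι → CommAlgCat.{0} ℂ)
      (f : ∀ i, R ⟶ B i), (∀ i, (f i).hom.toRingHom.Flat) →
      (∀ p : PrimeSpectrum R, ∃ i, ∃ q : PrimeSpectrum (B i), specMap (f i) q = p) →
      Sieve.generate (Presieve.ofArrows (fun i => op (B i)) fun i => (f i).op) ∈
        fppfTopology (op R) →
      ∀ x : ∀ i, X.obj (B i), (∀ i j (C : CommAlgCat.{0} ℂ) (u : B i ⟶ C) (v : B j ⟶ C),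
        f i ≫ u = f j ≫ v → X.map u (x i) = X.map v (x j)) →
        ∃ t, ∀ i, X.map (f i) t = x i) : IsFppfSheaf X := by
  rw [isFppfSheaf_iff]
  intro R S hS x hx
  have hS' := hS
  obtain ⟨ι, _, B, f, hf, hcov, hSf⟩ := hS
  have hT : Sieve.generate (Presieve.ofArrows (fun i => op (B i)) fun i => (f i).op) ∈
      fppfTopology (op R) :=
    ⟨ι, inferInstance, B, f, hf, hcov, fun i => Sieve.le_generate _ _ _ (Presieve.ofArrows.mk i)⟩
  have e3 : ∀ {C : CommAlgCat.{0} ℂ} (g g' : R ⟶ C) (e : g = g') (h : S g.op) (h' : S g'.op),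
      x C g h = x C g' h' := by
    rintro C g _ rfl _ _
    rfl
  obtain ⟨t, ht⟩ := hglue R ι B f (fun i => (hf i).1) hcov hT (fun i => x (B i) (f i) (hSf i))
    (fun i j C u v huv =>
      (hx _ _ _ _ (hSf i) (S.downward_closed (hSf i) u.op)).trans
        ((e3 _ _ huv _ _).trans (hx _ _ _ _ (hSf j) (S.downward_closed (hSf j) v.op)).symm))
  refine ⟨t, fun A u hu => ?_, fun t' ht' => ?_⟩
  · refine hsep A _ (fppfTopology.pullback_stable u.op hT) _ _ fun C v hv => ?_
    obtain ⟨Y, w, g, ⟨i⟩, hg⟩ := hv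
    have hg' : f i ≫ w.unop = u ≫ v := Quiver.Hom.op_inj hg
    have h1 := hx A C u v hu (S.downward_closed hu v.op)
    have h2 := hx (B i) C (f i) w.unop (hSf i) (S.downward_closed (hSf i) w)
    have h3 : X.map (u ≫ v) t = X.map w.unop (X.map (f i) t) := by
      rw [← hg', types_map_comp]
    rw [h1, ← types_map_comp, h3, ht]
    exact h2.trans (e3 _ _ hg' _ _)
  · refine hsep R S hS' _ _ fun A u hu => ?_
    rw [ht' A u hu]
    symm
    refine hsep A _ (fppfTopology.pullback_stable u.op hT) _ _ fun C v hv => ?_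
    obtain ⟨Y, w, g, ⟨i⟩, hg⟩ := hv
    have hg' : f i ≫ w.unop = u ≫ v := Quiver.Hom.op_inj hg
    have h1 := hx A C u v hu (S.downward_closed hu v.op)
    have h2 := hx (B i) C (f i) w.unop (hSf i) (S.downward_closed (hSf i) w)
    have h3 : X.map (u ≫ v) t = X.map w.unop (X.map (f i) t) := by
      rw [← hg', types_map_comp]
    rw [h1, ← types_map_comp, h3, ht]
    exact h2.trans (e3 _ _ hg' _ _)

/-- Partial flag varieties are fppf sheaves. -/
theorem isFppfSheaf_flagVariety {n : ℕ} (lam : Fin n → ℂ) : IsFppfSheaf (flagVariety lam).X := by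
  refine isFppfSheaf_of_finite _ (fun R S hS x y hxy => ?_) ?_
  · refine Subtype.ext (funext fun j => ?_)
    obtain ⟨e, he, hx, -⟩ := x.2.2 j
    obtain ⟨e', he', hy, -⟩ := y.2.2 j
    have h1 : ∀ (A : CommAlgCat.{0} ℂ) (f : R ⟶ A), S f.op →
        LinearMap.range (e.map f.hom.toRingHom).mulVecLin =
          LinearMap.range (e'.map f.hom.toRingHom).mulVecLin := by
      intro A f hf
      rw [← extendScalars_range, ← extendScalars_range, ← hx, ← hy]
      exact congrFun (congrArg Subtype.val (hxy A f hf)) j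
    rw [hx, hy]
    exact le_antisymm
      (extendScalars_injective_of_local hS he' fun A f hf => (h1 A f hf).le)
      (extendScalars_injective_of_local hS he fun A f hf => (h1 A f hf).ge)
  · intro R ι _ B f hflat hcov hT x hx
    let _ : ∀ i, Algebra R (B i) := fun i => (f i).hom.toRingHom.toAlgebra
    have hff : Module.FaithfullyFlat R (∀ i, B i) := faithfullyFlat_pi hflat hcov
    have hR : ∀ i, IsScalarTower ℂ R (B i) :=
      fun i => IsScalarTower.of_algebraMap_eq fun x => ((f i).hom.commutes x).symm
    choose e he hrange hrank using fun i j => (x i).2.2 j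
    -- Over `B i ⊗ B i'` the two projectors have the same range, so `1` minus the second kills the
    -- first. This is the cocycle condition over the product of all `B i`.
    have hcoc : ∀ j a b, ∑ k, (show ∀ i, B i from fun i => e i j k b) ⊗ₜ[R]
        (show ∀ i, B i from fun i => (1 - e i j) a k) = 0 := by
      intro j a b
      refine tensor_pi_ext fun i i' => ?_
      rw [map_sum, map_zero]
      simp only [TensorProduct.map_tmul, LinearMap.proj_apply]
      let C := CommAlgCat.of ℂ (B i ⊗[R] B i')
      let i1 : B i ⟶ C := CommAlgCat.ofHom (Algebra.TensorProduct.includeLeft)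
      let i2 : B i' ⟶ C := CommAlgCat.ofHom
        ((Algebra.TensorProduct.includeRight (R := R) (A := B i) (B := B i')).restrictScalars ℂ)
      have hc : f i ≫ i1 = f i' ≫ i2 := by
        ext a
        change (algebraMap R (B i) a) ⊗ₜ[R] (1 : B i') = (1 : B i) ⊗ₜ[R] (algebraMap R (B i') a)
        rw [Algebra.algebraMap_eq_smul_one, Algebra.algebraMap_eq_smul_one,
          TensorProduct.smul_tmul]
      have h1 : extendScalars i1.hom.toRingHom ((x i).1 j) =
          extendScalars i2.hom.toRingHom ((x i').1 j) :=
        congrFun (congrArg Subtype.val (hx i i' C i1 i2 hc)) j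
      rw [hrange, hrange, extendScalars_range, extendScalars_range,
        range_eq_range_iff (map_idempotent (he i j) _) (map_idempotent (he i' j) _)] at h1
      have h2 : ((1 - (e i' j)).map i2.hom.toRingHom * (e i j).map i1.hom.toRingHom) a b = 0 := by
        rw [Matrix.map_sub _ (map_sub _), Matrix.map_one _ (map_zero _) (map_one _),
          Matrix.sub_mul, Matrix.one_mul, h1.1, sub_self, Matrix.zero_apply]
      rw [← h2, Matrix.mul_apply]
      refine Finset.sum_congr rfl fun k _ => ?_
      change _ = ((1 : B i) ⊗ₜ[R] (1 - e i' j) a k) * ((e i j k b) ⊗ₜ[R] (1 : B i'))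
      rw [Algebra.TensorProduct.tmul_mul_tmul, one_mul, mul_one]
    have hdesc : ∀ j, ∃ e' : Matrix (Fin n) (Fin n) R, e' * e' = e' ∧ ∀ i,
        e i j * e'.map (f i).hom.toRingHom = e'.map (f i).hom.toRingHom ∧
        e'.map (f i).hom.toRingHom * e i j = e i j := by
      intro j
      let eB : Matrix (Fin n) (Fin n) (∀ i, B i) := Matrix.of fun a b i => e i j a b
      obtain ⟨e', h1, h2, h3⟩ := exists_idempotent_of_cocycle (R := R) eB (by
        intro a b
        rw [← hcoc j a b]
        refine Finset.sum_congr rfl fun k _ => ?_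
        congr 1
        funext i
        simp only [eB, Matrix.sub_apply, Pi.sub_apply, Matrix.of_apply, Matrix.one_apply]
        split_ifs <;> rfl)
      have hp : ∀ (i : ι) (M N : Matrix (Fin n) (Fin n) (∀ i, B i)),
          (M * N).map (Pi.evalRingHom (fun i => (B i : Type)) i) =
            M.map (Pi.evalRingHom (fun i => (B i : Type)) i) *
              N.map (Pi.evalRingHom (fun i => (B i : Type)) i) := fun i M N => Matrix.map_mul
      refine ⟨e', h1, fun i => ⟨?_, ?_⟩⟩
      · have h4 := congrArg (fun M => M.map (Pi.evalRingHom (fun i => (B i : Type)) i)) h2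
        exact (hp i eB (e'.map (algebraMap R (∀ i, B i)))).symm.trans h4
      · have h4 := congrArg (fun M => M.map (Pi.evalRingHom (fun i => (B i : Type)) i)) h3
        exact (hp i (e'.map (algebraMap R (∀ i, B i))) eB).symm.trans h4
    choose e' he' hee' using hdesc
    have hext : ∀ i j, LinearMap.range ((e' j).map (f i).hom.toRingHom).mulVecLin = (x i).1 j := by
      intro i j
      rw [hrange, range_eq_range_iff (map_idempotent (he' j) _) (he i j)]
      exact hee' j i
    refine ⟨⟨fun j => LinearMap.range (e' j).mulVecLin, fun j j' hjj' => ?_, fun j =>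
      ⟨e' j, he' j, rfl, fun K _ g => ?_⟩⟩, fun i => Subtype.ext (funext fun j => ?_)⟩
    · rw [range_le_range_iff (he' j')]
      ext a b
      apply FaithfulSMul.algebraMap_injective R (∀ i, B i)
      funext i
      have h1 := (range_le_range_iff (map_idempotent (he' j') (f i).hom.toRingHom)).1
        ((hext i j).le.trans (((x i).2.1 j j' hjj').trans (hext i j').ge))
      rw [← Matrix.map_mul] at h1
      exact congrFun (congrFun h1 a) b
    · obtain ⟨A, u, L, _, i, h, ⟨Y, w, g', ⟨m⟩, hg⟩, hi⟩ := exists_field_of_mem hT g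
      have hg' : f m ≫ w.unop = u := Quiver.Hom.op_inj hg
      subst hg'
      rw [← rank_map_field i]
      have h1 := ((x m).2.2 j).rank_eq (map_idempotent (he' j) (f m).hom.toRingHom)
        (hext m j).symm (h.comp w.unop.hom.toRingHom)
      rw [← h1]
      congr 1
      ext a b
      exact hi _
    · exact (extendScalars_range _ _).trans (hext i j)

/-! ### Local conjugacy of flags -/

section Flags

theorem isUnit_of_forall_field {R : Type} [CommRing R] {t : R}
    (h : ∀ (K : Type) [Field K] (f : R →+* K), f t ≠ 0) : IsUnit t := by
  by_contra hu
  obtain ⟨I, hI, hmem⟩ := exists_max_ideal_of_mem_nonunits hu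
  let _ : Field (R ⧸ I) := Ideal.Quotient.field I
  exact h _ (Ideal.Quotient.mk I) (Ideal.Quotient.eq_zero_iff_mem.2 hmem)

/-- An idempotent matrix vanishing at all points vanishes. -/
theorem idempotent_eq_zero {R : Type} [CommRing R] {n : ℕ} {D : Matrix (Fin n) (Fin n) R}
    (hD : D * D = D) (h : ∀ (K : Type) [Field K] (f : R →+* K), D.map f = 0) : D = 0 := by
  have h1 : IsUnit (1 - D) := by
    rw [Matrix.isUnit_iff_isUnit_det]
    refine isUnit_of_forall_field fun K _ f => ?_
    rw [RingHom.map_det, map_sub, map_one, RingHom.mapMatrix_apply, h, sub_zero, Matrix.det_one]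
    exact one_ne_zero
  refine h1.mul_left_cancel ?_
  rw [Matrix.mul_zero, Matrix.sub_mul, Matrix.one_mul, hD, sub_self]

/-- The matrix `e' - e e'` is an idempotent measuring the difference. It vanishes at every point
with values in a field, because there both ranges have the same dimension, and hence it is zero. -/
theorem IsSummandOfRank.eq_of_le {R : Type} [CommRing R] {n d : ℕ}
    {F F' : Submodule R (Fin n → R)} (hF : IsSummandOfRank F d) (hF' : IsSummandOfRank F' d)
    (h : F ≤ F') : F = F' := by
  obtain ⟨e, he, rfl, hr⟩ := hF
  obtain ⟨e', he', rfl, hr'⟩ := hF'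
  have h1 : e' * e = e := (range_le_range_iff he').1 h
  have h2 : e * e' * (e * e') = e * e' := by
    calc _ = e * (e' * e) * e' := by simp only [Matrix.mul_assoc]
      _ = _ := by rw [h1, he]
  have h3 : e' * (e * e') = e * e' := by rw [← Matrix.mul_assoc, h1]
  have h4 : e * e' * e' = e * e' := by rw [Matrix.mul_assoc, he']
  have h5 : e' - e * e' = 0 := by
    refine idempotent_eq_zero ?_ fun K _ f => ?_
    · rw [Matrix.sub_mul, Matrix.mul_sub, Matrix.mul_sub, he', h2, h3, h4, sub_self, sub_zero]
    · have h6 : LinearMap.range (e.map f).mulVecLin ≤ LinearMap.range (e'.map f).mulVecLin :=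
        (range_le_range_iff (map_idempotent he' f)).2 (by rw [← Matrix.map_mul, h1])
      have h7 := Submodule.eq_of_le_of_finrank_eq h6 ((hr K f).trans (hr' K f).symm)
      have h8 := ((range_eq_range_iff (map_idempotent he f) (map_idempotent he' f)).1 h7).2
      rw [Matrix.map_sub _ (map_sub _), Matrix.map_mul, h8, sub_self]
  refine le_antisymm h ((range_le_range_iff he).2 (sub_eq_zero.1 h5).symm)

theorem isSummandOfRank_coordSubmodule {R : Type} [CommRing R] {n d : ℕ} (p : Fin n → Prop)
    (hp : Nat.card {b // p b} = d) : IsSummandOfRank (coordSubmodule R p) d := by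
  classical
  refine ⟨Matrix.diagonal fun b => if p b then 1 else 0, ?_, ?_, fun K _ f => ?_⟩
  · rw [Matrix.diagonal_mul_diagonal]
    congr 1
    funext b
    split_ifs <;> simp
  · ext v
    constructor
    · intro hv
      refine ⟨v, ?_⟩
      ext a
      rw [Matrix.mulVecLin_apply, Matrix.mulVec_diagonal]
      split_ifs with ha
      · rw [one_mul]
      · rw [hv a ha, mul_zero]
    · rintro ⟨w, rfl⟩ a ha
      rw [Matrix.mulVecLin_apply, Matrix.mulVec_diagonal, if_neg ha, zero_mul]
  · rw [Matrix.diagonal_map (map_zero f), Matrix.rank_diagonal, ← hp, Nat.card_eq_fintype_card]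
    refine Fintype.card_congr (Equiv.subtypeEquivRight fun b => ?_)
    by_cases hb : p b <;> simp [hb]

theorem isSummandOfRank_top {R : Type} [CommRing R] {n : ℕ} :
    IsSummandOfRank (⊤ : Submodule R (Fin n → R)) n := by
  have h := isSummandOfRank_coordSubmodule (R := R) (n := n) (fun _ => True)
    (by rw [Nat.card_congr (Equiv.subtypeUnivEquiv fun _ => trivial), Nat.card_fin])
  have h1 : coordSubmodule R (fun _ : Fin n => True) = ⊤ :=
    eq_top_iff.2 fun v _ a ha => absurd trivial ha
  rwa [h1] at h

/-- Locally, a flag is the image of the standard one. -/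
theorem near_flag_eq {R : CommAlgCat.{0} ℂ} (p : PrimeSpectrum R) {n : ℕ} {ι : Type} {d : ι → ℕ}
    (hd : ∀ j, d j ≤ n) (F : ι → Submodule R (Fin n → R)) (hF : ∀ j, IsSummandOfRank (F j) (d j))
    (hmono : ∀ i j, d i ≤ d j → F i ≤ F j) :
    Near p fun A f => ∃ g : (glFunctor n).obj A, ∀ j,
      (coordSubmodule A fun b : Fin n => b.1 < d j).map (mat g).mulVecLin =
        extendScalars f.hom.toRingHom (F j) := by
  let K := p.asIdeal.ResidueField
  let κ : R →+* K := algebraMap R K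
  -- Basis vector number `b` has to lie in every member of rank greater than `b`; `X b` collects the
  -- values at `p` of the vectors over `R` that do.
  let X : ℕ → Set (Fin n → K) := fun b =>
    (fun u a => κ (u a)) '' {u | ∀ j, b < d j → u ∈ F j}
  have hX : ∀ b, 0 ≤ b → b < n → b < Module.finrank K (Submodule.span K (X b)) := by
    intro b _ hb
    -- The smallest member of rank greater than `b`, or the whole space if there is none, lies in
    -- all members concerned and has more than `b` dimensions at `p`.
    have hG : ∃ (G : Submodule R (Fin n → R)) (r : ℕ), IsSummandOfRank G r ∧ b < r ∧
        ∀ j, b < d j → G ≤ F j := by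
      by_cases h : ∃ j, b < d j
      · have hne : (d '' {j | b < d j}).Nonempty :=
          Set.Nonempty.image d h
        obtain ⟨j, hj, hj'⟩ := Nat.sInf_mem hne
        refine ⟨F j, d j, hF j, hj, fun k hk => hmono j k ?_⟩
        rw [hj']
        exact Nat.sInf_le ⟨k, hk, rfl⟩
      · exact ⟨⊤, n, isSummandOfRank_top, hb, fun j hj => absurd ⟨j, hj⟩ h⟩
    obtain ⟨G, r, ⟨e, -, hG, hr⟩, hbr, hle⟩ := hG
    refine hbr.trans_le ?_
    have h1 : extendScalars κ G ≤ Submodule.span K (X b) :=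
      Submodule.span_mono (Set.image_mono fun u hu j hj => hle j hj hu)
    rw [hG, extendScalars_range] at h1
    rw [← hr K κ]
    exact Submodule.finrank_mono h1
  obtain ⟨v, hv, -, hvX⟩ := exists_linearIndependent_extension X (Fin.elim0 : Fin 0 → Fin n → K)
    linearIndependent_empty_type n (Nat.zero_le n) hX
  choose u hu hu' using fun b => hvX b (Nat.zero_le _)
  let h : Matrix (Fin n) (Fin n) R := Matrix.of fun a b => u b a
  refine (near_exists_gl p h ?_).mono fun A f hg => ?_
  · rw [RingHom.map_det]
    apply isUnit_det_of_linearIndependent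
    have h4 : (κ.mapMatrix h).col = v := funext fun b => hu' b
    rwa [← h4] at hv
  · obtain ⟨g, hg⟩ := hg
    refine ⟨g, fun j => ?_⟩
    -- Both sides are summands of the same rank, so one inclusion is enough.
    refine ((isSummandOfRank_coordSubmodule _ ?_).map g).eq_of_le ((hF j).extendScalars _) ?_
    · rw [Nat.card_congr (Fin.castLEquiv (hd j)).symm, Nat.card_fin]
    · rw [Submodule.map_le_iff_le_comap]
      refine coordSubmodule_le fun b hb => ?_
      rw [Submodule.mem_comap, Matrix.mulVecLin_apply, Matrix.mulVec_single_one, hg]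
      exact mem_extendScalars _ _ (hu b j hb)

/-- The flag of the first coordinate subspaces. -/
def stdFlag {n : ℕ} (lam : Fin n → ℂ) (R : CommAlgCat.{0} ℂ) : (flagVariety lam).X.obj R :=
  ⟨fun j => coordSubmodule R fun b => b.1 < j.1 + 1,
    fun i j hij => coordSubmodule_le fun b hb =>
      single_mem_coordSubmodule (p := fun b : Fin n => b.1 < j.1 + 1) (by omega),
    fun j => isSummandOfRank_coordSubmodule _ (by
      rw [Nat.card_congr (Fin.castLEquiv (Exists.choose j.2).le).symm, Nat.card_fin])⟩

theorem exists_covering_stdFlag {n : ℕ} {lam : Fin n → ℂ} {R : CommAlgCat.{0} ℂ}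
    (x : (flagVariety lam).X.obj R) : ∃ S ∈ fppfTopology (op R),
      ∀ (A : CommAlgCat.{0} ℂ) (f : R ⟶ A), S f.op →
        ∃ g, (flagVariety lam).smul g (stdFlag lam A) = (flagVariety lam).X.map f x := by
  refine exists_covering_of_near (fun A f hg B u => ?_) fun p => ?_
  · obtain ⟨g, hg⟩ := hg
    refine ⟨(glFunctor n).map u g, ?_⟩
    rw [types_map_comp, ← hg, (flagVariety lam).map_smul]
    congr 1
    exact Subtype.ext (funext fun j => (extendScalars_coordSubmodule _ _).symm)
  · refine (near_flag_eq p (d := fun j : Jumps lam => j.1 + 1)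
      (fun j => (Exists.choose j.2).le) x.1 x.2.2
      (fun i j hij => x.2.1 i j (by omega))).mono fun A f hg => ?_
    obtain ⟨g, hg⟩ := hg
    exact ⟨g, Subtype.ext (funext hg)⟩

/-- Any two flags of the same type are locally conjugate. -/
theorem exists_covering_smul_flag_eq {n : ℕ} {lam : Fin n → ℂ} {R : CommAlgCat.{0} ℂ}
    (x y : (flagVariety lam).X.obj R) : ∃ S ∈ fppfTopology (op R),
      ∀ (A : CommAlgCat.{0} ℂ) (f : R ⟶ A), S f.op → ∃ g, (flagVariety lam).smul g
        ((flagVariety lam).X.map f x) = (flagVariety lam).X.map f y := by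
  obtain ⟨S, hS, hx⟩ := exists_covering_stdFlag x
  obtain ⟨S', hS', hy⟩ := exists_covering_stdFlag y
  refine ⟨S ⊓ S', fppfTopology.intersection_covering hS hS', fun A f hf => ?_⟩
  obtain ⟨g, hg⟩ := hx A f hf.1
  obtain ⟨h, hh⟩ := hy A f hf.2
  refine ⟨h * g⁻¹, ?_⟩
  rw [← hg, ← (flagVariety lam).mul_smul, inv_mul_cancel_right, hh]

end Flags

/-! ### The parameter space of `GL_n(ℂ)` and the Vogan variety -/

section CoordinateFlags

variable {n : ℕ} {lam : Fin n → ℂ} {R : CommAlgCat.{0} ℂ}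

/-- The image of each member is a summand of the same rank, so stability only requires inclusion,
which is the vanishing of entries. -/
theorem smul_flag_eq_iff {x : (flagVariety lam).X.obj R} {p : Jumps lam → Fin n → Prop}
    (hx : ∀ j, x.1 j = coordSubmodule R (p j)) (g : (glFunctor n).obj R) :
    (flagVariety lam).smul g x = x ↔ ∀ j a b, p j b → ¬ p j a → mat g a b = 0 := by
  constructor
  · intro h j
    have h1 : (x.1 j).map (mat g).mulVecLin = x.1 j := congrFun (congrArg Subtype.val h) j
    rw [hx] at h1
    exact map_coordSubmodule_le.1 h1.le
  · intro h
    refine Subtype.ext (funext fun j => ?_)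
    refine ((x.2.2 j).map g).eq_of_le (x.2.2 j) ?_
    rw [hx]
    exact map_coordSubmodule_le.2 (h j)

variable (lam) in
/-- The flag of the last coordinate subspaces. -/
def lastFlag (R : CommAlgCat.{0} ℂ) : (flagVariety lam).X.obj R :=
  ⟨fun j => coordSubmodule R fun b => n - (j.1 + 1) ≤ b.1,
    fun i j hij => coordSubmodule_le fun b hb =>
      single_mem_coordSubmodule (p := fun b : Fin n => n - (j.1 + 1) ≤ b.1) (by omega),
    fun j => isSummandOfRank_coordSubmodule _ (by
      have hj := Exists.choose j.2
      rw [Nat.card_congr (Equiv.subtypeEquiv (q := fun b : Fin n => b.1 < j.1 + 1) Fin.revPerm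
        fun b => by simp only [Fin.revPerm_apply, Fin.val_rev]; omega),
        Nat.card_congr (Fin.castLEquiv hj.le).symm, Nat.card_fin])⟩

theorem map_stdFlag {S : CommAlgCat.{0} ℂ} (f : R ⟶ S) :
    (flagVariety lam).X.map f (stdFlag lam R) = stdFlag lam S :=
  Subtype.ext (funext fun _ => extendScalars_coordSubmodule _ _)

theorem map_lastFlag {S : CommAlgCat.{0} ℂ} (f : R ⟶ S) :
    (flagVariety lam).X.map f (lastFlag lam R) = lastFlag lam S :=
  Subtype.ext (funext fun _ => extendScalars_coordSubmodule _ _)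

end CoordinateFlags

/-! ### The ABV stack as a quotient by two copies of the general linear group. -/

section DiagonalSlice

/-- The first projection of a product of groups. -/
def prodFst (G H : GroupFunctor) : prodGroup G H ⟶ G where
  app R := GrpCat.ofHom (MonoidHom.fst (G.obj R) (H.obj R))
  naturality _ _ _ := rfl

/-- The second projection of a product of groups. -/
def prodSnd (G H : GroupFunctor) : prodGroup G H ⟶ H where
  app R := GrpCat.ofHom (MonoidHom.snd (G.obj R) (H.obj R))
  naturality _ _ _ := rfl

variable {n : ℕ} (X Y : ActedSpace (glFunctor n))

/-- The space `X × Y × GL_n` with the action `(g, h) • (x, y, z) = (g x, h y, h z g⁻¹)`. -/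
def isoProdSpace : ActedSpace (prodGroup (glFunctor n) (glFunctor n)) :=
  prodSpace (prodSpace (X.pullback (prodFst _ _)) (Y.pullback (prodSnd _ _))) (isoSpace n n)

/-- The inclusion `(x, y) ↦ (x, y, 1)`, equivariant along the diagonal. -/
def diagonalIncl : EquivariantMap (prodLift (𝟙 (glFunctor n)) (𝟙 (glFunctor n))) (prodSpace X Y)
    (isoProdSpace X Y) where
  app x := (x, ⟨1, 1, Matrix.one_mul 1, Matrix.one_mul 1⟩)
  naturality f x := Prod.ext rfl (Subtype.ext
    (Matrix.map_one _ (map_zero _) (map_one _)).symm)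
  map_smul g x := Prod.ext rfl (Subtype.ext (by
    change 1 = mat g * 1 * mat g⁻¹
    rw [Matrix.mul_one, mat_mul_mat_inv]))

/-- The point of `GL_n` given by a point of `isoSpace n n`. -/
theorem exists_mat_eq {R : CommAlgCat.{0} ℂ} (x : (isoSpace n n).X.obj R) :
    ∃ g : (glFunctor n).obj R, mat g = x.1 := by
  obtain ⟨x, y, h1, h2⟩ := x
  exact ⟨(⟨x, y, h1, h2⟩ : GL (Fin n) R), rfl⟩

/-- The element `(1, z)` moves a point with last coordinate `1` to one with last coordinate `z`, so
the slice meets every orbit. A pair `(g, h)` preserves the condition `z = 1` only if `g = h`. -/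
theorem isSlice_diagonalIncl (hX : IsFppfSheaf X.X) (hY : IsFppfSheaf Y.X) :
    IsSlice (diagonalIncl X Y) where
  sheaf_group := isFppfSheaf_prodGroup (isFppfSheaf_glFunctor n) (isFppfSheaf_glFunctor n)
  sheaf_space := isFppfSheaf_prodSpace (isFppfSheaf_prodSpace hX hY) (isFppfSheaf_isoSpace n)
  group_injective _ _ _ h := congrArg Prod.fst h
  injective _ _ _ h := congrArg Prod.fst h
  mem_group {R} g y y' h := by
    have h1 : mat g.2 * 1 * mat g.1⁻¹ = 1 := congrArg (fun x => x.2.1) h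
    rw [Matrix.mul_one, ← mat_mul] at h1
    have h2 : g.2 * g.1⁻¹ = 1 := Units.ext h1
    exact ⟨g.1, Prod.ext rfl (mul_inv_eq_one.1 h2).symm⟩
  mem_range {R S} hS x hx := by
    refine ⟨x.1, Prod.ext rfl ((isFppfSheaf_isoSpace n).ext hS fun A f hf => ?_)⟩
    obtain ⟨y, hy⟩ := hx A f hf
    refine Eq.trans ?_ (congrArg Prod.snd hy)
    exact Subtype.ext (Matrix.map_one _ (map_zero _) (map_one _))
  covers {R} x := by
    refine ⟨⊤, fppfTopology.top_mem _, fun A f _ => ?_⟩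
    obtain ⟨g, hg⟩ := exists_mat_eq ((isoSpace n n).X.map f x.2)
    refine ⟨((1 : (glFunctor n).obj A), g), (X.X.map f x.1.1, Y.smul g⁻¹ (Y.X.map f x.1.2)),
      Prod.ext (Prod.ext (X.one_smul _) ?_) (Subtype.ext ?_)⟩
    · refine (Y.mul_smul g g⁻¹ _).symm.trans ?_
      rw [mul_inv_cancel]
      exact Y.one_smul _
    · change mat g * 1 * mat (1 : (glFunctor n).obj A)⁻¹ = _
      rw [inv_one, mat_one, Matrix.mul_one, Matrix.mul_one, hg]
      rfl

end DiagonalSlice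

/-! ### Jumps of weights and dimensions of flags. -/

section InfChar

variable {n : ℕ} {d : ℕ → ℕ} (hd : ∃ k, d (k + 1) = 0) (hanti : Antitone d) (hn : d 0 = n)

include hanti hn in
theorem flagBlock_anti {b b' : Fin n} (h : b.1 ≤ b'.1) : flagBlock d hd b' ≤ flagBlock d hd b := by
  rw [← lt_iff_le_flagBlock hd hanti hn]
  exact h.trans_lt ((lt_iff_le_flagBlock hd hanti hn b' _).2 le_rfl)

-- A change of block between neighbouring indices means that some step of the flag ends there.
-- Weights defined through `flagBlock` therefore jump at the dimensions of the flag.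
include hanti hn in
theorem flagBlock_ne_iff {b b' : Fin n} (h : b'.1 = b.1 + 1) :
    flagBlock d hd b ≠ flagBlock d hd b' ↔ ∃ k, d k = b'.1 := by
  have key := lt_iff_le_flagBlock hd hanti hn
  constructor
  · intro hne
    have h1 := flagBlock_anti hd hanti hn (b := b) (b' := b') (by omega)
    have h2 := (key b (flagBlock d hd b)).2 le_rfl
    have h3 := (key b' (flagBlock d hd b)).not.2 (by omega)
    exact ⟨flagBlock d hd b, by omega⟩
  · rintro ⟨k, hk⟩
    have h2 := (key b k).1 (by omega)
    have h3 := (key b' k).not.1 (by omega)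
    omega

end InfChar

namespace IsUnimodalPair

variable {φ : ℂ → ℕ} {ℓ c : ℂ} (hφ : IsUnimodalPair φ ℓ c)

/-- The left infinitesimal character. -/
noncomputable def lamL (b : Fin (φ ℓ)) : ℂ :=
  -- Block numbers decrease along the index, so they form a dominant weight.
  flagBlock (fun k : ℕ => φ (ℓ - k)) hφ.exists_left_eq_zero b

/-- The right infinitesimal character. -/
noncomputable def lamR (b : Fin (φ ℓ)) : ℂ :=
  -- The kernels are spanned by the last basis vectors and have dimensions `φ ℓ - φ (c + k)`.
  -- Reversing the index produces jumps at these dimensions, and the sign restores dominance.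
  -(flagBlock (fun k : ℕ => φ (c + k)) hφ.exists_right_eq_zero b.rev : ℂ)

theorem isIntegralInfChar : IsIntegralInfChar hφ.lamL hφ.lamR where
  sub_int i := ⟨flagBlock (fun k : ℕ => φ (ℓ - k)) hφ.exists_left_eq_zero i +
    flagBlock (fun k : ℕ => φ (c + k)) hφ.exists_right_eq_zero i.rev, by
      unfold lamL lamR
      push_cast
      ring⟩
  dominant_left i j hij := by
    have h := flagBlock_anti hφ.exists_left_eq_zero hφ.antitone_left (by simp) (b := i) (b' := j)
      hij
    exact ⟨_, by unfold lamL; exact (Nat.cast_sub h).symm⟩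
  dominant_right i j hij := by
    have h := flagBlock_anti hφ.exists_right_eq_zero hφ.antitone_right (by simpa using hφ.eq.symm)
      (b := j.rev) (b' := i.rev) (Fin.rev_le_rev.2 hij)
    refine ⟨_, Eq.trans ?_ (Nat.cast_sub h).symm⟩
    unfold lamR
    ring

theorem lamL_ne_iff {j : ℕ} (h : j + 1 < φ ℓ) :
    hφ.lamL ⟨j, Nat.lt_of_succ_lt h⟩ ≠ hφ.lamL ⟨j + 1, h⟩ ↔ ∃ k : ℕ, φ (ℓ - k) = j + 1 := by
  unfold lamL
  rw [Ne, Nat.cast_inj]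
  exact flagBlock_ne_iff hφ.exists_left_eq_zero hφ.antitone_left (by simp) rfl

theorem lamR_ne_iff {j : ℕ} (h : j + 1 < φ ℓ) :
    hφ.lamR ⟨j, Nat.lt_of_succ_lt h⟩ ≠ hφ.lamR ⟨j + 1, h⟩ ↔
      ∃ k : ℕ, φ (c + k) = φ ℓ - (j + 1) := by
  unfold lamR
  rw [Ne, neg_inj, Nat.cast_inj, ← Ne, ne_comm,
    flagBlock_ne_iff hφ.exists_right_eq_zero hφ.antitone_right (by simpa using hφ.eq.symm)
      (by simp only [Fin.val_rev]; omega)]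
  simp only [Fin.val_rev]

/-- A step of dimension zero or of full dimension imposes no condition. A step of any other
dimension `φ (ℓ - k)` is the member of the flag at the jump `φ (ℓ - k) - 1`, counted from zero. -/
theorem smul_stdFlag_eq_iff {R : CommAlgCat.{0} ℂ} (g : (glFunctor (φ ℓ)).obj R) :
    (flagVariety hφ.lamL).smul g (stdFlag hφ.lamL R) = stdFlag hφ.lamL R ↔
      g ∈ (flagStabilizer (leftFlag φ ℓ)).pts R := by
  rw [smul_flag_eq_iff (x := stdFlag hφ.lamL R) (fun j => rfl), mem_flagStabilizer_leftFlag hφ]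
  constructor
  · intro h k a b hb ha
    have h1 : φ (ℓ - k) - 1 + 1 = φ (ℓ - k) := by omega
    have h2 : φ (ℓ - k) - 1 + 1 < φ ℓ := by omega
    exact h ⟨φ (ℓ - k) - 1, h2, (hφ.lamL_ne_iff h2).2 ⟨k, h1.symm⟩⟩ a b (hb.trans_le h1.ge)
      (not_lt.2 (h1.le.trans ha))
  · rintro h ⟨j, h2, h3⟩ a b hb ha
    obtain ⟨k, hk⟩ := (hφ.lamL_ne_iff h2).1 h3
    exact h k a b (hk ▸ hb) (hk ▸ not_lt.1 ha)

/-- The same comparison for the kernels, whose dimension `φ ℓ - φ (c + k)` exceeds the corresponding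
jump position by one. -/
theorem smul_lastFlag_eq_iff {R : CommAlgCat.{0} ℂ} (g : (glFunctor (φ ℓ)).obj R) :
    (flagVariety hφ.lamR).smul g (lastFlag hφ.lamR R) = lastFlag hφ.lamR R ↔
      ∀ (k : ℕ) (a b : Fin (φ ℓ)), a.1 < φ (c + k) → φ (c + k) ≤ b.1 → mat g a b = 0 := by
  rw [smul_flag_eq_iff (x := lastFlag hφ.lamR R) (fun j => rfl)]
  constructor
  · intro h k a b ha hb
    have h1 : φ ℓ - (φ ℓ - φ (c + k) - 1 + 1) = φ (c + k) := by omega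
    have h2 : φ ℓ - φ (c + k) - 1 + 1 < φ ℓ := by omega
    exact h ⟨φ ℓ - φ (c + k) - 1, h2, (hφ.lamR_ne_iff h2).2 ⟨k, h1.symm⟩⟩ a b (h1.le.trans hb)
      (not_le.2 (ha.trans_le h1.ge))
  · rintro h ⟨j, h2, h3⟩ a b hb ha
    obtain ⟨k, hk⟩ := (hφ.lamR_ne_iff h2).1 h3
    exact h k a b (hk ▸ not_le.1 ha) (hk ▸ hb)

end IsUnimodalPair

/-! ### The fibre over the standard representation as a slice of the flag space. -/

section StandardSlice

theorem stdMat_conj_apply {R : Type*} [CommRing R] {n m : ℕ} (h : n = m)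
    (M : Matrix (Fin m) (Fin m) R) (a b : Fin n) :
    (stdMat R n m * M * stdMat R m n) a b = M (a.cast h) (b.cast h) := by
  subst h
  rw [stdMat_self, Matrix.one_mul, Matrix.mul_one]
  rfl

theorem constMat_stdMat (m n : ℕ) (R : CommAlgCat.{0} ℂ) :
    constMat (stdMat ℂ m n) R = stdMat R m n :=
  stdMat_map (algebraMap ℂ R)

/-- Conjugation by an invertible matrix, as a homomorphism of general linear groups. -/
def conjHom {n m : ℕ} {B : Matrix (Fin m) (Fin n) ℂ} {C : Matrix (Fin n) (Fin m) ℂ}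
    (h : B * C = 1) (h' : C * B = 1) : glFunctor m ⟶ glFunctor n where
  app R := GrpCat.ofHom
    { toFun := fun g => conjConstMat h h' g
      map_one' := Units.ext (by
        change constMat C R * (1 : Matrix (Fin m) (Fin m) R) * constMat B R = 1
        rw [Matrix.mul_one, constMat_mul h'])
      map_mul' := fun u v => Units.ext (by
        exact (conj_constMat_mul h (mat u) (mat v)).symm) }
  naturality R S f := by
    ext g
    refine Units.ext ?_
    change constMat C S * (mat g).map f.hom * constMat B S =
      (constMat C R * mat g * constMat B R).map f.hom
    rw [Matrix.map_mul, Matrix.map_mul, map_constMat, map_constMat]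

theorem conjHom_conjHom {n m : ℕ} {B : Matrix (Fin m) (Fin n) ℂ} {C : Matrix (Fin n) (Fin m) ℂ}
    (h : B * C = 1) (h' : C * B = 1) {R : CommAlgCat.{0} ℂ} (g : (glFunctor m).obj R) :
    (conjHom h' h).app R ((conjHom h h').app R g) = g := by
  refine Units.ext ?_
  change constMat B R * (constMat C R * mat g * constMat B R) * constMat C R = mat g
  calc _ = (constMat B R * constMat C R) * mat g * (constMat B R * constMat C R) := by
        simp only [Matrix.mul_assoc]
    _ = mat g := by rw [constMat_mul h, Matrix.one_mul, Matrix.mul_one]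

namespace IsUnimodalPair

variable {φ : ℂ → ℕ} {ℓ c : ℂ} (hφ : IsUnimodalPair φ ℓ c)

theorem dropComponent_stdRep_mem :
    dropComponent ℓ (stdRep φ ℂ) ∈ projectedPart φ ℓ :=
  ⟨stdRep φ ℂ, isFullRank_stdRep ℂ, rfl⟩

include hφ in
theorem stdMat_mul_left : stdMat ℂ (φ c) (φ ℓ) * stdMat ℂ (φ ℓ) (φ c) = 1 :=
  stdMat_mul_stdMat_self hφ.eq.ge

include hφ in
theorem stdMat_mul_right : stdMat ℂ (φ ℓ) (φ c) * stdMat ℂ (φ c) (φ ℓ) = 1 :=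
  stdMat_mul_stdMat_self hφ.eq.le

/-- The identification of `GL(V_c)` with `GL(V_ℓ)` by the standard bases. -/
def rightToLeft : glFunctor (φ c) ⟶ glFunctor (φ ℓ) :=
  conjHom hφ.stdMat_mul_left hφ.stdMat_mul_right

/-- The identification of `GL(V_ℓ)` with `GL(V_c)` by the standard bases. -/
def leftToRight : glFunctor (φ ℓ) ⟶ glFunctor (φ c) :=
  conjHom hφ.stdMat_mul_right hφ.stdMat_mul_left

variable {R : CommAlgCat.{0} ℂ}

theorem leftToRight_rightToLeft (g : (glFunctor (φ c)).obj R) :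
    hφ.leftToRight.app R (hφ.rightToLeft.app R g) = g :=
  conjHom_conjHom _ _ g

theorem rightToLeft_leftToRight (g : (glFunctor (φ ℓ)).obj R) :
    hφ.rightToLeft.app R (hφ.leftToRight.app R g) = g :=
  conjHom_conjHom _ _ g

theorem smul_rightToLeft_lastFlag_eq_iff (g : (glFunctor (φ c)).obj R) :
    (flagVariety hφ.lamR).smul (hφ.rightToLeft.app R g) (lastFlag hφ.lamR R) =
      lastFlag hφ.lamR R ↔ g ∈ (flagStabilizer (rightFlag φ c)).pts R := by
  rw [smul_lastFlag_eq_iff, mem_flagStabilizer_rightFlag hφ]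
  have key : ∀ a b, mat (hφ.rightToLeft.app R g) a b =
      mat g (a.cast hφ.eq) (b.cast hφ.eq) := by
    intro a b
    change (constMat (stdMat ℂ (φ ℓ) (φ c)) R * mat g * constMat (stdMat ℂ (φ c) (φ ℓ)) R) a b = _
    rw [constMat_stdMat, constMat_stdMat, stdMat_conj_apply hφ.eq]
  simp only [key]
  exact ⟨fun h k a b ha hb => h k (a.cast hφ.eq.symm) (b.cast hφ.eq.symm) ha hb,
    fun h k a b ha hb => h k _ _ ha hb⟩

/-- The space `𝒫_{λ_L} × 𝒫_{λ_R} × GL_n` with the action of `GL_n × GL_n`. -/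
noncomputable abbrev flagIsoSpace : ActedSpace (prodGroup (glFunctor (φ ℓ)) (glFunctor (φ ℓ))) :=
  isoProdSpace (flagVariety hφ.lamL) (flagVariety hφ.lamR)

/-- The homomorphism from the stabilizer of the standard representation to `GL_n × GL_n`. -/
noncomputable def stdHom : (stabilizer (dropComponent ℓ (stdRep φ ℂ))).toFunctor ⟶
    prodGroup (glFunctor (φ ℓ)) (glFunctor (φ ℓ)) :=
  prodLift (stabilizerProj _ ℓ) (stabilizerProj _ c ≫ hφ.rightToLeft)

/-- The component at `ℓ` in the standard bases. -/
noncomputable def stdComponent (x : (fibreOver ℓ (dropComponent ℓ (stdRep φ ℂ))).toActedSpace.X.obj R) :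
    (isoSpace (φ ℓ) (φ ℓ)).X.obj R :=
  ⟨constMat (stdMat ℂ (φ ℓ) (φ c)) R * ((fibreComponent hφ _).app x).1, by
    obtain ⟨y, h1, h2⟩ := ((fibreComponent hφ _).app x).2
    refine ⟨y * constMat (stdMat ℂ (φ c) (φ ℓ)) R, ?_, ?_⟩
    · rw [Matrix.mul_assoc, ← Matrix.mul_assoc _ y, h1, Matrix.one_mul,
        constMat_mul hφ.stdMat_mul_right]
    · rw [Matrix.mul_assoc, ← Matrix.mul_assoc _ (constMat (stdMat ℂ (φ ℓ) (φ c)) R),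
        constMat_mul hφ.stdMat_mul_left, Matrix.one_mul, h2]⟩

theorem stdComponent_bijective : Function.Bijective (hφ.stdComponent (R := R)) := by
  have hb := fibreComponent_bijective hφ (dropComponent_stdRep_mem (φ := φ) (ℓ := ℓ)) R
  constructor
  · intro x y hxy
    refine hb.1 (Subtype.ext ?_)
    have h1 := congrArg (fun z => constMat (stdMat ℂ (φ c) (φ ℓ)) R * z.1) hxy
    have h2 : ∀ M : Matrix (Fin (φ c)) (Fin (φ ℓ)) R, constMat (stdMat ℂ (φ c) (φ ℓ)) R *
        (constMat (stdMat ℂ (φ ℓ) (φ c)) R * M) = M := fun M => by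
      rw [← Matrix.mul_assoc, constMat_mul hφ.stdMat_mul_left, Matrix.one_mul]
    exact (h2 _).symm.trans (h1.trans (h2 _))
  · rintro ⟨z, w, h1, h2⟩
    obtain ⟨x, hx⟩ := hb.2 ⟨constMat (stdMat ℂ (φ c) (φ ℓ)) R * z,
      w * constMat (stdMat ℂ (φ ℓ) (φ c)) R, by
        rw [Matrix.mul_assoc, ← Matrix.mul_assoc z, h1, Matrix.one_mul,
          constMat_mul hφ.stdMat_mul_left], by
        rw [Matrix.mul_assoc, ← Matrix.mul_assoc _ (constMat (stdMat ℂ (φ c) (φ ℓ)) R),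
          constMat_mul hφ.stdMat_mul_right, Matrix.one_mul, h2]⟩
    refine ⟨x, Subtype.ext ?_⟩
    change constMat (stdMat ℂ (φ ℓ) (φ c)) R * ((fibreComponent hφ _).app x).1 = z
    rw [hx, ← Matrix.mul_assoc, constMat_mul hφ.stdMat_mul_right, Matrix.one_mul]

theorem stdHom_mem (g : (stabilizer (dropComponent ℓ (stdRep φ ℂ))).toFunctor.obj R) :
    (flagVariety hφ.lamL).smul (hφ.stdHom.app R g).1 (stdFlag hφ.lamL R) = stdFlag hφ.lamL R ∧
      (flagVariety hφ.lamR).smul (hφ.stdHom.app R g).2 (lastFlag hφ.lamR R) =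
        lastFlag hφ.lamR R :=
  ⟨(hφ.smul_stdFlag_eq_iff _).2 (stabilizer_std_left hφ g.2),
    (hφ.smul_rightToLeft_lastFlag_eq_iff _).2 (stabilizer_std_right hφ g.2)⟩

theorem stdComponent_smul (g : (stabilizer (dropComponent ℓ (stdRep φ ℂ))).toFunctor.obj R)
    (x : (fibreOver ℓ (dropComponent ℓ (stdRep φ ℂ))).toActedSpace.X.obj R) :
    hφ.stdComponent ((fibreOver ℓ (dropComponent ℓ (stdRep φ ℂ))).toActedSpace.smul g x) =
      (isoSpace (φ ℓ) (φ ℓ)).smul (hφ.stdHom.app R g) (hφ.stdComponent x) := by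
  refine Subtype.ext ?_
  change constMat (stdMat ℂ (φ ℓ) (φ c)) R * (mat (glAt g.1 c) *
      ((fibreComponent hφ _).app x).1 * mat (glAt g.1 ℓ)⁻¹) =
    (constMat (stdMat ℂ (φ ℓ) (φ c)) R * mat (glAt g.1 c) * constMat (stdMat ℂ (φ c) (φ ℓ)) R) *
      (constMat (stdMat ℂ (φ ℓ) (φ c)) R * ((fibreComponent hφ _).app x).1) * mat (glAt g.1 ℓ)⁻¹
  symm
  calc _ = constMat (stdMat ℂ (φ ℓ) (φ c)) R * mat (glAt g.1 c) *
        (constMat (stdMat ℂ (φ c) (φ ℓ)) R * constMat (stdMat ℂ (φ ℓ) (φ c)) R) *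
        ((fibreComponent hφ _).app x).1 * mat (glAt g.1 ℓ)⁻¹ := by simp only [Matrix.mul_assoc]
    _ = _ := by
      rw [constMat_mul hφ.stdMat_mul_left]
      simp only [Matrix.mul_assoc, Matrix.one_mul]

/-- The fibre over the standard representation as a slice of `𝒫_{λ_L} × 𝒫_{λ_R} × GL_n`. -/
noncomputable def stdIncl : EquivariantMap hφ.stdHom
    (fibreOver ℓ (dropComponent ℓ (stdRep φ ℂ))).toActedSpace hφ.flagIsoSpace where
  app {R} x := ((stdFlag hφ.lamL R, lastFlag hφ.lamR R), hφ.stdComponent x)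
  naturality {R S} f x := Prod.ext
    (Prod.ext (map_stdFlag f).symm (map_lastFlag f).symm) (Subtype.ext (by
      change constMat (stdMat ℂ (φ ℓ) (φ c)) S * (((fibreComponent hφ _).app x).1).map f.hom =
        (constMat (stdMat ℂ (φ ℓ) (φ c)) R * ((fibreComponent hφ _).app x).1).map f.hom
      rw [Matrix.map_mul, map_constMat]))
  map_smul {R} g x := Prod.ext
    (Prod.ext (hφ.stdHom_mem g).1.symm (hφ.stdHom_mem g).2.symm) (hφ.stdComponent_smul g x)

/-- Pairs of flags are locally conjugate to the chosen pair. The pairs of matrices preserving the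
chosen flags are exactly the images of the stabilizer, by `exists_stabilizer_std`, and the remaining
coordinate is the component at `ℓ`. -/
theorem isSlice_stdIncl : IsSlice hφ.stdIncl where
  sheaf_group := isFppfSheaf_prodGroup (isFppfSheaf_glFunctor _) (isFppfSheaf_glFunctor _)
  sheaf_space := isFppfSheaf_prodSpace (isFppfSheaf_prodSpace (isFppfSheaf_flagVariety _)
    (isFppfSheaf_flagVariety _)) (isFppfSheaf_isoSpace _)
  group_injective R g h hgh := Subtype.ext (stabilizer_std_ext hφ g.2 h.2
    (congrArg Prod.fst hgh) (by
      have h1 := congrArg (fun z => hφ.leftToRight.app R z.2) hgh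
      exact (hφ.leftToRight_rightToLeft _).symm.trans (h1.trans (hφ.leftToRight_rightToLeft _))))
  injective R x y hxy := hφ.stdComponent_bijective.1 (congrArg Prod.snd hxy)
  mem_group {R} g y y' h := by
    have h1 : (flagVariety hφ.lamL).smul g.1 (stdFlag hφ.lamL R) = stdFlag hφ.lamL R :=
      congrArg (fun z => z.1.1) h
    have h2 : (flagVariety hφ.lamR).smul g.2 (lastFlag hφ.lamR R) = lastFlag hφ.lamR R :=
      congrArg (fun z => z.1.2) h
    rw [← hφ.rightToLeft_leftToRight g.2, smul_rightToLeft_lastFlag_eq_iff] at h2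
    obtain ⟨k, hk, e1, e2⟩ := exists_stabilizer_std hφ ((hφ.smul_stdFlag_eq_iff _).1 h1) h2
    refine ⟨⟨k, hk⟩, Prod.ext e1 ?_⟩
    exact (congrArg (hφ.rightToLeft.app R) e2).trans (hφ.rightToLeft_leftToRight g.2)
  mem_range {R S} hS x hx := by
    obtain ⟨y, hy⟩ := hφ.stdComponent_bijective.2 x.2
    refine ⟨y, Prod.ext (Prod.ext ?_ ?_) hy⟩
    · refine (isFppfSheaf_flagVariety _).ext hS fun A f hf => ?_
      obtain ⟨z, hz⟩ := hx A f hf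
      exact (map_stdFlag f).trans (congrArg (fun z => z.1.1) hz)
    · refine (isFppfSheaf_flagVariety _).ext hS fun A f hf => ?_
      obtain ⟨z, hz⟩ := hx A f hf
      exact (map_lastFlag f).trans (congrArg (fun z => z.1.2) hz)
  covers {R} x := by
    obtain ⟨S, hS, h1⟩ := exists_covering_smul_flag_eq (stdFlag hφ.lamL R) x.1.1
    obtain ⟨S', hS', h2⟩ := exists_covering_smul_flag_eq (lastFlag hφ.lamR R) x.1.2
    refine ⟨S ⊓ S', fppfTopology.intersection_covering hS hS', fun A f hf => ?_⟩
    obtain ⟨g, hg⟩ := h1 A f hf.1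
    obtain ⟨h, hh⟩ := h2 A f hf.2
    let k : (prodGroup (glFunctor (φ ℓ)) (glFunctor (φ ℓ))).obj A := (g, h)
    obtain ⟨y, hy⟩ := hφ.stdComponent_bijective.2
      ((isoSpace (φ ℓ) (φ ℓ)).smul k⁻¹ ((isoSpace (φ ℓ) (φ ℓ)).X.map f x.2))
    refine ⟨k, y, Prod.ext (Prod.ext ?_ ?_) ?_⟩
    · rw [map_stdFlag] at hg
      exact hg
    · rw [map_lastFlag] at hh
      exact hh
    · refine (congrArg ((isoSpace (φ ℓ) (φ ℓ)).smul k) hy).trans ?_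
      refine ((isoSpace (φ ℓ) (φ ℓ)).mul_smul k k⁻¹ _).symm.trans ?_
      rw [mul_inv_cancel]
      exact (isoSpace (φ ℓ) (φ ℓ)).one_smul _

/-- Extend torsors along the diagonal slice, restrict to the slice of the chosen flags, which is the
fibre over the standard representation, and extend from this fibre to the full rank part. -/
theorem exists_abvStack_iso : ∃ e : BasedFunctor (abvStack hφ.lamL hφ.lamR)
    (quotientStack _ (fullRankPart φ).toActedSpace), IsStackIso e :=
  ⟨_, ((isSlice_diagonalIncl (flagVariety hφ.lamL) (flagVariety hφ.lamR)
      (isFppfSheaf_flagVariety _) (isFppfSheaf_flagVariety _)).isStackIso_inducedBased.comp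
    hφ.isSlice_stdIncl.isStackIso_restrictBased).comp
    (isSlice_fibreIncl hφ dropComponent_stdRep_mem).isStackIso_inducedBased⟩

end IsUnimodalPair

end StandardSlice

/-! ### Assembly of the theorem and the corollary. -/

theorem mainTheorem7 (φ : ℂ → ℕ) (a : ℂ) (q : ℚ) (hφ : IsUnimodalAt φ a q)
    (ℓ c : ℂ) (hℓ : ℓ = shiftedFloor a q) (hc : c = shiftedCeil a q) :
    -- the projected part is a single orbit
    (∃ S : QuiverRep φ ℂ, projectedPart φ ℓ =
      {T | ∃ g : (piGL φ).obj complexPoint,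
        T = (voganVariety φ).smul (R := complexPoint) g S}) ∧
    φ ℓ = φ c ∧
    (∀ T ∈ projectedPart φ ℓ,
      -- the image of the stabilizer in `GL(V_⌊r⌋)`
      (Antitone (fun k => imageFlag T k ℓ) ∧ (∃ k, imageFlag T k ℓ = ⊥) ∧
        (stabilizerImage T ℓ).IsParabolic ∧
        stabilizerImage T ℓ = flagStabilizer (fun k => imageFlag T k ℓ) ∧
        ∃ L, (stabilizerImage T ℓ).IsLevi L ∧
          Nonempty (L.toFunctor ≅ piGL (fun k : ℕ => φ (ℓ - k) - φ (ℓ - k - 1)))) ∧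
      -- the image of the stabilizer in `GL(V_⌈r⌉)`
      (Monotone (fun k => kernelFlag T k c) ∧ (∃ k, kernelFlag T k c = ⊤) ∧
        (stabilizerImage T c).IsParabolic ∧
        stabilizerImage T c = flagStabilizer (fun k => kernelFlag T k c) ∧
        ∃ L, (stabilizerImage T c).IsLevi L ∧
          Nonempty (L.toFunctor ≅ piGL (fun k : ℕ => φ (c + k) - φ (c + k + 1)))) ∧
      -- the stabilizer is the product of its two images
      IsIso (stabilizerToImages T ℓ c) ∧
      -- the fibre over `T`, with its action, and the isomorphisms of quotient stacks
      (∃ κ : EquivariantMap (stabilizerToImages T ℓ c) (fibreOver ℓ T).toActedSpace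
          (doubleCosetSpace (stabilizerImage T ℓ) (stabilizerImage T c)),
        (∀ (R : CommAlgCat.{0} ℂ) (x : (fibreOver ℓ T).toActedSpace.X.obj R),
          (κ.app x).1 = (x.1.1 : QuiverRep φ R) ℓ c (by rw [hc, hℓ, shiftedCeil_eq a q hφ.not_int])) ∧
        (∀ R : CommAlgCat.{0} ℂ, Function.Bijective (κ.app (R := R))) ∧
        (∃ F : BasedFunctor (quotientStack _ (fibreOver ℓ T).toActedSpace)
            (quotientStack _ (fullRankPart φ).toActedSpace),
          Nonempty (InducedBy (fibreIncl ℓ T) F) ∧ IsStackIso F) ∧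
        ∃ F : BasedFunctor (quotientStack _ (fibreOver ℓ T).toActedSpace)
            (quotientStack _ (doubleCosetSpace (stabilizerImage T ℓ) (stabilizerImage T c))),
          Nonempty (InducedBy κ F) ∧ IsStackIso F) ∧
      -- the same in bases of `V_⌊r⌋` and `V_⌈r⌉`
      (∀ (Bl Cl : Matrix (Fin (φ ℓ)) (Fin (φ ℓ)) ℂ)
          (Br : Matrix (Fin (φ c)) (Fin (φ ℓ)) ℂ)
          (Cr : Matrix (Fin (φ ℓ)) (Fin (φ c)) ℂ),
        Bl * Cl = 1 → Cl * Bl = 1 → Br * Cr = 1 → Cr * Br = 1 →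
        ∃ F : BasedFunctor (quotientStack _ (fullRankPart φ).toActedSpace)
            (quotientStack _ (doubleCosetSpace ((stabilizerImage T ℓ).transport Bl)
              ((stabilizerImage T c).transport Br))),
          IsStackIso F)) ∧
    -- the open immersion of the parameter space of `GL_n(ℂ)`
    ∃ lamL lamR : Fin (φ ℓ) → ℂ, IsIntegralInfChar lamL lamR ∧
      ∃ e : BasedFunctor (abvStack lamL lamR) (quotientStack _ (fullRankPart φ).toActedSpace),
        IsStackIso e ∧
        IsOpenImmersionOfStacks (e.comp (quotientStackMap (fullRankPart φ).incl)) := by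
  subst hℓ hc
  have h := hφ.isUnimodalPair
  refine ⟨⟨dropComponent _ (stdRep φ ℂ), Set.ext fun T => mem_projectedPart_iff h T⟩, h.eq,
    fun T hT => ⟨?_, ?_, isIso_stabilizerToImages h hT, ⟨fibreComponent h T, fun _ _ => rfl,
      fibreComponent_bijective h hT, ?_, ?_⟩, exists_stackIso_transport h hT⟩, h.lamL, h.lamR,
    h.isIntegralInfChar, ?_⟩
  · rw [stabilizerImage_left h hT]
    obtain ⟨h1, h2⟩ := isParabolic_imageFlag h hT
    exact ⟨(antitone_imageFlag h hT).1, (antitone_imageFlag h hT).2, h1, rfl, h2⟩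
  · rw [stabilizerImage_right h hT]
    obtain ⟨h1, h2⟩ := isParabolic_kernelFlag h hT
    exact ⟨(monotone_kernelFlag h hT).1, (monotone_kernelFlag h hT).2, h1, rfl, h2⟩
  · have hS := isSlice_fibreIncl h hT
    exact ⟨inducedBased _ hS.sheaf_group hS.sheaf_space, nonempty_inducedBy_inducedBased _ _ _,
      hS.isStackIso_inducedBased⟩
  · have := isIso_stabilizerToImages h hT
    exact ⟨transferBased (fibreComponent h T), nonempty_inducedBy_transferBased _,
      isStackIso_transferBased _ (fibreComponent_bijective h hT)⟩
  · obtain ⟨e, he⟩ := h.exists_abvStack_iso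
    exact ⟨e, he, (isOpenImmersion_quotientStackMap
      (isOpen_fullRankPart h.finite_support)).comp_stackIso he⟩
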